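/- Let $t\ge 3$, $p\ge 2$, $q\ge 1$ be integers with $t=(p-1)q$, and let $K^p_q$ be the complete partite graph with $p$ colour classes of size $q$ (it is $t$-regular). A simple graph is called bounded if all its degrees are at most $t+1$. A $K^p_q$ of a graph is a (not necessarily induced) subgraph of it isomorphic to $K^p_q$. Let $G$ be a bounded graph with $n$ vertices and $m$ edges. **Algorithm.** Start with $\tilde G:=G$ without the vertices of degree less than $t$ in $G$. While $\tilde G$ is non-empty, take any vertex $v_1$ of $\tilde G$ and run the *friend procedure*, which either concludes, correctly, that $v_1$ belongs to no $K^p_q$ of $\tilde G$, or returns a vertex $v_2\ne v_1$ of $\tilde G$ that has at least $\max\{p-2,1\}\,q$ common neighbours with $v_1$ in $\tilde G$. In the first case remove $v_1$ from $\tilde G$. In the second case find by *local search* the $K^p_q$'s of $\tilde G$ that contain $v_1$ or $v_2$. If there are none, remove $v_1$, $v_2$ and all their common neighbours from $\tilde G$. Otherwise let $H$ be any one of them; return the family of all $K^p_q$'s of $\tilde G$ that have a common vertex with $H$ (including $H$), return that every two different members of this family have a common vertex, and remove the vertices of $H$ from $\tilde G$. **Claim.** 1. Whatever choices are made, the algorithm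 never gets stuck, each round strictly decreases the vertex set of $\tilde G$, and when $\tilde G$ is empty, the set of returned subgraphs is the set of all $K^p_q$'s of $G$, and the set of returned pairs is the set of all pairs of different $K^p_q$'s of $G$ that have a common vertex. 2. There is an implementation of the algorithm that runs in $\mathcal O(m)$ time if $n\ge 1$ and every vertex of $G$ has degree at least one: its output describes the families returned in some complete execution of the algorithm. 3. (Local search.) There is a procedure that, for any bounded graph and any vertex $v$ of it, finds all $K^p_q$'s of the graph that contain $v$, in $\mathcal O(t^2)$ time. 4. (Friend procedure.) There is a procedure that, for any bounded graph and any vertex $v_1$ of it, gives an answer of the friend procedure as specified above, in $\mathcal O(t)$ time. Each of 2, 3, 4 asserts one fixed program and one absolute constant in the $\mathcal O$, valid for all $t$, $p$, $q$ and all graphs. **Machine.** Time is the number of elementary operations (additions, truncated subtractions, array reads and writes, comparisons) of a random access machine with finitely many integer variables and arrays, all numbers being at most $(n+t+2)^{\mathcal O(1)}$ ($n$ is the number of vertices of the input graph). The input consists of $n,t,p,q$, the adjacency lists of the graph in any order (concatenated in one array, with an array of their starting positions) and, in 3 and 4, the vertex; all other memory is initially zero. **Output.** In 2 and 3 the output is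 a list of records, written out in full; in 2 the $i$-th record describes exactly the $i$-th returned family, and in 3 the families described by the records have as their union the set of all $K^p_q$'s that contain $v$. A record consists of the vertices of one $K^p_q$, listed class by class, a list $C$ of vertices, and a list of quadruples $(x,y,x',y')$ of vertices. It describes exactly the $K^p_q$'s obtained from the listed one by an arbitrary permutation of the vertices of $C$ (in particular the listed one itself), and those obtained from the listed one by replacing $x$ by $y$ and $x'$ by $y'$ (with $x=x'$, $y=y'$ for a single replacement) for one of the quadruples; each of the colour class lists so described has to be a $K^p_q$ of the family. -/

import Mathlib

/-! ## The subgraphs `K^p_q` -/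

namespace KpqSearch

/-- The standing conditions on the parameters. -/
def Params (t p q : ℕ) : Prop := 3 ≤ t ∧ 2 ≤ p ∧ 1 ≤ q ∧ t = (p - 1) * q

/-- Every vertex has degree at most `t + 1`. -/
def Bounded {n : ℕ} (G : SimpleGraph (Fin n)) [DecidableRel G.Adj] (t : ℕ) : Prop :=
  ∀ v, G.degree v ≤ t + 1

/-- `H` is a (not necessarily induced) subgraph of the induced subgraph `G[S]`, and `H` is
isomorphic to the complete partite graph with `p` colour classes of size `q`. -/
def IsKpq {n : ℕ} {G : SimpleGraph (Fin n)} (p q : ℕ) (S : Set (Fin n)) (H : G.Subgraph) : Prop :=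
  H.verts ⊆ S ∧ Nonempty (H.coe ≃g SimpleGraph.completeEquipartiteGraph p q)

/-- The subgraphs `H` and `H'` have a common vertex. -/
def Meet {n : ℕ} {G : SimpleGraph (Fin n)} (H H' : G.Subgraph) : Prop :=
  (H.verts ∩ H'.verts).Nonempty

/-- The common neighbours of `u` and `v` in `G[S]` (for `u`, `v` in `S`). -/
def commonIn {n : ℕ} (G : SimpleGraph (Fin n)) (S : Set (Fin n)) (u v : Fin n) : Set (Fin n) :=
  {w | w ∈ S ∧ G.Adj u w ∧ G.Adj v w}

/-! ## The algorithm

The current graph is always an induced subgraph `G[S]`, so that it is given by its vertex set. -/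

/-- What the friend procedure may answer on `G[S]` and `v₁`: `none` is the conclusion that `v₁` lies
in no `K^p_q` of `G[S]`, and `some v₂` is a vertex that has enough common neighbours with `v₁`. -/
def FriendAnswer {n : ℕ} (G : SimpleGraph (Fin n)) (p q : ℕ) (S : Set (Fin n)) (v₁ : Fin n) :
    Option (Fin n) → Prop
  | none => ∀ H : G.Subgraph, IsKpq p q S H → v₁ ∉ H.verts
  | some v₂ => v₂ ∈ S ∧ v₂ ≠ v₁ ∧ max (p - 2) 1 * q ≤ (commonIn G S v₁ v₂).ncard

/-- The state of the algorithm: the vertex set of the current graph, and the list of the returned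
families. To return a family is to return all its members and, moreover, to return that every two
different members of it have a common vertex. -/
structure AlgState {n : ℕ} (G : SimpleGraph (Fin n)) where
  alive : Set (Fin n)
  out : List (Set G.Subgraph)

/-- At the beginning all vertices of degree less than `t` are removed. -/
def initState {n : ℕ} (G : SimpleGraph (Fin n)) [DecidableRel G.Adj] (t : ℕ) : AlgState G :=
  ⟨{v | t ≤ G.degree v}, []⟩

/-- One round of the algorithm, from the choice of `v₁` to the next removal of vertices. The choices
of `v₁`, of the answer of the friend procedure and of `H` are arbitrary. -/
inductive Round {n : ℕ} {G : SimpleGraph (Fin n)} (p q : ℕ) : AlgState G → AlgState G → Prop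
  /-- The friend procedure concludes that `v₁` is in no `K^p_q`; remove `v₁`. -/
  | dropOne (s : AlgState G) (v₁ : Fin n) (h₁ : v₁ ∈ s.alive)
      (hf : FriendAnswer G p q s.alive v₁ none) :
      Round p q s ⟨s.alive \ {v₁}, s.out⟩
  /-- Neither `v₁` nor `v₂` is in a `K^p_q`; remove them and their common neighbours. -/
  | dropMany (s : AlgState G) (v₁ v₂ : Fin n) (h₁ : v₁ ∈ s.alive)
      (hf : FriendAnswer G p q s.alive v₁ (some v₂))
      (hno : ∀ H : G.Subgraph, IsKpq p q s.alive H → v₁ ∉ H.verts ∧ v₂ ∉ H.verts) :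
      Round p q s ⟨s.alive \ ({v₁, v₂} ∪ commonIn G s.alive v₁ v₂), s.out⟩
  /-- `H` is a `K^p_q` that contains `v₁` or `v₂`; return all `K^p_q`'s of the current graph that
  have a common vertex with `H` (so also `H`), and remove the vertices of `H`. -/
  | report (s : AlgState G) (v₁ v₂ : Fin n) (h₁ : v₁ ∈ s.alive)
      (hf : FriendAnswer G p q s.alive v₁ (some v₂))
      (H : G.Subgraph) (hH : IsKpq p q s.alive H) (hv : v₁ ∈ H.verts ∨ v₂ ∈ H.verts) :
      Round p q s ⟨s.alive \ H.verts, s.out ++ [{H' | IsKpq p q s.alive H' ∧ Meet H' H}]⟩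

/-- The states that occur in the executions of the algorithm on `G`. -/
def Reachable {n : ℕ} (G : SimpleGraph (Fin n)) [DecidableRel G.Adj] (t p q : ℕ)
    (s : AlgState G) : Prop :=
  Relation.ReflTransGen (Round p q) (initState G t) s

/-- All subgraphs that were returned. -/
def AlgState.found {n : ℕ} {G : SimpleGraph (Fin n)} (s : AlgState G) : Set G.Subgraph :=
  {H | ∃ F ∈ s.out, H ∈ F}

/-- All (ordered) pairs of different subgraphs that were returned to have a common vertex. -/
def AlgState.foundPairs {n : ℕ} {G : SimpleGraph (Fin n)} (s : AlgState G) :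
    Set (G.Subgraph × G.Subgraph) :=
  {P | P.1 ≠ P.2 ∧ ∃ F ∈ s.out, P.1 ∈ F ∧ P.2 ∈ F}

/-! ## Descriptions of families of `K^p_q`'s -/

/-- `H` is the complete partite graph whose `i`-th colour class is `{f (i, j) | j}`. -/
def Spans {n p q : ℕ} {G : SimpleGraph (Fin n)} (f : Fin p × Fin q → Fin n)
    (H : G.Subgraph) : Prop :=
  H.verts = Set.range f ∧ ∀ u v, H.Adj u v ↔ ∃ a b, a.1 ≠ b.1 ∧ f a = u ∧ f b = v

/-- A record lists the vertices of one `K^p_q`, class by class, then some vertices that may be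
permuted arbitrarily, and then some replacements `(x, y, x', y')` of at most two vertices. -/
structure Record (n p q : ℕ) where
  base : Fin p × Fin q → Fin n
  core : List (Fin n)
  swaps : List (Fin n × Fin n × Fin n × Fin n)

/-- Replace `x` by `y` and `x'` by `y'`. -/
def substitute {n : ℕ} (w : Fin n × Fin n × Fin n × Fin n) (v : Fin n) : Fin n :=
  if v = w.1 then w.2.1 else if v = w.2.2.1 then w.2.2.2 else v

/-- The lists of colour classes described by a record: the base after some permutation of the core
vertices, or the base after one of the listed replacements. -/
def Record.Describes {n p q : ℕ} (r : Record n p q) (g : Fin p × Fin q → Fin n) : Prop :=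
  (∃ σ : Equiv.Perm (Fin n), (∀ v, v ∉ r.core → σ v = v) ∧ g = σ ∘ r.base) ∨
    ∃ w ∈ r.swaps, g = substitute w ∘ r.base

/-- The record describes only members of the family `F`, and all of them. -/
def Record.Represents {n p q : ℕ} {G : SimpleGraph (Fin n)} (r : Record n p q)
    (F : Set G.Subgraph) : Prop :=
  (∀ g, r.Describes g → ∃ H ∈ F, Spans g H) ∧ ∀ H ∈ F, ∃ g, r.Describes g ∧ Spans g H

/-- The record, written down as a sequence of numbers. -/
def Record.words {n p q : ℕ} (r : Record n p q) : List ℕ :=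
  (List.finRange p).flatMap (fun i => (List.finRange q).map (fun j => (r.base (i, j) : ℕ))) ++
    r.core.length :: r.core.map (fun v => (v : ℕ)) ++
    r.swaps.length :: r.swaps.flatMap
      (fun w => [(w.1 : ℕ), (w.2.1 : ℕ), (w.2.2.1 : ℕ), (w.2.2.2 : ℕ)])

/-! ## The machine model: a random access machine with unit costs and bounded words

A program uses finitely many variables and finitely many arrays of natural numbers. -/

/-- The contents of the variables and of the arrays. -/
structure Store where
  var : ℕ → ℕ
  arr : ℕ → ℕ → ℕ

/-- An operand is a constant or a variable. -/
inductive Operand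
  | lit (k : ℕ)
  | var (x : ℕ)

def Operand.val (s : Store) : Operand → ℕ
  | .lit k => k
  | .var x => s.var x

/-- Assign to a variable. -/
def Store.setVar (s : Store) (x k : ℕ) : Store := ⟨Function.update s.var x k, s.arr⟩

/-- Assign to the cell `i` of the array `a`. -/
def Store.setArr (s : Store) (a i k : ℕ) : Store :=
  ⟨s.var, Function.update s.arr a (Function.update (s.arr a) i k)⟩

inductive Program
  | skip
  /-- `x := u + v` -/
  | add (x : ℕ) (u v : Operand)
  /-- `x := u - v` (truncated) -/
  | sub (x : ℕ) (u v : Operand)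
  /-- `x := a[i]` -/
  | load (x a : ℕ) (i : Operand)
  /-- `a[i] := u` -/
  | store (a : ℕ) (i u : Operand)
  | seq (c d : Program)
  /-- `if u < v then c else d` -/
  | ite (u v : Operand) (c d : Program)
  /-- `while u < v do c` -/
  | loop (u v : Operand) (c : Program)

/-- `Runs W c s k s'`: started in `s`, the program `c` halts in `s'` after exactly `k` elementary
operations (assignments, array accesses and tests), and no number that it computes or writes
exceeds `W`. -/
inductive Runs (W : ℕ) : Program → Store → ℕ → Store → Prop
  | skip (s) : Runs W .skip s 0 s
  | add (s x u v) (h : u.val s + v.val s ≤ W) :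
      Runs W (.add x u v) s 1 (s.setVar x (u.val s + v.val s))
  | sub (s x u v) (h : u.val s - v.val s ≤ W) :
      Runs W (.sub x u v) s 1 (s.setVar x (u.val s - v.val s))
  | load (s x a i) (hi : i.val s ≤ W) (h : s.arr a (i.val s) ≤ W) :
      Runs W (.load x a i) s 1 (s.setVar x (s.arr a (i.val s)))
  | store (s a i u) (hi : i.val s ≤ W) (h : u.val s ≤ W) :
      Runs W (.store a i u) s 1 (s.setArr a (i.val s) (u.val s))
  | seq {s k s' l s''} {c d : Program} (h₁ : Runs W c s k s') (h₂ : Runs W d s' l s'') :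
      Runs W (.seq c d) s (k + l) s''
  | iteTrue {s k s'} {u v : Operand} {c d : Program} (h : u.val s < v.val s)
      (h₁ : Runs W c s k s') : Runs W (.ite u v c d) s (k + 1) s'
  | iteFalse {s k s'} {u v : Operand} {c d : Program} (h : ¬ u.val s < v.val s)
      (h₁ : Runs W d s k s') : Runs W (.ite u v c d) s (k + 1) s'
  | loopDone {s} {u v : Operand} {c : Program} (h : ¬ u.val s < v.val s) :
      Runs W (.loop u v c) s 1 s
  | loopMore {s k s' l s''} {u v : Operand} {c : Program} (h : u.val s < v.val s)
      (h₁ : Runs W c s k s') (h₂ : Runs W (.loop u v c) s' l s'') :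
      Runs W (.loop u v c) s (k + l + 1) s''

/-- The initial store for `G`, `t`, `p`, `q` and a further input number `x`: the variables `0, …, 4`
hold `n`, `t`, `p`, `q`, `x`; the adjacency lists (each in any order) stand one after the other in
array `1`, the list of `v` in the cells from `off v` to `off (v + 1) - 1`, where array `0` holds the
numbers `off 0, …, off n`. Everything else is zero. -/
structure IsInput {n : ℕ} (G : SimpleGraph (Fin n)) [DecidableRel G.Adj] (t p q x : ℕ)
    (s : Store) : Prop where
  var_n : s.var 0 = n
  var_t : s.var 1 = t
  var_p : s.var 2 = p
  var_q : s.var 3 = q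
  var_x : s.var 4 = x
  var_rest : ∀ i, 5 ≤ i → s.var i = 0
  off_zero : s.arr 0 0 = 0
  off_succ : ∀ v : Fin n, s.arr 0 (v + 1) = s.arr 0 v + G.degree v
  off_rest : ∀ i, n < i → s.arr 0 i = 0
  adj : ∀ u v : Fin n,
    G.Adj u v ↔ ∃ i, s.arr 0 u ≤ i ∧ i < s.arr 0 (u + 1) ∧ s.arr 1 i = v
  adj_rest : ∀ i, s.arr 0 n ≤ i → s.arr 1 i = 0
  arr_rest : ∀ a, 2 ≤ a → ∀ i, s.arr a i = 0

/-- The output of a list of records: their number is in variable `5`, and they are written one after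
the other at the beginning of array `2`. -/
def OutputRecords {n p q : ℕ} (s : Store) (rs : List (Record n p q)) : Prop :=
  s.var 5 = rs.length ∧
    ∀ (i : ℕ) (h : i < (rs.flatMap Record.words).length), s.arr 2 i = (rs.flatMap Record.words)[i]

/-- The output of a vertex or of no vertex: variable `5` is `v + 1` or `0`. -/
def OutputOption {n : ℕ} (s : Store) : Option (Fin n) → Prop
  | none => s.var 5 = 0
  | some v => s.var 5 = v + 1

end KpqSearch

open KpqSearch

namespace KpqSearch

set_option linter.unusedSectionVars false
/-! ## A program logic with costs -/

attribute [simp] Operand.val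

/-! Everything rests on one count. A vertex of a `K^p_q` has `t` neighbours in the other classes,
and its degree is at most `t + 1`, so it has at most one further neighbour (`no_two_extra`).

Correctness. If two `K^p_q`'s share a vertex, the second one misses at most one vertex of the first
outside the class of the shared vertex (`miss_le_one`). As `t ≥ 3`, there is a shared vertex in
another class too, so at most two vertices are missing, and at most one if `q = 1`
(`card_missing_le`). A `K^p_q` has `t + q` vertices, which is so many that two `K^p_q`'s that meet
it also meet each other inside it (`meet_trans`). Hence meeting is an equivalence relation, and a
returned family is one of its classes among all `K^p_q`'s of `G`. A common neighbour of `v₁` and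
`v₂` in a `K^p_q` that avoids both would have two further neighbours, so the removal of common
neighbours is harmless (`common_safe`). The invariant `Sound` collects these facts.

Friends. Of two neighbours of a vertex of a `K^p_q`, one is in another class (`exists_class_nbr`).
For `p ≥ 3` it is a friend; for `p = 2` some neighbour of it, in the class of `v₁`, is one. So three
neighbours of `v₁` and three neighbours of each of these are enough candidates (`friend_complete`).

Local search. For one of two neighbours `u` of `v`, a `K^p_q` through `v` lies in the union of the
neighbourhoods of `v` and `u`, which then has at most `p q + 2` vertices (`cover_two`,
`card_two_le`). While there is a surplus, six vertices can be named of which one may be deleted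
without losing all `K^p_q`'s through `v` (`branch_path`, `branch_cluster`), so a search tree of
depth two suffices. When `p q` vertices are left, a class is either connected by at most two steps
in the complement of `G`, or consists of vertices adjacent to all others; sorting by suitable keys
finds the classes (`sort_classes`), and a final check verifies them.

Families. A `K^p_q` that meets a given one has the same vertices, or arises by replacing one vertex,
or, for `p = 2`, two vertices of different classes (`meeting_cases`). The vertices determine the
classes if `q ≠ 2` (`sameSpan_of_range`). For `q = 2`, exactly the vertices adjacent to their class
mates can be regrouped, and arbitrarily so (`exists_perm`, `free_adj`). Thus a record describes a
whole family (`represents_of`). The replacements are found from the table of outside neighbours, of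
which each vertex has at most one.

Running time. A round costs `O(t)` if it only asks for a friend, and otherwise `O(t²)`, but then it
removes at least `t / 2` vertices (`le_ncard_commonIn`). So a potential proportional to `t` for each
remaining vertex pays for all rounds (`spec_round`), and initially it is `O(m)`, since the remaining
vertices have degree at least `t` (`spec_main`). The programs are verified in a weakest precondition
calculus that counts operations; working arrays that have to be zero are erased after use at the
cost of what was written. -/

@[simp] theorem Store.setVar_var (s : Store) (x k y : ℕ) :
    (s.setVar x k).var y = if y = x then k else s.var y := by
  simp [Store.setVar, Function.update_apply]

@[simp] theorem Store.setVar_arr (s : Store) (x k : ℕ) : (s.setVar x k).arr = s.arr := rfl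

@[simp] theorem Store.setArr_var (s : Store) (a i k : ℕ) : (s.setArr a i k).var = s.var := rfl

@[simp] theorem Store.setArr_arr (s : Store) (a i k b : ℕ) :
    (s.setArr a i k).arr b = if b = a then Function.update (s.arr a) i k else s.arr b := by
  simp [Store.setArr, Function.update_apply]

/-- Started in `s` after `k` operations, `c` halts, and then `Q` holds of the total number of
operations and of the store. -/
def wp (W : ℕ) (c : Program) (s : Store) (k : ℕ) (Q : ℕ → Store → Prop) : Prop :=
  ∃ l s', Runs W c s l s' ∧ Q (k + l) s'

/-- Started in `s`, the program `c` halts after at most `T` operations, and then `Q` holds. -/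
def Spec (W : ℕ) (c : Program) (T : ℕ) (s : Store) (Q : Store → Prop) : Prop :=
  wp W c s 0 fun k s' => k ≤ T ∧ Q s'

section
variable {W : ℕ} {s : Store} {k : ℕ} {Q : ℕ → Store → Prop}

@[simp] theorem wp_skip : wp W .skip s k Q ↔ Q k s := by
  constructor
  · rintro ⟨l, s', h, hQ⟩; cases h; simpa using hQ
  · intro h; exact ⟨0, s, .skip s, by simpa using h⟩

@[simp] theorem wp_add {x : ℕ} {u v : Operand} : wp W (.add x u v) s k Q ↔
    u.val s + v.val s ≤ W ∧ Q (k + 1) (s.setVar x (u.val s + v.val s)) := by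
  constructor
  · rintro ⟨l, s', h, hQ⟩; cases h; exact ⟨by assumption, hQ⟩
  · rintro ⟨h, hQ⟩; exact ⟨1, _, .add s x u v h, hQ⟩

@[simp] theorem wp_sub {x : ℕ} {u v : Operand} : wp W (.sub x u v) s k Q ↔
    u.val s - v.val s ≤ W ∧ Q (k + 1) (s.setVar x (u.val s - v.val s)) := by
  constructor
  · rintro ⟨l, s', h, hQ⟩; cases h; exact ⟨by assumption, hQ⟩
  · rintro ⟨h, hQ⟩; exact ⟨1, _, .sub s x u v h, hQ⟩

@[simp] theorem wp_load {x a : ℕ} {i : Operand} : wp W (.load x a i) s k Q ↔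
    i.val s ≤ W ∧ s.arr a (i.val s) ≤ W ∧ Q (k + 1) (s.setVar x (s.arr a (i.val s))) := by
  constructor
  · rintro ⟨l, s', h, hQ⟩; cases h; exact ⟨by assumption, by assumption, hQ⟩
  · rintro ⟨h, h', hQ⟩; exact ⟨1, _, .load s x a i h h', hQ⟩

@[simp] theorem wp_store {a : ℕ} {i u : Operand} : wp W (.store a i u) s k Q ↔
    i.val s ≤ W ∧ u.val s ≤ W ∧ Q (k + 1) (s.setArr a (i.val s) (u.val s)) := by
  constructor
  · rintro ⟨l, s', h, hQ⟩; cases h; exact ⟨by assumption, by assumption, hQ⟩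
  · rintro ⟨h, h', hQ⟩; exact ⟨1, _, .store s a i u h h', hQ⟩

@[simp] theorem wp_seq {c d : Program} :
    wp W (.seq c d) s k Q ↔ wp W c s k fun k' s' => wp W d s' k' Q := by
  constructor
  · rintro ⟨l, s', h, hQ⟩
    cases h with
    | seq h₁ h₂ => exact ⟨_, _, h₁, _, _, h₂, by rwa [add_assoc]⟩
  · rintro ⟨l, s', h, l', s'', h', hQ⟩
    exact ⟨_, _, .seq h h', by rwa [← add_assoc]⟩

@[simp] theorem wp_ite {u v : Operand} {c d : Program} : wp W (.ite u v c d) s k Q ↔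
    (u.val s < v.val s → wp W c s (k + 1) Q) ∧ (¬ u.val s < v.val s → wp W d s (k + 1) Q) := by
  constructor
  · rintro ⟨l, s', h, hQ⟩
    cases h with
    | iteTrue h h₁ => exact ⟨fun _ => ⟨_, _, h₁, by rwa [add_right_comm]⟩, fun h' => absurd h h'⟩
    | iteFalse h h₁ => exact ⟨fun h' => absurd h' h, fun _ => ⟨_, _, h₁, by rwa [add_right_comm]⟩⟩
  · rintro ⟨h₁, h₂⟩
    by_cases h : u.val s < v.val s
    · obtain ⟨l, s', hr, hQ⟩ := h₁ h
      exact ⟨_, _, .iteTrue h hr, by rwa [add_right_comm] at hQ⟩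
    · obtain ⟨l, s', hr, hQ⟩ := h₂ h
      exact ⟨_, _, .iteFalse h hr, by rwa [add_right_comm] at hQ⟩

/-- The cut rule: a verified subprogram is replaced by its cost bound and its postcondition. -/
theorem wp_of_spec {c : Program} {T : ℕ} {P : Store → Prop} (h : Spec W c T s P)
    (hQ : ∀ l s', l ≤ T → P s' → Q (k + l) s') : wp W c s k Q := by
  obtain ⟨l, s', hr, hl, hP⟩ := h
  exact ⟨l, s', hr, hQ l s' (by simpa using hl) hP⟩

/-- The continuation `Q` stays a variable during the symbolic execution, so that `simp` works on the
program and leaves the postcondition alone. -/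
theorem Spec.intro {c : Program} {T : ℕ} {P : Store → Prop}
    (h : ∀ Q : ℕ → Store → Prop, (∀ k s', k ≤ T → P s' → Q k s') → wp W c s 0 Q) :
    Spec W c T s P := h _ fun _ _ hk hP => ⟨hk, hP⟩

theorem Spec.mono {c : Program} {T T' : ℕ} {P P' : Store → Prop} (h : Spec W c T s P)
    (hT : T ≤ T') (hP : ∀ s', P s' → P' s') : Spec W c T' s P' :=
  wp_of_spec h fun l s' hl hs => ⟨by omega, hP s' hs⟩

/-- The bounded loop with counter `i`, from the current value of `i` up to the value of `N`. -/
def upTo (i : ℕ) (N : Operand) (c : Program) : Program :=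
  .loop (.var i) N (.seq c (.add i (.var i) (.lit 1)))

/-- A pass costs `T` for the body and two operations for the test and the increment; the final `1`
is the test that fails. The body has to leave the counter alone, and by `hI` the invariant keeps the
bound constant. -/
theorem spec_upTo {i : ℕ} {N : Operand} {c : Program} {m T : ℕ} {Inv : ℕ → Store → Prop}
    (hm : m ≤ W) (hI : ∀ j s, Inv j s → s.var i = j ∧ N.val s = m)
    {a : ℕ} (ha : a ≤ m) (h0 : Inv a s)
    (step : ∀ j, a ≤ j → j < m → ∀ s, Inv j s →
      Spec W c T s fun s' => s'.var i = j ∧ Inv (j + 1) (s'.setVar i (j + 1))) :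
    Spec W (upTo i N c) ((m - a) * (T + 2) + 1) s (Inv m) := by
  induction hd : m - a generalizing a s with
  | zero =>
    obtain rfl : a = m := by omega
    obtain ⟨h1, h2⟩ := hI _ _ h0
    exact ⟨1, s, .loopDone (by simp only [Operand.val] at *; omega), by simp, h0⟩
  | succ d ih =>
    obtain ⟨h1, h2⟩ := hI _ _ h0
    obtain ⟨l, s', hr, hl, h3, h4⟩ := step a le_rfl (by omega) s h0
    obtain ⟨l', s'', hr', hl', h5⟩ := ih (a := a + 1) (by omega) h4
      (fun j hj => step j (by omega)) (by omega)
    refine ⟨(l + 1) + l' + 1, s'', .loopMore (by simp only [Operand.val] at *; omega)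
      (.seq hr (?_ : Runs W _ _ 1 (s'.setVar i (a + 1)))) hr', ?_, h5⟩
    · have := Runs.add (W := W) s' i (.var i) (.lit 1) (by simp; omega)
      simpa [h3] using this
    · have : (d + 1) * (T + 2) = d * (T + 2) + (T + 2) := by ring
      omega

/-- The counting loop with counter `i`, from `0` up to the value of `N`. -/
def forTo (i : ℕ) (N : Operand) (c : Program) : Program :=
  .seq (.add i (.lit 0) (.lit 0)) (upTo i N c)

theorem spec_forTo {i : ℕ} {N : Operand} {c : Program} {m T : ℕ} {Inv : ℕ → Store → Prop}
    (hm : m ≤ W) (hI : ∀ j s, Inv j s → s.var i = j ∧ N.val s = m)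
    (step : ∀ j < m, ∀ s, Inv j s →
      Spec W c T s fun s' => s'.var i = j ∧ Inv (j + 1) (s'.setVar i (j + 1)))
    (h0 : Inv 0 (s.setVar i 0)) :
    Spec W (forTo i N c) (m * (T + 2) + 2) s (Inv m) := by
  have := spec_upTo hm hI (Nat.zero_le m) h0 fun j _ => step j
  simp only [forTo, Spec, wp_seq, wp_add, Operand.val]
  refine ⟨by omega, wp_of_spec this fun l s' hl h => ⟨by simp at hl; omega, h⟩⟩

/-- The variables below `B`, apart from those in `Xs`, and the arrays apart from those in `As`, are
the same in `s` and `s'`. -/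
def Keep (B : ℕ) (Xs As : List ℕ) (s s' : Store) : Prop :=
  (∀ x < B, x ∉ Xs → s'.var x = s.var x) ∧ ∀ a, a ∉ As → s'.arr a = s.arr a

variable {B : ℕ} {Xs As : List ℕ} {s' s'' : Store}

@[simp] theorem Keep.refl : Keep B Xs As s s := ⟨fun _ _ _ => rfl, fun _ _ => rfl⟩

theorem Keep.setVar (h : Keep B Xs As s s') {x v : ℕ} (hx : B ≤ x ∨ x ∈ Xs) :
    Keep B Xs As s (s'.setVar x v) := by
  refine ⟨fun y hy hy' => ?_, fun a ha => h.2 a ha⟩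
  have : y ≠ x := by rintro rfl; rcases hx with hx | hx; · omega
                     · exact hy' hx
  simp [this, h.1 y hy hy']

theorem Keep.setArr (h : Keep B Xs As s s') {a i v : ℕ} (ha : a ∈ As) :
    Keep B Xs As s (s'.setArr a i v) := by
  refine ⟨fun y hy hy' => h.1 y hy hy', fun b hb => ?_⟩
  have : b ≠ a := by rintro rfl; exact hb ha
  simp [this, h.2 b hb]

/-- The variables from `B` on count as scratch space. A subprogram that protects more of them (`B ≤
B'`) may change what the caller has given up. -/
theorem Keep.trans {B' : ℕ} {Xs' As' : List ℕ} (h : Keep B Xs As s s')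
    (h' : Keep B' Xs' As' s' s'') (hB : B ≤ B') (hX : ∀ x ∈ Xs', B ≤ x ∨ x ∈ Xs)
    (hA : ∀ a ∈ As', a ∈ As) : Keep B Xs As s s'' := by
  refine ⟨fun y hy hy' => ?_, fun a ha => ?_⟩
  · rw [h'.1 y (by omega) fun hm => (hX y hm).elim (by omega) hy', h.1 y hy hy']
  · rw [h'.2 a fun hm => ha (hA a hm), h.2 a ha]

end

/-! ## Adjacency lists -/

/-- The standing data of the verification: a bounded graph, its adjacency lists `a₀`, `a₁`, the
removed vertices `d`, and a bound `W` for all numbers. -/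
structure Ctx {n : ℕ} (G : SimpleGraph (Fin n)) [DecidableRel G.Adj] (t p q W : ℕ)
    (a₀ a₁ d : ℕ → ℕ) : Prop where
  params : Params t p q
  bounded : Bounded G t
  le_W : 1000 * (n + t + 2) ^ 4 ≤ W
  off_zero : a₀ 0 = 0
  off_succ : ∀ v : Fin n, a₀ (v + 1) = a₀ v + G.degree v
  adj : ∀ u v : Fin n, G.Adj u v ↔ ∃ i, a₀ u ≤ i ∧ i < a₀ (u + 1) ∧ a₁ i = v
  dead_le : ∀ i, d i ≤ 1

/-- The store holds the parameters, the adjacency lists, and the removed vertices. -/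
structure At (n t p q : ℕ) (a₀ a₁ d : ℕ → ℕ) (s : Store) : Prop where
  var_n : s.var 0 = n
  var_t : s.var 1 = t
  var_p : s.var 2 = p
  var_q : s.var 3 = q
  off : s.arr 0 = a₀
  adj : s.arr 1 = a₁
  dead : s.arr 3 = d

theorem At.keep {n t p q : ℕ} {a₀ a₁ d : ℕ → ℕ} {s s' : Store} (h : At n t p q a₀ a₁ d s)
    {B : ℕ} {Xs As : List ℕ} (hk : Keep B Xs As s s') (hB : 4 ≤ B := by norm_num)
    (hX : ∀ x ∈ Xs, 4 ≤ x := by simp) (h0 : 0 ∉ As := by simp) (h1 : 1 ∉ As := by simp)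
    (h3 : 3 ∉ As := by simp) : At n t p q a₀ a₁ d s' := by
  have key : ∀ x < 4, s'.var x = s.var x := fun x hx =>
    hk.1 x (by omega) fun hm => by have := hX x hm; omega
  exact ⟨by rw [key 0 (by omega), h.var_n], by rw [key 1 (by omega), h.var_t],
    by rw [key 2 (by omega), h.var_p], by rw [key 3 (by omega), h.var_q],
    by rw [hk.2 0 h0, h.off], by rw [hk.2 1 h1, h.adj], by rw [hk.2 3 h3, h.dead]⟩

/-- The neighbours of `v` that are not removed. -/
def nb {n : ℕ} (G : SimpleGraph (Fin n)) [DecidableRel G.Adj] (d : ℕ → ℕ) (v : Fin n) :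
    Finset (Fin n) := {x | G.Adj v x ∧ d x = 0}

section
variable {n t p q W : ℕ} {G : SimpleGraph (Fin n)} [DecidableRel G.Adj] {a₀ a₁ d : ℕ → ℕ}

@[simp] theorem mem_nb {v x : Fin n} : x ∈ nb G d v ↔ G.Adj v x ∧ d x = 0 := by simp [nb]

theorem Ctx.card_nb_le (h : Ctx G t p q W a₀ a₁ d) (v : Fin n) : (nb G d v).card ≤ t + 1 :=
  le_trans (Finset.card_le_card fun x hx => by simpa using (mem_nb.1 hx).1) (h.bounded v)

theorem Ctx.off_le (h : Ctx G t p q W a₀ a₁ d) : ∀ v ≤ n, a₀ v ≤ v * (t + 1)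
  | 0, _ => by simp [h.off_zero]
  | v + 1, hv => by
    have h1 := h.off_le v (by omega)
    have h2 := h.off_succ ⟨v, hv⟩
    have h3 := h.bounded ⟨v, hv⟩
    simp only at h2
    rw [h2, add_mul]; omega

theorem pow_bounds (n t : ℕ) : (n + t + 2) ^ 2 ≤ (n + t + 2) ^ 3 ∧
    (n + t + 2) ^ 3 ≤ (n + t + 2) ^ 4 ∧ n + t + 2 ≤ (n + t + 2) ^ 2 :=
  ⟨Nat.pow_le_pow_right (by omega) (by omega), Nat.pow_le_pow_right (by omega) (by omega),
    Nat.le_self_pow (by omega) _⟩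

theorem Ctx.le_W₂ (h : Ctx G t p q W a₀ a₁ d) : 1000 * (n + t + 2) ^ 2 ≤ W := by
  have := pow_bounds n t; have := h.le_W; omega

theorem Ctx.le_W₁ (h : Ctx G t p q W a₀ a₁ d) : 1000 * (n + t + 2) ≤ W := by
  have := pow_bounds n t; have := h.le_W₂; omega

theorem Ctx.off_le_W (h : Ctx G t p q W a₀ a₁ d) {v : ℕ} (hv : v ≤ n) : a₀ v ≤ W := by
  have h1 := h.off_le v hv
  have h2 := h.le_W₂
  nlinarith

/-- The hypothesis on the lists only says which vertices occur. Since the list of `v` has `G.degree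
v` cells and all neighbours occur in it, counting excludes repetitions and foreign entries. -/
theorem Ctx.lists (h : Ctx G t p q W a₀ a₁ d) (v : Fin n) :
    (∀ i, a₀ v ≤ i → i < a₀ (v + 1) → ∃ x : Fin n, a₁ i = x ∧ G.Adj v x) ∧
    ∀ i j, a₀ v ≤ i → i < a₀ (v + 1) → a₀ v ≤ j → j < a₀ (v + 1) → a₁ i = a₁ j → i = j := by
  classical
  set I := Finset.Ico (a₀ v) (a₀ (v + 1)) with hI
  set N := (G.neighborFinset v).image (fun x : Fin n => (x : ℕ)) with hN
  have hNc : N.card = G.degree v := by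
    rw [hN, Finset.card_image_of_injective _ Fin.val_injective, SimpleGraph.card_neighborFinset_eq_degree]
  have hIc : I.card = G.degree v := by rw [hI, Nat.card_Ico, h.off_succ]; omega
  have hsub : N ⊆ I.image a₁ := by
    intro y hy
    obtain ⟨x, hx, rfl⟩ := Finset.mem_image.1 hy
    obtain ⟨i, h1, h2, h3⟩ := (h.adj v x).1 (by simpa using hx)
    exact Finset.mem_image.2 ⟨i, by simp [hI, h1, h2], h3⟩
  have hle : (I.image a₁).card ≤ I.card := Finset.card_image_le
  have heq : N = I.image a₁ := Finset.eq_of_subset_of_card_le hsub (by omega)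
  have hinj : Set.InjOn a₁ I := Finset.card_image_iff.1 (by rw [← heq]; omega)
  refine ⟨fun i h1 h2 => ?_, fun i j h1 h2 h3 h4 h5 => hinj (by simp [*]) (by simp [*]) h5⟩
  have : a₁ i ∈ N := heq ▸ Finset.mem_image_of_mem _ (by simp [hI, h1, h2])
  obtain ⟨x, hx, hxi⟩ := Finset.mem_image.1 this
  exact ⟨x, hxi.symm, by simpa using hx⟩

/-- Run `c` for all neighbours `x` (variable `162`) of the vertex in variable `y` that are not
removed. -/
def forNbr (y : ℕ) (c : Program) : Program :=
  .seq (.add 161 (.var y) (.lit 1)) (.seq (.load 160 0 (.var y)) (.seq (.load 161 0 (.var 161))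
    (upTo 160 (.var 161) (.seq (.load 162 1 (.var 160)) (.seq (.load 163 3 (.var 162))
      (.ite (.var 163) (.lit 1) c .skip))))))

/-- The lists come in any order, so the invariant is indexed by the set `P` of the neighbours
already visited. By `hI` it does not depend on the variables from `160` on, which the loop uses
itself. -/
theorem spec_forNbr (h : Ctx G t p q W a₀ a₁ d) {s : Store} (hs : At n t p q a₀ a₁ d s)
    {y : ℕ} {v : Fin n} (hy : y < 160) (ho : s.var y = v) {c : Program} {T : ℕ}
    {Inv : Finset (Fin n) → Store → Prop} (h0 : Inv ∅ s)
    (hI : ∀ P s s', Inv P s → (∀ x < 160, s'.var x = s.var x) → s'.arr = s.arr → Inv P s')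
    (step : ∀ P (x : Fin n) s, G.Adj v x → d x = 0 → x ∉ P → P ⊆ nb G d v →
      At n t p q a₀ a₁ d s → Inv P s → s.var 162 = x →
      Spec W c T s fun s' => Inv (insert x P) s' ∧ s'.var 160 = s.var 160 ∧
        s'.var 161 = s.var 161 ∧ At n t p q a₀ a₁ d s') :
    Spec W (forNbr y c) ((t + 1) * (T + 5) + 4) s
      fun s' => Inv (nb G d v) s' ∧ At n t p q a₀ a₁ d s' := by
  classical
  have hW := h.le_W₁
  set done : ℕ → Finset (Fin n) := fun i =>
    {x ∈ nb G d v | ∃ j, a₀ v ≤ j ∧ j < i ∧ a₁ j = x} with hdone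
  have hlast : done (a₀ (v + 1)) = nb G d v := by
    ext x
    simp only [hdone, Finset.mem_filter, and_iff_left_iff_imp]
    intro hx
    simpa using (h.adj v x).1 (mem_nb.1 hx).1
  have hm : a₀ (v + 1) ≤ W := h.off_le_W v.2
  have hv : a₀ v ≤ W := h.off_le_W v.2.le
  have hle : a₀ v ≤ a₀ (v + 1) := by rw [h.off_succ]; omega
  have hdeg : a₀ (v + 1) - a₀ v ≤ t + 1 := by have := h.off_succ v; have := h.bounded v; omega
  have at_set : ∀ {s : Store} {x k : ℕ}, At n t p q a₀ a₁ d s → 160 ≤ x →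
      At n t p q a₀ a₁ d (s.setVar x k) := fun hs hx =>
    hs.keep (B := 160) (Xs := []) (As := []) (Keep.setVar Keep.refl (.inl hx))
  have hy' : y ≠ 161 := by omega
  simp only [forNbr, Spec, wp_seq, wp_add, wp_load, Operand.val, Store.setVar_var, Store.setVar_arr,
    ho, hs.off, if_neg hy', if_true]
  norm_num
  refine ⟨by omega, by omega, hv, by omega, hm, ?_⟩
  refine wp_of_spec (spec_upTo (N := .var 161) (a := a₀ v) (m := a₀ (v + 1)) (T := T + 3)
    (Inv := fun i s => Inv (done i) s ∧ At n t p q a₀ a₁ d s ∧ s.var 160 = i ∧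
      s.var 161 = a₀ (v + 1)) hm (fun j s hj => ⟨hj.2.2.1, hj.2.2.2⟩) hle ?_ ?_) ?_
  · refine ⟨?_, at_set (at_set (at_set hs (by norm_num)) (by norm_num)) (by norm_num), ?_, ?_⟩
    · have : done (a₀ v) = ∅ := by
        ext z
        simp only [hdone, Finset.mem_filter, Finset.notMem_empty, iff_false, not_and, not_exists]
        rintro - j hj1 hj2; omega
      rw [this]
      exact hI _ _ _ h0 (fun z hz => by
          simp [show z ≠ 161 by omega, show z ≠ 160 by omega]) rfl
    · simp
    · simp
  · rintro i hiv hi s ⟨h1, h2, h3, h4⟩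
    · obtain ⟨x, hx, hvx⟩ := (h.lists v).1 i hiv hi
      have hxn := x.2
      have hdx := h.dead_le x
      have hdone' : d x = 0 → done (i + 1) = insert x (done i) := by
        intro hdx
        ext z
        simp only [hdone, Finset.mem_filter, Finset.mem_insert, mem_nb]
        constructor
        · rintro ⟨hz, j, hj1, hj2, hj3⟩
          by_cases hji : j = i
          · left; subst hji; exact Fin.ext (by omega)
          · right; exact ⟨hz, j, hj1, by omega, hj3⟩
        · rintro (rfl | ⟨hz, j, hj1, hj2, hj3⟩)
          · exact ⟨⟨hvx, hdx⟩, i, hiv, by omega, hx⟩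
          · exact ⟨hz, j, hj1, by omega, hj3⟩
      simp only [Spec, wp_seq, wp_load, wp_ite, wp_skip, Operand.val, Store.setVar_var,
        Store.setVar_arr, h2.adj, h2.dead, h3, hx, if_true]
      norm_num
      refine ⟨by omega, by omega, by omega, fun hd0 => ?_, fun hd1 => ?_⟩
      -- As the list has no repetitions, no neighbour is treated twice; counts would otherwise be
      -- wrong.
      · have hx' : x ∉ done i := by
          simp only [hdone, Finset.mem_filter, not_and, not_exists]
          rintro - j hj1 hj2 hj3
          have := (h.lists v).2 i j hiv hi hj1 (by omega) (by omega)
          omega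
        have hst := step (done i) x ((s.setVar 162 x).setVar 163 (d x)) hvx hd0 hx'
          (Finset.filter_subset _ _) (at_set (at_set h2 (by norm_num)) (by norm_num))
          (hI _ _ _ h1 (fun z hz => by
            simp [show z ≠ 162 by omega, show z ≠ 163 by omega]) rfl) (by simp)
        refine wp_of_spec hst ?_
        rintro l s' hl ⟨g1, g2, g3, g4⟩
        simp at g2 g3
        refine ⟨by omega, by omega, ?_, at_set g4 (by norm_num), by omega⟩
        rw [hdone' hd0]
        exact hI _ _ _ g1 (fun z hz => by simp [show z ≠ 160 by omega]) rfl
      · refine ⟨?_, at_set (at_set (at_set h2 (by norm_num)) (by norm_num))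
          (by norm_num), h4⟩
        have : done (i + 1) = done i := by
          ext z
          simp only [hdone, Finset.mem_filter, mem_nb]
          constructor
          · rintro ⟨hz, j, hj1, hj2, hj3⟩
            by_cases hji : j = i
            · subst hji; rw [hx] at hj3; exact absurd (hj3 ▸ hz.2) hd1
            · exact ⟨hz, j, hj1, by omega, hj3⟩
          · rintro ⟨hz, j, hj1, hj2, hj3⟩
            exact ⟨hz, j, hj1, by omega, hj3⟩
        rw [this]
        exact hI _ _ _ h1 (fun z hz => by
          simp [show z ≠ 162 by omega, show z ≠ 163 by omega, show z ≠ 160 by omega]) rfl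
  · rintro l s' hl ⟨g1, g2, -, -⟩
    rw [hlast] at g1
    refine ⟨?_, g1, g2⟩
    have : (a₀ (v + 1) - a₀ v) * (T + 3 + 2) ≤ (t + 1) * (T + 5) := Nat.mul_le_mul hdeg (by omega)
    omega

/-! ## Loops over neighbourhoods -/

theorem Keep.stable {B : ℕ} {Xs As : List ℕ} {s₀ s s' : Store} (h : Keep B Xs As s₀ s)
    (hB : B ≤ 160) (hv : ∀ x < 160, s'.var x = s.var x) (ha : s'.arr = s.arr) :
    Keep B Xs As s₀ s' :=
  ⟨fun x hx hX => by rw [hv x (by omega), h.1 x hx hX], fun a hA => by rw [ha, h.2 a hA]⟩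

/-- The array `a` begins with the list `l` of vertices. -/
def Lst {n : ℕ} (s : Store) (a : ℕ) (l : List (Fin n)) : Prop :=
  ∀ j (h : j < l.length), s.arr a j = (l[j] : ℕ)

theorem Lst.append {n : ℕ} {s s' : Store} {a : ℕ} {l : List (Fin n)} (h : Lst s a l) {x : Fin n}
    (hs : s'.arr a = Function.update (s.arr a) l.length x) : Lst s' a (l ++ [x]) := by
  intro j hj
  rw [hs, Function.update_apply]
  simp at hj
  split_ifs with hjl
  · subst hjl; simp
  · rw [h j (by omega), List.getElem_append_left (by omega)]

theorem Lst.congr {n : ℕ} {s s' : Store} {a : ℕ} {l : List (Fin n)} (h : Lst s a l)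
    (hs : s'.arr a = s.arr a) : Lst s' a l := fun j hj => by rw [hs, h j hj]

/-- Write `k` into the cells `o + x` of array `4`, for all neighbours `x` of `y`. -/
def markRow (o y k : ℕ) : Program :=
  forNbr y (.seq (.add 170 (.var o) (.var 162)) (.store 4 (.var 170) (.lit k)))

/-- Count the neighbours `x` of `y` for which the cell `x` of array `4` is not `0`. -/
def countMarked (y : ℕ) : Program :=
  .seq (.add 150 (.lit 0) (.lit 0)) (forNbr y (.seq (.load 170 4 (.var 162))
    (.ite (.lit 0) (.var 170) (.add 150 (.var 150) (.lit 1)) .skip)))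

/-- Append the neighbours `x` of `y` for which the cell `x` of array `4` is `0` to array `a`. -/
def appendUnmarked (a y : ℕ) : Program :=
  forNbr y (.seq (.load 170 4 (.var 162)) (.ite (.lit 0) (.var 170) .skip
    (.seq (.store a (.var 150) (.var 162)) (.add 150 (.var 150) (.lit 1)))))

/-- Called with `1` and later with `0` for the same vertex, so that array `4` is clean again after
`O(t)` operations, however large `n` is. -/
theorem spec_markRow (h : Ctx G t p q W a₀ a₁ d) {s : Store} (hs : At n t p q a₀ a₁ d s)
    {y o k off : ℕ} {v : Fin n} (hy : y < 160) (hyv : s.var y = v) (ho : o < 160)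
    (hov : s.var o = off) (hoff : off ≤ 500 * (n + t + 2) ^ 2) (hk : k ≤ 1) :
    Spec W (markRow o y k) (20 * t + 20) s fun s' => At n t p q a₀ a₁ d s' ∧
      Keep 160 [] [4] s s' ∧
      s'.arr 4 = fun j => if ∃ x ∈ nb G d v, j = off + x then k else s.arr 4 j := by
  have hW₁ := h.le_W₁
  have hW₂ := h.le_W₂
  refine (spec_forNbr (T := 2) h hs hy hyv (Inv := fun P s' => Keep 160 [] [4] s s' ∧
      s'.arr 4 = fun j => if ∃ x ∈ P, j = off + x then k else s.arr 4 j) (by simp) ?_ ?_).mono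
      (by ring_nf; omega) (fun s' h => ⟨h.2, h.1⟩)
  · rintro P s₁ s₂ ⟨h1, h2⟩ hv ha
    exact ⟨h1.stable le_rfl hv ha, by rw [ha, h2]⟩
  · rintro P x s₁ hvx hdx hxP hP hs₁ ⟨h1, h2⟩ hx
    have hov' : s₁.var o = off := by rw [h1.1 o ho (by simp), hov]
    have hk' : Keep 160 [] [4] s₁ ((s₁.setVar 170 (off + x)).setArr 4 (off + x) k) :=
      (Keep.refl.setVar (by simp)).setArr (by simp)
    simp only [Spec, wp_seq, wp_add, wp_store, Operand.val, Store.setVar_var, hov', hx, if_true]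
    refine ⟨by omega, by omega, by omega, by omega, ⟨h1.trans hk' le_rfl (by simp) (by simp), ?_⟩,
      by simp, by simp, hs₁.keep hk'⟩
    funext j
    simp only [Store.setArr_arr, if_true, Store.setVar_arr, h2, Function.update_apply,
      Finset.mem_insert, exists_eq_or_imp]
    by_cases hj : j = off + x <;> simp [hj]

theorem spec_countMarked (h : Ctx G t p q W a₀ a₁ d) {s : Store} (hs : At n t p q a₀ a₁ d s)
    {y : ℕ} {v : Fin n} (hy : y < 150) (hyv : s.var y = v) (hM : ∀ j, s.arr 4 j ≤ 1) :
    Spec W (countMarked y) (20 * t + 20) s fun s' => At n t p q a₀ a₁ d s' ∧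
      Keep 150 [] [] s s' ∧ s'.var 150 = ((nb G d v).filter fun x : Fin n => s.arr 4 x ≠ 0).card := by
  have hW₁ := h.le_W₁
  have hk0 : Keep 150 [] [] s (s.setVar 150 0) := Keep.refl.setVar (by simp)
  simp only [countMarked, Spec, wp_seq, wp_add, Operand.val]
  refine ⟨by omega, wp_of_spec (spec_forNbr (T := 3) h (s := s.setVar 150 0) (v := v) (y := y)
      (hs.keep hk0) (by omega)
      (by simp [hyv]; omega) (Inv := fun P s' => Keep 150 [] [] s s' ∧
      s'.var 150 = (P.filter fun x : Fin n => s.arr 4 x ≠ 0).card) ⟨hk0, by simp⟩ ?_ ?_) ?_⟩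
  · rintro P s₁ s₂ ⟨h1, h2⟩ hv ha
    exact ⟨h1.stable (by omega) hv ha, by rw [hv 150 (by omega), h2]⟩
  · rintro P x s₁ hvx hdx hxP hP hs₁ ⟨h1, h2⟩ hx
    have hc : (P.filter fun x : Fin n => s.arr 4 x ≠ 0).card ≤ t + 1 :=
      le_trans (Finset.card_le_card ((Finset.filter_subset _ _).trans hP)) (h.card_nb_le v)
    have hMx := hM x
    have h4 : s₁.arr 4 = s.arr 4 := h1.2 4 (by simp)
    have hkeep : ∀ k l, Keep 150 [] [] s₁ ((s₁.setVar 170 k).setVar 150 l) := fun k l =>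
      (Keep.refl.setVar (by simp)).setVar (by simp)
    have hkeep' : ∀ k, Keep 150 [] [] s₁ (s₁.setVar 170 k) := fun k => Keep.refl.setVar (by simp)
    simp only [Spec, wp_seq, wp_add, wp_load, wp_ite, wp_skip, Operand.val, Store.setVar_var,
      h4, hx, if_true]
    refine ⟨by omega, by omega, fun h0 => ⟨?_, by omega, ⟨h1.trans (hkeep _ _) le_rfl (by simp)
      (by simp), ?_⟩, by simp, by simp, hs₁.keep (hkeep _ _)⟩, fun h0 => ⟨by omega,
        ⟨h1.trans (hkeep' _) le_rfl (by simp) (by simp), ?_⟩, by simp, by simp, hs₁.keep (hkeep' _)⟩⟩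
    · norm_num; omega
    · norm_num
      rw [h2, Finset.filter_insert, if_pos (by omega), Finset.card_insert_of_notMem (by simp [hxP])]
    · norm_num
      rw [h2, Finset.filter_insert, if_neg (by omega)]
  · rintro l s' hl ⟨⟨h1, h2⟩, h3⟩
    exact ⟨by ring_nf at hl; omega, h3, h1, h2⟩

theorem spec_appendUnmarked (h : Ctx G t p q W a₀ a₁ d) {s : Store} (hs : At n t p q a₀ a₁ d s)
    {a y : ℕ} {v : Fin n} (ha : 5 ≤ a) (hy : y < 160) (hyv : s.var y = v)
    (hM : ∀ j, s.arr 4 j ≤ 1) {l : List (Fin n)} (hl : Lst s a l) (hll : s.var 150 = l.length)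
    (hlen : l.length ≤ 500 * (n + t + 2)) :
    Spec W (appendUnmarked a y) (20 * t + 20) s fun s' => At n t p q a₀ a₁ d s' ∧
      Keep 150 [] [a] s s' ∧ ∃ l' : List (Fin n), l'.Nodup ∧
        (∀ x, x ∈ l' ↔ x ∈ nb G d v ∧ s.arr 4 x = 0) ∧ Lst s' a (l ++ l') ∧
        s'.var 150 = (l ++ l').length := by
  have hW₁ := h.le_W₁
  refine (spec_forNbr (T := 4) h hs hy hyv (Inv := fun P s' => Keep 150 [] [a] s s' ∧
      ∃ l' : List (Fin n), l'.Nodup ∧ (∀ x, x ∈ l' ↔ x ∈ P ∧ s.arr 4 x = 0) ∧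
      Lst s' a (l ++ l') ∧ s'.var 150 = (l ++ l').length)
      ⟨Keep.refl, [], by simp, by simp, by simpa using hl, by simpa using hll⟩ ?_ ?_).mono
      (by ring_nf; omega) (fun s' h => ⟨h.2, h.1⟩)
  · rintro P s₁ s₂ ⟨h1, l', h2, h3, h4, h5⟩ hv ha
    exact ⟨h1.stable (by omega) hv ha, l', h2, h3, h4.congr (by rw [ha]), by rw [hv 150 (by omega), h5]⟩
  · rintro P x s₁ hvx hdx hxP hP hs₁ ⟨h1, l', h2, h3, h4, h5⟩ hx
    have hc : l'.length ≤ t + 1 := by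
      rw [← List.toFinset_card_of_nodup h2]
      exact le_trans (Finset.card_le_card fun y hy => hP ((h3 y).1 (by simpa using hy)).1)
        (h.card_nb_le v)
    have hxn := x.2
    have hMx := hM x
    have hb : s₁.arr 4 = s.arr 4 := h1.2 4 (by simp; omega)
    have hx' : x ∉ l' := fun hm => hxP ((h3 x).1 hm).1
    have hkeep : ∀ k i m j, Keep 150 [] [a] s₁ (((s₁.setVar 170 k).setArr a i m).setVar 150 j) :=
      fun k i m j => ((Keep.refl.setVar (by simp)).setArr (by simp)).setVar (by simp)
    have hkeep' : ∀ k, Keep 150 [] [a] s₁ (s₁.setVar 170 k) := fun k => Keep.refl.setVar (by simp)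
    simp only [Spec, wp_seq, wp_add, wp_load, wp_store, wp_ite, wp_skip, Operand.val,
      Store.setVar_var, Store.setArr_var, hb, hx, if_true]
    norm_num
    simp only [h5, List.length_append]
    have at1 : ∀ k, At n t p q a₀ a₁ d (s₁.setVar 170 k) := fun k => hs₁.keep (Keep.refl.setVar (B := 150) (Xs := []) (As := []) (by simp))
    refine ⟨by omega, by omega, fun h0 => ⟨⟨h1.trans (hkeep' _) le_rfl (by simp) (by simp), l', h2,
      ?_, h4, ?_⟩, at1 _⟩, fun h0 => ⟨by omega, by omega, by omega,
        ⟨h1.trans (hkeep _ _ _ _) le_rfl (by simp) (by simp), l' ++ [x], ?_, ?_, ?_, ?_⟩,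
        hs₁.keep (hkeep _ _ _ _) (by norm_num) (by simp) (by simp; omega) (by simp; omega)
          (by simp; omega)⟩⟩
    · intro y
      rw [h3]
      constructor
      · rintro ⟨g1, g2⟩; exact ⟨.inr g1, g2⟩
      · rintro ⟨rfl | g1, g2⟩; · omega
        · exact ⟨g1, g2⟩
    · simp
    · rw [List.nodup_append]; refine ⟨h2, by simp, ?_⟩
      rintro z hz w hw rfl
      simp at hw; subst hw; exact hx' hz
    · intro y
      simp only [List.mem_append, h3, List.mem_singleton]
      constructor
      · rintro (⟨g1, g2⟩ | rfl); · exact ⟨.inr g1, g2⟩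
        · exact ⟨.inl rfl, h0⟩
      · rintro ⟨rfl | g1, g2⟩; · exact .inr rfl
        · exact .inl ⟨g1, g2⟩
    · rw [← List.append_assoc]
      refine h4.append ?_
      simp
    · simp; omega

end

/-! ## Parametrized `K^p_q`'s -/

section
variable {n t p q : ℕ} {G : SimpleGraph (Fin n)}

/-- The sets `{f (i, j) | j}` are the colour classes of a `K^p_q` of `G`. -/
def KF (G : SimpleGraph (Fin n)) (f : Fin p × Fin q → Fin n) : Prop :=
  Function.Injective f ∧ ∀ a b, a.1 ≠ b.1 → G.Adj (f a) (f b)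

/-- The subgraph that `f` parametrizes. -/
def toSub {f : Fin p × Fin q → Fin n} (hf : KF G f) : G.Subgraph where
  verts := Set.range f
  Adj u v := ∃ a b, a.1 ≠ b.1 ∧ f a = u ∧ f b = v
  adj_sub := by rintro _ _ ⟨a, b, h, rfl, rfl⟩; exact hf.2 a b h
  edge_vert := by rintro _ _ ⟨a, b, h, rfl, rfl⟩; exact ⟨a, rfl⟩
  symm := ⟨by rintro _ _ ⟨a, b, h, rfl, rfl⟩; exact ⟨b, a, h.symm, rfl, rfl⟩⟩

theorem spans_toSub {f : Fin p × Fin q → Fin n} (hf : KF G f) : Spans f (toSub hf) :=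
  ⟨rfl, fun _ _ => Iff.rfl⟩

theorem Spans.mem {f : Fin p × Fin q → Fin n} {H : G.Subgraph} (h : Spans f H) {v : Fin n} :
    v ∈ H.verts ↔ ∃ a, f a = v := by rw [h.1]; rfl

/-- From here on a `K^p_q` is an injective map from the positions (class, index) to the vertices.
The isomorphism of the definition is unpacked only here. -/
theorem isKpq_iff {S : Set (Fin n)} {H : G.Subgraph} : IsKpq p q S H ↔
    ∃ f : Fin p × Fin q → Fin n, KF G f ∧ (∀ a, f a ∈ S) ∧ Spans f H := by
  constructor
  · rintro ⟨hS, ⟨e⟩⟩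
    have hadj : ∀ a b, H.Adj (e.symm a) (e.symm b) ↔ a.1 ≠ b.1 := by
      intro a b
      have := e.symm.map_adj_iff (v := a) (w := b)
      simpa [SimpleGraph.completeEquipartiteGraph] using this
    refine ⟨fun a => e.symm a, ⟨fun a b h => e.symm.injective (Subtype.ext h), fun a b h => ?_⟩,
      fun a => hS (e.symm a).2, ?_, fun u v => ?_⟩
    · exact H.adj_sub ((hadj a b).2 h)
    · ext v
      constructor
      · intro hv; exact ⟨e ⟨v, hv⟩, by simp⟩
      · rintro ⟨a, rfl⟩; exact (e.symm a).2
    · constructor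
      · intro h
        refine ⟨e ⟨u, H.edge_vert h⟩, e ⟨v, H.edge_vert h.symm⟩, ?_, by simp, by simp⟩
        rw [← hadj]; simpa using h
      · rintro ⟨a, b, h, rfl, rfl⟩; exact (hadj a b).2 h
  · rintro ⟨f, hf, hS, hs⟩
    refine ⟨by rw [hs.1]; rintro _ ⟨a, rfl⟩; exact hS a, ⟨?_⟩⟩
    refine SimpleGraph.Iso.symm ⟨((Equiv.ofInjective f hf.1).trans (Equiv.setCongr hs.1.symm)), ?_⟩
    intro a b
    simp only [Equiv.trans_apply, Equiv.setCongr_apply, Equiv.ofInjective_apply,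
      SimpleGraph.Subgraph.coe_adj, hs.2, SimpleGraph.completeEquipartiteGraph]
    simp only [SimpleGraph.comap_adj, SimpleGraph.top_adj]
    constructor
    · rintro ⟨a', b', h, h1, h2⟩
      rwa [← hf.1 h1, ← hf.1 h2]
    · intro h; exact ⟨a, b, h, rfl, rfl⟩

theorem IsKpq.mono {S S' : Set (Fin n)} {H : G.Subgraph} (h : IsKpq p q S H) (hS : H.verts ⊆ S') :
    IsKpq p q S' H := ⟨hS, h.2⟩

theorem card_other (hP : Params t p q) (a : Fin p × Fin q) :
    (Finset.univ.filter fun b : Fin p × Fin q => b.1 ≠ a.1).card = t := by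
  have : (Finset.univ.filter fun b : Fin p × Fin q => b.1 ≠ a.1) =
      (Finset.univ.erase a.1) ×ˢ Finset.univ := by ext b; simp
  rw [this, Finset.card_product, Finset.card_erase_of_mem (Finset.mem_univ _)]
  simp [hP.2.2.2]

theorem KF.pq (hP : Params t p q) : p * q = t + q := by
  obtain ⟨h1, h2, h3, h4⟩ := hP
  obtain ⟨r, rfl⟩ : ∃ r, p = r + 1 := ⟨p - 1, by omega⟩
  rw [h4]; simp [add_mul]

theorem q_le_t (hP : Params t p q) : q ≤ t := by
  obtain ⟨h1, h2, h3, h4⟩ := hP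
  rw [h4]; exact Nat.le_mul_of_pos_left _ (by omega)

/-! ### Two `K^p_q`'s with a common vertex in a bounded graph -/

variable [DecidableRel G.Adj]

/-- Justifies the initial removal of the vertices of degree less than `t`. -/
theorem KF.le_degree (hP : Params t p q) {f : Fin p × Fin q → Fin n} (hf : KF G f)
    (a : Fin p × Fin q) : t ≤ G.degree (f a) := by
  rw [← card_other hP a, ← Finset.card_image_of_injective _ hf.1,
    ← SimpleGraph.card_neighborFinset_eq_degree]
  refine Finset.card_le_card fun v hv => ?_
  obtain ⟨b, hb, rfl⟩ := Finset.mem_image.1 hv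
  simpa using hf.2 a b (by simpa using Ne.symm (Finset.mem_filter.1 hb).2)

/-- A vertex of a `K^p_q` has at most one neighbour in `G` that is not its neighbour in `K^p_q`. -/
theorem no_two_extra (hP : Params t p q) (hB : Bounded G t) {f : Fin p × Fin q → Fin n}
    (hf : KF G f) {a : Fin p × Fin q} {u₁ u₂ : Fin n} (hu : u₁ ≠ u₂) (h₁ : G.Adj (f a) u₁)
    (h₂ : G.Adj (f a) u₂) (h₁' : ∀ b, b.1 ≠ a.1 → f b ≠ u₁) (h₂' : ∀ b, b.1 ≠ a.1 → f b ≠ u₂) :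
    False := by
  set N := (Finset.univ.filter fun b : Fin p × Fin q => b.1 ≠ a.1).image f with hN
  have hNc : N.card = t := by rw [hN, Finset.card_image_of_injective _ hf.1, card_other hP]
  have h1 : u₁ ∉ insert u₂ N := by
    simp only [Finset.mem_insert, hu, hN, Finset.mem_image, false_or, not_exists]
    rintro b ⟨hb, hb'⟩; exact h₁' b (Finset.mem_filter.1 hb).2 hb'
  have h2 : u₂ ∉ N := by
    simp only [hN, Finset.mem_image, not_exists]
    rintro b ⟨hb, hb'⟩; exact h₂' b (Finset.mem_filter.1 hb).2 hb'
  -- The `t` vertices of the other classes together with `u₁` and `u₂` would be `t + 2` neighbours.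
  have hsub : insert u₁ (insert u₂ N) ⊆ G.neighborFinset (f a) := by
    intro v hv
    simp only [Finset.mem_insert, hN, Finset.mem_image] at hv
    rcases hv with rfl | rfl | ⟨b, hb, rfl⟩
    · simpa using h₁
    · simpa using h₂
    · simpa using hf.2 a b (Ne.symm (Finset.mem_filter.1 hb).2)
  have := Finset.card_le_card hsub
  rw [Finset.card_insert_of_notMem h1, Finset.card_insert_of_notMem h2,
    SimpleGraph.card_neighborFinset_eq_degree] at this
  have := hB (f a)
  omega

/-- The vertices of `f` outside the class of the shared vertex are neighbours of it. Those that `f'`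
misses are extra neighbours with respect to `f'`, and `no_two_extra` allows only one. -/
theorem miss_le_one (hP : Params t p q) (hB : Bounded G t) {f f' : Fin p × Fin q → Fin n}
    (hf : KF G f) (hf' : KF G f') {a a' b c : Fin p × Fin q} (ha : f a = f' a') (hb : b.1 ≠ a.1)
    (hc : c.1 ≠ a.1) (hb' : f b ∉ Set.range f') (hc' : f c ∉ Set.range f') : b = c := by
  by_contra hbc
  refine no_two_extra hP hB hf' (a := a') (u₁ := f b) (u₂ := f c) (fun h => hbc (hf.1 h))
    (ha ▸ hf.2 a b hb.symm) (ha ▸ hf.2 a c hc.symm) (fun x _ h => hb' ⟨x, h⟩) fun x _ h => hc' ⟨x, h⟩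

/-- The positions of the vertices of `f` that are not vertices of `f'`. -/
noncomputable def missing (f f' : Fin p × Fin q → Fin n) : Finset (Fin p × Fin q) := by
  classical exact Finset.univ.filter fun b => f b ∉ Set.range f'

theorem mem_missing {f f' : Fin p × Fin q → Fin n} {b : Fin p × Fin q} :
    b ∈ missing f f' ↔ f b ∉ Set.range f' := by simp [missing]

/-- If `f` and `f'` meet in `f a`, they meet in a further vertex, in another class of `f`. -/
theorem exists_other_class (hP : Params t p q) (hB : Bounded G t) {f f' : Fin p × Fin q → Fin n}
    (hf : KF G f) (hf' : KF G f') {a a' : Fin p × Fin q} (ha : f a = f' a') :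
    ∃ c c', c.1 ≠ a.1 ∧ f c = f' c' := by
  have h2 := card_other hP a
  -- The other classes have `t ≥ 3` vertices, and of any two of them at most one can be missing.
  obtain ⟨b, hb, c, hc, hbc⟩ := Finset.one_lt_card.1 (by rw [h2]; have := hP.1; omega)
  simp only [Finset.mem_filter, Finset.mem_univ, true_and] at hb hc
  by_contra! hno
  refine hbc (miss_le_one hP hB hf hf' ha hb hc ?_ ?_)
  · rintro ⟨x, hx⟩; exact hno b x hb hx.symm
  · rintro ⟨x, hx⟩; exact hno c x hc hx.symm

/-- There are shared vertices in two classes of `f`. A missing vertex lies outside one of these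
classes, and outside each of them at most one vertex is missing. For `q = 1` the class of the shared
vertex contains nothing else. -/
theorem card_missing_le (hP : Params t p q) (hB : Bounded G t) {f f' : Fin p × Fin q → Fin n}
    (hf : KF G f) (hf' : KF G f') {a a' : Fin p × Fin q} (ha : f a = f' a') :
    (missing f f').card ≤ 2 ∧ (q = 1 → (missing f f').card ≤ 1) := by
  classical
  have key : ∀ a a', f a = f' a' → ((missing f f').filter fun b => b.1 ≠ a.1).card ≤ 1 := by
    intro a a' ha
    refine Finset.card_le_one.2 fun b hb c hc => ?_
    simp only [Finset.mem_filter, mem_missing] at hb hc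
    exact miss_le_one hP hB hf hf' ha hb.2 hc.2 hb.1 hc.1
  obtain ⟨c, c', hca, hc⟩ := exists_other_class hP hB hf hf' ha
  refine ⟨?_, ?_⟩
  · have h1 := key a a' ha
    have h2 := key c c' hc
    have : missing f f' ⊆ ((missing f f').filter fun b => b.1 ≠ a.1) ∪
        ((missing f f').filter fun b => b.1 ≠ c.1) := by
      intro b hb
      by_cases hba : b.1 = a.1
      · simp only [Finset.mem_union, Finset.mem_filter, hb, true_and]; right; rw [hba]; exact hca.symm
      · simp [hb, hba]
    have := (Finset.card_le_card this).trans (Finset.card_union_le _ _)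
    omega
  · rintro rfl
    refine le_trans (Finset.card_le_card fun b hb => ?_) (key a a' ha)
    simp only [Finset.mem_filter, hb, true_and]
    intro hba
    have : b = a := Prod.ext hba (Subsingleton.elim _ _)
    rw [mem_missing, this] at hb
    exact hb ⟨a', ha.symm⟩

/-- If `H'` and `H''` shared no vertex of `H`, each of its `t + q` vertices would be missing from
one of them. But that accounts for at most `2 + 2` vertices, or `1 + 1` if `q = 1`, while `t + q` is
at least `5`, or `4` if `q = 1`. This serves both for the pairs within a family and for its
closedness. -/
theorem meet_trans (hP : Params t p q) (hB : Bounded G t) {H H' H'' : G.Subgraph}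
    {S S' S'' : Set (Fin n)} (hH : IsKpq p q S H) (hH' : IsKpq p q S' H')
    (hH'' : IsKpq p q S'' H'') (h' : Meet H' H) (h'' : Meet H'' H) : Meet H' H'' := by
  classical
  obtain ⟨f, hf, -, hs⟩ := isKpq_iff.1 hH
  obtain ⟨f', hf', -, hs'⟩ := isKpq_iff.1 hH'
  obtain ⟨f'', hf'', -, hs''⟩ := isKpq_iff.1 hH''
  have get : ∀ {H₁ : G.Subgraph} {f₁ : Fin p × Fin q → Fin n}, Spans f₁ H₁ → Meet H₁ H →
      ∃ a b, f a = f₁ b := by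
    rintro H₁ f₁ hs₁ ⟨v, hv1, hv2⟩
    obtain ⟨b, rfl⟩ := hs₁.mem.1 hv1
    obtain ⟨a, ha⟩ := hs.mem.1 hv2
    exact ⟨a, b, ha⟩
  obtain ⟨a, b, hab⟩ := get hs' h'
  obtain ⟨c, e, hce⟩ := get hs'' h''
  obtain ⟨h1, h2⟩ := card_missing_le hP hB hf hf' hab
  obtain ⟨h3, h4⟩ := card_missing_le hP hB hf hf'' hce
  by_contra hno
  have : (Finset.univ : Finset (Fin p × Fin q)) ⊆ missing f f' ∪ missing f f'' := by
    intro x _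
    by_contra hx
    simp only [Finset.mem_union, mem_missing, not_or, not_not] at hx
    exact hno ⟨f x, by rw [hs'.1]; exact hx.1, by rw [hs''.1]; exact hx.2⟩
  have := (Finset.card_le_card this).trans (Finset.card_union_le _ _)
  rw [Finset.card_univ, Fintype.card_prod, Fintype.card_fin, Fintype.card_fin, KF.pq hP] at this
  obtain ⟨h5, -, h6, -⟩ := hP
  rcases h6.eq_or_lt with h6 | h6
  · have := h2 h6.symm; have := h4 h6.symm; omega
  · omega

theorem Meet.symm' {H H' : G.Subgraph} (h : Meet H H') : Meet H' H := by
  obtain ⟨v, h1, h2⟩ := h; exact ⟨v, h2, h1⟩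

/-- A common neighbour of `v₁` and `v₂` lies only in `K^p_q`'s that contain `v₁` or `v₂`. -/
theorem common_safe (hP : Params t p q) (hB : Bounded G t) {S : Set (Fin n)} {H : G.Subgraph}
    (hH : IsKpq p q S H) {v₁ v₂ w : Fin n} (hne : v₂ ≠ v₁) (h₁ : G.Adj v₁ w) (h₂ : G.Adj v₂ w)
    (hw : w ∈ H.verts) : v₁ ∈ H.verts ∨ v₂ ∈ H.verts := by
  obtain ⟨f, hf, -, hs⟩ := isKpq_iff.1 hH
  obtain ⟨a, rfl⟩ := hs.mem.1 hw
  by_contra! hno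
  rw [hs.1] at hno
  exact no_two_extra hP hB hf hne.symm h₁.symm h₂.symm (fun b _ h => hno.1 ⟨b, h⟩)
    fun b _ h => hno.2 ⟨b, h⟩

/-! ### Friends of a vertex of a `K^p_q` -/

theorem exists_ne_fst (hP : Params t p q) (a : Fin p × Fin q) : ∃ b : Fin p × Fin q, b.1 ≠ a.1 := by
  have h2 := card_other hP a
  obtain ⟨b, hb⟩ := Finset.card_pos.1 (by rw [h2]; have := hP.1; omega :
    0 < (Finset.univ.filter fun b : Fin p × Fin q => b.1 ≠ a.1).card)
  exact ⟨b, by simpa using hb⟩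

/-- The threshold as the program computes it: because of `t = (p - 1) q` no multiplication is
needed. -/
theorem thr_eq (hP : Params t p q) : max (p - 2) 1 * q = if p < 3 then t else t - q := by
  obtain ⟨h1, h2, h3, h4⟩ := hP
  split_ifs with h
  · obtain rfl : p = 2 := by omega
    simpa using h4.symm
  · obtain ⟨r, rfl⟩ : ∃ r, p = r + 3 := ⟨p - 3, by omega⟩
    rw [h4]
    have : (r + 3 - 1) * q = (r + 1) * q + q := by rw [show r + 3 - 1 = r + 1 + 1 by omega]; ring
    rw [this]; simp

/-- A vertex in another class has `(p - 2) q` common neighbours. -/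
theorem card_common_of_ne (hP : Params t p q) (h3 : 3 ≤ p) (a b : Fin p × Fin q) (hab : b.1 ≠ a.1) :
    t - q ≤ (Finset.univ.filter fun c : Fin p × Fin q => c.1 ≠ a.1 ∧ c.1 ≠ b.1).card := by
  have : (Finset.univ.filter fun c : Fin p × Fin q => c.1 ≠ a.1 ∧ c.1 ≠ b.1) =
      ((Finset.univ.erase a.1).erase b.1) ×ˢ Finset.univ := by ext c; simp; tauto
  rw [this, Finset.card_product, Finset.card_erase_of_mem (by simp [hab]),
    Finset.card_erase_of_mem (Finset.mem_univ _)]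
  have := thr_eq hP
  rw [if_neg (by omega), max_eq_left (by omega)] at this
  simp only [Finset.card_univ, Fintype.card_fin]
  rw [← this, Nat.sub_sub]

/-- For `p = 2` a second vertex of the same class shares all `t` neighbours (it exists, since then
`q = t`); for `p ≥ 3` any vertex of another class shares `(p - 2) q` of them. -/
theorem friend_exists (hP : Params t p q) {S : Set (Fin n)} {f : Fin p × Fin q → Fin n}
    (hf : KF G f) (hS : ∀ a, f a ∈ S) (a : Fin p × Fin q) :
    ∃ v₂, FriendAnswer G p q S (f a) (some v₂) := by
  classical
  have fin : ∀ (A : Finset (Fin p × Fin q)) (v : Fin n),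
      (∀ c ∈ A, G.Adj (f a) (f c) ∧ G.Adj v (f c)) →
      A.card ≤ (commonIn G S (f a) v).ncard := by
    intro A v hA
    rw [← Finset.card_image_of_injective _ hf.1, ← Set.ncard_coe_finset]
    refine Set.ncard_le_ncard ?_ (Set.toFinite _)
    intro u hu
    obtain ⟨c, hc, rfl⟩ := Finset.mem_image.1 (Finset.mem_coe.1 hu)
    exact ⟨hS c, hA c hc⟩
  obtain ⟨b, hb⟩ := exists_ne_fst hP a
  rcases lt_or_ge p 3 with h3 | h3
  · have hq : 1 < q := by
      obtain ⟨h1, h2, h4, h5⟩ := hP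
      obtain rfl : p = 2 := by omega
      omega
    obtain ⟨j, hj⟩ := Fintype.exists_ne_of_one_lt_card (by simpa using hq) a.2
    refine ⟨f (a.1, j), hS _, fun h => hj (congrArg Prod.snd (hf.1 h)), ?_⟩
    rw [thr_eq hP, if_pos h3, ← card_other hP a]
    refine fin _ _ fun c hc => ?_
    simp only [Finset.mem_filter, Finset.mem_univ, true_and] at hc
    exact ⟨hf.2 _ _ hc.symm, hf.2 _ _ hc.symm⟩
  · refine ⟨f b, hS b, fun h => hb (congrArg Prod.fst (hf.1 h)), ?_⟩
    rw [thr_eq hP, if_neg (by omega)]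
    refine (card_common_of_ne hP h3 a b hb).trans (fin _ _ fun c hc => ?_)
    simp only [Finset.mem_filter, Finset.mem_univ, true_and] at hc
    exact ⟨hf.2 _ _ hc.1.symm, hf.2 _ _ hc.2.symm⟩

/-! ## Correctness of the algorithm -/

/-- A vertex in no `K^p_q` can be dropped at once. For a vertex in one, `friend_exists` supplies a
friend, and this `K^p_q` can be reported. -/
theorem exists_round (hP : Params t p q) {s : AlgState G} (hs : s.alive.Nonempty) :
    ∃ s', Round p q s s' := by
  obtain ⟨v, hv⟩ := hs
  by_cases h : ∀ H : G.Subgraph, IsKpq p q s.alive H → v ∉ H.verts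
  · exact ⟨_, .dropOne s v hv h⟩
  · push Not at h
    obtain ⟨H, hH, hvH⟩ := h
    obtain ⟨f, hf, hS, hs⟩ := isKpq_iff.1 hH
    obtain ⟨a, rfl⟩ := hs.mem.1 hvH
    obtain ⟨v₂, h₂⟩ := friend_exists hP hf hS a
    exact ⟨_, .report s (f a) v₂ hv h₂ H hH (.inl hvH)⟩

theorem round_ssubset {s s' : AlgState G} (h : Round p q s s') : s'.alive ⊂ s.alive := by
  have key : ∀ {A B : Set (Fin n)} {v : Fin n}, v ∈ A → v ∈ B → A \ B ⊂ A := fun hA hB =>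
    ⟨Set.sdiff_subset, fun h => (h hA).2 hB⟩
  cases h with
  | dropOne v₁ h₁ hf => exact key h₁ rfl
  | dropMany v₁ v₂ h₁ hf hno => exact key h₁ (.inl (.inl rfl))
  | report v₁ v₂ h₁ hf H hH hv =>
    rcases hv with hv | hv
    · exact key h₁ hv
    · exact key hf.1 hv

/-- What holds in all states of the algorithm. -/
structure Sound (p q : ℕ) (s : AlgState G) : Prop where
  isKpq : ∀ F ∈ s.out, ∀ H ∈ F, IsKpq p q Set.univ H
  meet : ∀ F ∈ s.out, ∀ H ∈ F, ∀ H' ∈ F, Meet H H'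
  closed : ∀ F ∈ s.out, ∀ H ∈ F, ∀ H', IsKpq p q Set.univ H' → Meet H' H → H' ∈ F
  gone : ∀ F ∈ s.out, ∀ H ∈ F, ¬ H.verts ⊆ s.alive
  total : ∀ H : G.Subgraph, IsKpq p q Set.univ H → H.verts ⊆ s.alive ∨ ∃ F ∈ s.out, H ∈ F

/-- The first two kinds of rounds are harmless because no remaining `K^p_q` uses a removed vertex;
for the common neighbours this is `common_safe`. In the third kind the family is the class of `H`
under meeting, which is an equivalence relation by `meet_trans`. -/
theorem sound_of_reachable (hP : Params t p q) (hB : Bounded G t) {s : AlgState G}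
    (h : Reachable G t p q s) : Sound p q s := by
  have drop : ∀ {s : AlgState G} {A : Set (Fin n)}, Sound p q s →
      (∀ H : G.Subgraph, IsKpq p q s.alive H → ∀ v ∈ H.verts, v ∉ A) →
      Sound p q (⟨s.alive \ A, s.out⟩ : AlgState G) := fun hs hA =>
    ⟨hs.isKpq, hs.meet, hs.closed, fun F hF H hH hv => hs.gone F hF H hH
      fun v hvH => (hv hvH).1, fun H hH => (hs.total H hH).imp_left fun h v hv =>
        ⟨h hv, hA H (hH.mono h) v hv⟩⟩
  induction h with
  | refl =>
    refine ⟨by simp [initState], by simp [initState], by simp [initState], by simp [initState],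
      fun H hH => .inl fun v hv => ?_⟩
    obtain ⟨f, hf, -, hs⟩ := isKpq_iff.1 hH
    obtain ⟨a, rfl⟩ := hs.mem.1 hv
    exact hf.le_degree hP a
  | @tail s _ _ hr ih =>
    cases hr with
    | dropOne v₁ h₁ hf => 
      refine drop ih fun H hH v hv hv' => ?_
      rw [Set.mem_singleton_iff] at hv'; exact hf H hH (hv' ▸ hv)
    | dropMany v₁ v₂ h₁ hf hno =>
      refine drop ih fun H hH v hv hv' => ?_
      obtain ⟨g1, g2⟩ := hno H hH
      rcases hv' with (rfl | hv') | hv'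
      · exact g1 hv
      · rw [Set.mem_singleton_iff] at hv'; exact g2 (hv' ▸ hv)
      · exact (common_safe hP hB hH hf.2.1 hv'.2.1 hv'.2.2 hv).elim g1 g2
    | report v₁ v₂ h₁ hf H hH hv =>
      have univ : ∀ {H : G.Subgraph}, IsKpq p q s.alive H → IsKpq p q Set.univ H := fun h =>
        h.mono (Set.subset_univ _)
      refine ⟨?_, ?_, ?_, ?_, ?_⟩
      · intro F hF H' hH'
        rcases List.mem_append.1 hF with hF | hF
        · exact ih.isKpq F hF H' hH'
        · rw [List.mem_singleton] at hF; subst hF; exact univ hH'.1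
      · intro F hF H₁ hH₁ H₂ hH₂
        rcases List.mem_append.1 hF with hF | hF
        · exact ih.meet F hF H₁ hH₁ H₂ hH₂
        · rw [List.mem_singleton] at hF; subst hF
          exact meet_trans hP hB hH hH₁.1 hH₂.1 hH₁.2 hH₂.2
      · intro F hF H₁ hH₁ H₂ hH₂ hm
        rcases List.mem_append.1 hF with hF | hF
        · exact ih.closed F hF H₁ hH₁ H₂ hH₂ hm
        · rw [List.mem_singleton] at hF; subst hF
          rcases ih.total H₂ hH₂ with h | ⟨F', hF', h⟩
          · exact ⟨hH₂.mono h, meet_trans hP hB hH₁.1 hH₂ hH hm hH₁.2.symm'⟩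
          -- Had `H₂` been returned earlier, then so had `H₁`, because the older family is closed;
          -- but then some vertex of `H₁` would be gone.
          · exact absurd hH₁.1.1 (ih.gone F' hF' H₁
              (ih.closed F' hF' H₂ h H₁ (univ hH₁.1) hm.symm'))
      · intro F hF H₁ hH₁ hsub
        rcases List.mem_append.1 hF with hF | hF
        · exact ih.gone F hF H₁ hH₁ fun v hv => (hsub hv).1
        · rw [List.mem_singleton] at hF; subst hF
          obtain ⟨v, hv1, hv2⟩ := hH₁.2
          exact (hsub hv1).2 hv2
      · intro H₁ hH₁
        rcases ih.total H₁ hH₁ with h | ⟨F', hF', h⟩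
        · by_cases hm : Meet H₁ H
          · exact .inr ⟨_, List.mem_append_right _ (List.mem_singleton.2 rfl), hH₁.mono h, hm⟩
          · exact .inl fun v hv => ⟨h hv, fun hvH => hm ⟨v, hv, hvH⟩⟩
        · exact .inr ⟨F', List.mem_append_left _ hF', h⟩

/-- When nothing is left, the alternative of `Sound.total` that a `K^p_q` survives is void, as every
`K^p_q` has a vertex. -/
theorem algorithm_correct (hP : Params t p q) (hB : Bounded G t) {s : AlgState G}
    (h : Reachable G t p q s) :
    (s.alive.Nonempty → ∃ s', Round p q s s') ∧ (∀ s', Round p q s s' → s'.alive ⊂ s.alive) ∧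
    (s.alive = ∅ → s.found = {H | IsKpq p q Set.univ H} ∧
      s.foundPairs = {P | IsKpq p q Set.univ P.1 ∧ IsKpq p q Set.univ P.2 ∧
        P.1 ≠ P.2 ∧ Meet P.1 P.2}) := by
  refine ⟨exists_round hP, fun _ => round_ssubset, fun he => ?_⟩
  have hs := sound_of_reachable hP hB h
  have tot : ∀ H : G.Subgraph, IsKpq p q Set.univ H → ∃ F ∈ s.out, H ∈ F := fun H hH => by
    refine (hs.total H hH).resolve_left fun hsub => ?_
    obtain ⟨f, hf, -, hsp⟩ := isKpq_iff.1 hH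
    obtain ⟨h1, h2, h3, h4⟩ := hP
    have := hsub (hsp.mem.2 ⟨(⟨0, by omega⟩, ⟨0, by omega⟩), rfl⟩)
    rw [he] at this
    exact this
  constructor
  · ext H
    exact ⟨fun ⟨F, hF, hH⟩ => hs.isKpq F hF H hH, fun hH => tot H hH⟩
  · ext ⟨H, H'⟩
    constructor
    · rintro ⟨hne, F, hF, hH, hH'⟩
      exact ⟨hs.isKpq F hF H hH, hs.isKpq F hF H' hH', hne, hs.meet F hF H hH H' hH'⟩
    · rintro ⟨h1, h2, hne, hm⟩
      obtain ⟨F, hF, hH⟩ := tot H h1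
      exact ⟨hne, F, hF, hH, hs.closed F hF H hH H' h2 hm.symm'⟩

end

/-! ## Branching: how to shrink a vertex set that contains a `K^p_q` -/

section
variable {n t p q : ℕ} {G : SimpleGraph (Fin n)}

/-- There is a `K^p_q` within `A` that contains `v`. -/
def HasK (G : SimpleGraph (Fin n)) (p q : ℕ) (A : Finset (Fin n)) (v : Fin n) : Prop :=
  ∃ f : Fin p × Fin q → Fin n, KF G f ∧ (∀ a, f a ∈ A) ∧ ∃ a, f a = v

theorem KF.update {f : Fin p × Fin q → Fin n} (hf : KF G f) {e : Fin n} (he : ∀ b, f b ≠ e)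
    {a : Fin p × Fin q} (hadj : ∀ b, b.1 ≠ a.1 → G.Adj e (f b)) : KF G (Function.update f a e) := by
  refine ⟨fun b c hbc => ?_, fun b c hbc => ?_⟩
  · simp only [Function.update_apply] at hbc
    split_ifs at hbc with h1 h2 h2
    · rw [h1, h2]
    · exact absurd hbc.symm (he c)
    · exact absurd hbc (he b)
    · exact hf.1 hbc
  · simp only [Function.update_apply]
    split_ifs with h1 h2 h2
    · subst h1; subst h2; exact absurd rfl hbc
    · subst h1; exact hadj c hbc.symm
    · subst h2; exact (hadj b hbc).symm
    · exact hf.2 b c hbc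

/-- An unused vertex `e` that sees all other classes can take the place of `f a`, which thus becomes
superfluous. The position `c` is that of the vertex that has to stay. -/
theorem hasK_replace {f : Fin p × Fin q → Fin n} (hf : KF G f) {A : Finset (Fin n)}
    (hA : ∀ a, f a ∈ A) {e : Fin n} (heA : e ∈ A) (he : ∀ b, f b ≠ e) {a c : Fin p × Fin q}
    (hadj : ∀ b, b.1 ≠ a.1 → G.Adj e (f b)) (hc : f a ≠ f c) : HasK G p q (A.erase (f a)) (f c) := by
  refine ⟨_, hf.update he hadj, fun b => ?_, c, ?_⟩
  · rw [Function.update_apply]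
    split_ifs with h
    · exact Finset.mem_erase.2 ⟨fun h => he a h.symm, heA⟩
    · exact Finset.mem_erase.2 ⟨fun h' => h (hf.1 h'), hA b⟩
  · rw [Function.update_of_ne]; rintro rfl; exact hc rfl

theorem hasK_erase {f : Fin p × Fin q → Fin n} (hf : KF G f) {A : Finset (Fin n)}
    (hA : ∀ a, f a ∈ A) {e : Fin n} (he : ∀ b, f b ≠ e) (c : Fin p × Fin q) :
    HasK G p q (A.erase e) (f c) :=
  ⟨f, hf, fun b => Finset.mem_erase.2 ⟨he b, hA b⟩, c, rfl⟩

theorem exists_bad {f : Fin p × Fin q → Fin n} {A : Finset (Fin n)} (hA : p * q < A.card) :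
    ∃ e ∈ A, ∀ b, f b ≠ e := by
  classical
  by_contra! h
  have : A ⊆ Finset.univ.image f := fun e he => by
    obtain ⟨b, hb⟩ := h e he; exact Finset.mem_image.2 ⟨b, by simp, hb⟩
  have := (Finset.card_le_card this).trans Finset.card_image_le
  simp at this
  omega

/-! ### Two rules for finding a superfluous vertex -/

variable [DecidableRel G.Adj]

/-- If `w`, `x`, `y` induce a path in the complement, one of them can be removed; but if a second
such path begins at `w`, it may be necessary to remove a vertex of that one. -/
theorem branch_path (hP : Params t p q) (hB : Bounded G t) {A : Finset (Fin n)} {v : Fin n}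
    (hK : HasK G p q A v) (hA : p * q < A.card) {w x y : Fin n} (hwx : ¬ G.Adj w x)
    (hxy : ¬ G.Adj x y) (hwy : G.Adj w y) :
    (∃ z, (z = w ∨ z = x ∨ z = y) ∧ z ≠ v ∧ HasK G p q (A.erase z) v) ∨
    (∃ x₂ ∈ A, ∃ y₂ ∈ A, ¬ G.Adj w x₂ ∧ ¬ G.Adj x₂ y₂ ∧ G.Adj w y₂ ∧ y₂ ≠ y) ∧
    ∀ x₂ y₂, ¬ G.Adj w x₂ → ¬ G.Adj x₂ y₂ → G.Adj w y₂ → y₂ ≠ y →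
      ∃ z, (z = x₂ ∨ z = y₂) ∧ z ≠ v ∧ HasK G p q (A.erase z) v := by
  obtain ⟨f, hf, hfA, c, rfl⟩ := hK
  have bad : ∀ z, (∀ b, f b ≠ z) → z ≠ f c ∧ HasK G p q (A.erase z) (f c) := fun z hz =>
    ⟨(hz c).symm, hasK_erase hf hfA hz c⟩
  by_cases hw : ∀ b, f b ≠ w; · exact .inl ⟨w, .inl rfl, bad w hw⟩
  by_cases hx : ∀ b, f b ≠ x; · exact .inl ⟨x, .inr (.inl rfl), bad x hx⟩
  by_cases hy : ∀ b, f b ≠ y; · exact .inl ⟨y, .inr (.inr rfl), bad y hy⟩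
  push Not at hw hx hy
  obtain ⟨bw, rfl⟩ := hw
  obtain ⟨bx, rfl⟩ := hx
  obtain ⟨by', rfl⟩ := hy
  have same : ∀ b b', ¬ G.Adj (f b) (f b') → b.1 = b'.1 := fun b b' h => by
    by_contra hne; exact h (hf.2 b b' hne)
  -- Non-adjacent vertices of the `K^p_q` are in one class. So all three are, and `f by'` is the one
  -- extra neighbour of `f bw`.
  have h1 : bw.1 = by'.1 := (same _ _ hwx).trans (same _ _ hxy)
  by_cases h2 : ∃ x₂ ∈ A, ∃ y₂ ∈ A, ¬ G.Adj (f bw) x₂ ∧ ¬ G.Adj x₂ y₂ ∧ G.Adj (f bw) y₂ ∧ y₂ ≠ f by'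
  · refine .inr ⟨h2, fun x₂ y₂ g1 g2 g3 g4 => ?_⟩
    by_cases hx : ∀ b, f b ≠ x₂; · exact ⟨x₂, .inl rfl, bad x₂ hx⟩
    by_cases hy : ∀ b, f b ≠ y₂; · exact ⟨y₂, .inr rfl, bad y₂ hy⟩
    push Not at hx hy
    obtain ⟨b₁, rfl⟩ := hx
    obtain ⟨b₂, rfl⟩ := hy
    have h3 : bw.1 = b₂.1 := (same _ _ g1).trans (same _ _ g2)
    -- If the second path were inside as well, `f bw` would have two neighbours in its own class.
    exact (no_two_extra hP hB hf g4 g3 hwy (fun b hb h => hb (by rw [hf.1 h, h3]))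
      fun b hb h => hb (by rw [hf.1 h, h1])).elim
  · left
    -- A surplus vertex `e` can replace `f bw`. It is not adjacent to `f bw`, whose one extra
    -- neighbour is `f by'`; so a non-neighbour of `e` in another class would complete a second
    -- path.
    obtain ⟨e, heA, he⟩ := exists_bad (f := f) hA
    have hwe : ¬ G.Adj (f bw) e := fun h => no_two_extra hP hB hf (he by').symm h hwy
      (fun b _ => he b) fun b hb h => hb (by rw [hf.1 h, h1])
    have hadj : ∀ b, b.1 ≠ bw.1 → G.Adj e (f b) := by
      intro b hb
      by_contra hn
      refine h2 ⟨e, heA, f b, hfA b, hwe, hn, hf.2 _ _ hb.symm, fun h => hb ?_⟩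
      rw [hf.1 h, h1]
    -- If `f bw` is the vertex that has to stay, its neighbour `f by'` in the same class is replaced
    -- instead.
    by_cases hc : f bw = f c
    · refine ⟨f by', .inr (.inr rfl), ?_, hasK_replace hf hfA heA he (h1 ▸ hadj) ?_⟩ <;>
        exact hc ▸ hwy.ne'
    · exact ⟨f bw, .inl rfl, hc, hasK_replace hf hfA heA he hadj hc⟩

/-- If non-adjacency is transitive on `A`, a vertex with many non-neighbours can be removed, and if
there is none, any vertex. -/
theorem branch_cluster (hP : Params t p q) (hB : Bounded G t) {A : Finset (Fin n)} {v : Fin n}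
    (hK : HasK G p q A v) (hA : p * q < A.card)
    (htr : ∀ w ∈ A, ∀ x ∈ A, ∀ y ∈ A, ¬ G.Adj w x → ¬ G.Adj x y → ¬ G.Adj w y) {z : Fin n}
    (hz : z ∈ A) (hzv : z ≠ v) (h : q < (A.filter fun x => ¬ G.Adj z x).card ∨
      ∀ y ∈ A, y ≠ v → (A.filter fun x => ¬ G.Adj y x).card ≤ q) : HasK G p q (A.erase z) v := by
  classical
  obtain ⟨f, hf, hfA, c, rfl⟩ := hK
  have same : ∀ b b', ¬ G.Adj (f b) (f b') → b.1 = b'.1 := fun b b' h => by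
    by_contra hne; exact h (hf.2 b b' hne)
  by_cases hzf : ∀ b, f b ≠ z
  · exact hasK_erase hf hfA hzf c
  push Not at hzf
  obtain ⟨b, rfl⟩ := hzf
  have cls : ∀ b : Fin p × Fin q,
      ((Finset.univ.filter fun b' : Fin p × Fin q => b'.1 = b.1).image f).card = q := by
    intro b
    rw [Finset.card_image_of_injective _ hf.1]
    have : (Finset.univ.filter fun b' : Fin p × Fin q => b'.1 = b.1) = {b.1} ×ˢ Finset.univ := by
      ext b'; simp only [Finset.mem_filter, Finset.mem_univ, true_and, Finset.mem_product,
        Finset.mem_singleton, and_true]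
    rw [this]; simp
  rcases h with h | h
  -- All non-neighbours of `f b` that are used lie in its class, which has only `q` places. So one
  -- of them is unused, and by transitivity it sees the other classes.
  · obtain ⟨e, he, hne⟩ : ∃ e ∈ A.filter fun x => ¬ G.Adj (f b) x, ∀ b', f b' ≠ e := by
      by_contra! hno
      have : (A.filter fun x => ¬ G.Adj (f b) x) ⊆
          (Finset.univ.filter fun b' : Fin p × Fin q => b'.1 = b.1).image f := by
        intro e he
        obtain ⟨b', rfl⟩ := hno e he
        exact Finset.mem_image.2 ⟨b', by simpa using (same _ _ (Finset.mem_filter.1 he).2).symm, rfl⟩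
      have := Finset.card_le_card this
      rw [cls] at this; omega
    rw [Finset.mem_filter] at he
    refine hasK_replace hf hfA he.1 hne (fun b' hb' => ?_) hzv
    by_contra hn
    exact hb' (same _ _ (htr _ (hfA b) _ he.1 _ (hfA b') he.2 hn)).symm
  · obtain ⟨e, heA, he⟩ := exists_bad (f := f) hA
    -- Otherwise `e`, with at most `q` non-neighbours and itself among them, sees some `f b''` in
    -- the class of `f b'`. By transitivity `f b''` sees `f b'` as well, and has two extra
    -- neighbours.
    have hall : ∀ b', G.Adj e (f b') := by
      intro b'
      by_contra hn
      have h1 := h e heA (he c).symm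
      obtain ⟨b'', hb'', hn''⟩ : ∃ b'', b''.1 = b'.1 ∧ G.Adj e (f b'') := by
        by_contra! hno
        have : insert e ((Finset.univ.filter fun b'' : Fin p × Fin q => b''.1 = b'.1).image f) ⊆
            A.filter fun x => ¬ G.Adj e x := by
          intro u hu
          rcases Finset.mem_insert.1 hu with rfl | hu
          · simp [heA]
          · obtain ⟨b'', hb, rfl⟩ := Finset.mem_image.1 hu
            exact Finset.mem_filter.2 ⟨hfA _, hno b'' (by simpa using hb)⟩
        have := Finset.card_le_card this
        rw [Finset.card_insert_of_notMem, cls] at this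
        · omega
        · simp only [Finset.mem_image, not_exists]; rintro u ⟨-, hu⟩; exact he u hu
      have h2 : G.Adj (f b'') (f b') := by
        by_contra h3
        exact htr _ heA _ (hfA b') _ (hfA b'') hn (fun h => h3 h.symm) hn''
      exact no_two_extra hP hB hf (he b') h2 hn''.symm (fun u hu h => hu (by rw [hf.1 h, hb'']))
        fun u _ => he u
    exact hasK_replace hf hfA heA he (fun b' _ => hall b') hzv

end

/-! ## Finding the classes when the vertex set is known -/

section
variable {n t p q : ℕ} {G : SimpleGraph (Fin n)} [DecidableRel G.Adj]

/-- The position of `i` when `0, …, L - 1` are sorted by `key`. -/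
def pos (L : ℕ) (key : ℕ → ℕ) (i : ℕ) : ℕ :=
  ((Finset.range L).filter fun j => key j < key i ∨ key j = key i ∧ j < i).card

theorem pos_lt {L : ℕ} {key : ℕ → ℕ} {i : ℕ} (hi : i < L) : pos L key i < L := by
  have : ((Finset.range L).filter fun j => key j < key i ∨ key j = key i ∧ j < i) ⊂
      Finset.range L := by
    refine Finset.ssubset_iff_subset_ne.2 ⟨Finset.filter_subset _ _, fun h => ?_⟩
    have := h ▸ Finset.mem_range.2 hi
    simp at this
  simpa [pos] using Finset.card_lt_card this

theorem pos_lt_pos {L : ℕ} {key : ℕ → ℕ} {i j : ℕ} (hi : i < L)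
    (h : key i < key j ∨ key i = key j ∧ i < j) : pos L key i < pos L key j := by
  refine Finset.card_lt_card (Finset.ssubset_iff_of_subset (fun k hk => ?_) |>.2 ⟨i, ?_, by simp⟩)
  · simp only [Finset.mem_filter, Finset.mem_range] at hk ⊢
    exact ⟨hk.1, by omega⟩
  · simp only [Finset.mem_filter, Finset.mem_range]; exact ⟨hi, h⟩

theorem pos_inj {L : ℕ} {key : ℕ → ℕ} {i j : ℕ} (hi : i < L) (hj : j < L)
    (h : pos L key i = pos L key j) : i = j := by
  by_contra hne
  have h1 := pos_lt_pos (L := L) (key := key) (i := i) (j := j) hi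
  have h2 := pos_lt_pos (L := L) (key := key) (i := j) (j := i) hj
  omega

/-- Sorting puts each fibre of `key` into consecutive positions. The fibres of the keys below `L`
are empty or have `q` elements, so each of them starts at a multiple of `q`. -/
theorem pos_div {L : ℕ} {key : ℕ → ℕ} {i j : ℕ} (hi : i < L) (hj : j < L) (hij : key i = key j)
    (hL : key i < L) (hfib : ∀ k < L, ((Finset.range L).filter fun j => key j = k).card = 0 ∨
      ((Finset.range L).filter fun j => key j = k).card = q) : pos L key i / q = pos L key j / q := by
  obtain ⟨r, hr⟩ : q ∣ ((Finset.range L).filter fun j => key j < key i).card := by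
    have : (Finset.range L).filter (fun j => key j < key i) =
        (Finset.range (key i)).biUnion fun k => (Finset.range L).filter fun j => key j = k := by
      ext j; simp [and_comm]
    rw [this, Finset.card_biUnion]
    · refine Finset.dvd_sum fun k hk => ?_
      rcases hfib k (by simp at hk; omega) with h | h <;> simp [h]
    · intro k _ l _ hkl
      exact Finset.disjoint_filter.2 fun j _ h1 h2 => hkl (h1.symm.trans h2)
  have key : ∀ i', i' < L → key i' = key i → pos L key i' / q = r := by
    intro i' hi' he
    have h1 : pos L key i' = ((Finset.range L).filter fun j => key j < key i).card +
        ((Finset.range L).filter fun j => key j = key i ∧ j < i').card := by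
      rw [pos, ← Finset.card_union_of_disjoint]
      · congr 1; ext j; simp [he]; tauto
      · exact Finset.disjoint_filter.2 fun j _ h1 h2 => by omega
    have h2 : ((Finset.range L).filter fun j => key j = key i ∧ j < i').card <
        ((Finset.range L).filter fun j => key j = key i).card := by
      refine Finset.card_lt_card (Finset.ssubset_iff_of_subset (fun k hk => ?_) |>.2 ⟨i', ?_, by simp⟩)
      · simp only [Finset.mem_filter] at hk ⊢; exact ⟨hk.1, hk.2.1⟩
      · simp [hi', he]
    have h3 := hfib _ hL
    rw [h1, hr, Nat.mul_add_div (by omega), Nat.div_eq_of_lt (by omega), add_zero]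
  rw [key i hi rfl, key j hj hij.symm]

/-- The key by which the vertices are sorted puts the classes together. -/
theorem sort_classes (hP : Params t p q) (hB : Bounded G t) {L : ℕ} (hL : L = p * q)
    {w : ℕ → Fin n} (hw : Set.InjOn w (Set.Iio L)) {f : Fin p × Fin q → Fin n} (hf : KF G f)
    (hfw : ∀ a, ∃ i < L, w i = f a) {lam mu c : ℕ → ℕ}
    (hlam : ∀ i < L, IsLeast {j | j < L ∧ ¬ G.Adj (w i) (w j)} (lam i))
    (hmu : ∀ i < L, IsLeast {k | ∃ j < L, ¬ G.Adj (w i) (w j) ∧ k = lam j} (mu i))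
    (hc : ∀ i < L, c i = ((Finset.range L).filter fun j => ¬ G.Adj (w i) (w j)).card)
    {i j : ℕ} (hi : i < L) (hj : j < L)
    (hne : pos L (fun i => if c i < 2 then L else mu i) i / q ≠
      pos L (fun i => if c i < 2 then L else mu i) j / q) : G.Adj (w i) (w j) := by
  classical
  -- every index below `L` is a vertex of `f`
  have hcov : ∀ i, i < L → ∃ a, f a = w i := by
    have himg : Finset.univ.image f = (Finset.range L).image w := by
      refine Finset.eq_of_subset_of_card_le (fun u hu => ?_) ?_
      · obtain ⟨a, -, rfl⟩ := Finset.mem_image.1 hu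
        obtain ⟨i, hi, h⟩ := hfw a
        exact Finset.mem_image.2 ⟨i, by simpa using hi, h⟩
      · refine Finset.card_image_le.trans ?_
        rw [Finset.card_image_of_injective _ hf.1]; simp [hL]
    intro i hi
    have : w i ∈ Finset.univ.image f := himg ▸ Finset.mem_image_of_mem w (by simpa using hi)
    simpa using this
  have : Nonempty (Fin p × Fin q) := ⟨(hcov i hi).choose⟩
  choose! e he using hcov
  have heinj : ∀ i < L, ∀ j < L, e i = e j → i = j := fun i hi j hj h =>
    hw hi hj (by rw [← he i hi, ← he j hj, h])
  have same : ∀ i < L, ∀ j < L, ¬ G.Adj (w i) (w j) → (e i).1 = (e j).1 := fun i hi j hj h => by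
    by_contra hne; rw [← he i hi, ← he j hj] at h; exact h (hf.2 _ _ hne)
  have mate : ∀ i < L, ∀ j < L, ∀ k < L, (e i).1 = (e j).1 → (e i).1 = (e k).1 → j ≠ k →
      G.Adj (w i) (w j) → G.Adj (w i) (w k) → False := by
    intro i hi j hj k hk hij hik hjk h1 h2
    rw [← he i hi, ← he j hj] at h1
    rw [← he i hi, ← he k hk] at h2
    refine no_two_extra hP hB hf (fun h => hjk (heinj j hj k hk (hf.1 h))) h1 h2 ?_ ?_
    · intro b hb h; exact hb (by rw [hf.1 h, hij])
    · intro b hb h; exact hb (by rw [hf.1 h, hik])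
  have two : ∀ i < L, (2 ≤ c i ↔ ∃ j < L, j ≠ i ∧ ¬ G.Adj (w i) (w j)) := by
    intro i hi
    rw [hc i hi]
    constructor
    · intro h
      obtain ⟨a, ha, b, hb, hab⟩ := Finset.one_lt_card.1 h
      simp only [Finset.mem_filter, Finset.mem_range] at ha hb
      by_cases hai : a = i
      · exact ⟨b, hb.1, fun h => hab (hai.trans h.symm), hb.2⟩
      · exact ⟨a, ha.1, hai, ha.2⟩
    · rintro ⟨j, hj, hji, hn⟩
      exact Finset.one_lt_card.2 ⟨j, by simp [hj, hn], i, by simp [hi], hji⟩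
  -- the least index of the class
  have hex : ∀ i, i < L → ∃ m < L, (e m).1 = (e i).1 ∧ ∀ j < L, (e j).1 = (e i).1 → m ≤ j := by
    intro i hi
    have hne : ∃ m, m < L ∧ (e m).1 = (e i).1 := ⟨i, hi, rfl⟩
    exact ⟨Nat.find hne, (Nat.find_spec hne).1, (Nat.find_spec hne).2, fun j hj h =>
      Nat.find_min' hne ⟨hj, h⟩⟩
  choose! m hmL hme hmin using hex
  have lam_class : ∀ i < L, lam i < L ∧ (e (lam i)).1 = (e i).1 := fun i hi =>
    ⟨(hlam i hi).1.1, (same i hi _ (hlam i hi).1.1 (hlam i hi).1.2).symm⟩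
  -- Two steps along non-edges lead from `i` to the first index `m i` of its class. If `i` and `m i`
  -- are adjacent, any other non-neighbour `j` of `i` serves as the middle, because `i` is already
  -- the one neighbour of `m i` in the class.
  have mu_eq : ∀ i < L, 2 ≤ c i → mu i = m i := by
    intro i hi h2
    obtain ⟨j, hj, hn, hmj⟩ : ∃ j < L, ¬ G.Adj (w i) (w j) ∧ ¬ G.Adj (w j) (w (m i)) := by
      by_cases him : G.Adj (w i) (w (m i))
      · obtain ⟨j, hj, hji, hn⟩ := (two i hi).1 h2
        have hji' := same i hi j hj hn
        refine ⟨j, hj, hn, fun h => ?_⟩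
        exact mate (m i) (hmL i hi) i hi j hj (hme i hi) ((hme i hi).trans hji') (Ne.symm hji)
          him.symm h.symm
      · exact ⟨m i, hmL i hi, him, by simp⟩
    have h1 : lam j = m i := by
      refine le_antisymm ((hlam j hj).2 ⟨hmL i hi, hmj⟩) (hmin i hi _ (lam_class j hj).1 ?_)
      rw [(lam_class j hj).2, same i hi j hj hn]
    refine le_antisymm ((hmu i hi).2 ⟨j, hj, hn, h1.symm⟩) ?_
    obtain ⟨k, hk, hkn, hkm⟩ := (hmu i hi).1
    rw [hkm]
    exact hmin i hi _ (lam_class k hk).1 (by rw [(lam_class k hk).2, same i hi k hk hkn])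
  have m_congr : ∀ i < L, ∀ j < L, (e i).1 = (e j).1 → m i = m j := fun i hi j hj h =>
    le_antisymm (hmin i hi _ (hmL j hj) (by rw [hme j hj, h]))
      (hmin j hj _ (hmL i hi) (by rw [hme i hi, h]))
  by_contra hn
  have hij : i ≠ j := by rintro rfl; exact hne rfl
  have hci : 2 ≤ c i := (two i hi).2 ⟨j, hj, hij.symm, hn⟩
  have hcj : 2 ≤ c j := (two j hj).2 ⟨i, hi, hij, fun h => hn h.symm⟩
  -- The key `L` puts at the end the vertices that are adjacent to all others, for which any
  -- grouping is right. Here `i` is not one of them.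
  have hki : (if c i < 2 then L else mu i) = m i := by rw [if_neg (by omega), mu_eq i hi hci]
  have hkj : (if c j < 2 then L else mu j) = m j := by rw [if_neg (by omega), mu_eq j hj hcj]
  refine hne (pos_div hi hj ?_ ?_ ?_)
  · simp only [hki, hkj]; exact m_congr i hi j hj (same i hi j hj hn)
  · simp only [hki]; exact hmL i hi
  · intro k hk
    by_cases hex : ∃ i, i < L ∧ (if c i < 2 then L else mu i) = k
    · right
      obtain ⟨i, hi, hik⟩ := hex
      have hci : 2 ≤ c i := by by_contra h; rw [if_pos (by omega)] at hik; omega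
      rw [if_neg (by omega), mu_eq i hi hci] at hik
      -- In a class with a non-adjacent pair no vertex is adjacent to all its mates, since it would
      -- have both vertices of the pair as neighbours. So the fibre of a key below `L` is a whole
      -- class.
      have hcl : ∀ j < L, (e j).1 = (e i).1 → 2 ≤ c j := by
        intro j hj hji
        obtain ⟨a, ha, hai, hna⟩ := (two i hi).1 hci
        by_cases hij : j = i
        · rwa [hij]
        by_cases hja : j = a
        · subst hja; exact (two j hj).2 ⟨i, hi, hai.symm, fun h => hna h.symm⟩
        by_cases h1 : G.Adj (w j) (w i)
        · refine (two j hj).2 ⟨a, ha, Ne.symm hja, fun h2 => ?_⟩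
          exact mate j hj i hi a ha hji (hji.trans (same i hi a ha hna)) hai.symm h1 h2
        · exact (two j hj).2 ⟨i, hi, Ne.symm hij, h1⟩
      have : (Finset.range L).filter (fun j => (if c j < 2 then L else mu j) = k) =
          (Finset.range L).filter fun j => (e j).1 = (e i).1 := by
        ext j
        simp only [Finset.mem_filter, Finset.mem_range, and_congr_right_iff]
        intro hj
        constructor
        · intro h
          have hcj : 2 ≤ c j := by by_contra h'; rw [if_pos (by omega)] at h; omega
          rw [if_neg (by omega), mu_eq j hj hcj] at h
          rw [← hme j hj, h, ← hik, hme i hi]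
        · intro h
          have := hcl j hj h
          rw [if_neg (by omega), mu_eq j hj this, ← hik, m_congr j hj i hi h]
      rw [this]
      have hinj : Set.InjOn e (Finset.range L) := fun a ha b hb h =>
        heinj a (by simpa using ha) b (by simpa using hb) h
      have himg : (Finset.range L).image e = Finset.univ := by
        apply Finset.eq_univ_of_card
        rw [Finset.card_image_of_injOn hinj]; simp [hL]
      have himg' : ((Finset.range L).filter fun j => (e j).1 = (e i).1).image e =
          {(e i).1} ×ˢ Finset.univ := by
        ext a
        simp only [Finset.mem_image, Finset.mem_filter, Finset.mem_product, Finset.mem_singleton,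
          Finset.mem_univ, and_true]
        constructor
        · rintro ⟨j, ⟨-, h⟩, rfl⟩; exact h
        · intro h
          have : a ∈ (Finset.range L).image e := himg ▸ Finset.mem_univ a
          obtain ⟨j, hj, rfl⟩ := Finset.mem_image.1 this
          exact ⟨j, ⟨hj, h⟩, rfl⟩
      rw [← Finset.card_image_of_injOn (s := (Finset.range L).filter fun j => (e j).1 = (e i).1)
        (f := e) (fun a ha b hb h => hinj (Finset.filter_subset _ _ ha) (Finset.filter_subset _ _ hb) h),
        himg']
      simp
    · left
      rw [Finset.card_eq_zero, Finset.filter_eq_empty_iff]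
      intro j hj h
      exact hex ⟨j, by simpa using hj, h⟩

end

/-! ## The `K^p_q`'s that meet a given one -/

section
variable {n t p q : ℕ} {G : SimpleGraph (Fin n)}

/-- `g` and `f` have the same vertices and the same classes. -/
def SameSpan (g f : Fin p × Fin q → Fin n) : Prop :=
  Set.range g = Set.range f ∧
    ∀ a b a' b', g a = f a' → g b = f b' → (a.1 = b.1 ↔ a'.1 = b'.1)

theorem SameSpan.spans {g f : Fin p × Fin q → Fin n} (h : SameSpan g f) {H : G.Subgraph}
    (hf : Spans f H) : Spans g H := by
  refine ⟨by rw [hf.1, h.1], fun u v => (hf.2 u v).trans ⟨?_, ?_⟩⟩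
  · rintro ⟨a', b', hab, rfl, rfl⟩
    obtain ⟨a, ha⟩ : f a' ∈ Set.range g := h.1 ▸ ⟨a', rfl⟩
    obtain ⟨b, hb⟩ : f b' ∈ Set.range g := h.1 ▸ ⟨b', rfl⟩
    exact ⟨a, b, fun h' => hab ((h.2 a b a' b' ha hb).1 h'), ha, hb⟩
  · rintro ⟨a, b, hab, rfl, rfl⟩
    obtain ⟨a', ha⟩ : g a ∈ Set.range f := h.1 ▸ ⟨a, rfl⟩
    obtain ⟨b', hb⟩ : g b ∈ Set.range f := h.1 ▸ ⟨b, rfl⟩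
    exact ⟨a', b', fun h' => hab ((h.2 a b a' b' ha.symm hb.symm).2 h'), ha, hb⟩

theorem SameSpan.adj {g f : Fin p × Fin q → Fin n} (h : SameSpan g f) (hf : KF G f)
    {a b : Fin p × Fin q} (hab : a.1 ≠ b.1) : G.Adj (g a) (g b) := by
  obtain ⟨a', ha⟩ : g a ∈ Set.range f := h.1 ▸ ⟨a, rfl⟩
  obtain ⟨b', hb⟩ : g b ∈ Set.range f := h.1 ▸ ⟨b, rfl⟩
  rw [← ha, ← hb]
  exact hf.2 _ _ fun h' => hab ((h.2 a b a' b' ha.symm hb.symm).2 h')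

/-- It is enough to send the vertices of each class of `g` into one class of `f`, different classes
to different ones: the ranges have the same size, so inclusion is equality. -/
theorem sameSpan_of_class {g f : Fin p × Fin q → Fin n} (hg : Function.Injective g)
    (hf : Function.Injective f) {ψ : Fin p → Fin p} (hψ : Function.Injective ψ)
    (h : ∀ a, ∃ a', g a = f a' ∧ a'.1 = ψ a.1) : SameSpan g f := by
  classical
  refine ⟨?_, fun a b a' b' ha hb => ?_⟩
  · have hsub : Finset.univ.image g ⊆ Finset.univ.image f := fun u hu => by
      obtain ⟨a, -, rfl⟩ := Finset.mem_image.1 hu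
      obtain ⟨a', ha', -⟩ := h a
      exact Finset.mem_image.2 ⟨a', by simp, ha'.symm⟩
    have := Finset.eq_of_subset_of_card_le hsub (by
      rw [Finset.card_image_of_injective _ hg, Finset.card_image_of_injective _ hf])
    have h2 := congrArg (fun A : Finset (Fin n) => (A : Set (Fin n))) this
    simpa using h2
  · obtain ⟨a'', h1, h2⟩ := h a
    obtain ⟨b'', h3, h4⟩ := h b
    rw [hf (ha.symm.trans h1), hf (hb.symm.trans h3), h2, h4]
    exact hψ.eq_iff.symm

/-- The induced map on the `p` classes is onto, since every vertex of `f` occurs in `g`, and hence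
it is injective. So one implication between the partitions is enough. -/
theorem sameSpan_of_imp (hq : 0 < q) {g f : Fin p × Fin q → Fin n} (hg : Function.Injective g)
    (hf : Function.Injective f) (hr : Set.range g = Set.range f)
    (h : ∀ a b a' b', g a = f a' → g b = f b' → a.1 = b.1 → a'.1 = b'.1) : SameSpan g f := by
  have he : ∀ a, ∃ a', g a = f a' := fun a => by
    obtain ⟨a', h'⟩ : g a ∈ Set.range f := hr ▸ ⟨a, rfl⟩; exact ⟨a', h'.symm⟩
  choose e he using he
  have key : ∀ a, (e a).1 = (e (a.1, ⟨0, hq⟩)).1 := fun a => h _ _ _ _ (he a) (he _) rfl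
  refine sameSpan_of_class hg hf (ψ := fun i => (e (i, ⟨0, hq⟩)).1) ?_ fun a => ⟨e a, he a, key a⟩
  refine Finite.injective_iff_surjective.2 fun i => ?_
  obtain ⟨a, ha⟩ : f (i, ⟨0, hq⟩) ∈ Set.range g := hr ▸ ⟨_, rfl⟩
  refine ⟨a.1, ?_⟩
  rw [he a] at ha
  simp only [← key, hf ha]

/-- A class of `f'` has `q` vertices, while the class of `a` without `a` has `q - 1` places, so they
cannot all come from there. This provides the new vertex of a replacement. -/
theorem exists_new {f f' : Fin p × Fin q → Fin n} (hf' : Function.Injective f')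
    {a : Fin p × Fin q} {i : Fin p} (h : ∀ k, ∃ c, c ≠ a ∧ c.1 = a.1 ∧ f c = f' (i, k)) : False := by
  choose c hca hc hcf using h
  have hinj : Function.Injective fun k => (c k).2 := fun k l hkl => by
    have : c k = c l := Prod.ext ((hc k).trans (hc l).symm) hkl
    have h2 := (hcf k).symm.trans (this ▸ hcf l)
    exact congrArg Prod.snd (hf' h2)
  obtain ⟨k, hk⟩ := Finite.injective_iff_surjective.1 hinj a.2
  exact hca k (Prod.ext (hc k) hk)

/-! ### How the classes of a `K^p_q` carry over to one that meets it -/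

variable [DecidableRel G.Adj]

/-- The shared vertex `f b` sees the missing vertex `f x` and also `f c`. If `f c` were in its class
of `f'`, these would be two extra neighbours. -/
theorem new_classes (hP : Params t p q) (hB : Bounded G t) {f f' : Fin p × Fin q → Fin n}
    (hf : KF G f) (hf' : KF G f') {x : Fin p × Fin q} (hx : f x ∉ Set.range f')
    {b c b' c' : Fin p × Fin q} (hxb : x.1 ≠ b.1) (hcb : c.1 ≠ b.1) (hb : f b = f' b')
    (hc : f c = f' c') : c'.1 ≠ b'.1 := by
  intro h
  refine no_two_extra hP hB hf' (a := b') (u₁ := f x) (u₂ := f c) ?_ ?_ ?_ ?_ ?_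
  · intro h'; exact hx ⟨c', by rw [h', hc]⟩
  · rw [← hb]; exact hf.2 _ _ hxb.symm
  · rw [← hb]; exact hf.2 _ _ hcb.symm
  · intro e _ h'; exact hx ⟨e, h'⟩
  · intro e he h'; rw [hc] at h'; exact he (hf'.1 h' ▸ h)

/-- `f` with its vertex `a` replaced by `y` is a `K^p_q`. -/
def Single (G : SimpleGraph (Fin n)) (S : Set (Fin n)) (f : Fin p × Fin q → Fin n)
    (a : Fin p × Fin q) (y : Fin n) : Prop :=
  y ∈ S ∧ (∀ b, f b ≠ y) ∧ ∀ b, b.1 ≠ a.1 → G.Adj y (f b)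

/-- `f` with its vertices `a` and `b` replaced by `y` and `y'` is a `K^2_q`. -/
def Double (G : SimpleGraph (Fin n)) (S : Set (Fin n)) (f : Fin p × Fin q → Fin n)
    (a b : Fin p × Fin q) (y y' : Fin n) : Prop :=
  p = 2 ∧ a.1 ≠ b.1 ∧ y ∈ S ∧ y' ∈ S ∧ (∀ c, f c ≠ y) ∧ (∀ c, f c ≠ y') ∧
    (∀ c, c.1 ≠ a.1 → c ≠ b → G.Adj y (f c)) ∧ (∀ c, c.1 ≠ b.1 → c ≠ a → G.Adj y' (f c)) ∧
    G.Adj y y'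

theorem update_injective {f : Fin p × Fin q → Fin n} (hf : Function.Injective f)
    {a : Fin p × Fin q} {y : Fin n} (hy : ∀ b, f b ≠ y) :
    Function.Injective (Function.update f a y) := by
  intro b c hbc
  simp only [Function.update_apply] at hbc
  split_ifs at hbc with h1 h2 h2
  · rw [h1, h2]
  · exact absurd hbc.symm (hy c)
  · exact absurd hbc (hy b)
  · exact hf hbc

/-- For `q ≥ 2` every class of `f` keeps a vertex other than that at `a`, and by `new_classes`, with
`a` as the missing position, different classes go to different classes of `f'`. The class of `f'`
that corresponds to that of `a` has a vertex that `f` lacks, by `exists_new`; this is `y`. For `q =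
1` the classes are single vertices, and counting gives `y`. -/
theorem single_of_missing (hP : Params t p q) (hB : Bounded G t) {S : Set (Fin n)}
    {f f' : Fin p × Fin q → Fin n} (hf : KF G f) (hf' : KF G f') (hS : ∀ a, f' a ∈ S)
    {a : Fin p × Fin q} (ha : f a ∉ Set.range f') (hne : ∀ b, b ≠ a → f b ∈ Set.range f') :
    ∃ y, Single G S f a y ∧ SameSpan (Function.update f a y) f' := by
  classical
  suffices h : ∃ y, y ∈ Set.range f' ∧ (∀ b, f b ≠ y) ∧ SameSpan (Function.update f a y) f' by
    obtain ⟨y, ⟨y', rfl⟩, hy2, hy3⟩ := h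
    refine ⟨f' y', ⟨hS y', hy2, fun b hb => ?_⟩, hy3⟩
    have h1 := hy3.adj hf' (a := a) (b := b) hb.symm
    rwa [Function.update_self, Function.update_of_ne (by rintro rfl; exact hb rfl)] at h1
  rcases Nat.lt_or_ge 1 q with hq | hq
  · have hb : ∀ i : Fin p, ∃ j : Fin q, (i, j) ≠ a := fun i => by
      obtain ⟨j, hj⟩ := Fintype.exists_ne_of_one_lt_card (by simpa using hq) a.2
      exact ⟨j, fun h => hj (congrArg Prod.snd h)⟩
    choose j hj using hb
    have hr : ∀ c, ∃ c', c ≠ a → f' c' = f c := fun c => by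
      by_cases h : c = a
      · exact ⟨c, fun h' => absurd h h'⟩
      · obtain ⟨c', hc'⟩ := hne c h; exact ⟨c', fun _ => hc'⟩
    choose e he using hr
    have diff : ∀ b c, b ≠ a → c ≠ a → b.1 ≠ c.1 → (e b).1 ≠ (e c).1 := by
      intro b c hb hc hbc
      by_cases hac : a.1 = c.1
      · exact (new_classes hP hB hf hf' ha (fun h => hbc (h.symm.trans hac)) hbc.symm (he b hb).symm
          (he c hc).symm).symm
      · exact new_classes hP hB hf hf' ha hac hbc (he c hc).symm (he b hb).symm
    set ψ : Fin p → Fin p := fun i => (e (i, j i)).1 with hψ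
    have hψi : Function.Injective ψ := fun i k hik => by
      by_contra hne; exact diff _ _ (hj i) (hj k) hne hik
    have hcl : ∀ c, c ≠ a → (e c).1 = ψ c.1 := by
      intro c hc
      obtain ⟨i, hi⟩ := Finite.injective_iff_surjective.1 hψi (e c).1
      by_cases hic : i = c.1
      · rw [← hi, hic]
      · exact absurd hi (diff _ _ (hj i) hc hic)
    obtain ⟨k, hk⟩ : ∃ k, ∀ b, f b ≠ f' (ψ a.1, k) := by
      by_contra! hno
      refine exists_new hf'.1 (a := a) (i := ψ a.1) (f := f) fun k => ?_
      obtain ⟨c, hc⟩ := hno k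
      have hca : c ≠ a := by rintro rfl; exact ha ⟨_, hc.symm⟩
      refine ⟨c, hca, hψi ?_, hc⟩
      rw [← hcl c hca, hf'.1 ((he c hca).trans hc)]
    refine ⟨_, ⟨_, rfl⟩, hk, sameSpan_of_class (update_injective hf.1 hk) hf'.1 hψi fun c => ?_⟩
    by_cases hca : c = a
    · subst hca; exact ⟨_, Function.update_self .., rfl⟩
    · exact ⟨e c, by rw [Function.update_of_ne hca, he c hca], hcl c hca⟩
  · obtain rfl : q = 1 := by have := hP.2.2.1; omega
    obtain ⟨k, hk⟩ : ∃ k, ∀ b, f b ≠ f' k := by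
      by_contra! hno
      have : Finset.univ.image f' ⊆ (Finset.univ.erase a).image f := fun u hu => by
        obtain ⟨k, -, rfl⟩ := Finset.mem_image.1 hu
        obtain ⟨b, hb⟩ := hno k
        exact Finset.mem_image.2 ⟨b, by simp; rintro rfl; exact ha ⟨k, hb.symm⟩, hb⟩
      have := Finset.card_le_card this
      rw [Finset.card_image_of_injective _ hf.1, Finset.card_image_of_injective _ hf'.1,
        Finset.card_erase_of_mem (Finset.mem_univ _)] at this
      have h2 : 0 < (Finset.univ : Finset (Fin p × Fin 1)).card := Finset.card_pos.2 ⟨a, by simp⟩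
      omega
    have hr : ∀ c, ∃ c', Function.update f a (f' k) c = f' c' := fun c => by
      by_cases hca : c = a
      · subst hca; exact ⟨_, Function.update_self ..⟩
      · rw [Function.update_of_ne hca]
        obtain ⟨c', hc'⟩ := hne c hca
        exact ⟨c', hc'.symm⟩
    choose e he using hr
    have hinj := update_injective hf.1 hk (a := a)
    refine ⟨_, ⟨_, rfl⟩, hk, sameSpan_of_class (ψ := fun i => (e (i, 0)).1) hinj hf'.1 ?_
      fun c => ⟨e c, he c, ?_⟩⟩
    · intro i i' h
      have : e (i, 0) = e (i', 0) := Prod.ext h (Subsingleton.elim _ _)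
      have h2 := (he (i, 0)).trans (this ▸ (he (i', 0)).symm)
      exact congrArg Prod.fst (hinj h2)
    · have : c = (c.1, 0) := Prod.ext rfl (Subsingleton.elim _ _)
      rw [← this]

/-- The two missing vertices are not both outside the class of a shared vertex, so every shared
vertex is in one of their classes. These classes differ, since the shared vertices occupy at least
two. A third class would have shared vertices, so `p = 2`. Then `q = t ≥ 3` leaves a shared vertex
in each class, and from these the classes of `f'` can be read off. -/
theorem double_of_missing (hP : Params t p q) (hB : Bounded G t) {S : Set (Fin n)}
    {f f' : Fin p × Fin q → Fin n} (hf : KF G f) (hf' : KF G f') (hS : ∀ a, f' a ∈ S)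
    {a b m m' : Fin p × Fin q} (hm : f m = f' m') (hab : a ≠ b) (ha : f a ∉ Set.range f')
    (hb : f b ∉ Set.range f') : ∃ a b y y', Double G S f a b y y' ∧
      SameSpan (Function.update (Function.update f a y) b y') f' := by
  classical
  have two : ∀ c, f c ∈ Set.range f' → c.1 = a.1 ∨ c.1 = b.1 := by
    rintro c ⟨c', hc⟩
    by_contra! h
    exact hab (miss_le_one hP hB hf hf' hc.symm h.1.symm h.2.symm ha hb)
  have hab1 : a.1 ≠ b.1 := by
    intro h
    obtain ⟨c, c', h1, h2⟩ := exists_other_class hP hB hf hf' hm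
    rcases two m ⟨_, hm.symm⟩ with h3 | h3 <;> rcases two c ⟨_, h2.symm⟩ with h4 | h4
    all_goals exact h1 (by simp only [h3, h4, h])
  -- name the classes so that `m` lies in that of `a`
  wlog hma : m.1 = a.1 generalizing a b
  · have hmb : m.1 = b.1 := (two m ⟨_, hm.symm⟩).resolve_left hma
    exact this hab.symm hb ha (fun c hc => (two c hc).symm) hab1.symm hmb
  have hrest : ∀ c, c.1 ≠ a.1 → c ≠ b → f c ∈ Set.range f' := by
    intro c hc hcb
    by_contra h
    exact hcb (miss_le_one hP hB hf hf' hm (hma ▸ hc) (hma ▸ hab1.symm) h hb)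
  have hp : p = 2 := by
    by_contra hp
    obtain ⟨i, hi⟩ : ∃ i : Fin p, i ∉ ({a.1, b.1} : Finset (Fin p)) := by
      by_contra! h
      have h2 := Finset.card_le_card (fun i _ => h i : Finset.univ ⊆ _)
      have := h2.trans Finset.card_le_two
      simp at this
      have := hP.2.1; omega
    simp only [Finset.mem_insert, Finset.mem_singleton, not_or] at hi
    rcases two (i, b.2) (hrest (i, b.2) hi.1 fun h => hi.2 (congrArg Prod.fst h)) with h | h
    · exact hi.1 h
    · exact hi.2 h
  have hq : 3 ≤ q := by
    obtain ⟨h1, h2, h3, h4⟩ := hP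
    rw [hp] at h4; omega
  obtain ⟨l, hl⟩ : ∃ l : Fin q, l ≠ b.2 :=
    Fintype.exists_ne_of_one_lt_card (by simp; omega) b.2
  set m₂ : Fin p × Fin q := (b.1, l) with hm₂
  have hm₂b : m₂ ≠ b := fun h => hl (congrArg Prod.snd h)
  obtain ⟨m₂', hm₂'⟩ := hrest m₂ hab1.symm hm₂b
  have hrest' : ∀ c, c.1 ≠ b.1 → c ≠ a → f c ∈ Set.range f' := by
    intro c hc hca
    by_contra h
    exact hca (miss_le_one hP hB hf hf' hm₂'.symm hc hab1 h ha)
  have cases2 : ∀ i : Fin p, i = a.1 ∨ i = b.1 := by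
    subst hp
    intro i; omega
  have cases2' : ∀ i j k : Fin p, i ≠ j → j ≠ k → i = k := by
    subst hp
    intro i j k; omega
  have hdiff : m'.1 ≠ m₂'.1 := 
    new_classes hP hB hf hf' (b := m₂) (c := m) ha hab1 (by rw [hma]; exact hab1) hm₂'.symm hm
  set ψ : Fin p → Fin p := fun i => if i = a.1 then m'.1 else m₂'.1 with hψ
  have hψa : ψ a.1 = m'.1 := by simp [hψ]
  have hψb : ψ b.1 = m₂'.1 := by simp [hψ, hab1.symm]
  have hψi : Function.Injective ψ := by
    intro i k h
    rcases cases2 i with rfl | rfl <;> rcases cases2 k with rfl | rfl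
    · rfl
    · rw [hψa, hψb] at h; exact absurd h hdiff
    · rw [hψa, hψb] at h; exact absurd h.symm hdiff
    · rfl
  have hcl : ∀ c c', c ≠ a → c ≠ b → f c = f' c' → c'.1 = ψ c.1 := by
    intro c c' hca hcb hcc
    rcases cases2 c.1 with h | h
    · rw [h, hψa]
      refine cases2' _ m₂'.1 _ ?_ hdiff.symm
      exact new_classes hP hB hf hf' (b := m₂) (c := c) ha hab1 (by rw [h]; exact hab1) hm₂'.symm hcc
    · rw [h, hψb]
      refine cases2' _ m'.1 _ ?_ hdiff
      exact new_classes hP hB hf hf' hb (hma ▸ hab1.symm) (by rw [h, hma]; exact hab1.symm) hm hcc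
  have hnew : ∀ x, (x = a ∨ x = b) → ∃ k, ∀ c, f c ≠ f' (ψ x.1, k) := by
    intro x hx
    by_contra! hno
    refine exists_new hf'.1 (a := x) (i := ψ x.1) (f := f) fun k => ?_
    obtain ⟨c, hc⟩ := hno k
    have hca : c ≠ a := by rintro rfl; exact ha ⟨_, hc.symm⟩
    have hcb : c ≠ b := by rintro rfl; exact hb ⟨_, hc.symm⟩
    exact ⟨c, by rcases hx with rfl | rfl <;> assumption, hψi (hcl c _ hca hcb hc).symm, hc⟩
  obtain ⟨k, hk⟩ := hnew a (.inl rfl)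
  obtain ⟨k', hk'⟩ := hnew b (.inr rfl)
  have hyy : f' (ψ a.1, k) ≠ f' (ψ b.1, k') := fun h =>
    hab1 (hψi (congrArg Prod.fst (hf'.1 h)))
  have hinj : Function.Injective
      (Function.update (Function.update f a (f' (ψ a.1, k))) b (f' (ψ b.1, k'))) := by
    refine update_injective (update_injective hf.1 hk) fun c => ?_
    rw [Function.update_apply]; split_ifs
    · exact hyy
    · exact hk' c
  have hss : SameSpan (Function.update (Function.update f a (f' (ψ a.1, k))) b (f' (ψ b.1, k')))
      f' := by
    refine sameSpan_of_class hinj hf'.1 hψi fun c => ?_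
    by_cases hcb : c = b
    · subst hcb; exact ⟨_, Function.update_self .., rfl⟩
    by_cases hca : c = a
    · subst hca; exact ⟨_, by rw [Function.update_of_ne hcb, Function.update_self], rfl⟩
    · rw [Function.update_of_ne hcb, Function.update_of_ne hca]
      obtain ⟨c', hc'⟩ : f c ∈ Set.range f' := by
        rcases cases2 c.1 with h | h
        · exact hrest' c (h ▸ hab1) hca
        · exact hrest c (h ▸ hab1.symm) hcb
      exact ⟨c', hc'.symm, hcl c c' hca hcb hc'.symm⟩
  refine ⟨a, b, _, _, ⟨hp, hab1, hS _, hS _, hk, hk', fun c hc hcb => ?_, fun c hc hca => ?_, ?_⟩,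
    hss⟩
  · have hca : c ≠ a := by rintro rfl; exact hc rfl
    have := hss.adj hf' (a := a) (b := c) hc.symm
    rwa [Function.update_of_ne hab, Function.update_self, Function.update_of_ne hcb,
      Function.update_of_ne hca] at this
  · have hcb : c ≠ b := by rintro rfl; exact hc rfl
    have := hss.adj hf' (a := b) (b := c) hc.symm
    rwa [Function.update_self, Function.update_of_ne hcb, Function.update_of_ne hca] at this
  · have := hss.adj hf' (a := a) (b := b) hab1
    rwa [Function.update_of_ne hab, Function.update_self, Function.update_self] at this

/-- The `K^p_q`'s that meet `f`. -/
theorem meeting_cases (hP : Params t p q) (hB : Bounded G t) {S : Set (Fin n)}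
    {f f' : Fin p × Fin q → Fin n} (hf : KF G f) (hf' : KF G f') (hS : ∀ a, f' a ∈ S)
    {m m' : Fin p × Fin q} (hm : f m = f' m') :
    (∀ a, f a ∈ Set.range f') ∨
    (∃ a y, Single G S f a y ∧ SameSpan (Function.update f a y) f') ∨
    ∃ a b y y', Double G S f a b y y' ∧
      SameSpan (Function.update (Function.update f a y) b y') f' := by
  by_cases h0 : ∀ a, f a ∈ Set.range f'
  · exact .inl h0
  push Not at h0
  obtain ⟨a, ha⟩ := h0
  by_cases h1 : ∀ b, b ≠ a → f b ∈ Set.range f'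
  · exact .inr (.inl ⟨a, single_of_missing hP hB hf hf' hS ha h1⟩)
  · push Not at h1
    obtain ⟨b, hab, hb⟩ := h1
    exact .inr (.inr (double_of_missing hP hB hf hf' hS hm hab.symm ha hb))

theorem range_eq_of_subset {f f' : Fin p × Fin q → Fin n} (hf : Function.Injective f)
    (hf' : Function.Injective f') (h : ∀ a, f a ∈ Set.range f') : Set.range f = Set.range f' := by
  classical
  have hsub : Finset.univ.image f ⊆ Finset.univ.image f' := fun u hu => by
    obtain ⟨a, -, rfl⟩ := Finset.mem_image.1 hu
    simpa using h a
  have := Finset.eq_of_subset_of_card_le hsub (by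
    rw [Finset.card_image_of_injective _ hf, Finset.card_image_of_injective _ hf'])
  have h2 := congrArg (fun A : Finset (Fin n) => (A : Set (Fin n))) this
  simpa using h2

/-- For `q ≠ 2`, the vertices of a `K^p_q` determine its classes. -/
theorem sameSpan_of_range (hP : Params t p q) (hB : Bounded G t) (hq : q ≠ 2)
    {f f' : Fin p × Fin q → Fin n} (hf : KF G f) (hf' : KF G f') (h : ∀ a, f a ∈ Set.range f') :
    SameSpan f f' := by
  have hq1 := hP.2.2.1
  -- If `f'` separates a vertex from two of its class mates in `f`, it is adjacent to both, against
  -- `no_two_extra`.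
  have key : ∀ b c d b' c' d', f b = f' b' → f c = f' c' → f d = f' d' → b.1 = c.1 → b.1 = d.1 →
      c ≠ d → b'.1 ≠ c'.1 → b'.1 ≠ d'.1 → False := by
    intro b c d b' c' d' hb hc hd hbc hbd hcd h1 h2
    refine no_two_extra hP hB hf (a := b) (u₁ := f c) (u₂ := f d) (fun h => hcd (hf.1 h)) ?_ ?_ ?_ ?_
    · rw [hb, hc]; exact hf'.2 _ _ h1
    · rw [hb, hd]; exact hf'.2 _ _ h2
    · intro e he h; exact he (by rw [hf.1 h, hbc])
    · intro e he h; exact he (by rw [hf.1 h, hbd])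
  refine sameSpan_of_imp (by omega) hf.1 hf'.1 (range_eq_of_subset hf.1 hf'.1 h) ?_
  intro b c b' c' hb hc hbc
  by_contra hne
  have hbc' : b ≠ c := by rintro rfl; exact hne (by rw [hf'.1 (hb.symm.trans hc)])
  have hq3 : 3 ≤ q := by
    rcases Nat.lt_or_ge 1 q with h | h
    · omega
    · obtain rfl : q = 1 := by omega
      exact absurd (Prod.ext hbc (Subsingleton.elim _ _)) hbc'
  obtain ⟨j, hj⟩ : ∃ j : Fin q, j ∉ ({b.2, c.2} : Finset (Fin q)) := by
    by_contra! h
    have h2 := Finset.card_le_card (fun i _ => h i : Finset.univ ⊆ _)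
    have := h2.trans Finset.card_le_two
    simp at this
    omega
  simp only [Finset.mem_insert, Finset.mem_singleton, not_or] at hj
  obtain ⟨d', hd⟩ := h (b.1, j)
  have hdb : (b.1, j) ≠ b := fun h => hj.1 (congrArg Prod.snd h)
  have hdc : (b.1, j) ≠ c := fun h => hj.2 (congrArg Prod.snd h)
  -- The third vertex `d` of the class is, in `f'`, not with both `b` and `c`; so `c` or `b` is
  -- separated from two mates.
  by_cases h1 : b'.1 = d'.1
  · exact key c b _ c' b' d' hc hb hd.symm hbc.symm hbc.symm hdb.symm (Ne.symm hne)
      (fun h => hne (h1.trans h.symm))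
  · exact key b c _ b' c' d' hb hc hd.symm hbc rfl hdc.symm hne h1

/-- For `q = 2`, the vertex `v` of `f` is adjacent to the other vertex of its class. -/
def Free (G : SimpleGraph (Fin n)) (f : Fin p × Fin q → Fin n) (v : Fin n) : Prop :=
  ∃ a b, a ≠ b ∧ a.1 = b.1 ∧ f a = v ∧ G.Adj (f a) (f b)

/-- A non-adjacent pair that is a class of `f` must be a class of `f'` too, so only adjacent pairs
can be regrouped. The correspondence of the classes in `J` extends to a bijection `ψ` of all
classes. The map `g` agrees with `f` on `J` and takes the classes of `f'` elsewhere, and `σ` carries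
`f` to `g`. -/
theorem exists_perm {f f' : Fin p × Fin 2 → Fin n} (hf : KF G f) (hf' : KF G f')
    (h : ∀ a, f a ∈ Set.range f') :
    ∃ σ : Equiv.Perm (Fin n), (∀ v, ¬ Free G f v → σ v = v) ∧ SameSpan (σ ∘ f) f' := by
  classical
  have hr := range_eq_of_subset hf.1 hf'.1 h
  choose e he using h
  set J : Finset (Fin p) := Finset.univ.filter fun i => ¬ G.Adj (f (i, 0)) (f (i, 1)) with hJ
  have hcls : ∀ i ∈ J, ∀ j k, (e (i, j)).1 = (e (i, k)).1 := by
    intro i hi j k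
    by_contra hne
    have h1 := hf'.2 _ _ hne
    rw [he, he] at h1
    have h0 : ¬ G.Adj (f (i, 0)) (f (i, 1)) := by simpa [hJ] using hi
    fin_cases j <;> fin_cases k
    · exact h1.ne rfl
    · exact h0 h1
    · exact h0 h1.symm
    · exact h1.ne rfl
  have hinj : Set.InjOn (fun i => (e (i, 0)).1) (J : Set (Fin p)) := by
    intro i hi k hk hik
    have h3 : (e (i, 1)).1 = (e (i, 0)).1 := hcls i hi _ _
    have hne : e (i, 0) ≠ e (i, 1) := fun h => by
      have := hf.1 ((he (i, 0)).symm.trans (h ▸ he (i, 1)))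
      simp at this
    have hsnd : (e (i, 0)).2 ≠ (e (i, 1)).2 := fun h => hne (Prod.ext h3.symm h)
    have : e (k, 0) = e (i, 0) ∨ e (k, 0) = e (i, 1) := by
      have : (e (k, 0)).2 = (e (i, 0)).2 ∨ (e (k, 0)).2 = (e (i, 1)).2 := by omega
      rcases this with h | h
      · exact .inl (Prod.ext hik.symm h)
      · exact .inr (Prod.ext (hik.symm.trans h3.symm) h)
    rcases this with h | h
    · exact congrArg Prod.fst (hf.1 ((he (i, 0)).symm.trans (h ▸ he (k, 0))))
    · exact congrArg Prod.fst (hf.1 ((he (i, 1)).symm.trans (h ▸ he (k, 0))))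
  obtain ⟨ψ', hψ'⟩ := Set.MapsTo.exists_equiv_extend_of_card_eq (t := (Finset.univ : Finset (Fin p)))
    (by simp) (fun i _ => by simp) hinj
  set ψ : Fin p → Fin p := fun i => ψ' i with hψ
  have hψi : Function.Injective ψ := fun i k h => ψ'.injective (Subtype.ext h)
  set g : Fin p × Fin 2 → Fin n := fun a => if a.1 ∈ J then f a else f' (ψ a.1, a.2) with hg
  have hga : ∀ a, ∃ a', g a = f' a' ∧ a'.1 = ψ a.1 := by
    intro a
    by_cases ha : a.1 ∈ J
    · refine ⟨e a, by simp [hg, ha, he], ?_⟩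
      rw [hψ]; simp only
      rw [hψ' a.1 ha]
      exact hcls a.1 ha a.2 0
    · exact ⟨(ψ a.1, a.2), by simp only [hg, if_neg ha], rfl⟩
  have hginj : Function.Injective g := by
    intro a b hab
    obtain ⟨a', h1, h2⟩ := hga a
    obtain ⟨b', h3, h4⟩ := hga b
    have h5 : a' = b' := hf'.1 (h1.symm.trans (hab.trans h3))
    have h6 : a.1 = b.1 := hψi (by rw [← h2, ← h4, h5])
    by_cases ha : a.1 ∈ J
    · simp only [hg, if_pos ha, if_pos (h6 ▸ ha)] at hab; exact hf.1 hab
    · simp only [hg, if_neg ha, if_neg (h6 ▸ ha)] at hab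
      exact Prod.ext h6 (Prod.mk.inj (hf'.1 hab : (ψ a.1, a.2) = (ψ b.1, b.2))).2
  have hss : SameSpan g f' := sameSpan_of_class hginj hf'.1 hψi hga
  set σ : Fin n → Fin n := fun v => if hv : ∃ a, f a = v then g hv.choose else v with hσ
  have hσf : ∀ a, σ (f a) = g a := by
    intro a
    have hv : ∃ a', f a' = f a := ⟨a, rfl⟩
    simp only [hσ, dif_pos hv]
    rw [hf.1 hv.choose_spec]
  have hgr : ∀ a, ∃ b, f b = g a := fun a => by
    have : g a ∈ Set.range f := by rw [hr, ← hss.1]; exact ⟨a, rfl⟩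
    exact this
  have hσi : Function.Injective σ := by
    intro u v huv
    by_cases hu : ∃ a, f a = u <;> by_cases hv : ∃ a, f a = v
    · obtain ⟨a, rfl⟩ := hu
      obtain ⟨b, rfl⟩ := hv
      rw [hσf, hσf] at huv; rw [hginj huv]
    · obtain ⟨a, rfl⟩ := hu
      rw [hσf] at huv
      simp only [hσ, dif_neg hv] at huv
      exact absurd (huv ▸ hgr a) hv
    · obtain ⟨a, rfl⟩ := hv
      rw [hσf] at huv
      simp only [hσ, dif_neg hu] at huv
      exact absurd (huv ▸ hgr a) hu
    · simpa only [hσ, dif_neg hu, dif_neg hv] using huv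
  refine ⟨Equiv.ofBijective σ (Finite.injective_iff_bijective.1 hσi), fun v hv => ?_, ?_⟩
  · simp only [Equiv.ofBijective_apply]
    by_cases hvr : ∃ a, f a = v
    · obtain ⟨a, rfl⟩ := hvr
      rw [hσf]
      have : a.1 ∈ J := by
        simp only [hJ, Finset.mem_filter, Finset.mem_univ, true_and]
        intro hadj
        obtain ⟨i, j⟩ := a
        fin_cases j
        · exact hv ⟨(i, 0), (i, 1), by simp, rfl, rfl, hadj⟩
        · exact hv ⟨(i, 1), (i, 0), by simp, rfl, rfl, hadj.symm⟩
      simp only [hg, if_pos this]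
    · simp only [hσ, dif_neg hvr]
  · have : (Equiv.ofBijective σ (Finite.injective_iff_bijective.1 hσi)) ∘ f = g := by
      funext a; simpa using hσf a
    rw [this]; exact hss

theorem substitute_single {f : Fin p × Fin q → Fin n} (hf : Function.Injective f)
    (a : Fin p × Fin q) (y : Fin n) :
    substitute (f a, y, f a, y) ∘ f = Function.update f a y := by
  funext b
  simp only [Function.comp, substitute, Function.update_apply, hf.eq_iff]
  split_ifs <;> rfl

theorem substitute_double {f : Fin p × Fin q → Fin n} (hf : Function.Injective f)
    {a b : Fin p × Fin q} (hab : a ≠ b) (y y' : Fin n) :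
    substitute (f a, y, f b, y') ∘ f = Function.update (Function.update f a y) b y' := by
  funext c
  simp only [Function.comp, substitute, Function.update_apply, hf.eq_iff]
  by_cases hca : c = a
  · subst hca; simp [hab]
  · simp [hca]

theorem Double.symm {S : Set (Fin n)} {f : Fin p × Fin q → Fin n} {a b : Fin p × Fin q}
    {y y' : Fin n} (h : Double G S f a b y y') : Double G S f b a y' y :=
  ⟨h.1, h.2.1.symm, h.2.2.2.1, h.2.2.1, h.2.2.2.2.2.1, h.2.2.2.2.1, h.2.2.2.2.2.2.2.1,
    h.2.2.2.2.2.2.1, h.2.2.2.2.2.2.2.2.symm⟩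

theorem Double.kf {S : Set (Fin n)} {f : Fin p × Fin q → Fin n} (hf : KF G f)
    {a b : Fin p × Fin q} {y y' : Fin n} (h : Double G S f a b y y') :
    KF G (Function.update (Function.update f a y) b y') := by
  obtain ⟨hp, hab, -, -, hy, hy', h1, h2, h3⟩ := h
  have hne : a ≠ b := by rintro rfl; exact hab rfl
  have key : ∀ c e, c.1 ≠ e.1 → c.1 = a.1 →
      G.Adj (Function.update (Function.update f a y) b y' c)
        (Function.update (Function.update f a y) b y' e) := by
    intro c e hce hca
    have hcb : c ≠ b := by rintro rfl; exact hab hca.symm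
    have hea : e ≠ a := by rintro rfl; exact hce hca
    rw [Function.update_of_ne hcb]
    by_cases hca' : c = a
    · subst hca'
      rw [Function.update_self]
      by_cases heb : e = b
      · subst heb; rwa [Function.update_self]
      · rw [Function.update_of_ne heb, Function.update_of_ne hea]
        exact h1 e hce.symm heb
    · rw [Function.update_of_ne hca']
      by_cases heb : e = b
      · subst heb; rw [Function.update_self]; exact (h2 c (hca ▸ hab) hca').symm
      · rw [Function.update_of_ne heb, Function.update_of_ne hea]
        exact hf.2 _ _ hce
  refine ⟨update_injective (update_injective hf.1 hy) fun c => ?_, fun c e hce => ?_⟩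
  · rw [Function.update_apply]; split_ifs
    · exact h3.ne
    · exact hy' c
  · have cases2 : c.1 = a.1 ∨ e.1 = a.1 := by
      have hc := c.1.2; have he := e.1.2; have ha := a.1.2; subst hp; omega
    rcases cases2 with h | h
    · exact key c e hce h
    · exact (key e c hce.symm h).symm

/-- A free vertex sees its only class mate and all other classes, hence all of the `K^p_q`.
Therefore free vertices may exchange their places arbitrarily. -/
theorem free_adj {f : Fin p × Fin 2 → Fin n} (hf : KF G f)
    {v u : Fin n} (hv : Free G f v) (hu : ∃ b, f b = u) (hne : v ≠ u) : G.Adj v u := by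
  obtain ⟨a, b, hab, hab1, rfl, hadj⟩ := hv
  obtain ⟨c, rfl⟩ := hu
  by_cases hac : a.1 = c.1
  · have hca : c ≠ a := by rintro rfl; exact hne rfl
    have : c = b := by
      refine Prod.ext (hac.symm.trans hab1) ?_
      have h1 : c.2 ≠ a.2 := fun h => hca (Prod.ext hac.symm h)
      have h2 : a.2 ≠ b.2 := fun h => hab (Prod.ext hab1 h)
      omega
    exact this ▸ hadj
  · exact hf.2 _ _ hac

theorem Free.exists_eq {f : Fin p × Fin q → Fin n} {v : Fin n} (h : Free G f v) : ∃ a, f a = v := by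
  obtain ⟨a, -, -, -, h, -⟩ := h; exact ⟨a, h⟩

/-- The record of a `K^p_q` represents all `K^p_q`'s of the current graph that meet it and contain
the vertices in `fix`. -/
theorem represents_of (hP : Params t p q) (hB : Bounded G t) {S : Set (Fin n)}
    {f : Fin p × Fin q → Fin n} (hf : KF G f) (hS : ∀ a, f a ∈ S) {H : G.Subgraph}
    (hH : Spans f H) {fix : Fin n → Prop} (hfix : ∀ v, fix v → ∃ a, f a = v) {r : Record n p q}
    (hbase : r.base = f) (hcore : ∀ v, v ∈ r.core ↔ q = 2 ∧ Free G f v)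
    (hswap : ∀ w ∈ r.swaps, (∃ a y, Single G S f a y ∧ ¬ fix (f a) ∧ w = (f a, y, f a, y)) ∨
      ∃ a b y y', Double G S f a b y y' ∧ ¬ fix (f a) ∧ ¬ fix (f b) ∧ w = (f a, y, f b, y'))
    (hsingle : ∀ a y, Single G S f a y → ¬ fix (f a) → (f a, y, f a, y) ∈ r.swaps)
    (hdouble : ∀ a b y y', (a.1 : ℕ) = 0 → Double G S f a b y y' → ¬ fix (f a) → ¬ fix (f b) →
      (f a, y, f b, y') ∈ r.swaps) :
    r.Represents {H' : G.Subgraph | IsKpq p q S H' ∧ Meet H' H ∧ ∀ v, fix v → v ∈ H'.verts} := by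
  have three : 3 ≤ p * q := by have := KF.pq hP; have := hP.1; omega
  subst hbase
  set f := r.base with hfdef
  constructor
  · -- everything that is described is a member
    have fin : ∀ (g : Fin p × Fin q → Fin n), KF G g → (∀ a, g a ∈ S) → (∃ a b, g a = f b) →
        (∀ v, fix v → ∃ a, g a = v) →
        ∃ H' ∈ {H' : G.Subgraph | IsKpq p q S H' ∧ Meet H' H ∧ ∀ v, fix v → v ∈ H'.verts},
          Spans g H' := by
      rintro g hg hgS ⟨a, b, hab⟩ hgf
      exact ⟨toSub hg, ⟨isKpq_iff.2 ⟨g, hg, hgS, spans_toSub hg⟩, ⟨f b, ⟨a, hab⟩, hH.mem.2 ⟨b, rfl⟩⟩,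
        hgf⟩, spans_toSub hg⟩
    rintro g (⟨σ, hσ, rfl⟩ | ⟨w, hw, rfl⟩)
    -- A permutation that fixes everything off the core maps the core to itself. So the vertex set
    -- does not change, and adjacency survives because the core vertices are free.
    · have hmem : ∀ v, (∃ a, f a = v) → ∃ a, f a = σ v := by
        rintro v ⟨a, rfl⟩
        by_cases hv : f a ∈ r.core
        · have : σ (f a) ∈ r.core := by
            by_contra hn
            have := σ.injective (hσ _ hn)
            rw [this] at hn; exact hn hv
          exact ((hcore _).1 this).2.exists_eq
        · exact ⟨a, (hσ _ hv).symm⟩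
      have hkf : KF G (σ ∘ f) := by
        refine ⟨σ.injective.comp hf.1, fun a b hab => ?_⟩
        have hne : σ (f a) ≠ σ (f b) := fun h => hab (congrArg Prod.fst (hf.1 (σ.injective h)))
        have mv : ∀ v, v ∈ r.core → σ v ∈ r.core := fun v hv => by
          by_contra hn
          have := σ.injective (hσ _ hn)
          rw [this] at hn; exact hn hv
        by_cases ha : f a ∈ r.core
        · obtain ⟨rfl, hfree⟩ := (hcore _).1 (mv _ ha)
          exact free_adj hf hfree (hmem _ ⟨b, rfl⟩) hne
        by_cases hb : f b ∈ r.core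
        · obtain ⟨rfl, hfree⟩ := (hcore _).1 (mv _ hb)
          exact (free_adj hf hfree (hmem _ ⟨a, rfl⟩) hne.symm).symm
        · simp only [Function.comp, hσ _ ha, hσ _ hb]; exact hf.2 _ _ hab
      have hr := range_eq_of_subset hkf.1 hf.1 fun a => (hmem (f a) ⟨a, rfl⟩)
      refine fin _ hkf (fun a => ?_) ?_ fun v hv => ?_
      · obtain ⟨b, hb⟩ := hmem (f a) ⟨a, rfl⟩
        exact (hb ▸ hS b : σ (f a) ∈ S)
      · have a : Fin p × Fin q := (⟨0, by have := hP.2.1; omega⟩, ⟨0, by have := hP.2.2.1; omega⟩)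
        obtain ⟨b, hb⟩ := hmem (f a) ⟨a, rfl⟩
        exact ⟨a, b, hb.symm⟩
      · have : v ∈ Set.range (σ ∘ f) := hr ▸ hfix v hv
        exact this
    · rcases hswap w hw with ⟨a, y, hs, hfa, rfl⟩ | ⟨a, b, y, y', hs, hfa, hfb, rfl⟩
      · rw [substitute_single hf.1]
        refine fin _ (hf.update hs.2.1 hs.2.2) (fun b => ?_) ?_ fun v hv => ?_
        · rw [Function.update_apply]; split_ifs
          · exact hs.1
          · exact hS b
        · obtain ⟨b, hb⟩ := exists_ne_fst hP a
          exact ⟨b, b, Function.update_of_ne (by rintro rfl; exact hb rfl) ..⟩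
        · obtain ⟨b, rfl⟩ := hfix v hv
          exact ⟨b, Function.update_of_ne (by rintro rfl; exact hfa hv) ..⟩
      · have hab : a ≠ b := by rintro rfl; exact hs.2.1 rfl
        rw [substitute_double hf.1 hab]
        refine fin _ (hs.kf hf) (fun c => ?_) ?_ fun v hv => ?_
        · rw [Function.update_apply]; split_ifs
          · exact hs.2.2.2.1
          · rw [Function.update_apply]; split_ifs
            · exact hs.2.2.1
            · exact hS c
        · obtain ⟨c, hc⟩ : ∃ c : Fin p × Fin q, c ∉ ({a, b} : Finset _) := by
            by_contra! h
            have h2 := Finset.card_le_card (fun i _ => h i : Finset.univ ⊆ _)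
            have := h2.trans Finset.card_le_two
            simp at this
            omega
          simp only [Finset.mem_insert, Finset.mem_singleton, not_or] at hc
          exact ⟨c, c, by rw [Function.update_of_ne hc.2, Function.update_of_ne hc.1]⟩
        · obtain ⟨c, rfl⟩ := hfix v hv
          refine ⟨c, ?_⟩
          rw [Function.update_of_ne (by rintro rfl; exact hfb hv),
            Function.update_of_ne (by rintro rfl; exact hfa hv)]
  · rintro H' ⟨hH', ⟨v, hv1, hv2⟩, hfixH⟩
    obtain ⟨f', hf', hS', hs'⟩ := isKpq_iff.1 hH'
    obtain ⟨m', hm'⟩ := hs'.mem.1 hv1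
    obtain ⟨m, hm⟩ := hH.mem.1 hv2
    rcases meeting_cases hP hB hf hf' hS' (hm.trans hm'.symm) with h | ⟨a, y, h1, h2⟩ |
        ⟨a, b, y, y', h1, h2⟩
    -- The vertices are the same. For `q ≠ 2` the classes are the same too, and the identity
    -- permutation describes `H'`.
    · by_cases hq : q = 2
      · subst hq
        obtain ⟨σ, hσ, hss⟩ := exists_perm hf hf' h
        refine ⟨_, .inl ⟨σ, fun v hv => hσ v fun hfree => hv ?_, rfl⟩, hss.spans hs'⟩
        exact (hcore v).2 ⟨rfl, hfree⟩
      · exact ⟨f, .inl ⟨1, by simp, by simp [hfdef]⟩, (sameSpan_of_range hP hB hq hf hf' h).spans hs'⟩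
    -- A vertex that `H'` has to contain cannot be the one that was replaced.
    · have hfa : ¬ fix (f a) := fun h => by
        have h3 : f a ∈ Set.range (Function.update f a y) := by
          rw [h2.1, ← hs'.1]; exact hfixH _ h
        obtain ⟨b, hb⟩ := h3
        rw [Function.update_apply] at hb
        split_ifs at hb with hba
        · exact h1.2.1 a hb.symm
        · exact hba (hf.1 hb)
      refine ⟨_, .inr ⟨_, hsingle a y h1 hfa, rfl⟩, ?_⟩
      rw [substitute_single hf.1]; exact h2.spans hs'
    · have hab : a ≠ b := by rintro rfl; exact h1.2.1 rfl
      have hfx : ∀ x, (x = a ∨ x = b) → ¬ fix (f x) := fun x hx h => by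
        have h3 : f x ∈ Set.range (Function.update (Function.update f a y) b y') := by
          rw [h2.1, ← hs'.1]; exact hfixH _ h
        obtain ⟨c, hc⟩ := h3
        rw [Function.update_apply] at hc
        split_ifs at hc with hcb
        · exact h1.2.2.2.2.2.1 x hc.symm
        · rw [Function.update_apply] at hc
          split_ifs at hc with hca
          · exact h1.2.2.2.2.1 x hc.symm
          · rcases hx with rfl | rfl
            · exact hca (hf.1 hc)
            · exact hcb (hf.1 hc)
      -- Only the double replacements that begin in class `0` have to be listed; the others are the
      -- same with the two entries exchanged.
      have h0 : (a.1 : ℕ) = 0 ∨ (b.1 : ℕ) = 0 := by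
        have h3 := a.1.2; have h4 := b.1.2; have h5 := h1.1; have h6 := h1.2.1
        have : (a.1 : ℕ) ≠ b.1 := fun h => h6 (Fin.ext h)
        omega
      rcases h0 with h0 | h0
      · refine ⟨_, .inr ⟨_, hdouble a b y y' h0 h1 (hfx a (.inl rfl)) (hfx b (.inr rfl)), rfl⟩, ?_⟩
        rw [substitute_double hf.1 hab]; exact h2.spans hs'
      · refine ⟨_, .inr ⟨_, hdouble b a y' y h0 h1.symm (hfx b (.inr rfl)) (hfx a (.inl rfl)), rfl⟩, ?_⟩
        rw [substitute_double hf.1 hab.symm, Function.update_comm hab.symm]; exact h2.spans hs'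

end

/-! ## The friend procedure -/

/-- Append three of the neighbours of `y` (or all if there are less) to the list in array `7`. -/
def appendThree (y : ℕ) : Program :=
  .seq (.add 140 (.var 150) (.lit 3)) (.seq (appendUnmarked 7 y)
    (.ite (.var 140) (.var 150) (.add 150 (.var 140) (.lit 0)) .skip))

/-- Check whether the candidate in variable `36` has enough common neighbours with `v₁`. -/
def checkFriend : Program :=
  .seq (.load 36 7 (.var 35)) (.seq (.sub 38 (.var 36) (.var 30)) (.seq (.sub 39 (.var 30) (.var 36))
    (.seq (.add 38 (.var 38) (.var 39)) (.ite (.lit 0) (.var 38)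
      (.seq (countMarked 36) (.ite (.var 150) (.var 32) .skip (.add 31 (.var 36) (.lit 1)))) .skip))))

/-- The friend procedure for the vertex in variable `30`, with the answer in variable `31`. -/
def friend : Program :=
  .seq (.add 31 (.lit 0) (.lit 0)) (.seq (.sub 32 (.var 1) (.var 3))
  (.seq (.ite (.var 2) (.lit 3) (.add 32 (.var 1) (.lit 0)) .skip)
  (.seq (.add 33 (.lit 0) (.lit 0)) (.seq (.add 150 (.lit 0) (.lit 0))
  (.seq (appendThree 30) (.seq (.add 34 (.var 150) (.lit 0))
  (.seq (forTo 35 (.var 34) (.seq (.load 36 7 (.var 35)) (appendThree 36)))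
  (.seq (.add 37 (.var 150) (.lit 0)) (.seq (markRow 33 30 1)
  (.seq (forTo 35 (.var 37) checkFriend) (markRow 33 30 0)))))))))))

/-- The vertices that are not removed. -/
def alive (n : ℕ) (d : ℕ → ℕ) : Set (Fin n) := {v | d v = 0}

section
variable {n t p q W : ℕ} {G : SimpleGraph (Fin n)} [DecidableRel G.Adj] {a₀ a₁ d : ℕ → ℕ}

theorem At.q_le (h : Ctx G t p q W a₀ a₁ d) : q ≤ t ∧ p ≤ t + 1 ∧ 3 ≤ t ∧ 2 ≤ p ∧ 1 ≤ q := by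
  obtain ⟨h1, h2, h3, h4⟩ := h.params
  refine ⟨q_le_t h.params, ?_, h1, h2, h3⟩
  have : p - 1 ≤ (p - 1) * q := Nat.le_mul_of_pos_right _ h3
  omega

/-- All neighbours are appended, and then the length is cut back to three; this is still `O(t)`. -/
theorem spec_appendThree (h : Ctx G t p q W a₀ a₁ d) {s : Store} (hs : At n t p q a₀ a₁ d s)
    {y : ℕ} {v : Fin n} (hy : y < 140) (hyv : s.var y = v) (hM : s.arr 4 = fun _ => 0)
    {l : List (Fin n)} (hl : Lst s 7 l) (hll : s.var 150 = l.length) (hlen : l.length ≤ 12) :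
    Spec W (appendThree y) (20 * t + 23) s fun s' => At n t p q a₀ a₁ d s' ∧ Keep 140 [] [7] s s' ∧
      ∃ l' : List (Fin n), l'.Nodup ∧ (∀ x ∈ l', x ∈ nb G d v) ∧ l'.length ≤ 3 ∧
        (3 ≤ (nb G d v).card → l'.length = 3) ∧ Lst s' 7 (l ++ l') ∧
        s'.var 150 = (l ++ l').length := by
  have hW₁ := h.le_W₁
  have hk : ∀ k, Keep 140 [] [7] s (s.setVar 140 k) := fun k => Keep.refl.setVar (by simp)
  simp only [appendThree, Spec, wp_seq, wp_add, Operand.val, hll]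
  refine ⟨by omega, wp_of_spec (spec_appendUnmarked h (hs.keep (hk _)) (a := 7) (y := y) (v := v)
    (by norm_num) (by omega) (by simp [show y ≠ 140 by omega, hyv]) (by simp [hM])
    (hl.congr (by simp)) (by simp [hll]) (by omega)) ?_⟩
  rintro k s' hk' ⟨h1, h2, l', h3, h4, h5, h6⟩
  have h140 : s'.var 140 = l.length + 3 := by rw [h2.1 140 (by norm_num) (by simp)]; simp
  have hc : l'.length = (nb G d v).card := by
    rw [← List.toFinset_card_of_nodup h3]
    congr 1; ext x; simp [h4, hM]
  simp only [List.length_append] at h6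
  have hk2 : Keep 140 [] [7] s s' := (hk _).trans h2 (by norm_num) (by simp) (by simp)
  simp only [wp_ite, wp_add, wp_skip, Operand.val, h140, h6]
  refine ⟨fun hlt => ⟨by omega, by omega, ?_⟩, fun hle => ⟨by omega, h1, hk2, l', h3,
    fun x hx => ((h4 x).1 hx).1, by omega, by omega, h5, by simp⟩⟩
  have hk3 : ∀ k, Keep 140 [] [7] s' (s'.setVar 150 k) := fun k => Keep.refl.setVar (by simp)
  refine ⟨h1.keep (hk3 _), hk2.trans (hk3 _) le_rfl (by simp) (by simp), l'.take 3,
    h3.sublist (List.take_sublist _ _), fun x hx => ((h4 x).1 (List.mem_of_mem_take hx)).1, by simp,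
    by simp; omega, ?_, by simp; omega⟩
  intro j hj
  simp only [List.length_append, List.length_take] at hj
  rw [Store.setVar_arr, h5 j (by simp; omega)]
  by_cases hjl : j < l.length
  · rw [List.getElem_append_left hjl, List.getElem_append_left hjl]
  · rw [List.getElem_append_right (by omega), List.getElem_append_right (by omega),
      List.getElem_take]

/-- Three neighbours of `v` are on the list `l`. -/
def Covers (G : SimpleGraph (Fin n)) [DecidableRel G.Adj] (d : ℕ → ℕ) (l : List (Fin n))
    (v : Fin n) : Prop :=
  3 ≤ (nb G d v).card → ∃ l' : List (Fin n), l'.Nodup ∧ l'.length = 3 ∧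
    ∀ x ∈ l', x ∈ nb G d v ∧ x ∈ l

theorem Covers.mono {l l' : List (Fin n)} {v : Fin n} (h : Covers G d l v) :
    Covers G d (l ++ l') v := fun h3 => by
  obtain ⟨l₁, h1, h2, h4⟩ := h h3
  exact ⟨l₁, h1, h2, fun x hx => ⟨(h4 x hx).1, List.mem_append_left _ (h4 x hx).2⟩⟩

/-- The number of common neighbours. -/
def common (G : SimpleGraph (Fin n)) [DecidableRel G.Adj] (d : ℕ → ℕ) (u v : Fin n) : ℕ :=
  ((nb G d u).filter fun x => x ∈ nb G d v).card

theorem ncard_commonIn (u v : Fin n) :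
    (commonIn G (alive n d) v u).ncard = common G d u v := by
  have : commonIn G (alive n d) v u = ↑((nb G d u).filter fun x => x ∈ nb G d v) := by
    ext x; simp [commonIn, alive]; tauto
  rw [this, Set.ncard_coe_finset, common]

/-- By `no_two_extra`, two neighbours suffice to reach another class. This is why a constant number
of candidates is enough, here and in `find`. -/
theorem exists_class_nbr (hP : Params t p q) (hB : Bounded G t) {f : Fin p × Fin q → Fin n}
    (hf : KF G f) {a : Fin p × Fin q} {x y : Fin n} (hxy : x ≠ y) (hx : G.Adj (f a) x)
    (hy : G.Adj (f a) y) : ∃ b, b.1 ≠ a.1 ∧ (f b = x ∨ f b = y) := by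
  by_contra! h
  exact no_two_extra hP hB hf hxy hx hy (fun b hb => (h b hb).1) fun b hb => (h b hb).2

theorem le_common {f : Fin p × Fin q → Fin n} (hf : KF G f) (hS : ∀ a, f a ∈ alive n d)
    (a b : Fin p × Fin q) :
    (Finset.univ.filter fun c : Fin p × Fin q => c.1 ≠ a.1 ∧ c.1 ≠ b.1).card ≤
      common G d (f b) (f a) := by
  rw [← Finset.card_image_of_injective _ hf.1, common]
  refine Finset.card_le_card fun u hu => ?_
  obtain ⟨c, hc, rfl⟩ := Finset.mem_image.1 hu
  simp only [Finset.mem_filter, Finset.mem_univ, true_and] at hc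
  have := hS c
  simp only [alive, Set.mem_ofPred_eq] at this
  simp [this, hf.2 _ _ hc.1.symm, hf.2 _ _ hc.2.symm]

/-- Of the first two neighbours of `v` one, `f b`, is in another class. For `p ≥ 3` it shares enough
neighbours with `v`. For `p = 2` a class mate of `v` is wanted: two of the three listed neighbours
of `f b` differ from `v`, and one of these two is outside the class of `f b`, hence in that of `v`.
-/
theorem friend_complete (hP : Params t p q) (hB : Bounded G t) {v : Fin n} {l l₁ : List (Fin n)}
    (h1 : 3 ≤ (nb G d v).card → l₁.length = 3) (h2 : l₁.Nodup)
    (h3 : ∀ x ∈ l₁, x ∈ nb G d v ∧ x ∈ l ∧ Covers G d l x)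
    (hno : ∀ x ∈ l, x ≠ v → common G d x v < max (p - 2) 1 * q) :
    FriendAnswer G p q (alive n d) v none := by
  intro H hH hv
  obtain ⟨f, hf, hS, hs⟩ := isKpq_iff.1 hH
  obtain ⟨a, rfl⟩ := hs.mem.1 hv
  have hdeg : ∀ a, 3 ≤ (nb G d (f a)).card := by
    intro a
    refine hP.1.trans ?_
    rw [← card_other hP a, ← Finset.card_image_of_injective _ hf.1]
    refine Finset.card_le_card fun u hu => ?_
    obtain ⟨c, hc, rfl⟩ := Finset.mem_image.1 hu
    simp only [Finset.mem_filter, Finset.mem_univ, true_and] at hc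
    have := hS c
    simp only [alive, Set.mem_ofPred_eq] at this
    simp [this, hf.2 _ _ hc.symm]
  have hl := h1 (hdeg a)
  match l₁, hl with
  | [x, y, z], _ =>
  have hxy : x ≠ y := by simp at h2; tauto
  obtain ⟨b, hb, hbx⟩ := exists_class_nbr hP hB hf hxy (mem_nb.1 (h3 x (by simp)).1).1
    (mem_nb.1 (h3 y (by simp)).1).1
  have hbl : f b ∈ l ∧ Covers G d l (f b) := by
    rcases hbx with rfl | rfl
    · exact (h3 _ (by simp)).2
    · exact (h3 _ (by simp)).2
  rw [thr_eq hP] at hno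
  by_cases hp : p < 3
  · rw [if_pos hp] at hno
    obtain ⟨l', g1, g2, g3⟩ := hbl.2 (hdeg b)
    match l', g2 with
    | [x', y', z'], _ =>
    have g3x := g3 x' (by simp)
    have g3y := g3 y' (by simp)
    have g3z := g3 z' (by simp)
    simp only [mem_nb] at g3x g3y g3z
    have hd : x' ≠ y' ∧ x' ≠ z' ∧ y' ≠ z' := by simp at g1; tauto
    have key : ∀ x y : Fin n, x ≠ y → x ∈ l → y ∈ l → G.Adj (f b) x → G.Adj (f b) y → x ≠ f a →
        y ≠ f a → False := by
      intro x y hxy hxl hyl hx hy hxa hya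
      obtain ⟨c, hc, hcx⟩ := exists_class_nbr hP hB hf hxy hx hy
      have hca : c.1 = a.1 := by
        have h1 := c.1.2; have h2 := a.1.2; have h3 := b.1.2; have h4 := hP.2.1
        have h5 : (c.1 : ℕ) ≠ b.1 := fun h => hc (Fin.ext h)
        have h6 : (b.1 : ℕ) ≠ a.1 := fun h => hb (Fin.ext h)
        exact Fin.ext (by omega)
      have h7 := le_common hf hS a c
      rw [hca] at h7
      simp only [and_self] at h7
      rw [card_other hP a] at h7
      have h8 : f c ∈ l ∧ f c ≠ f a := by
        rcases hcx with h | h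
        · rw [h]; exact ⟨hxl, hxa⟩
        · rw [h]; exact ⟨hyl, hya⟩
      have := hno _ h8.1 h8.2
      omega
    by_cases e1 : x' = f a
    · exact key y' z' hd.2.2 g3y.2 g3z.2 g3y.1.1 g3z.1.1 (by rw [← e1]; exact hd.1.symm)
        (by rw [← e1]; exact hd.2.1.symm)
    by_cases e2 : y' = f a
    · exact key x' z' hd.2.1 g3x.2 g3z.2 g3x.1.1 g3z.1.1 e1 (by rw [← e2]; exact hd.2.2.symm)
    · exact key x' y' hd.1 g3x.2 g3y.2 g3x.1.1 g3y.1.1 e1 e2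
  · rw [if_neg hp] at hno
    have h5 := card_common_of_ne hP (by omega) a b hb
    have h6 := le_common hf hS a b
    have := hno _ hbl.1 fun h => hb (congrArg Prod.fst (hf.1 h))
    omega

/-- Three neighbours of `v` and three of each of these make at most `3 + 9 = 12` candidates. -/
theorem spec_collectCandidates (h : Ctx G t p q W a₀ a₁ d) {s : Store} (hs : At n t p q a₀ a₁ d s)
    {v : Fin n} (hM : s.arr 4 = fun _ => 0) {l₁ : List (Fin n)} (hl : Lst s 7 l₁)
    (hll : s.var 150 = l₁.length) (hlen : l₁.length ≤ 3) (h34 : s.var 34 = l₁.length)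
    (hl₁ : ∀ x ∈ l₁, x ∈ nb G d v) :
    Spec W (forTo 35 (.var 34) (.seq (.load 36 7 (.var 35)) (appendThree 36))) (60 * t + 80) s
      fun s' => At n t p q a₀ a₁ d s' ∧ Keep 35 [] [7] s s' ∧ ∃ l : List (Fin n), Lst s' 7 (l₁ ++ l) ∧
        s'.var 150 = (l₁ ++ l).length ∧ (l₁ ++ l).length ≤ 12 ∧ (∀ x ∈ l₁ ++ l, d x = 0) ∧
        ∀ x ∈ l₁, Covers G d (l₁ ++ l) x := by
  have hW₁ := h.le_W₁
  have hk : ∀ k, Keep 35 [] [7] s (s.setVar 35 k) := fun k => Keep.refl.setVar (by simp)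
  refine (spec_forTo (m := l₁.length) (T := 20 * t + 24) (Inv := fun j s' =>
    At n t p q a₀ a₁ d s' ∧ Keep 35 [] [7] s s' ∧ s'.var 35 = j ∧ ∃ l : List (Fin n),
      Lst s' 7 (l₁ ++ l) ∧ s'.var 150 = (l₁ ++ l).length ∧ l.length ≤ 3 * j ∧
      (∀ x ∈ l₁ ++ l, d x = 0) ∧ ∀ i (hi : i < l₁.length), i < j → Covers G d (l₁ ++ l) l₁[i])
      (by omega) (fun j s' h => ⟨h.2.2.1, by
        simp only [Operand.val]; rw [h.2.1.1 34 (by norm_num) (by simp), h34]⟩) ?_ ?_).mono ?_ ?_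
  · rintro j hj s' ⟨g1, g2, g3, l, g4, g5, g6, g7, g8⟩
    have hx : s'.arr 7 j = l₁[j] := by
      rw [g4 j (by simp; omega), List.getElem_append_left hj]
    have hxn := (l₁[j]).2
    have hk1 : ∀ k, Keep 35 [] [7] s' (s'.setVar 36 k) := fun k => Keep.refl.setVar (by simp)
    have hM' : s'.arr 4 = fun _ => 0 := by rw [g2.2 4 (by simp), hM]
    simp only [Spec, wp_seq, wp_load, Operand.val, g3, hx]
    simp only [List.length_append] at g5
    refine ⟨by omega, by omega, wp_of_spec (spec_appendThree h (g1.keep (hk1 _)) (y := 36)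
      (v := l₁[j]) (by norm_num) (by simp) (by simpa using hM') (g4.congr (by simp))
      (by simp [g5]) (by simp; omega)) ?_⟩
    rintro k s'' hk' ⟨f1, f2, l', f3, f4, f5, f6, f7, f8⟩
    have hk2 : Keep 35 [] [7] s' s'' := (hk1 _).trans f2 (by norm_num) (by simp) (by simp)
    have hk3 : ∀ k, Keep 35 [] [7] s'' (s''.setVar 35 k) := fun k => Keep.refl.setVar (by simp)
    have h35 : s''.var 35 = j := by rw [f2.1 35 (by norm_num) (by simp)]; simp [g3]
    refine ⟨by omega, h35, f1.keep (hk3 _),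
      (g2.trans hk2 le_rfl (by simp) (by simp)).trans (hk3 _) le_rfl (by simp) (by simp), by simp,
      l ++ l', (by rw [← List.append_assoc]; exact f7.congr (by simp)), ?_, ?_, ?_, ?_⟩
    · simp only [Store.setVar_var]; norm_num; rw [f8]; simp
    · simp; omega
    · intro x hx
      rw [← List.append_assoc] at hx
      rcases List.mem_append.1 hx with hx | hx
      · exact g7 x hx
      · exact (mem_nb.1 (f4 x hx)).2
    · intro i hi hij
      rw [← List.append_assoc]
      by_cases hij' : i < j
      · exact (g8 i hi hij').mono
      · obtain rfl : i = j := by omega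
        exact fun h3 => ⟨l', f3, f6 h3, fun x hx => ⟨f4 x hx, List.mem_append_right _ hx⟩⟩
  · exact ⟨hs.keep (hk _), hk _, by simp, [], by simpa using hl.congr (by simp), by simp [hll],
      by simp, by simpa using fun x hx => (mem_nb.1 (hl₁ x hx)).2, by simp⟩
  · nlinarith
  · rintro s' ⟨g1, g2, -, l, g4, g5, g6, g7, g8⟩
    refine ⟨g1, g2, l, g4, g5, by simp; omega, g7, fun x hx => ?_⟩
    obtain ⟨i, hi, rfl⟩ := List.getElem_of_mem hx
    exact g8 i hi hi

/-- With the neighbours of `v` marked, each candidate costs one pass through its list. A later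
success may overwrite an earlier one, so the invariant only says that a positive answer is correct.
-/
theorem spec_checkCandidates (h : Ctx G t p q W a₀ a₁ d) {s : Store} (hs : At n t p q a₀ a₁ d s)
    {v : Fin n} (hM : s.arr 4 = fun j : ℕ => if ∃ x ∈ nb G d v, j = 0 + (x : ℕ) then 1 else 0)
    {l : List (Fin n)} (hl : Lst s 7 l) (h37 : s.var 37 = l.length) (hlen : l.length ≤ 12)
    (hla : ∀ x ∈ l, d x = 0) {thr : ℕ} (h30 : s.var 30 = v) (h31 : s.var 31 = 0)
    (h32 : s.var 32 = thr) :
    Spec W (forTo 35 (.var 37) checkFriend) (240 * t + 400) s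
      fun s' => At n t p q a₀ a₁ d s' ∧ Keep 35 [31] [] s s' ∧
        ((s'.var 31 = 0 ∧ ∀ x ∈ l, x ≠ v → common G d x v < thr) ∨
        ∃ x : Fin n, s'.var 31 = x + 1 ∧ d x = 0 ∧ x ≠ v ∧ thr ≤ common G d x v) := by
  have hW₁ := h.le_W₁
  have hM0 : ∀ j, s.arr 4 j ≤ 1 := fun j => by rw [hM]; simp only; split_ifs <;> simp
  refine (spec_forTo (N := .var 37) (m := l.length) (T := 20 * t + 30) (Inv := fun j s' =>
    At n t p q a₀ a₁ d s' ∧ Keep 35 [31] [] s s' ∧ s'.var 35 = j ∧ s'.var 37 = l.length ∧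
        ((s'.var 31 = 0 ∧ ∀ i (hi : i < l.length), i < j → l[i] ≠ v → common G d l[i] v < thr) ∨
        ∃ x : Fin n, s'.var 31 = x + 1 ∧ d x = 0 ∧ x ≠ v ∧ thr ≤ common G d x v))
      (by omega) (fun j s' h => ⟨h.2.2.1, h.2.2.2.1⟩) ?_ ?_).mono ?_ ?_
  · rintro j hj s' ⟨g1, g2, g3, g4, g5⟩
    have hx : s'.arr 7 j = l[j] := by rw [g2.2 7 (by simp), hl j hj]
    have hxn := (l[j]).2
    have e30 : s'.var 30 = v := by rw [g2.1 30 (by norm_num) (by simp), h30]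
    have e4 : s'.arr 4 = s.arr 4 := g2.2 4 (by simp)
    refine Spec.intro fun Q hQ => ?_
    simp only [checkFriend, wp_seq, wp_load, wp_sub, wp_add, wp_ite, wp_skip, Operand.val,
      Store.setVar_var, g3, hx, e30]
    norm_num
    -- The sum of the two truncated differences is positive exactly if the candidate is not `v`.
    set s₁ := ((((s'.setVar 36 l[j]).setVar 38 (l[j] - v)).setVar 39 (v - l[j])).setVar 38
      (l[j] - v + (v - l[j]))) with hs₁
    have hk1 : Keep 35 [31] [] s' s₁ := (((Keep.refl.setVar (by simp)).setVar (by simp)).setVar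
      (by simp)).setVar (by simp)
    have fin : ∀ s₂, Keep 35 [31] [] s' s₂ → At n t p q a₀ a₁ d s₂ → s₂.var 37 = l.length →
        ((s₂.var 31 = 0 ∧ s'.var 31 = 0 ∧ (l[j] ≠ v → common G d l[j] v < thr)) ∨
        ∃ x : Fin n, s₂.var 31 = x + 1 ∧ d x = 0 ∧ x ≠ v ∧ thr ≤ common G d x v) →
        At n t p q a₀ a₁ d (s₂.setVar 35 (j + 1)) ∧ Keep 35 [31] [] s (s₂.setVar 35 (j + 1)) ∧
        s₂.var 37 = l.length ∧
        ((s₂.var 31 = 0 ∧ ∀ i (hi : i < l.length), i < j + 1 → l[i] ≠ v → common G d l[i] v < thr) ∨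
        ∃ x : Fin n, s₂.var 31 = x + 1 ∧ d x = 0 ∧ x ≠ v ∧ thr ≤ common G d x v) := by
      intro s₂ f1 f2 f3 f4
      have hk : ∀ k, Keep 35 [31] [] s₂ (s₂.setVar 35 k) := fun k => Keep.refl.setVar (by simp)
      refine ⟨f2.keep (hk _), (g2.trans f1 le_rfl (by simp) (by simp)).trans (hk _) le_rfl
        (by simp) (by simp), f3, ?_⟩
      rcases f4 with ⟨f5, f6, f7⟩ | f4
      · rcases g5 with ⟨g5, g6⟩ | ⟨x, g5, -⟩
        · refine .inl ⟨f5, fun i hi hij hiv => ?_⟩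
          by_cases hij' : i < j
          · exact g6 i hi hij' hiv
          · obtain rfl : i = j := by omega
            exact f7 hiv
        · omega
      · exact .inr f4
    refine ⟨by omega, by omega, by omega, by omega, by omega, fun hne => ?_, fun hle => ?_⟩
    · have hat := g1.keep hk1
      refine wp_of_spec (spec_countMarked h hat (y := 36) (v := l[j]) (by norm_num)
        (by simp [hs₁]) (by simpa [hs₁, e4] using hM0)) ?_
      rintro k s₂ hk ⟨f1, f2, f3⟩
      have hcount : s₂.var 150 = common G d l[j] v := by
        rw [f3, common]
        congr 1
        ext x
        simp only [hs₁, Store.setVar_arr, e4, hM, Finset.mem_filter]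
        simp [Fin.val_inj]
      have e36 : s₂.var 36 = l[j] := by rw [f2.1 36 (by norm_num) (by simp)]; simp [hs₁]
      have e32 : s₂.var 32 = thr := by
        rw [f2.1 32 (by norm_num) (by simp), hk1.1 32 (by norm_num) (by simp),
          g2.1 32 (by norm_num) (by simp), h32]
      have e35 : s₂.var 35 = j := by rw [f2.1 35 (by norm_num) (by simp)]; simp [hs₁, g3]
      have e37 : s₂.var 37 = l.length := by rw [f2.1 37 (by norm_num) (by simp)]; simp [hs₁, g4]
      have e31 : s₂.var 31 = s'.var 31 := by rw [f2.1 31 (by norm_num) (by simp)]; simp [hs₁]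
      have hk2 : Keep 35 [31] [] s' s₂ := hk1.trans f2 (by norm_num) (by simp) (by simp)
      simp only [e36, e32, hcount]
      refine ⟨fun hlt => hQ _ _ (by omega) ⟨e35, ?_⟩, fun hge => ⟨by omega,
        hQ _ _ (by omega) ⟨by simpa using e35, ?_⟩⟩⟩
      · have := fin s₂ hk2 f1 e37 (by
          rcases g5 with ⟨g5, g6⟩ | g5
          · exact .inl ⟨by rw [e31, g5], g5, fun _ => hlt⟩
          · exact .inr (by rw [e31]; exact g5))
        simpa [e37] using this
      · have hk3 : ∀ k, Keep 35 [31] [] s₂ (s₂.setVar 31 k) := fun k => Keep.refl.setVar (by simp)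
        have := fin (s₂.setVar 31 (l[j] + 1)) (hk2.trans (hk3 _) le_rfl (by simp) (by simp))
          (f1.keep (hk3 _)) (by simpa using e37) (.inr ⟨l[j], by simp, hla _ (List.getElem_mem hj), ?_,
            by omega⟩)
        · simpa [e37] using this
        · intro h; rw [h] at hne; omega
    · have hv : l[j] = v := Fin.ext (by omega)
      have := fin s₁ hk1 (g1.keep hk1) (by simpa [hs₁] using g4) (by
          rcases g5 with ⟨g5, g6⟩ | g5
          · exact .inl ⟨by simpa [hs₁] using g5, g5, fun h => absurd hv h⟩
          · exact .inr (by simpa [hs₁] using g5))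
      exact hQ _ _ (by omega) ⟨by simp [hs₁, g3], this.1, this.2.1, by simp, by
        simpa [hs₁] using this.2.2.1, by simpa using this.2.2.2⟩
  · have hk : ∀ k, Keep 35 [31] [] s (s.setVar 35 k) := fun k => Keep.refl.setVar (by simp)
    exact ⟨hs.keep (hk _), hk _, by simp, by simpa using h37, .inl ⟨by simpa using h31, by simp⟩⟩
  · nlinarith
  · rintro s' ⟨g1, g2, -, -, g5⟩
    refine ⟨g1, g2, g5.imp_left fun ⟨g5, g6⟩ => ⟨g5, fun x hx => ?_⟩⟩
    obtain ⟨i, hi, rfl⟩ := List.getElem_of_mem hx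
    exact g6 i hi hi

theorem spec_friend (h : Ctx G t p q W a₀ a₁ d) {s : Store} (hs : At n t p q a₀ a₁ d s)
    {v : Fin n} (hM : s.arr 4 = fun _ => 0) (h30 : s.var 30 = v) :
    Spec W friend (1000 * t) s fun s' => At n t p q a₀ a₁ d s' ∧ Keep 31 [] [7] s s' ∧
      ((s'.var 31 = 0 ∧ FriendAnswer G p q (alive n d) v none) ∨
        ∃ x : Fin n, s'.var 31 = x + 1 ∧ FriendAnswer G p q (alive n d) v (some x)) := by
  have hW₁ := h.le_W₁
  obtain ⟨hqt, hpt, ht, hp2, hq⟩ := At.q_le h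
  set thr := max (p - 2) 1 * q with hthr
  have hthr' := thr_eq h.params
  rw [← hthr] at hthr'
  refine Spec.intro fun Q hQ => ?_
  simp only [friend, wp_seq, wp_sub, wp_add, wp_ite, wp_skip, Operand.val,
      Store.setVar_var, hs.var_t, hs.var_q, hs.var_p]
  norm_num
  have main : ∀ s₁ k, Keep 31 [] [7] s s₁ → k ≤ 6 → s₁.var 31 = 0 → s₁.var 32 = thr →
      s₁.var 33 = 0 → s₁.var 150 = 0 → wp W (appendThree 30) s₁ k fun k' s' =>
        s'.var 150 ≤ W ∧ wp W (forTo 35 (.var 34) ((Program.load 36 7 (.var 35)).seq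
          (appendThree 36))) (s'.setVar 34 (s'.var 150)) (k' + 1) fun k' s' =>
        s'.var 150 ≤ W ∧ wp W (markRow 33 30 1) (s'.setVar 37 (s'.var 150)) (k' + 1) fun k' s' =>
          wp W (forTo 35 (.var 37) checkFriend) s' k' fun k' s' => wp W (markRow 33 30 0) s' k' Q := by
    intro s₁ k hk hk6 e31 e32 e33 e150
    have h1 : At n t p q a₀ a₁ d s₁ := hs.keep hk
    have e30 : s₁.var 30 = v := by rw [hk.1 30 (by norm_num) (by simp), h30]
    have hM₁ : s₁.arr 4 = fun _ => 0 := by rw [hk.2 4 (by simp), hM]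
    refine wp_of_spec (spec_appendThree h h1 (y := 30) (by norm_num) e30 hM₁ (l := [])
      (by simp [Lst]) (by simpa using e150) (by simp)) ?_
    rintro k₂ s₂ hk₂ ⟨h2, f1, l₁, f2, f3, f4, f5, f6, f7⟩
    simp only [List.nil_append] at f6 f7
    refine ⟨by omega, ?_⟩
    have g1 : Keep 34 [] [7] s₁ (s₂.setVar 34 (s₂.var 150)) :=
      (Keep.refl.trans f1 (by norm_num) (by simp) (by simp)).setVar (by simp)
    refine wp_of_spec (spec_collectCandidates h (h1.keep g1) (v := v) (l₁ := l₁)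
      (by rw [g1.2 4 (by simp), hM₁]) (f6.congr (by simp)) (by simp [f7]) f4 (by simp [f7]) f3) ?_
    rintro k₃ s₃ hk₃ ⟨h3, m1, l, m2, m3, m4, m5, m6⟩
    refine ⟨by omega, ?_⟩
    have g2 : Keep 34 [] [7] s₁ (s₃.setVar 37 (s₃.var 150)) :=
      (g1.trans m1 (by norm_num) (by simp) (by simp)).setVar (by simp)
    refine wp_of_spec (spec_markRow h (h1.keep g2) (y := 30) (o := 33) (v := v) (off := 0) (k := 1)
      (by norm_num) (by rw [g2.1 30 (by norm_num) (by simp), e30]) (by norm_num)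
      (by rw [g2.1 33 (by norm_num) (by simp), e33]) (by positivity) le_rfl) ?_
    rintro k₄ s₄ hk₄ ⟨h4, i1, i2⟩
    rw [g2.2 4 (by simp), hM₁] at i2
    have g3 : Keep 34 [] [7, 4] s₁ s₄ := (Keep.refl.trans g2 le_rfl (by simp) (by simp)).trans i1
      (by norm_num) (by simp) (by simp)
    refine wp_of_spec (spec_checkCandidates h h4 (v := v) (l := l₁ ++ l) (thr := thr)
      i2 (m2.congr (by rw [i1.2 7 (by simp)]; rfl))
      (by rw [i1.1 37 (by norm_num) (by simp)]; simp [m3]) m4 m5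
      (by rw [g3.1 30 (by norm_num) (by simp), e30]) (by rw [g3.1 31 (by norm_num) (by simp), e31])
      (by rw [g3.1 32 (by norm_num) (by simp), e32])) ?_
    rintro k₅ s₅ hk₅ ⟨h5, j1, j2⟩
    have g4 : Keep 34 [31] [7, 4] s₁ s₅ := (Keep.refl.trans g3 le_rfl (by simp) (by simp)).trans j1
      (by norm_num) (by simp) (by simp)
    refine wp_of_spec (spec_markRow h h5 (y := 30) (o := 33) (v := v) (off := 0) (k := 0)
      (by norm_num) (by rw [g4.1 30 (by norm_num) (by simp), e30]) (by norm_num)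
      (by rw [g4.1 33 (by norm_num) (by simp), e33]) (by positivity) (by norm_num)) ?_
    rintro k₆ s₆ hk₆ ⟨h6, n1, n2⟩
    have g5 : Keep 31 [] [7, 4] s s₆ :=
      ((Keep.refl.trans hk le_rfl (by simp) (by simp)).trans g4 (by norm_num) (by simp)
        (by simp)).trans n1 (by norm_num) (by simp) (by simp)
    -- The marks are erased again, so array `4` counts as unchanged.
    have e4 : s₆.arr 4 = fun _ => 0 := by
      rw [n2, j1.2 4 (by simp), i2]
      funext j; by_cases hj : ∃ x ∈ nb G d v, j = 0 + (x : ℕ) <;> simp only [hj, if_true, if_false]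
    have e31' : s₆.var 31 = s₅.var 31 := n1.1 31 (by norm_num) (by simp)
    refine hQ _ _ (by omega) ⟨h6, ⟨g5.1, fun a ha => ?_⟩, ?_⟩
    · by_cases ha4 : a = 4
      · rw [ha4, e4, hM]
      · exact g5.2 a (by simp at ha ⊢; exact ⟨ha, ha4⟩)
    · rw [e31']
      refine j2.imp (fun ⟨r1, r2⟩ => ⟨r1, ?_⟩) fun ⟨x, r1, r2, r3, r4⟩ => ⟨x, r1, r2, r3, ?_⟩
      · exact friend_complete h.params h.bounded f5 f2 (fun x hx => ⟨f3 x hx,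
          List.mem_append_left _ hx, m6 x hx⟩) r2
      · rw [ncard_commonIn]; exact r4
  have hk0 : ∀ a b c d e, Keep 31 [] [7] s
      (((((s.setVar 31 a).setVar 32 b).setVar 32 c).setVar 33 d).setVar 150 e) := fun a b c d e =>
    (((((Keep.refl.setVar (by simp)).setVar (by simp)).setVar (by simp)).setVar (by simp)).setVar
      (by simp))
  have hk0' : ∀ a b d e, Keep 31 [] [7] s
      ((((s.setVar 31 a).setVar 32 b).setVar 33 d).setVar 150 e) := fun a b d e =>
    ((((Keep.refl.setVar (by simp)).setVar (by simp)).setVar (by simp)).setVar (by simp))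
  refine ⟨by omega, fun hp => ⟨by omega, main _ _ (hk0 _ _ _ _ _) (by norm_num) (by simp) ?_
    (by simp) (by simp)⟩, fun hp => main _ _ (hk0' _ _ _ _) (by norm_num) (by simp) ?_
    (by simp) (by simp)⟩
  · simp; rw [hthr', if_pos hp]
  · simp; rw [hthr', if_neg (by omega)]

end

/-! ## Loops over pairs -/

section
variable {s s' : Store} {B : ℕ} {Xs As : List ℕ}

@[simp] theorem Keep.setVar_iff {x v : ℕ} (hx : B ≤ x ∨ x ∈ Xs) :
    Keep B Xs As s (s'.setVar x v) ↔ Keep B Xs As s s' :=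
  ⟨fun h => ⟨fun y hy hy' => by
    rw [← h.1 y hy hy', Store.setVar_var, if_neg]
    rintro rfl
    exact hx.elim (by omega) hy', h.2⟩, fun h => h.setVar hx⟩

@[simp] theorem Keep.setArr_iff {a i v : ℕ} (ha : a ∈ As) :
    Keep B Xs As s (s'.setArr a i v) ↔ Keep B Xs As s s' :=
  ⟨fun h => ⟨h.1, fun b hb => by
    rw [← h.2 b hb, Store.setArr_arr, if_neg]
    rintro rfl
    exact hb ha⟩, fun h => h.setArr ha⟩

theorem Keep.mono {B' : ℕ} {Xs' As' : List ℕ} (h : Keep B Xs As s s') (hB : B' ≤ B)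
    (hX : ∀ x ∈ Xs, B' ≤ x ∨ x ∈ Xs') (hA : ∀ a ∈ As, a ∈ As') : Keep B' Xs' As' s s' :=
  Keep.refl.trans h hB hX hA

variable {n t p q : ℕ} {a₀ a₁ d : ℕ → ℕ}

@[simp] theorem At.setVar_iff {x k : ℕ} (hx : 4 ≤ x) :
    At n t p q a₀ a₁ d (s.setVar x k) ↔ At n t p q a₀ a₁ d s := by
  have h0 : 0 ≠ x := by omega
  have h1 : 1 ≠ x := by omega
  have h2 : 2 ≠ x := by omega
  have h3 : 3 ≠ x := by omega
  constructor <;> rintro ⟨g0, g1, g2, g3, g4, g5, g6⟩ <;> constructor <;> simp_all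

@[simp] theorem At.setArr_iff {a i k : ℕ} (ha : a ≠ 0 ∧ a ≠ 1 ∧ a ≠ 3) :
    At n t p q a₀ a₁ d (s.setArr a i k) ↔ At n t p q a₀ a₁ d s := by
  obtain ⟨h0, h1, h3⟩ := ha
  have h0' := h0.symm; have h1' := h1.symm; have h3' := h3.symm
  constructor <;> rintro ⟨g0, g1, g2, g3, g4, g5, g6⟩ <;> constructor <;> simp_all

@[simp] theorem Lst.setVar_iff {x k a : ℕ} {l : List (Fin n)} :
    Lst (s.setVar x k) a l ↔ Lst s a l := Iff.rfl

@[simp] theorem Lst.setArr_iff {b i k a : ℕ} {l : List (Fin n)} (h : a ≠ b) :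
    Lst (s.setArr b i k) a l ↔ Lst s a l := by simp [Lst, h]

end

/-- The program sets variable `202` to a positive number if and only if `P` holds of the variables
`200` and `201`. -/
def Tests (W L c : ℕ) (s₀ : Store) (As : List ℕ) (test : Program) (P : ℕ → ℕ → Prop) : Prop :=
  ∀ s, Keep 200 [] As s₀ s → s.var 200 < L → s.var 201 < L →
    Spec W test c s fun s' => Keep 210 [202] [] s s' ∧ (0 < s'.var 202 ↔ P (s.var 200) (s.var 201))

/-- Look for a pair of numbers below `N` that passes the test. -/
def scan (N : Operand) (test : Program) : Program :=
  .seq (.add 203 (.lit 0) (.lit 0)) (forTo 200 N (forTo 201 N (.seq test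
    (.ite (.lit 0) (.var 202) (.seq (.add 203 (.lit 1) (.lit 0)) (.seq (.add 204 (.var 200) (.lit 0))
      (.add 205 (.var 201) (.lit 0)))) .skip))))

/-- For every number `i` below `N`, compute the number of `j` below `N` that pass the test, and the
least entry of the array `src` at these `j` (or `cap`). -/
def foldMin (N cap : Operand) (test : Program) (src dst cnt : ℕ) : Program :=
  forTo 200 N (.seq (.add 206 cap (.lit 0)) (.seq (.add 207 (.lit 0) (.lit 0))
    (.seq (forTo 201 N (.seq test (.ite (.lit 0) (.var 202)
      (.seq (.add 207 (.var 207) (.lit 1)) (.seq (.load 208 src (.var 201))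
        (.ite (.var 208) (.var 206) (.add 206 (.var 208) (.lit 0)) .skip))) .skip)))
    (.seq (.store dst (.var 200) (.var 206)) (.store cnt (.var 200) (.var 207))))))

theorem Keep.lit {k B : ℕ} {Xs As : List ℕ} {s s' : Store} {y : ℕ} (h : Keep B Xs As s s')
    (hs : s.var y = k) (hy : y < B := by norm_num) (hX : y ∉ Xs := by simp) : s'.var y = k := by
  rw [h.1 y hy hX, hs]

section
variable {W L c : ℕ} {s : Store} {test : Program} {P : ℕ → ℕ → Prop}

/-- The cost is stated with any `m ≥ L`, in order that all loops over pairs can be charged to the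
same quantity `(3 t)²`. -/
theorem spec_scan {y m : ℕ} (hy : y < 200) (hs : s.var y = L) (hL : L ≤ W) (hW : 1 ≤ W)
    (ht : Tests W L c s [] test P) (hm : L ≤ m) (h1 : 1 ≤ m) :
    Spec W (scan (.var y) test) ((c + 20) * (m * m)) s fun s' => Keep 200 [] [] s s' ∧
      ((s'.var 203 = 0 ∧ ∀ i < L, ∀ j < L, ¬ P i j) ∨
        (s'.var 203 = 1 ∧ s'.var 204 < L ∧ s'.var 205 < L ∧ P (s'.var 204) (s'.var 205))) := by
  refine Spec.intro fun Q hQ => ?_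
  simp only [scan, wp_seq, wp_add, Operand.val]
  refine ⟨by omega, wp_of_spec (spec_forTo (N := .var y) (m := L) (T := L * (c + 6) + 2)
    (Inv := fun i s' => Keep 200 [] [] s s' ∧ s'.var 200 = i ∧
      ((s'.var 203 = 0 ∧ ∀ i' < i, ∀ j < L, ¬ P i' j) ∨
        (s'.var 203 = 1 ∧ s'.var 204 < L ∧ s'.var 205 < L ∧ P (s'.var 204) (s'.var 205)))) hL
      (fun j s' h => ⟨h.2.1, h.1.lit hs hy⟩) ?_ ⟨by simp, by simp, .inl (by simp)⟩) ?_⟩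
  · rintro i hi s₁ ⟨k1, e1, r1⟩
    refine (spec_forTo (N := .var y) (m := L) (T := c + 4)
      (Inv := fun j s' => Keep 200 [] [] s s' ∧ s'.var 200 = i ∧ s'.var 201 = j ∧
      ((s'.var 203 = 0 ∧ (∀ i' < i, ∀ j < L, ¬ P i' j) ∧ ∀ j' < j, ¬ P i j') ∨
        (s'.var 203 = 1 ∧ s'.var 204 < L ∧ s'.var 205 < L ∧ P (s'.var 204) (s'.var 205)))) hL
      (fun j s' h => ⟨h.2.2.1, h.1.lit hs hy⟩) ?_ ⟨by simpa using k1, by simpa using e1, by simp,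
        by simpa using r1⟩).mono (by ring_nf; omega) ?_
    · rintro j hj s₂ ⟨k2, e2, e3, r2⟩
      refine Spec.intro fun Q hQ => ?_
      simp only [wp_seq, wp_ite, wp_add, wp_skip, Operand.val]
      refine wp_of_spec (ht s₂ k2 (by omega) (by omega)) ?_
      rintro l s₃ hl ⟨k3, r3⟩
      rw [e2, e3] at r3
      have f200 := k3.lit e2
      have f201 := k3.lit e3
      have f203 : s₃.var 203 = s₂.var 203 := k3.lit rfl
      have f204 : s₃.var 204 = s₂.var 204 := k3.lit rfl
      have f205 : s₃.var 205 = s₂.var 205 := k3.lit rfl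
      have k4 : Keep 200 [] [] s s₃ := k2.trans k3 (by norm_num) (by simp) (by simp)
      refine ⟨fun hT => ?_, fun hT => hQ _ _ (by omega) ⟨f201, by simpa using k4, by simpa using f200,
        by simp, ?_⟩⟩
      · simp [f200, f201]
        refine ⟨by omega, by omega, by omega, hQ _ _ (by omega) ⟨by simpa using f201,
          by simpa using k4, by simpa using f200, by simp, .inr ⟨by simp, by simpa using hi,
          by simpa using hj, by simpa using r3.1 hT⟩⟩⟩
      · rw [r3] at hT
        simp [f203, f204, f205]
        refine r2.imp_left fun ⟨g1, g2, g3⟩ => ⟨g1, g2, fun j' hj' => ?_⟩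
        rcases (by omega : j' < j ∨ j' = j) with h | rfl
        · exact g3 j' h
        · exact hT
    · rintro s' ⟨k2, e2, e3, r2⟩
      refine ⟨e2, by simpa using k2, by simp, ?_⟩
      simp
      refine r2.imp_left fun ⟨g1, g2, g3⟩ => ⟨g1, fun i' hi' => ?_⟩
      rcases (by omega : i' < i ∨ i' = i) with h | rfl
      · exact g2 i' h
      · exact g3
  · rintro l s' hl ⟨k1, -, r1⟩
    refine hQ _ _ ?_ ⟨k1, r1⟩
    have h0 := Nat.mul_le_mul_right (c + 6) hm
    have h2 : L * (L * (c + 6) + 2 + 2) ≤ m * (m * (c + 6) + 4) :=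
      Nat.mul_le_mul hm (by omega)
    have h3 : m ≤ m * m := Nat.le_mul_self m
    have h4 : m * (m * (c + 6) + 4) = (c + 6) * (m * m) + 4 * m := by ring
    have h5 : (c + 20) * (m * m) = (c + 6) * (m * m) + 14 * (m * m) := by ring
    omega

/-- The least non-neighbours, the minima over non-neighbours, the ranks in the sorted order (as
counts) and the common values are all instances of this loop. The count is expressed by a set `F`
because `P` need not be decidable. -/
theorem spec_foldMin {y z m K src dst cnt : ℕ} (hy : y < 200) (hz : z < 200) (hs : s.var y = L)
    (hsz : s.var z = K) (hK : K ≤ W)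
    (hL : L < W) (hd : dst ≠ src) (hc : cnt ≠ src) (hdc : dst ≠ cnt)
    (hsrc : ∀ j < L, s.arr src j ≤ W)
    (ht : Tests W L c s [dst, cnt] test P) (hm : L ≤ m) (h1 : 1 ≤ m) :
    Spec W (foldMin (.var y) (.var z) test src dst cnt) ((c + 30) * (m * m)) s fun s' =>
      Keep 200 [] [dst, cnt] s s' ∧ ∀ i < L,
        (∃ F : Finset ℕ, (∀ j, j ∈ F ↔ j < L ∧ P i j) ∧ s'.arr cnt i = F.card) ∧
        (∀ j < L, P i j → s'.arr dst i ≤ s.arr src j) ∧ s'.arr dst i ≤ K ∧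
        (s'.arr dst i = K ∨ ∃ j < L, P i j ∧ s'.arr dst i = s.arr src j) := by
  refine Spec.intro fun Q hQ => ?_
  simp only [foldMin]
  refine wp_of_spec (spec_forTo (N := .var y) (m := L) (T := L * (c + 8) + 6)
    (Inv := fun i s' => Keep 200 [] [dst, cnt] s s' ∧ s'.var 200 = i ∧ ∀ i' < i,
        (∃ F : Finset ℕ, (∀ j, j ∈ F ↔ j < L ∧ P i' j) ∧ s'.arr cnt i' = F.card) ∧
        (∀ j < L, P i' j → s'.arr dst i' ≤ s.arr src j) ∧ s'.arr dst i' ≤ K ∧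
        (s'.arr dst i' = K ∨ ∃ j < L, P i' j ∧ s'.arr dst i' = s.arr src j)) (by omega)
      (fun j s' h => ⟨h.2.1, h.1.lit hs hy⟩) ?_ ⟨by simp, by simp, by simp⟩) ?_
  · rintro i hi s₁ ⟨k1, e1, r1⟩
    refine Spec.intro fun Q hQ => ?_
    have ez : s₁.var z = K := k1.lit hsz hz
    simp only [wp_seq, wp_add, Operand.val, ez]
    refine ⟨by omega, by omega, ?_⟩
    refine wp_of_spec (spec_forTo (N := .var y) (m := L) (T := c + 6)
      (Inv := fun j s' => Keep 200 [] [dst, cnt] s s' ∧ s'.arr = s₁.arr ∧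
        s'.var 200 = i ∧ s'.var 201 = j ∧
        (∃ F : Finset ℕ, (∀ j', j' ∈ F ↔ j' < j ∧ P i j') ∧ s'.var 207 = F.card) ∧
        (∀ j' < j, P i j' → s'.var 206 ≤ s.arr src j') ∧ s'.var 206 ≤ K ∧
        (s'.var 206 = K ∨ ∃ j' < j, P i j' ∧ s'.var 206 = s.arr src j')) (by omega)
      (fun j s' h => ⟨h.2.2.2.1, h.1.lit hs hy⟩) ?_ ⟨by simpa using k1, by simp, by simpa using e1,
        by simp, ⟨∅, by simp, by simp⟩, by simp, by simp, by simp⟩) ?_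
    · rintro j hj s₂ ⟨k2, a2, e2, e3, ⟨F, r2, r3⟩, r4, r5, r6⟩
      refine Spec.intro fun Q hQ => ?_
      simp only [wp_seq, wp_ite, wp_add, wp_load, wp_skip, Operand.val]
      refine wp_of_spec (ht s₂ k2 (by omega) (by omega)) ?_
      rintro l s₃ hl ⟨k3, hT⟩
      rw [e2, e3] at hT
      have f200 := k3.lit e2
      have f201 := k3.lit e3
      have f206 : s₃.var 206 = s₂.var 206 := k3.lit rfl
      have f207 : s₃.var 207 = F.card := k3.lit r3
      have fa : s₃.arr = s₁.arr := by rw [← a2]; exact funext fun a => k3.2 a (by simp)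
      have fsrc : s₁.arr src = s.arr src := k1.2 src (by simp [hd.symm, hc.symm])
      have k4 : Keep 200 [] [dst, cnt] s s₃ := k2.trans k3 (by norm_num) (by simp) (by simp)
      have hFc : F.card ≤ j := by
        rw [← Finset.card_range j]; exact Finset.card_le_card fun x hx => by simpa using ((r2 x).1 hx).1
      have hsj := hsrc j hj
      refine ⟨fun h => ?_, fun h => hQ _ _ (by omega) ⟨f201, by simpa using k4, by simpa using fa,
        by simpa using f200, by simp, ⟨F, fun j' => ?_, by simpa using f207⟩, ?_, ?_, ?_⟩⟩
      · have hP := hT.1 h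
        simp only [Store.setVar_var, f201, f207, fa, fsrc, f206, Store.setVar_arr]
        norm_num
        have hF : ∃ F' : Finset ℕ, (∀ j', j' ∈ F' ↔ j' < j + 1 ∧ P i j') ∧ F.card + 1 = F'.card := by
          refine ⟨insert j F, fun j' => ?_, ?_⟩
          · rw [Finset.mem_insert, r2]
            constructor
            · rintro (rfl | h); exacts [⟨by omega, hP⟩, ⟨by omega, h.2⟩]
            · rintro ⟨h1, h2⟩
              by_cases h3 : j' = j
              · exact .inl h3
              · exact .inr ⟨by omega, h2⟩
          · rw [Finset.card_insert_of_notMem (by simp [r2])]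
        refine ⟨by omega, by omega, hsj, fun hlt => ⟨hsj, hQ _ _ (by omega) ⟨by simpa using f201,
          by simpa using k4, by simpa using fa, by simpa using f200, by simp, by simpa using hF,
          ?_, ?_, ?_⟩⟩,
          fun hge => hQ _ _ (by omega) ⟨by simpa using f201,
          by simpa using k4, by simpa using fa, by simpa using f200, by simp, by simpa using hF,
          ?_, ?_, ?_⟩⟩
        · simp
          intro j' hj' hP'
          rcases (by omega : j' < j ∨ j' = j) with h | rfl
          · have := r4 j' h hP'; omega
          · exact le_rfl
        · simp; omega
        · simp; exact .inr ⟨j, by omega, hP, rfl⟩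
        · simp [f206]
          intro j' hj' hP'
          rcases (by omega : j' < j ∨ j' = j) with h | rfl
          · exact r4 j' h hP'
          · omega
        · simp [f206]; omega
        · simp [f206]
          refine r6.imp_right fun ⟨j', g1, g2, g3⟩ => ⟨j', by omega, g2, g3⟩
      · rw [r2]
        constructor
        · rintro ⟨h1, h2⟩; exact ⟨by omega, h2⟩
        · rintro ⟨h1, h2⟩
          refine ⟨?_, h2⟩
          by_contra h3
          obtain rfl : j' = j := by omega
          exact h (hT.2 h2)
      · simp [f206]
        intro j' hj' hP'
        rcases (by omega : j' < j ∨ j' = j) with h' | rfl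
        · exact r4 j' h' hP'
        · exact absurd (hT.2 hP') h
      · simp [f206]; omega
      · simp [f206]
        refine r6.imp_right fun ⟨j', g1, g2, g3⟩ => ⟨j', by omega, g2, g3⟩
    · rintro l s₂ hl ⟨k2, a2, e2, e3, ⟨F, r2, r3⟩, r4, r5, r6⟩
      have hFc : F.card ≤ L := by
        rw [← Finset.card_range L]; exact Finset.card_le_card fun x hx => by simpa using ((r2 x).1 hx).1
      simp only [wp_store, Operand.val, e2, Store.setArr_var, r3]
      refine ⟨by omega, by omega, by omega, by omega, hQ _ _ (by ring_nf at hl ⊢; omega)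
        ⟨by simpa using e2, by simpa using k2, by simp, ?_⟩⟩
      intro i' hi'
      simp only [Store.setVar_arr, Store.setArr_arr, if_neg hdc, if_neg hdc.symm, if_true,
        Function.update_apply, a2]
      rcases (by omega : i' < i ∨ i' = i) with h | rfl
      · rw [if_neg (by omega), if_neg (by omega)]; exact r1 i' h
      · simp only [if_true]
        exact ⟨⟨F, r2, rfl⟩, r4, r5, r6⟩
  · rintro l s' hl ⟨k1, -, r1⟩
    refine hQ _ _ ?_ ⟨k1, r1⟩
    have h0 := Nat.mul_le_mul_right (c + 8) hm
    have h2 : L * (L * (c + 8) + 6 + 2) ≤ m * (m * (c + 8) + 8) :=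
      Nat.mul_le_mul hm (by omega)
    have h3 : m ≤ m * m := Nat.le_mul_self m
    have h4 : m * (m * (c + 8) + 8) = (c + 8) * (m * m) + 8 * m := by ring
    have h5 : (c + 30) * (m * m) = (c + 8) * (m * m) + 22 * (m * m) := by ring
    omega

end

/-! ## The adjacency matrix of a list of vertices -/

/-- Array `4` holds the adjacency matrix of the vertices on the list, array `6` the places where its
rows begin. -/
structure Mat {n : ℕ} (G : SimpleGraph (Fin n)) [DecidableRel G.Adj] (t : ℕ) (s : Store)
    (l : List (Fin n)) : Prop where
  nodup : l.Nodup
  row_le : ∀ x ∈ l, s.arr 6 x ≤ 400 * (n + t + 2) ^ 2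
  cell : ∀ x ∈ l, ∀ y ∈ l, s.arr 4 (s.arr 6 x + y) = if G.Adj x y then 1 else 0

/-- Set the variable `out` to `1` if the entries of array `a` at the positions `x` and `y` are
adjacent, and to `0` otherwise. -/
def adjTest (a x y out : ℕ) : Program :=
  .seq (.load 211 a (.var x)) (.seq (.load 212 a (.var y)) (.seq (.load 213 6 (.var 211))
    (.seq (.add 213 (.var 213) (.var 212)) (.load out 4 (.var 213)))))

/-- The test for non-adjacency. -/
def nonadjTest (a : ℕ) : Program :=
  .seq (adjTest a 200 201 214) (.sub 202 (.lit 1) (.var 214))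

/-- The test for a smaller key in array `12`. -/
def keyTest : Program :=
  .seq (.load 211 12 (.var 201)) (.seq (.load 212 12 (.var 200)) (.seq (.sub 202 (.var 212) (.var 211))
    (.seq (.sub 213 (.var 211) (.var 212)) (.ite (.lit 0) (.var 202) .skip
      (.ite (.lit 0) (.var 213) .skip (.sub 202 (.var 200) (.var 201)))))))

/-- The test for non-adjacent vertices whose positions (array `13`) are in different classes (array
`16`). -/
def classTest (a : ℕ) : Program :=
  .seq (adjTest a 200 201 214) (.seq (.load 215 13 (.var 200)) (.seq (.load 216 13 (.var 201))
    (.seq (.load 215 16 (.var 215)) (.seq (.load 216 16 (.var 216))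
      (.seq (.sub 202 (.var 215) (.var 216)) (.seq (.sub 217 (.var 216) (.var 215))
        (.seq (.add 202 (.var 202) (.var 217))
          (.ite (.lit 0) (.var 214) (.add 202 (.lit 0) (.lit 0)) .skip))))))))

/-- Compute the sorting keys in array `12`. -/
def sortKeys (y : ℕ) : Program :=
  forTo 200 (.var y) (.seq (.load 201 11 (.var 200)) (.seq (.load 202 10 (.var 200))
    (.seq (.ite (.var 202) (.lit 2) (.add 201 (.var y) (.lit 0)) .skip)
      (.store 12 (.var 200) (.var 201)))))

/-- Write the sorted list to array `14`. -/
def writeSorted (a y : ℕ) : Program :=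
  forTo 200 (.var y) (.seq (.load 201 13 (.var 200)) (.seq (.load 202 a (.var 200))
    (.store 14 (.var 201) (.var 202))))

/-- Decide whether the list in array `a` is the vertex set of a `K^p_q`, and write its classes to
array `14`. -/
def tryList (a y : ℕ) : Program :=
  .seq (foldMin (.var y) (.var y) (nonadjTest a) 8 9 10)
  (.seq (foldMin (.var y) (.var y) (nonadjTest a) 9 11 22)
  (.seq (sortKeys y) (.seq (foldMin (.var y) (.var y) keyTest 8 22 13)
  (.seq (scan (.var y) (classTest a)) (.ite (.var 203) (.lit 1)
    (.seq (.add 50 (.lit 1) (.lit 0)) (writeSorted a y)) .skip)))))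

/-! ### Recognizing the vertex set of a `K^p_q` -/

section
variable {n t p q W : ℕ} {G : SimpleGraph (Fin n)} [DecidableRel G.Adj] {a₀ a₁ d : ℕ → ℕ}

theorem Mat.keep {s s' : Store} {l l' : List (Fin n)} (h : Mat G t s l) {B : ℕ} {Xs As : List ℕ}
    (hk : Keep B Xs As s s') (hl : ∀ x ∈ l', x ∈ l) (hn : l'.Nodup) (h4 : 4 ∉ As := by simp)
    (h6 : 6 ∉ As := by simp) : Mat G t s' l' := by
  refine ⟨hn, fun x hx => ?_, fun x hx y hy => ?_⟩
  · rw [hk.2 6 h6]; exact h.row_le x (hl x hx)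
  · rw [hk.2 6 h6, hk.2 4 h4]; exact h.cell x (hl x hx) y (hl y hy)

theorem Lst.nth {s : Store} {a : ℕ} {l : List (Fin n)} (h : Lst s a l) {w : ℕ → Fin n}
    (hw : ∀ i (h : i < l.length), l[i] = w i) {i : ℕ} (hi : i < l.length) : s.arr a i = w i := by
  rw [h i hi, hw i hi]

theorem nth_mem {l : List (Fin n)} {w : ℕ → Fin n}
    (hw : ∀ i (h : i < l.length), l[i] = w i) {i : ℕ} (hi : i < l.length) : w i ∈ l := by
  rw [← hw i hi]; exact List.getElem_mem hi

theorem spec_adjTest (hW : 1000 * (n + t + 2) ^ 2 ≤ W) {s : Store} {a : ℕ} {l : List (Fin n)}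
    (hM : Mat G t s l) (hl : Lst s a l) {w : ℕ → Fin n}
    (hw : ∀ i (h : i < l.length), l[i] = w i) {x y i j out : ℕ} (hx : s.var x = i)
    (hy : s.var y = j) (hi : i < l.length) (hj : j < l.length) (hll : l.length ≤ W)
    (hyn : y ≠ 211) :
    Spec W (adjTest a x y out) 5 s fun s' => Keep 220 [211, 212, 213, out] [] s s' ∧
      s'.var out = if G.Adj (w i) (w j) then 1 else 0 := by
  have h1 := hM.row_le _ (nth_mem hw hi)
  have h2 := hM.cell _ (nth_mem hw hi) _ (nth_mem hw hj)
  have h3 := (w i).2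
  have h4 := (w j).2
  have h5 := pow_bounds n t
  refine Spec.intro fun Q hQ => ?_
  simp only [adjTest, wp_seq, wp_load, wp_add, Operand.val, hx, hl.nth hw hi, hl.nth hw hj,
    Store.setVar_var, Store.setVar_arr, if_neg hyn, hy]
  norm_num
  simp only [h2]
  refine ⟨by omega, by omega, by omega, by omega, by omega, by omega, by omega,
    by split_ifs <;> omega, hQ _ _ (by omega) ⟨by simp, by simp⟩⟩

theorem tests_nonadj (hW : 1000 * (n + t + 2) ^ 2 ≤ W) {s : Store} {a : ℕ} {l : List (Fin n)}
    (hM : Mat G t s l) (hl : Lst s a l) {w : ℕ → Fin n}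
    (hw : ∀ i (h : i < l.length), l[i] = w i) (hll : l.length ≤ W) {As : List ℕ}
    (h4 : 4 ∉ As) (h6 : 6 ∉ As) (ha : a ∉ As) :
    Tests W l.length 6 s As (nonadjTest a) fun i j => ¬ G.Adj (w i) (w j) := by
  intro s₁ hk hi hj
  refine Spec.intro fun Q hQ => ?_
  simp only [nonadjTest, wp_seq]
  refine wp_of_spec (spec_adjTest hW (hM.keep hk (fun x h => h) hM.nodup h4 h6)
    (hl.congr (hk.2 a ha)) hw rfl rfl hi hj hll (by norm_num)) ?_
  rintro k s₂ hk₂ ⟨g1, g2⟩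
  simp only [wp_sub, Operand.val, g2]
  refine ⟨by omega, hQ _ _ (by omega) ⟨?_, ?_⟩⟩
  · simpa using (Keep.refl.trans g1 (by norm_num) (by simp) (by simp) : Keep 210 [202] [] s₁ s₂)
  · simp

theorem tests_key {L : ℕ} {s : Store} {key : ℕ → ℕ} (hs : ∀ i < L, s.arr 12 i = key i)
    (hkey : ∀ i < L, key i ≤ W) (hL : L ≤ W) {As : List ℕ} (h12 : 12 ∉ As) :
    Tests W L 7 s As keyTest fun i j => key j < key i ∨ key j = key i ∧ j < i := by
  intro s₁ hk hi hj
  have h1 : s₁.arr 12 = s.arr 12 := hk.2 12 h12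
  have k1 := hkey _ hi
  have k2 := hkey _ hj
  refine Spec.intro fun Q hQ => ?_
  simp only [keyTest, wp_seq, wp_load, wp_sub, wp_ite, wp_skip, Operand.val, Store.setVar_var,
    Store.setVar_arr, h1, hs _ hj]
  norm_num
  simp only [hs _ hi]
  refine ⟨by omega, by omega, by omega, by omega, by omega, by omega, fun h2 => ?_, fun h2 =>
    ⟨fun h3 => ?_, fun h3 => ⟨by omega, ?_⟩⟩⟩
  · exact hQ _ _ (by omega) ⟨by simp, by simp; omega⟩
  · exact hQ _ _ (by omega) ⟨by simp, by simp; omega⟩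
  · exact hQ _ _ (by omega) ⟨by simp, by simp; omega⟩

theorem tests_class (hW : 1000 * (n + t + 2) ^ 2 ≤ W) {s : Store} {a : ℕ} {l : List (Fin n)}
    (hM : Mat G t s l) (hl : Lst s a l) {w : ℕ → Fin n}
    (hw : ∀ i (h : i < l.length), l[i] = w i) (hll : l.length ≤ W) {ps : ℕ → ℕ}
    (hps : ∀ i < l.length, s.arr 13 i = ps i) (hpsl : ∀ i < l.length, ps i < l.length)
    (hc : ∀ i < l.length, s.arr 16 i = i / q) :
    Tests W l.length 14 s [] (classTest a) fun i j =>
      ps i / q ≠ ps j / q ∧ ¬ G.Adj (w i) (w j) := by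
  intro s₁ hk hi hj
  have e13 : s₁.arr 13 = s.arr 13 := hk.2 13 (by simp)
  have e16 : s₁.arr 16 = s.arr 16 := hk.2 16 (by simp)
  have p1 := hpsl _ hi
  have p2 := hpsl _ hj
  have p3 : ∀ i, ps i < l.length → ∃ m, m ≤ W ∧ ps i / q = m := fun i hi =>
    ⟨_, (Nat.div_le_self _ _).trans (by omega), rfl⟩
  obtain ⟨m₂, p4, h4⟩ := p3 _ p2
  obtain ⟨m₁, p3, h3⟩ := p3 _ p1
  refine Spec.intro fun Q hQ => ?_
  simp only [classTest, wp_seq]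
  refine wp_of_spec (spec_adjTest hW (hM.keep hk (fun x h => h) hM.nodup)
    (hl.congr (hk.2 a (by simp))) hw rfl rfl hi hj hll (by norm_num)) ?_
  rintro k s₂ hk₂ ⟨g1, g2⟩
  have f200 : s₂.var 200 = s₁.var 200 := g1.lit rfl
  have f201 : s₂.var 201 = s₁.var 201 := g1.lit rfl
  have f13 : s₂.arr 13 = s.arr 13 := by rw [g1.2 13 (by simp), e13]
  have f16 : s₂.arr 16 = s.arr 16 := by rw [g1.2 16 (by simp), e16]
  have hk3 : Keep 210 [202] [] s₁ s₂ := Keep.refl.trans g1 (by norm_num) (by simp) (by simp)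
  simp only [wp_load, wp_add, wp_sub, wp_ite, wp_skip, Operand.val, Store.setVar_var,
    Store.setVar_arr, f200, f201, f13, f16, g2]
  norm_num
  simp only [hps _ hi, hps _ hj, hc _ p1, hc _ p2, h3, h4]
  refine ⟨by omega, by omega, by omega, by omega, by omega, by omega, by omega, by omega, by omega,
    by omega, by omega, fun h => ?_, fun h => ?_⟩
  · exact hQ _ _ (by omega) ⟨by simpa using hk3, by simp [h3, h4]; intro _; by_contra hn; simp [hn] at h⟩
  · refine hQ _ _ (by omega) ⟨by simpa using hk3, ?_⟩
    have : ¬ G.Adj (w (s₁.var 200)) (w (s₁.var 201)) := by simpa using h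
    simp [h3, h4, this]; omega

theorem spec_sortKeys {s : Store} {y L : ℕ} (hy : y < 200) (hs : s.var y = L) (hL : L ≤ W)
    (h11 : ∀ i < L, s.arr 11 i ≤ W) (h10 : ∀ i < L, s.arr 10 i ≤ W) :
    Spec W (sortKeys y) (8 * L + 2) s fun s' => Keep 200 [] [12] s s' ∧
      ∀ i < L, s'.arr 12 i = if s.arr 10 i < 2 then L else s.arr 11 i := by
  refine (spec_forTo (N := .var y) (m := L) (T := 6) (Inv := fun i s' => Keep 200 [] [12] s s' ∧
      s'.var 200 = i ∧ ∀ i' < i, s'.arr 12 i' = if s.arr 10 i' < 2 then L else s.arr 11 i')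
      hL (fun j s' h => ⟨h.2.1, h.1.lit hs hy⟩) ?_ ⟨by simp, by simp, by simp⟩).mono (by omega)
      fun s' h => ⟨h.1, h.2.2⟩
  rintro i hi s₁ ⟨k1, e1, r1⟩
  have f1 := k1.2 11 (by simp)
  have f2 := k1.2 10 (by simp)
  have f3 := h11 i hi
  have f4 := h10 i hi
  have hyv : s₁.var y = L := k1.lit hs hy
  have hy1 : y ≠ 201 := by omega
  have hy2 : y ≠ 202 := by omega
  refine Spec.intro fun Q hQ => ?_
  simp only [wp_seq, wp_load, wp_add, wp_ite, wp_skip, wp_store, Operand.val, Store.setVar_var,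
    Store.setVar_arr, e1, f1, f2, if_neg hy1, if_neg hy2, hyv]
  norm_num
  refine ⟨by omega, f3, by omega, f4, fun h => ⟨by omega, by omega, by omega, hQ _ _ (by omega)
    ⟨by simpa using e1, by simpa using k1, by simp, ?_⟩⟩, fun h => ⟨by omega, by omega, hQ _ _ (by omega)
    ⟨by simpa using e1, by simpa using k1, by simp, ?_⟩⟩⟩
  · intro i' hi'
    by_cases h3 : i' = i
    · subst h3; simp [h]
    · simp [h3]; exact (r1 i' (by omega)).trans (by simp only [Nat.lt_succ_iff])
  · intro i' hi'
    by_cases h3 : i' = i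
    · subst h3; simp; intro; omega
    · simp [h3]; exact (r1 i' (by omega)).trans (by simp only [Nat.lt_succ_iff])

theorem spec_writeSorted {s : Store} {a y : ℕ} {l : List (Fin n)} (hl : Lst s a l)
    {w : ℕ → Fin n} (hw : ∀ i (h : i < l.length), l[i] = w i) (hy : y < 200)
    (hs : s.var y = l.length) (hL : l.length ≤ W) (hn : n ≤ W) (ha : a ≠ 14) {ps : ℕ → ℕ}
    (hps : ∀ i < l.length, s.arr 13 i = ps i) (hpsl : ∀ i < l.length, ps i < l.length)
    (hinj : ∀ i < l.length, ∀ j < l.length, ps i = ps j → i = j) :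
    Spec W (writeSorted a y) (5 * l.length + 2) s fun s' => Keep 200 [] [14] s s' ∧
      ∀ i < l.length, s'.arr 14 (ps i) = w i := by
  refine (spec_forTo (N := .var y) (m := l.length) (T := 3) (Inv := fun i s' =>
      Keep 200 [] [14] s s' ∧ s'.var 200 = i ∧ ∀ i' < i, s'.arr 14 (ps i') = w i')
      hL (fun j s' h => ⟨h.2.1, h.1.lit hs hy⟩) ?_ ⟨by simp, by simp, by simp⟩).mono (by omega)
      fun s' h => ⟨h.1, h.2.2⟩
  rintro i hi s₁ ⟨k1, e1, r1⟩
  have f1 := k1.2 13 (by simp)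
  have f2 := k1.2 a (by simp [ha])
  have f3 := hpsl i hi
  have f4 := (w i).2
  refine Spec.intro fun Q hQ => ?_
  simp only [wp_seq, wp_load, wp_store, Operand.val, Store.setVar_var,
    Store.setVar_arr, e1, f1, f2, hps i hi]
  norm_num
  simp only [hl.nth hw hi]
  refine ⟨by omega, by omega, by omega, by omega, by omega, by omega, hQ _ _ (by omega)
    ⟨by simpa using e1, by simpa using k1, by simp, fun i' hi' => ?_⟩⟩
  by_cases h3 : i' = i
  · subst h3; simp
  · have : ps i' ≠ ps i := fun h => h3 (hinj i' (by omega) i hi h)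
    simp [this]; exact r1 i' (by omega)

/-- The array `14` holds the classes of a `K^p_q`. -/
def Classes (p q : ℕ) (s : Store) (f : Fin p × Fin q → Fin n) : Prop :=
  ∀ b, s.arr 14 ((b.1 : ℕ) * q + b.2) = f b

/-- The tables of the identity (array `8`) and of the quotients by `q` (array `16`). -/
structure Tab (t p q : ℕ) (s : Store) : Prop where
  id : ∀ i < 3 * t, s.arr 8 i = i
  div : ∀ i < p * q, s.arr 16 i = i / q

theorem Tab.keep {s s' : Store} (h : Tab t p q s) {B : ℕ} {Xs As : List ℕ} (hk : Keep B Xs As s s')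
    (h8 : 8 ∉ As := by simp) (h16 : 16 ∉ As := by simp) : Tab t p q s' :=
  ⟨fun i hi => by rw [hk.2 8 h8, h.id i hi], fun i hi => by rw [hk.2 16 h16, h.div i hi]⟩

theorem div_of_lt {i j : ℕ} (hj : j < q) : (i * q + j) / q = i := by
  rw [mul_comm, Nat.mul_add_div (by omega), Nat.div_eq_of_lt hj, add_zero]

theorem index_lt (b : Fin p × Fin q) : (b.1 : ℕ) * q + b.2 < p * q := by
  have h1 := b.1.2
  have h2 := b.2.2
  calc (b.1 : ℕ) * q + b.2 < b.1 * q + q := by omega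
    _ = (b.1 + 1) * q := by ring
    _ ≤ p * q := Nat.mul_le_mul_right _ h1

theorem index_inj {b c : Fin p × Fin q} (h : (b.1 : ℕ) * q + b.2 = (c.1 : ℕ) * q + c.2) : b = c := by
  have h1 : (b.1 : ℕ) = c.1 := by rw [← div_of_lt (i := b.1) b.2.2, h, div_of_lt c.2.2]
  rw [h1] at h
  exact Prod.ext (Fin.ext h1) (Fin.ext (by omega))

/-- The ranks permute the indices. The position `(i, j)` receives the vertex of rank `i q + j`, so
the classes are the blocks of length `q`, and `hadj` says that vertices of different blocks are
adjacent. -/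
theorem exists_sorted {l : List (Fin n)} {w : ℕ → Fin n} (hn : l.Nodup)
    (hw : ∀ i (h : i < l.length), l[i] = w i) (hL : l.length = p * q) {ps : ℕ → ℕ}
    (hpsl : ∀ i < l.length, ps i < l.length)
    (hinj : ∀ i < l.length, ∀ j < l.length, ps i = ps j → i = j)
    (hadj : ∀ i < l.length, ∀ j < l.length, ¬ (ps i / q ≠ ps j / q ∧ ¬ G.Adj (w i) (w j))) :
    ∃ f : Fin p × Fin q → Fin n, KF G f ∧ (∀ x, x ∈ l ↔ ∃ a, f a = x) ∧
      ∀ b, ∃ i < l.length, ps i = (b.1 : ℕ) * q + b.2 ∧ w i = f b := by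
  have hsurj : ∀ r < l.length, ∃ i < l.length, ps i = r := by
    have : (Finset.range l.length).image ps = Finset.range l.length := by
      refine Finset.eq_of_subset_of_card_le (fun r hr => ?_) ?_
      · obtain ⟨i, hi, rfl⟩ := Finset.mem_image.1 hr
        simpa using hpsl i (by simpa using hi)
      · rw [Finset.card_image_of_injOn fun i hi j hj h =>
          hinj i (by simpa using hi) j (by simpa using hj) h]
    intro r hr
    have h : r ∈ (Finset.range l.length).image ps := by rw [this]; simpa using hr
    simpa using h
  have hsurj' : ∀ b : Fin p × Fin q, ∃ i, i < l.length ∧ ps i = (b.1 : ℕ) * q + b.2 := fun b => by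
    have := index_lt b
    obtain ⟨i, h1, h2⟩ := hsurj ((b.1 : ℕ) * q + b.2) (by omega)
    exact ⟨i, h1, h2⟩
  choose e he1 he2 using hsurj'
  have hwinj : ∀ i < l.length, ∀ j < l.length, w i = w j → i = j := fun i hi j hj h => by
    rw [← hw i hi, ← hw j hj] at h; exact (hn.getElem_inj_iff).1 h
  have hf : Function.Injective (w ∘ e) := fun b c h => by
    have h1 := hwinj _ (he1 b) _ (he1 c) h
    exact index_inj (by rw [← he2, ← he2, h1])
  refine ⟨w ∘ e, ⟨hf, fun b c hbc => ?_⟩, fun x => ?_, fun b => ⟨e b, he1 b, he2 b, rfl⟩⟩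
  · by_contra hn
    refine hadj _ (he1 b) _ (he1 c) ⟨?_, hn⟩
    rw [he2, he2, div_of_lt b.2.2, div_of_lt c.2.2]
    exact fun h => hbc (Fin.ext h)
  · have himg : Finset.univ.image (w ∘ e) = l.toFinset := by
      refine Finset.eq_of_subset_of_card_le (fun u hu => ?_) ?_
      · obtain ⟨b, -, rfl⟩ := Finset.mem_image.1 hu
        simpa using nth_mem hw (he1 b)
      · rw [Finset.card_image_of_injective _ hf, List.toFinset_card_of_nodup hn, hL]; simp
    rw [← List.mem_toFinset, ← himg]; simp

/-- A positive answer does not depend on the choice of the keys, since the final scan verifies the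
blocks of the sorted list. Only the negative answer needs `sort_classes`. -/
theorem spec_tryList (h : Ctx G t p q W a₀ a₁ d) {s : Store} {a y : ℕ} {l : List (Fin n)}
    (hM : Mat G t s l) (hT : Tab t p q s) (hl : Lst s a l) (hy : y < 200)
    (hs : s.var y = l.length) (hL : l.length = p * q) (hLt : l.length ≤ 3 * t) (ha : 30 ≤ a)
    (h50 : s.var 50 = 0) (hy50 : y ≠ 50) :
    Spec W (tryList a y) (300 * (3 * t * (3 * t))) s fun s' =>
      Keep 200 [50] [9, 10, 11, 12, 13, 14, 22] s s' ∧
      ((s'.var 50 = 0 ∧ ¬ ∃ f : Fin p × Fin q → Fin n, KF G f ∧ ∀ a, f a ∈ l) ∨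
        (s'.var 50 = 1 ∧ ∃ f : Fin p × Fin q → Fin n, KF G f ∧ (∀ x, x ∈ l ↔ ∃ a, f a = x) ∧
          Classes p q s' f)) := by
  have hW₁ := h.le_W₁
  have hW₂ := h.le_W₂
  have ht := h.params.1
  obtain ⟨w, hw⟩ : ∃ w : ℕ → Fin n, ∀ i (h : i < l.length), l[i] = w i := by
    have hpos : 0 < l.length := by have := KF.pq h.params; omega
    exact ⟨fun i => l.getD i l[0], fun i hi => (List.getD_eq_getElem _ _ hi).symm⟩
  have hwinj : ∀ i < l.length, ∀ j < l.length, w i = w j → i = j := fun i hi j hj h => by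
    rw [← hw i hi, ← hw j hj] at h; exact (hM.nodup.getElem_inj_iff).1 h
  have hll : l.length ≤ W := by omega
  set L := l.length with hLdef
  refine Spec.intro fun Q hQ => ?_
  simp only [tryList, wp_seq]
  -- the least non-neighbours
  refine wp_of_spec (spec_foldMin hy hy hs hs hll (by omega) (by simp) (by simp)
    (by simp) (fun j hj => by rw [hT.id j (by omega)]; omega)
    (tests_nonadj hW₂ hM hl hw hll (by simp) (by simp) (by simp; omega)) hLt (by omega)) ?_
  rintro k₁ s₁ hk₁ ⟨g1, r1⟩
  have hlam : ∀ i < L, IsLeast {j | j < L ∧ ¬ G.Adj (w i) (w j)} (s₁.arr 9 i) := by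
    intro i hi
    obtain ⟨-, h1, h2, h3⟩ := r1 i hi
    -- A vertex is its own non-neighbour, so the default value `L` is not the result.
    have h4 := h1 i hi (by simp)
    rw [hT.id i (by omega)] at h4
    rcases h3 with h3 | ⟨j, hj, hn, h3⟩
    · omega
    · rw [hT.id j (by omega)] at h3
      rw [h3]
      refine ⟨⟨hj, hn⟩, fun j' ⟨h5, h6⟩ => ?_⟩
      have := h1 j' h5 h6
      rw [hT.id j' (by omega)] at this
      omega
  have hc : ∀ i < L, s₁.arr 10 i = ((Finset.range L).filter fun j => ¬ G.Adj (w i) (w j)).card := by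
    intro i hi
    obtain ⟨⟨F, h1, h2⟩, -⟩ := r1 i hi
    rw [h2]; congr 1; ext j; simp [h1]
  -- the representatives of the classes
  have hM₁ : Mat G t s₁ l := hM.keep g1 (fun x h => h) hM.nodup
  have hl₁ : Lst s₁ a l := hl.congr (g1.2 a (by simp; omega))
  have e1 : s₁.var y = L := g1.lit hs hy
  refine wp_of_spec (spec_foldMin (src := 9) hy hy e1 e1 hll (by omega) (by simp) (by simp)
    (by simp) (fun j hj => by have := (hlam j hj).1.1; omega)
    (tests_nonadj hW₂ hM₁ hl₁ hw hll (by simp) (by simp) (by simp; omega)) hLt (by omega)) ?_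
  rintro k₂ s₂ hk₂ ⟨g2, r2⟩
  have hmu : ∀ i < L, IsLeast {k | ∃ j < L, ¬ G.Adj (w i) (w j) ∧ k = s₁.arr 9 j} (s₂.arr 11 i) := by
    intro i hi
    obtain ⟨-, h1, h2, h3⟩ := r2 i hi
    have h4 := h1 i hi (by simp)
    have h5 := (hlam i hi).1.1
    rcases h3 with h3 | ⟨j, hj, hn, h3⟩
    · omega
    · rw [h3]
      refine ⟨⟨j, hj, hn, rfl⟩, ?_⟩
      rintro k ⟨j', h5, h6, rfl⟩
      rw [← h3]; exact h1 j' h5 h6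
  have g12 : Keep 200 [] [9, 10, 11, 22] s s₂ := (g1.mono le_rfl (by simp) (by simp)).trans g2 le_rfl
    (by simp) (by simp)
  have hc₂ : ∀ i < L, s₂.arr 10 i = s₁.arr 10 i := fun i hi => by rw [g2.2 10 (by simp)]
  have hcL : ∀ i < L, s₁.arr 10 i ≤ W := fun i hi => by
    rw [hc i hi]; refine (Finset.card_filter_le _ _).trans ?_; simpa using hll
  have e2 : s₂.var y = L := g12.lit hs hy
  refine wp_of_spec (spec_sortKeys hy e2 hll (fun i hi => (r2 i hi).2.2.1.trans hll)
    (fun i hi => by rw [hc₂ i hi]; exact hcL i hi)) ?_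
  rintro k₃ s₃ hk₃ ⟨g3, r3⟩
  -- sorting
  have g13 : Keep 200 [] [9, 10, 11, 12, 22] s s₃ := (g12.mono le_rfl (by simp) (by simp)).trans g3
    le_rfl (by simp) (by simp)
  have hT₃ : Tab t p q s₃ := hT.keep g13
  have e3 : s₃.var y = L := g13.lit hs hy
  set key : ℕ → ℕ := fun i => if s₁.arr 10 i < 2 then L else s₂.arr 11 i with hkey
  have hkeyL : ∀ i < L, key i ≤ W := fun i hi => by
    have h1 := (r2 i hi).2.2.1
    simp only [hkey]; split_ifs <;> omega
  refine wp_of_spec (spec_foldMin (src := 8) hy hy e3 e3 hll (by omega) (by simp) (by simp)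
    (by simp) (fun j hj => by rw [hT₃.id j (by omega)]; omega)
    (tests_key (key := key) (fun i hi => by rw [r3 i hi, hc₂ i hi]) hkeyL hll (by simp)) hLt
    (by omega)) ?_
  rintro k₄ s₄ hk₄ ⟨g4, r4⟩
  have hps : ∀ i < L, s₄.arr 13 i = pos L key i := by
    intro i hi
    obtain ⟨⟨F, h1, h2⟩, -⟩ := r4 i hi
    rw [h2, pos]; congr 1; ext j; simp [h1]
  -- verification
  have g14 : Keep 200 [] [9, 10, 11, 12, 13, 22] s s₄ := (g13.mono le_rfl (by simp) (by simp)).trans g4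
    le_rfl (by simp) (by simp)
  have hT₄ : Tab t p q s₄ := hT.keep g14
  have e4 : s₄.var y = L := g14.lit hs hy
  have hM₄ : Mat G t s₄ l := hM.keep g14 (fun x h => h) hM.nodup
  have hl₄ : Lst s₄ a l := hl.congr (g14.2 a (by simp; omega))
  refine wp_of_spec (spec_scan hy e4 hll (by omega) (tests_class hW₂ hM₄ hl₄ hw hll hps
    (fun i hi => pos_lt hi) (fun i hi => hT₄.div i (by omega))) hLt (by omega)) ?_
  rintro k₅ s₅ hk₅ ⟨g5, r5⟩
  have g15 : Keep 200 [] [9, 10, 11, 12, 13, 22] s s₅ := g14.trans g5 le_rfl (by simp) (by simp)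
  have e5 : s₅.var y = L := g15.lit hs hy
  have e50 : s₅.var 50 = 0 := g15.lit h50
  have hmm : 3 * t ≤ 3 * t * (3 * t) := Nat.le_mul_self _
  simp only [wp_ite, wp_seq, wp_add, wp_skip, Operand.val]
  rcases r5 with ⟨r5, r6⟩ | ⟨r5, r6, r7, r8, r9⟩
  · rw [r5]
    refine ⟨fun _ => ⟨by omega, ?_⟩, fun h => by omega⟩
    refine wp_of_spec (spec_writeSorted (s := s₅.setVar 50 (1 + 0)) (a := a) (l := l) (ps := pos L key)
      (hl₄.congr (by simp [g5.2 a (by simp)])) hw hy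
      (by simp [hy50, e5, hLdef]) hll (by omega) (by omega) (fun i hi => by
        simp [g5.2 13 (by simp), hps i hi]) (fun i hi => pos_lt hi) fun i hi j hj h => pos_inj hi hj h) ?_
    rintro k₆ s₆ hk₆ ⟨g6, r10⟩
    refine hQ _ _ (by omega) ⟨?_, .inr ⟨g6.lit (by simp), ?_⟩⟩
    · exact ((g15.mono le_rfl (by simp) (by simp)).setVar (.inr (by simp))).trans g6 le_rfl
        (by simp) (by simp)
    · obtain ⟨f, hf, hfl, hfp⟩ := exists_sorted (G := G) hM.nodup hw hL (fun i hi => pos_lt hi)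
        (fun i hi j hj h => pos_inj hi hj h) r6
      refine ⟨f, hf, hfl, fun b => ?_⟩
      obtain ⟨i, hi, h1, h2⟩ := hfp b
      rw [← h1, r10 i hi, h2]
  · rw [r5]
    refine ⟨fun h => by omega, fun _ => hQ _ _ (by omega) ⟨g15.mono le_rfl (by simp) (by simp),
      .inl ⟨e50, ?_⟩⟩⟩
    rintro ⟨f, hf, hfl⟩
    refine r9 (sort_classes h.params h.bounded hL (fun i hi j hj h => hwinj i hi j hj h) hf
      (fun b => ?_) hlam hmu hc r6 r7 r8)
    obtain ⟨i, hi, h1⟩ := List.getElem_of_mem (hfl b)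
    exact ⟨i, hi, by rw [← hw i hi, h1]⟩

/-! ## The branching step -/

/-- The test whether the entry of array `a` differs from variable `51`. -/
def neqTest (a : ℕ) : Program :=
  .seq (.load 211 a (.var 200)) (.seq (.sub 202 (.var 211) (.var 51))
    (.seq (.sub 212 (.var 51) (.var 211)) (.add 202 (.var 202) (.var 212))))

/-- The same test for an entry that has more than `q` non-neighbours. -/
def bigTest (a : ℕ) : Program :=
  .seq (neqTest a) (.ite (.lit 0) (.var 202) (.seq (.load 213 10 (.var 200))
    (.sub 202 (.var 213) (.var 3))) .skip)

/-- The test whether a vertex distinguishes another one from its least non-neighbour. -/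
def pathTest (a : ℕ) : Program :=
  .seq (adjTest a 200 201 214) (.seq (.load 215 9 (.var 200)) (.seq (adjTest a 215 201 216)
    (.seq (.sub 202 (.var 214) (.var 216)) (.seq (.sub 217 (.var 216) (.var 214))
      (.add 202 (.var 202) (.var 217))))))

/-- The test for a second path in the complement. -/
def secondTest (a : ℕ) : Program :=
  .seq (adjTest a 198 200 214) (.seq (adjTest a 200 201 215) (.seq (adjTest a 198 201 216)
    (.seq (.sub 202 (.var 216) (.var 214)) (.seq (.sub 202 (.var 202) (.var 215))
      (.seq (.sub 217 (.var 201) (.var 199)) (.seq (.sub 218 (.var 199) (.var 201))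
        (.seq (.add 217 (.var 217) (.var 218))
          (.ite (.lit 0) (.var 217) .skip (.add 202 (.lit 0) (.lit 0))))))))))

/-- Write the entry of array `a` at the position `x` to the `k`-th cell of array `a + 10`. -/
def put (a k x : ℕ) : Program :=
  .seq (.load 211 a (.var x)) (.store (a + 10) (.lit k) (.var 211))

/-- Write a vertex with many non-neighbours (or any vertex) to the first cell of array `a + 10`. -/
def pickBig (a y : ℕ) : Program :=
  .seq (foldMin (.var y) (.var y) (nonadjTest a) 8 9 10)
  (.seq (forTo 200 (.lit 6) (.store (a + 10) (.var 200) (.var 51)))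
  (.seq (scan (.var y) (neqTest a)) (.seq (.ite (.lit 0) (.var 203) (put a 0 204) .skip)
  (.seq (scan (.var y) (bigTest a)) (.ite (.lit 0) (.var 203) (put a 0 204) .skip)))))

/-- Write the vertices of paths in the complement to array `a + 10`. -/
def pickPath (a y : ℕ) : Program :=
  .seq (scan (.var y) (pathTest a)) (.ite (.lit 0) (.var 203)
    (.seq (.load 197 9 (.var 204)) (.seq (adjTest a 204 205 214)
    (.seq (.add 199 (.var 205) (.lit 0)) (.seq (.ite (.lit 0) (.var 214)
      (.seq (.add 198 (.var 204) (.lit 0)) (.add 196 (.var 197) (.lit 0)))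
      (.seq (.add 198 (.var 197) (.lit 0)) (.add 196 (.var 204) (.lit 0))))
    (.seq (put a 1 198) (.seq (put a 2 196) (.seq (put a 3 199)
    (.seq (scan (.var y) (secondTest a)) (.ite (.lit 0) (.var 203)
      (.seq (put a 4 204) (put a 5 205)) .skip))))))))) .skip)

/-! ### Verification of the branching step -/

theorem tests_neq {s : Store} {a : ℕ} {l : List (Fin n)} (hl : Lst s a l) {w : ℕ → Fin n}
    (hw : ∀ i (h : i < l.length), l[i] = w i) {v : Fin n} (h51 : s.var 51 = v) (hll : l.length ≤ W)
    (hn : n ≤ W) : Tests W l.length 4 s [] (neqTest a) fun i _ => w i ≠ v := by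
  intro s₁ hk hi hj
  have f1 : s₁.arr a = s.arr a := hk.2 a (by simp)
  have f2 : s₁.var 51 = v := hk.lit h51
  have f3 := (w (s₁.var 200)).2
  have f4 := v.2
  refine Spec.intro fun Q hQ => ?_
  simp only [neqTest, wp_seq, wp_load, wp_sub, wp_add, Operand.val, Store.setVar_var, f1,
    hl.nth hw hi, f2]
  norm_num
  refine ⟨by omega, by omega, by omega, by omega, by omega, hQ _ _ (by omega) ⟨by simp, ?_⟩⟩
  simp [Fin.ext_iff]; omega

theorem tests_big {s : Store} {a : ℕ} {l : List (Fin n)} (hl : Lst s a l) {w : ℕ → Fin n}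
    (hw : ∀ i (h : i < l.length), l[i] = w i) {v : Fin n} (h51 : s.var 51 = v) (hll : l.length ≤ W)
    (hn : n ≤ W) {c : ℕ → ℕ} (hc : ∀ i < l.length, s.arr 10 i = c i)
    (hcW : ∀ i < l.length, c i ≤ W) (h3 : s.var 3 = q) :
    Tests W l.length 7 s [] (bigTest a) fun i _ => w i ≠ v ∧ q < c i := by
  intro s₁ hk hi hj
  have f1 : s₁.arr 10 = s.arr 10 := hk.2 10 (by simp)
  have f2 := hc _ hi
  have f3 := hcW _ hi
  refine Spec.intro fun Q hQ => ?_
  simp only [bigTest, wp_seq]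
  refine wp_of_spec (tests_neq hl hw h51 hll hn s₁ hk hi hj) ?_
  rintro k s₂ hk₂ ⟨g1, g2⟩
  have f200 : s₂.var 200 = s₁.var 200 := g1.lit rfl
  have f4 : s₂.var 3 = q := g1.lit (hk.lit h3)
  have f5 : s₂.arr 10 = s.arr 10 := by rw [g1.2 10 (by simp), f1]
  simp only [wp_ite, wp_seq, wp_load, wp_sub, wp_skip, Operand.val, Store.setVar_var, f200, f4, f5, f2]
  norm_num
  refine ⟨fun h => ⟨by omega, by omega, by omega, hQ _ _ (by omega) ⟨by simpa using g1, ?_⟩⟩,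
    fun h => hQ _ _ (by omega) ⟨by simpa using g1, ?_⟩⟩
  · simp [g2.1 h]
  · have : ¬ w (s₁.var 200) ≠ v := fun h' => by have := g2.2 h'; omega
    simp [h, this]

theorem tests_path (hW : 1000 * (n + t + 2) ^ 2 ≤ W) {s : Store} {a : ℕ} {l : List (Fin n)}
    (hM : Mat G t s l) (hl : Lst s a l) {w : ℕ → Fin n}
    (hw : ∀ i (h : i < l.length), l[i] = w i) (hll : l.length ≤ W) {lam : ℕ → ℕ}
    (h9 : ∀ i < l.length, s.arr 9 i = lam i) (hlam : ∀ i < l.length, lam i < l.length) :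
    Tests W l.length 14 s [] (pathTest a) fun i j =>
      ¬ (G.Adj (w i) (w j) ↔ G.Adj (w (lam i)) (w j)) := by
  intro s₁ hk hi hj
  have f1 : s₁.arr 9 = s.arr 9 := hk.2 9 (by simp)
  have f2 := h9 _ hi
  have f3 := hlam _ hi
  refine Spec.intro fun Q hQ => ?_
  simp only [pathTest, wp_seq]
  refine wp_of_spec (spec_adjTest hW (hM.keep hk (fun x h => h) hM.nodup)
    (hl.congr (hk.2 a (by simp))) hw rfl rfl hi hj hll (by norm_num)) ?_
  rintro k s₂ hk₂ ⟨g1, g2⟩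
  have f200 : s₂.var 200 = s₁.var 200 := g1.lit rfl
  have f5 : s₂.arr 9 = s.arr 9 := by rw [g1.2 9 (by simp), f1]
  have g3 : Keep 210 [202] [] s₁ (s₂.setVar 215 (lam (s₁.var 200))) := by
    simpa using (g1.mono (by norm_num) (by simp) (by simp) : Keep 210 [202] [] s₁ s₂)
  simp only [wp_load, Operand.val, f200, f5, f2]
  refine ⟨by omega, by omega, ?_⟩
  refine wp_of_spec (spec_adjTest hW (hM.keep (hk.trans g3 (by norm_num) (by simp) (by simp))
    (fun x h => h) hM.nodup) (hl.congr (by rw [g3.2 a (by simp), hk.2 a (by simp)])) hw (i := lam (s₁.var 200))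
    (by simp) (g3.lit rfl) f3 hj hll (by norm_num)) ?_
  rintro k₃ s₃ hk₃ ⟨g4, g5⟩
  have g6 : Keep 210 [202] [] s₁ s₃ := g3.trans g4 (by norm_num) (by simp) (by simp)
  have f214 : s₃.var 214 = if G.Adj (w (s₁.var 200)) (w (s₁.var 201)) then 1 else 0 := by
    rw [g4.lit rfl, Store.setVar_var, if_neg (by norm_num), g2]
  simp only [wp_add, wp_sub, Operand.val, Store.setVar_var, g5, f214]
  norm_num
  refine ⟨by split_ifs <;> omega, by split_ifs <;> omega, by split_ifs <;> omega, hQ _ _ (by omega)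
    ⟨by simpa using g6, ?_⟩⟩
  by_cases h1 : G.Adj (w (s₁.var 200)) (w (s₁.var 201)) <;>
    by_cases h2 : G.Adj (w (lam (s₁.var 200))) (w (s₁.var 201)) <;> simp [h1, h2]

/-- For entries `0` and `1`, the iterated truncated difference is positive exactly if the end
vertices are adjacent and neither is adjacent to the middle one. -/
theorem tests_second (hW : 1000 * (n + t + 2) ^ 2 ≤ W) {s : Store} {a : ℕ} {l : List (Fin n)}
    (hM : Mat G t s l) (hl : Lst s a l) {w : ℕ → Fin n}
    (hw : ∀ i (h : i < l.length), l[i] = w i) (hll : l.length ≤ W) {iw iy : ℕ}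
    (h198 : s.var 198 = iw) (h199 : s.var 199 = iy) (hiw : iw < l.length) (hiy : iy < l.length) :
    Tests W l.length 22 s [] (secondTest a) fun i j => ¬ G.Adj (w iw) (w i) ∧ ¬ G.Adj (w i) (w j) ∧
      G.Adj (w iw) (w j) ∧ j ≠ iy := by
  intro s₁ hk hi hj
  have e198 : s₁.var 198 = iw := hk.lit h198
  have e199 : s₁.var 199 = iy := hk.lit h199
  refine Spec.intro fun Q hQ => ?_
  simp only [secondTest, wp_seq]
  have hl₁ : Lst s₁ a l := hl.congr (hk.2 a (by simp))
  have hM₁ : Mat G t s₁ l := hM.keep hk (fun x h => h) hM.nodup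
  refine wp_of_spec (spec_adjTest hW hM₁ hl₁ hw e198 rfl hiw hi hll (by norm_num)) ?_
  rintro k₂ s₂ hk₂ ⟨g1, g2⟩
  refine wp_of_spec (spec_adjTest hW (hM₁.keep g1 (fun x h => h) hM.nodup)
    (hl₁.congr (g1.2 a (by simp))) hw (g1.lit rfl) (g1.lit rfl) hi hj hll (by norm_num)) ?_
  rintro k₃ s₃ hk₃ ⟨g3, g4⟩
  have g5 : Keep 210 [202] [] s₁ s₃ := (g1.mono (by norm_num) (by simp) (by simp)).trans g3
    (by norm_num) (by simp) (by simp)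
  refine wp_of_spec (spec_adjTest hW (hM₁.keep g5 (fun x h => h) hM.nodup)
    (hl₁.congr (g5.2 a (by simp))) hw (g5.lit e198) (g5.lit rfl) hiw hj hll (by norm_num)) ?_
  rintro k₄ s₄ hk₄ ⟨g6, g7⟩
  have g8 : Keep 210 [202] [] s₁ s₄ := g5.trans g6 (by norm_num) (by simp) (by simp)
  have f214 : s₄.var 214 = _ := g6.lit (g3.lit g2)
  have f215 : s₄.var 215 = _ := g6.lit g4
  have f201 : s₄.var 201 = s₁.var 201 := g8.lit rfl
  have f199 : s₄.var 199 = iy := g8.lit e199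
  simp only [wp_add, wp_sub, wp_ite, wp_skip, Operand.val, Store.setVar_var, g7, f214, f215, f201, f199]
  norm_num
  refine ⟨by split_ifs <;> omega, by split_ifs <;> omega, by omega, by omega, by omega, fun h => ?_,
    fun h => ?_⟩
  · refine hQ _ _ (by omega) ⟨by simpa using g8, ?_⟩
    have : s₁.var 201 ≠ iy := by omega
    by_cases h1 : G.Adj (w iw) (w (s₁.var 200)) <;>
    by_cases h2 : G.Adj (w (s₁.var 200)) (w (s₁.var 201)) <;>
    by_cases h3 : G.Adj (w iw) (w (s₁.var 201)) <;> simp [h1, h2, h3, this]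
  · refine hQ _ _ (by omega) ⟨by simpa using g8, ?_⟩
    have : s₁.var 201 = iy := by omega
    simp [this]

/-- If no vertex distinguishes any other one from its least non-neighbour, non-adjacency is
transitive. -/
theorem nonadj_trans {L : ℕ} {w : ℕ → Fin n} {lam : ℕ → ℕ}
    (hlam : ∀ i < L, IsLeast {j | j < L ∧ ¬ G.Adj (w i) (w j)} (lam i))
    (h : ∀ i < L, ∀ j < L, (G.Adj (w i) (w j) ↔ G.Adj (w (lam i)) (w j))) {i j k : ℕ} (hi : i < L)
    (hj : j < L) (hk : k < L) (hij : ¬ G.Adj (w i) (w j)) (hjk : ¬ G.Adj (w j) (w k)) :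
    ¬ G.Adj (w i) (w k) := by
  -- As `j` is a non-neighbour of `i`, and `i` does not distinguish `j` from `lam j`, also `lam j`
  -- is a non-neighbour of `i`; and conversely.
  have key : lam i = lam j := by
    refine le_antisymm ((hlam i hi).2 ⟨(hlam j hj).1.1, ?_⟩) ((hlam j hj).2 ⟨(hlam i hi).1.1, ?_⟩)
    · rw [G.adj_comm, ← h j hj i hi, G.adj_comm]; exact hij
    · rw [G.adj_comm, ← h i hi j hj]; exact hij
  rw [h i hi k hk, key, ← h j hj k hk]
  exact hjk

theorem spec_put {s : Store} {a k x i : ℕ} {l : List (Fin n)} (hl : Lst s a l) {w : ℕ → Fin n}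
    (hw : ∀ i (h : i < l.length), l[i] = w i) (hll : l.length ≤ W) (hn : n ≤ W) (hk : k ≤ W)
    (hx : s.var x = i) (hi : i < l.length) {z : ℕ → Fin n} {m : ℕ}
    (hz : ∀ k < m, s.arr (a + 10) k = z k) :
    Spec W (put a k x) 2 s fun s' => Keep 211 [] [a + 10] s s' ∧
      ∀ k' < m, s'.arr (a + 10) k' = Function.update z k (w i) k' := by
  have := (w i).2
  refine Spec.intro fun Q hQ => ?_
  simp only [put, wp_seq, wp_load, wp_store, Operand.val, hx, hl.nth hw hi, Store.setVar_var]
  norm_num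
  refine ⟨by omega, by omega, hk, by omega, hQ _ _ (by omega) ⟨by simp, fun k' hk' => ?_⟩⟩
  simp only [Store.setArr_arr, if_true, Function.update_apply, Store.setVar_arr]
  split_ifs
  · rfl
  · exact hz k' hk'

theorem exists_nth {l : List (Fin n)} (v : Fin n) :
    ∃ w : ℕ → Fin n, ∀ i (h : i < l.length), l[i] = w i :=
  ⟨fun i => l.getD i v, fun _ hi => (List.getD_eq_getElem _ _ hi).symm⟩

theorem spec_fill {s : Store} {a : ℕ} {v : Fin n} (h51 : s.var 51 = v) (hn : n ≤ W) (h6 : 6 ≤ W) :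
    Spec W (forTo 200 (.lit 6) (.store (a + 10) (.var 200) (.var 51))) 20 s fun s' =>
      Keep 200 [] [a + 10] s s' ∧ ∀ k < 6, s'.arr (a + 10) k = v := by
  refine (spec_forTo (N := .lit 6) (m := 6) (T := 1) (Inv := fun i s' => Keep 200 [] [a + 10] s s' ∧
    s'.var 200 = i ∧ ∀ k < i, s'.arr (a + 10) k = v) h6 (fun j s' h => ⟨h.2.1, rfl⟩) ?_
    ⟨by simp, by simp, by simp⟩).mono (by norm_num) fun s' h => ⟨h.1, h.2.2⟩
  rintro i hi s₁ ⟨k1, e1, r1⟩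
  have e51 : s₁.var 51 = v := k1.lit h51
  refine Spec.intro fun Q hQ => ?_
  simp only [wp_store, Operand.val, e1, e51]
  refine ⟨by omega, by omega, hQ _ _ le_rfl ⟨by simpa using e1, by simpa using k1, by simp,
    fun k hk => ?_⟩⟩
  by_cases h : k = i
  · subst h; simp
  · simp [h]; exact r1 k (by omega)

theorem spec_putIf {s : Store} {a k x i : ℕ} {l : List (Fin n)} (hl : Lst s a l) {w : ℕ → Fin n}
    (hw : ∀ i (h : i < l.length), l[i] = w i) (hll : l.length ≤ W) (hn : n ≤ W) (hk : k ≤ W)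
    {P : Prop} (h203 : (s.var 203 = 0 ∧ ¬ P) ∨ (s.var 203 = 1 ∧ P ∧ s.var x = i ∧ i < l.length))
    {z : ℕ → Fin n} {m : ℕ} (hz : ∀ k < m, s.arr (a + 10) k = z k) :
    Spec W (.ite (.lit 0) (.var 203) (put a k x) .skip) 3 s fun s' => Keep 211 [] [a + 10] s s' ∧
      ((P ∧ ∀ k' < m, s'.arr (a + 10) k' = Function.update z k (w i) k') ∨
        (¬ P ∧ ∀ k' < m, s'.arr (a + 10) k' = z k')) := by
  refine Spec.intro fun Q hQ => ?_
  simp only [wp_ite, wp_skip, Operand.val]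
  rcases h203 with ⟨h1, h2⟩ | ⟨h1, h2, h3, h4⟩
  · rw [h1]; exact ⟨fun h => by omega, fun _ => hQ _ _ (by omega) ⟨by simp, .inr ⟨h2, hz⟩⟩⟩
  · rw [h1]
    refine ⟨fun _ => wp_of_spec (spec_put hl hw hll hn hk h3 h4 hz) ?_, fun h => by omega⟩
    rintro k' s' hk' ⟨g1, g2⟩
    exact hQ _ _ (by omega) ⟨g1, .inl ⟨h2, g2⟩⟩

theorem update_mem {l : List (Fin n)} {z : ℕ → Fin n} (hz : ∀ k, z k ∈ l) {x : Fin n} (hx : x ∈ l)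
    (j : ℕ) : ∀ k, Function.update z j x k ∈ l := fun k => by
  rw [Function.update_apply]; split_ifs; exacts [hx, hz k]

/-- All six cells first get `v`, which makes them void for the search. Then the first cell gets some
other vertex, and finally, if possible, one with more than `q` non-neighbours. These are the two
alternatives of `branch_cluster`. -/
theorem spec_pickBig (h : Ctx G t p q W a₀ a₁ d) {s : Store} (hs : At n t p q a₀ a₁ d s) {a y : ℕ}
    {l : List (Fin n)} (hM : Mat G t s l) (hT : Tab t p q s) (hl : Lst s a l) (hy : y < 200)
    (hsy : s.var y = l.length) (hLt : l.length ≤ 3 * t) (ha : 30 ≤ a) {v : Fin n}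
    (h51 : s.var 51 = v) (hv : v ∈ l) {w : ℕ → Fin n} (hw : ∀ i (h : i < l.length), l[i] = w i) :
    Spec W (pickBig a y) (200 * (3 * t * (3 * t))) s fun s' => Keep 200 [] [9, 10, a + 10] s s' ∧
      (∀ i < l.length, IsLeast {j | j < l.length ∧ ¬ G.Adj (w i) (w j)} (s'.arr 9 i)) ∧
      ∃ z : ℕ → Fin n, (∀ k < 6, s'.arr (a + 10) k = z k) ∧ (∀ k, z k ∈ l) ∧ ((∃ i < l.length, w i ≠ v) →
        ∃ i < l.length, z 0 = w i ∧ w i ≠ v ∧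
        (q < ((Finset.range l.length).filter fun j => ¬ G.Adj (w i) (w j)).card ∨
          ∀ i' < l.length, w i' ≠ v →
            ((Finset.range l.length).filter fun j => ¬ G.Adj (w i') (w j)).card ≤ q)) := by
  have hW₁ := h.le_W₁
  have hW₂ := h.le_W₂
  have ht := h.params.1
  have hll : l.length ≤ W := by omega
  set L := l.length
  refine Spec.intro fun Q hQ => ?_
  simp only [pickBig, wp_seq]
  refine wp_of_spec (spec_foldMin hy hy hsy hsy hll (by omega) (by simp) (by simp)
    (by simp) (fun j hj => by rw [hT.id j (by omega)]; omega)
    (tests_nonadj hW₂ hM hl hw hll (by simp) (by simp) (by simp; omega)) hLt (by omega)) ?_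
  rintro k₁ s₁ hk₁ ⟨g1, r1⟩
  have hlam : ∀ i < L, IsLeast {j | j < L ∧ ¬ G.Adj (w i) (w j)} (s₁.arr 9 i) := by
    intro i hi
    obtain ⟨-, h1, h2, h3⟩ := r1 i hi
    have h4 := h1 i hi (by simp)
    rw [hT.id i (by omega)] at h4
    rcases h3 with h3 | ⟨j, hj, hn, h3⟩
    · omega
    · rw [hT.id j (by omega)] at h3
      rw [h3]
      refine ⟨⟨hj, hn⟩, fun j' ⟨h5, h6⟩ => ?_⟩
      have := h1 j' h5 h6
      rw [hT.id j' (by omega)] at this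
      omega
  set c : ℕ → ℕ := fun i => ((Finset.range L).filter fun j => ¬ G.Adj (w i) (w j)).card with hcdef
  have hc : ∀ i < L, s₁.arr 10 i = c i := by
    intro i hi
    obtain ⟨⟨F, h1, h2⟩, -⟩ := r1 i hi
    rw [h2, hcdef]; congr 1; ext j; simp [h1]
  have hcL : ∀ i < L, c i ≤ W := fun i hi => by
    refine (Finset.card_filter_le _ _).trans ?_; simpa using hll
  refine wp_of_spec (spec_fill (v := v) (g1.lit h51) (by omega) (by omega)) ?_
  rintro k₂ s₂ hk₂ ⟨g2, r2⟩
  have g12 : Keep 200 [] [9, 10, a + 10] s s₂ := (g1.mono le_rfl (by simp) (by simp)).trans g2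
    le_rfl (by simp) (by simp)
  have hl₂ : Lst s₂ a l := hl.congr (g12.2 a (by simp; omega))
  refine wp_of_spec (spec_scan hy (g12.lit hsy hy) hll (by omega) (tests_neq hl₂ hw (g12.lit h51) hll
    (by omega)) hLt (by omega)) ?_
  rintro k₃ s₃ hk₃ ⟨g3, r3⟩
  have g13 : Keep 200 [] [9, 10, a + 10] s s₃ := g12.trans g3 le_rfl (by simp) (by simp)
  have hl₃ : Lst s₃ a l := hl.congr (g13.2 a (by simp; omega))
  refine wp_of_spec (spec_putIf hl₃ hw hll (i := s₃.var 204) (by omega) (by omega)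
    (P := ∃ i < L, w i ≠ v ∧ i = s₃.var 204) (z := fun _ => v) (m := 6) ?_ ?_) ?_
  · rcases r3 with ⟨r3, r4⟩ | ⟨r3, r4, r5, r6⟩
    · exact .inl ⟨r3, fun ⟨i, hi, h, _⟩ => r4 i hi i hi h⟩
    · exact .inr ⟨r3, ⟨_, r4, r6, rfl⟩, rfl, r4⟩
  · intro k hk; rw [g3.2 _ (by simp), r2 k hk]
  rintro k₄ s₄ hk₄ ⟨g4, r4⟩
  have g14 : Keep 200 [] [9, 10, a + 10] s s₄ := g13.trans g4 (by norm_num) (by simp) (by simp)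
  have g24 : Keep 200 [] [a + 10] s₁ s₄ := (g2.trans g3 le_rfl (by simp) (by simp)).trans g4
    (by norm_num) (by simp) (by simp)
  have hl₄ : Lst s₄ a l := hl.congr (g14.2 a (by simp; omega))
  obtain ⟨z, hz, hzl, hz0⟩ : ∃ z : ℕ → Fin n, (∀ k < 6, s₄.arr (a + 10) k = z k) ∧ (∀ k, z k ∈ l) ∧
      ((∃ i < L, w i ≠ v) → ∃ i < L, z 0 = w i ∧ w i ≠ v) := by
    rcases r4 with ⟨⟨i, hi, h1, h2⟩, h3⟩ | ⟨h1, h2⟩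
    · exact ⟨_, h3, update_mem (fun _ => hv) (nth_mem hw (h2 ▸ hi)) _, fun _ => ⟨i, hi, by simp [h2], h1⟩⟩
    · refine ⟨_, h2, fun _ => hv, fun ⟨i, hi, h3⟩ => ?_⟩
      rcases r3 with ⟨r3, r4⟩ | ⟨r3, r4, r5, r6⟩
      · exact absurd h3 (r4 i hi i hi)
      · exact absurd ⟨_, r4, r6, rfl⟩ h1
  refine wp_of_spec (spec_scan hy (g14.lit hsy hy) hll (by omega) (tests_big hl₄ hw (g14.lit h51) hll
    (by omega) (fun i hi => by rw [g24.2 10 (by simp; omega), hc i hi]) hcL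
    (g14.lit hs.var_q)) hLt (by omega)) ?_
  rintro k₅ s₅ hk₅ ⟨g5, r5⟩
  have g15 : Keep 200 [] [9, 10, a + 10] s s₅ := g14.trans g5 le_rfl (by simp) (by simp)
  have hl₅ : Lst s₅ a l := hl.congr (g15.2 a (by simp; omega))
  refine wp_of_spec (spec_putIf hl₅ hw hll (i := s₅.var 204) (by omega) (by omega)
    (P := ∃ i < L, (w i ≠ v ∧ q < c i) ∧ i = s₅.var 204) (z := z) (m := 6) ?_ ?_) ?_
  · rcases r5 with ⟨r3, r4⟩ | ⟨r3, r4, r5, r6⟩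
    · exact .inl ⟨r3, fun ⟨i, hi, h, _⟩ => r4 i hi i hi h⟩
    · exact .inr ⟨r3, ⟨_, r4, r6, rfl⟩, rfl, r4⟩
  · intro k hk; rw [g5.2 _ (by simp), hz k hk]
  rintro k₆ s₆ hk₆ ⟨g6, r6⟩
  have hmm : 3 * t ≤ 3 * t * (3 * t) := Nat.le_mul_self _
  refine hQ _ _ (by omega) ⟨g15.trans g6 (by norm_num) (by simp) (by simp), ?_, ?_⟩
  · rw [g6.2 9 (by simp; try omega), g5.2 9 (by simp), g24.2 9 (by simp; try omega)]; exact hlam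
  · rcases r6 with ⟨⟨i, hi, h1, h2⟩, h3⟩ | ⟨h1, h2⟩
    · exact ⟨_, h3, update_mem hzl (nth_mem hw (h2 ▸ hi)) _, fun _ => ⟨i, hi, by simp [h2], h1.1, .inl h1.2⟩⟩
    · refine ⟨_, h2, hzl, fun hex => ?_⟩
      obtain ⟨i, hi, h3, h4⟩ := hz0 hex
      refine ⟨i, hi, h3, h4, .inr fun i' hi' h5 => ?_⟩
      rcases r5 with ⟨r3, r4⟩ | ⟨r3, r4, r5, r6⟩
      · have := r4 i' hi' i' hi'
        by_contra hlt
        exact this ⟨h5, by simpa [hcdef] using hlt⟩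
      · exact absurd ⟨_, r4, r6, rfl⟩ h1

/-- Write six vertices to array `a + 10`, one of which can be removed from the list in array `a`. -/
def branch (a y : ℕ) : Program := .seq (pickBig a y) (pickPath a y)

/-- If `j` sees exactly one of `i` and `lam i`, that one is the beginning `w` of a path as in
`branch_path`, the other one its middle, and `j` its end. It suffices to compare each vertex with
its least non-neighbour by `nonadj_trans`, so that a loop over pairs is enough instead of one over
triples. -/
theorem spec_pickPath (hW₂ : 1000 * (n + t + 2) ^ 2 ≤ W) (ht : 3 ≤ t) {s : Store} {a y : ℕ}
    {l : List (Fin n)} (hM : Mat G t s l) (hl : Lst s a l) (hy : y < 190)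
    (hsy : s.var y = l.length) (hLt : l.length ≤ 3 * t)
    {w : ℕ → Fin n} (hw : ∀ i (h : i < l.length), l[i] = w i) {lam : ℕ → ℕ}
    (h9 : ∀ i < l.length, s.arr 9 i = lam i)
    (hlam : ∀ i < l.length, lam i < l.length ∧ ¬ G.Adj (w i) (w (lam i))) {z : ℕ → Fin n}
    (hz : ∀ k < 6, s.arr (a + 10) k = z k) (hzl : ∀ k, z k ∈ l) :
    Spec W (pickPath a y) (200 * (3 * t * (3 * t))) s fun s' => Keep 190 [] [a + 10] s s' ∧
      ∃ z' : ℕ → Fin n, (∀ k < 6, s'.arr (a + 10) k = z' k) ∧ (∀ k, z' k ∈ l) ∧ z' 0 = z 0 ∧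
      ((∀ i < l.length, ∀ j < l.length, (G.Adj (w i) (w j) ↔ G.Adj (w (lam i)) (w j))) ∨
        (¬ G.Adj (z' 1) (z' 2) ∧ ¬ G.Adj (z' 2) (z' 3) ∧ G.Adj (z' 1) (z' 3) ∧
          ((∃ i < l.length, ∃ j < l.length, ¬ G.Adj (z' 1) (w i) ∧ ¬ G.Adj (w i) (w j) ∧
            G.Adj (z' 1) (w j) ∧ w j ≠ z' 3) → ¬ G.Adj (z' 1) (z' 4) ∧ ¬ G.Adj (z' 4) (z' 5) ∧
            G.Adj (z' 1) (z' 5) ∧ z' 5 ≠ z' 3))) := by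
  have hW' := pow_bounds n t
  have hll : l.length ≤ W := by omega
  have hmm : 3 * t ≤ 3 * t * (3 * t) := Nat.le_mul_self _
  have hwinj : ∀ i < l.length, ∀ j < l.length, w i = w j → i = j := fun i hi j hj h => by
    rw [← hw i hi, ← hw j hj] at h; exact (hM.nodup.getElem_inj_iff).1 h
  refine Spec.intro fun Q hQ => ?_
  simp only [pickPath, wp_seq]
  refine wp_of_spec (spec_scan (by omega) hsy hll (by omega) (tests_path hW₂ hM hl hw hll h9
    fun i hi => (hlam i hi).1) hLt (by omega)) ?_
  rintro k₁ s₁ hk₁ ⟨g1, r1⟩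
  simp only [wp_ite, wp_seq, wp_load, wp_add, wp_skip, Operand.val]
  rcases r1 with ⟨r1, r2⟩ | ⟨r1, hi, hj, r2⟩
  · rw [r1]
    refine ⟨fun h => by omega, fun _ => hQ _ _ (by omega) ⟨g1.mono (by norm_num) (by simp) (by simp),
      z, fun k hk => by rw [g1.2 _ (by simp), hz k hk], hzl, rfl, .inl fun i hi j hj => ?_⟩⟩
    exact not_not.1 (r2 i hi j hj)
  rw [r1]
  refine ⟨fun _ => ?_, fun h => by omega⟩
  obtain ⟨hl1, hl2⟩ := hlam _ hi
  have e9 : s₁.arr 9 (s₁.var 204) = lam (s₁.var 204) := by rw [g1.2 9 (by simp), h9 _ hi]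
  rw [e9]
  refine ⟨by omega, by omega, ?_⟩
  have g2 : Keep 190 [] [a + 10] s (s₁.setVar 197 (lam (s₁.var 204))) := by
    simpa using (g1.mono (by norm_num) (by simp) (by simp) : Keep 190 [] [a + 10] s s₁)
  have h4 : 4 ∉ [a + 10] := by simp
  have h6 : 6 ∉ [a + 10] := by simp
  have hA : a ∉ [a + 10] := by simp
  refine wp_of_spec (spec_adjTest hW₂ (hM.keep g2 (fun x h => h) hM.nodup h4 h6) (hl.congr (g2.2 a hA))
    hw (i := s₁.var 204) (j := s₁.var 205) (by simp) (by simp) hi hj hll (by norm_num)) ?_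
  rintro k₂ s₂ hk₂ ⟨g3, r3⟩
  have e204 : s₂.var 204 = s₁.var 204 := g3.lit (by simp)
  have e205 : s₂.var 205 = s₁.var 205 := g3.lit (by simp)
  have e197 : s₂.var 197 = lam (s₁.var 204) := g3.lit (by simp)
  set i := s₁.var 204
  set j := s₁.var 205
  have g4 : Keep 190 [] [a + 10] s s₂ := g2.trans g3 (by norm_num) (by simp) (by simp)
  -- the common continuation
  have main : ∀ s₃ k₃ iw ix, k₃ ≤ k₁ + 20 → Keep 190 [] [a + 10] s s₃ →
      (∀ k < 6, s₃.arr (a + 10) k = z k) → s₃.var 198 = iw → s₃.var 196 = ix → s₃.var 199 = j →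
      iw < l.length → ix < l.length → ¬ G.Adj (w iw) (w ix) → ¬ G.Adj (w ix) (w j) →
      G.Adj (w iw) (w j) →
      wp W (put a 1 198) s₃ k₃ fun k' s' => wp W (put a 2 196) s' k' fun k' s' =>
        wp W (put a 3 199) s' k' fun k' s' => wp W (scan (.var y) (secondTest a)) s' k' fun k' s' =>
          (0 < s'.var 203 → wp W (put a 4 204) s' (k' + 1) fun k' s' => wp W (put a 5 205) s' k' Q) ∧
          (s'.var 203 = 0 → Q (k' + 1) s') := by
    intro s₃ k₃ iw ix hk₃ m1 hz₃ e198 e196 e199 hiw hix n1 n2 n3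
    refine wp_of_spec (spec_put (hl.congr (m1.2 a hA)) hw hll (by omega) (by omega) e198 hiw hz₃) ?_
    rintro k₄ s₄ hk₄ ⟨m2, r4⟩
    have m3 := m1.trans m2 (by norm_num) (by simp) (by simp)
    refine wp_of_spec (spec_put (hl.congr (m3.2 a hA)) hw hll (by omega) (by omega) (m2.lit e196) hix r4) ?_
    rintro k₅ s₅ hk₅ ⟨m4, r5⟩
    have m5 := m3.trans m4 (by norm_num) (by simp) (by simp)
    refine wp_of_spec (spec_put (hl.congr (m5.2 a hA)) hw hll (by omega) (by omega)
      (m4.lit (m2.lit e199)) hj r5) ?_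
    rintro k₆ s₆ hk₆ ⟨m6, r6⟩
    have m7 := m5.trans m6 (by norm_num) (by simp) (by simp)
    have hl₆ : Lst s₆ a l := hl.congr (m7.2 a hA)
    refine wp_of_spec (spec_scan (by omega) (m7.lit hsy hy) hll (by omega) (tests_second hW₂
      (hM.keep m7 (fun x h => h) hM.nodup h4 h6) hl₆ hw hll (m6.lit (m4.lit (m2.lit e198)))
      (m6.lit (m4.lit (m2.lit e199))) hiw hj) hLt (by omega)) ?_
    rintro k₇ s₇ hk₇ ⟨m8, r7⟩
    have m9 := m7.trans m8 (by norm_num) (by simp) (by simp)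
    have hzl' := update_mem (update_mem (update_mem hzl (nth_mem hw hiw) 1) (nth_mem hw hix) 2)
      (nth_mem hw hj) 3
    rcases r7 with ⟨r7, r8⟩ | ⟨r7, hi', hj', r8, r9, r10, r11⟩
    · rw [r7]
      refine ⟨fun h => by omega, fun _ => hQ _ _ (by omega) ⟨m9, _, fun k hk => by
        rw [m8.2 _ (by simp), r6 k hk], hzl', by simp, .inr ?_⟩⟩
      simp
      refine ⟨n1, n2, n3, fun i' hi' j' hj' c1 c2 c3 c4 => ?_⟩
      exact absurd ⟨c1, c2, c3, fun h => c4 (by rw [h])⟩ (r8 i' hi' j' hj')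
    · rw [r7]
      refine ⟨fun _ => ?_, fun h => by omega⟩
      refine wp_of_spec (spec_put (hl.congr (m9.2 a hA)) hw hll (by omega) (by omega) rfl hi'
        (z := Function.update (Function.update (Function.update z 1 (w iw)) 2 (w ix)) 3 (w j))
        (m := 6) fun k hk => by rw [m8.2 _ (by simp), r6 k hk]) ?_
      rintro k₈ s₈ hk₈ ⟨m10, r12⟩
      have m11 := m9.trans m10 (by norm_num) (by simp) (by simp)
      refine wp_of_spec (spec_put (hl.congr (m11.2 a hA)) hw hll (by omega) (by omega) (m10.lit rfl) hj'
        r12) ?_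
      rintro k₉ s₉ hk₉ ⟨m12, r13⟩
      refine hQ _ _ (by omega) ⟨m11.trans m12 (by norm_num) (by simp) (by simp), _, r13,
        update_mem (update_mem hzl' (nth_mem hw hi') _) (nth_mem hw hj') _, by simp,
        .inr ?_⟩
      simp
      refine ⟨n1, n2, n3, fun _ _ _ _ _ _ _ _ => ⟨r8, r9, r10, fun h => r11 (hwinj _ hj' _ hj h)⟩⟩
  have hz₂ : ∀ k < 6, s₂.arr (a + 10) k = z k := fun k hk => by
    rw [g3.2 _ (by simp), Store.setVar_arr, g1.2 _ (by simp), hz k hk]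
  have hsymm : ¬ G.Adj (w (lam i)) (w i) := fun h => hl2 h.symm
  simp only [Store.setVar_var, e205, e204, e197, r3]
  norm_num
  refine ⟨by omega, fun hpos => ⟨by omega, by omega, ?_⟩, fun hadj => ⟨by omega, by omega, ?_⟩⟩
  · have hadj : G.Adj (w i) (w j) := by by_contra h; simp [h] at hpos
    refine main _ _ i (lam i) (by omega) (by simpa using g4) (by simpa using hz₂) (by simp) (by simp)
      (by simp) hi hl1 hl2 (fun h => r2 ⟨fun _ => h, fun _ => hadj⟩) hadj
  · refine main _ _ (lam i) i (by omega) (by simpa using g4) (by simpa using hz₂) (by simp) (by simp)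
      (by simp) hl1 hi hsymm hadj ?_
    by_contra h; exact r2 ⟨fun h' => absurd h' hadj, fun h' => absurd h' h⟩

theorem card_nonadj {l : List (Fin n)} (hn : l.Nodup) {w : ℕ → Fin n}
    (hw : ∀ i (h : i < l.length), l[i] = w i) (u : Fin n) :
    (l.toFinset.filter fun x => ¬ G.Adj u x).card =
      ((Finset.range l.length).filter fun j => ¬ G.Adj u (w j)).card := by
  have : l.toFinset.filter (fun x => ¬ G.Adj u x) =
      ((Finset.range l.length).filter fun j => ¬ G.Adj u (w j)).image w := by
    ext x
    simp only [Finset.mem_filter, List.mem_toFinset, Finset.mem_image, Finset.mem_range]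
    constructor
    · rintro ⟨hx, h⟩
      obtain ⟨i, hi, rfl⟩ := List.getElem_of_mem hx
      exact ⟨i, ⟨hi, hw i hi ▸ h⟩, (hw i hi).symm⟩
    · rintro ⟨i, ⟨hi, h⟩, rfl⟩; exact ⟨nth_mem hw hi, h⟩
  rw [this, Finset.card_image_of_injOn]
  intro i hi j hj h
  simp only [Finset.coe_filter, Finset.mem_range, Set.mem_ofPred_eq] at hi hj
  rw [← hw i hi.1, ← hw j hj.1] at h
  exact hn.getElem_inj_iff.1 h

/-- Cell `0` serves `branch_cluster`. Cells `1`, `2`, `3` hold a path and cells `4`, `5` the rest of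
a second one from the same beginning, for `branch_path`. -/
theorem spec_branch (h : Ctx G t p q W a₀ a₁ d) {s : Store} (hs : At n t p q a₀ a₁ d s) {a y : ℕ}
    {l : List (Fin n)} (hM : Mat G t s l) (hT : Tab t p q s) (hl : Lst s a l) (hy : y < 190)
    (hsy : s.var y = l.length) (hLt : l.length ≤ 3 * t) (ha : 30 ≤ a) {v : Fin n}
    (h51 : s.var 51 = v) (hv : v ∈ l) :
    Spec W (branch a y) (400 * (3 * t * (3 * t))) s fun s' => Keep 190 [] [9, 10, a + 10] s s' ∧
      ∃ z : ℕ → Fin n, (∀ k < 6, s'.arr (a + 10) k = z k) ∧ (∀ k, z k ∈ l) ∧ (HasK G p q l.toFinset v →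
        p * q < l.length → ∃ k < 6, z k ≠ v ∧ HasK G p q (l.toFinset.erase (z k)) v) := by
  obtain ⟨w, hw⟩ := exists_nth (l := l) v
  refine Spec.intro fun Q hQ => ?_
  simp only [branch, wp_seq]
  refine wp_of_spec (spec_pickBig h hs hM hT hl (by omega) hsy hLt ha h51 hv hw) ?_
  rintro k₁ s₁ hk₁ ⟨g1, hlam, z, hz, hzl, hz0⟩
  refine wp_of_spec (spec_pickPath h.le_W₂ h.params.1 (hM.keep g1 (fun x h => h) hM.nodup)
    (hl.congr (g1.2 a (by simp; omega))) hy (g1.lit hsy (by omega)) hLt hw (lam := s₁.arr 9)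
    (fun _ _ => rfl) (fun i hi => (hlam i hi).1) hz hzl) ?_
  rintro k₂ s₂ hk₂ ⟨g2, z', hz', hz'l, hz'0, hcase⟩
  refine hQ _ _ (by omega) ⟨(g1.mono (by norm_num) (by simp) (by simp)).trans g2 (by norm_num) (by simp)
    (by simp), z', hz', hz'l, fun hK hlt => ?_⟩
  have hcard : l.toFinset.card = l.length := List.toFinset_card_of_nodup hM.nodup
  have hmem : ∀ x, x ∈ l.toFinset → ∃ i < l.length, w i = x := fun x hx => by
    obtain ⟨i, hi, rfl⟩ := List.getElem_of_mem (List.mem_toFinset.1 hx)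
    exact ⟨i, hi, (hw i hi).symm⟩
  rcases hcase with htr | ⟨c1, c2, c3, c4⟩
  · have hex : ∃ i < l.length, w i ≠ v := by
      by_contra! hno
      have h1 : l.toFinset ⊆ {v} := fun x hx => by
        obtain ⟨i, hi, rfl⟩ := hmem x hx; simp [hno i hi]
      have h2 := Finset.card_le_card h1
      have h3 := KF.pq h.params
      have h4 := h.params.1
      simp only [Finset.card_singleton, hcard] at h2
      omega
    obtain ⟨i, hi, h1, h2, h3⟩ := hz0 hex
    refine ⟨0, by norm_num, by rw [hz'0, h1]; exact h2, ?_⟩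
    rw [hz'0, h1]
    refine branch_cluster h.params h.bounded hK (by omega) ?_ (by simpa using nth_mem hw hi) h2 ?_
    · intro x hx y hy z hz
      obtain ⟨i, hi, rfl⟩ := hmem x hx
      obtain ⟨j, hj, rfl⟩ := hmem y hy
      obtain ⟨k, hk, rfl⟩ := hmem z hz
      exact nonadj_trans hlam htr hi hj hk
    · rw [card_nonadj hM.nodup hw]
      refine h3.imp_right fun h3 y hy hyv => ?_
      obtain ⟨j, hj, rfl⟩ := hmem y hy
      rw [card_nonadj hM.nodup hw]
      exact h3 j hj hyv
  · rcases branch_path h.params h.bounded hK (by omega) c1 c2 c3 with ⟨x, hx, h1, h2⟩ |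
      ⟨⟨x, hx, y, hy, h1, h2, h3, h4⟩, h5⟩
    · rcases hx with rfl | rfl | rfl
      exacts [⟨1, by norm_num, h1, h2⟩, ⟨2, by norm_num, h1, h2⟩, ⟨3, by norm_num, h1, h2⟩]
    · obtain ⟨i, hi, rfl⟩ := hmem x hx
      obtain ⟨j, hj, rfl⟩ := hmem y hy
      obtain ⟨d1, d2, d3, d4⟩ := c4 ⟨i, hi, j, hj, h1, h2, h3, h4⟩
      obtain ⟨x, hx, h6, h7⟩ := h5 _ _ d1 d2 d3 d4
      rcases hx with rfl | rfl
      exacts [⟨4, by norm_num, h6, h7⟩, ⟨5, by norm_num, h6, h7⟩]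

/-! ## The search -/

/-- Copy the list in array `a` without the vertex in variable `z` to array `a + 1`. -/
def copyWithout (a y z y' : ℕ) : Program :=
  .seq (.add y' (.lit 0) (.lit 0)) (forTo 200 (.var y) (.seq (.load 211 a (.var 200))
    (.seq (.sub 212 (.var 211) (.var z)) (.seq (.sub 213 (.var z) (.var 211))
    (.seq (.add 212 (.var 212) (.var 213)) (.ite (.lit 0) (.var 212)
      (.seq (.store (a + 1) (.var y') (.var 211)) (.add y' (.var y') (.lit 1))) .skip))))))

/-- Search for a `K^p_q` that contains the vertex in variable `51` in the list in array `a` of length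
variable `b`, with at most `k` branchings. -/
def search : ℕ → ℕ → ℕ → Program
  | 0, b, a => .ite (.var b) (.var 6) .skip (.ite (.var 6) (.var b) .skip (tryList a b))
  | k + 1, b, a => .ite (.var b) (.var 6) .skip (.ite (.var 6) (.var b)
      (.seq (branch a b) (forTo (b + 1) (.lit 6) (.ite (.var 50) (.lit 1)
        (.seq (.load (b + 2) (a + 10) (.var (b + 1))) (.seq (.sub (b + 3) (.var (b + 2)) (.var 51))
        (.seq (.sub (b + 4) (.var 51) (.var (b + 2))) (.seq (.add (b + 3) (.var (b + 3)) (.var (b + 4)))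
        (.ite (.lit 0) (.var (b + 3))
          (.seq (copyWithout a b (b + 2) (b + 10)) (search k (b + 10) (a + 1))) .skip))))) .skip)))
      (tryList a b))

/-- The constant in the cost of the search. -/
def searchCost : ℕ → ℕ
  | 0 => 310
  | k + 1 => 6 * searchCost k + 700

/-- The arrays that the search changes. -/
def searchArrays (k a : ℕ) : List ℕ :=
  [9, 10, 11, 12, 13, 14, 22] ++ List.range' (a + 1) k ++ List.range' (a + 10) k

theorem spec_copyWithout {s : Store} {a y z y' : ℕ} {l : List (Fin n)} (hl : Lst s a l) {x : Fin n}
    (hz : s.var z = x) (hsy : s.var y = l.length) (hy : y < 200) (hz200 : z < 200) (hy' : y' < 200)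
    (hyy : y ≠ y') (hzy : z ≠ y') (hll : l.length < W) (hn : n ≤ W) :
    Spec W (copyWithout a y z y') (9 * l.length + 3) s fun s' => Keep 200 [y'] [a + 1] s s' ∧
      Lst s' (a + 1) (l.filter (· ≠ x)) ∧ s'.var y' = (l.filter (· ≠ x)).length := by
  refine Spec.intro fun Q hQ => ?_
  simp only [copyWithout, wp_seq, wp_add, Operand.val]
  refine ⟨by omega, ?_⟩
  refine wp_of_spec (spec_forTo (N := .var y) (m := l.length) (T := 7) (Inv := fun i s' =>
    Keep 200 [y'] [a + 1] s s' ∧ s'.var 200 = i ∧ Lst s' (a + 1) ((l.take i).filter (· ≠ x)) ∧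
      s'.var y' = ((l.take i).filter (· ≠ x)).length) hll.le
      (fun j s' h => ⟨h.2.1, h.1.lit hsy hy (by simpa using hyy)⟩) ?_ ?_) ?_
  · rintro i hi s₁ ⟨k1, e1, r1, r2⟩
    have ez : s₁.var z = x := k1.lit hz hz200 (by simpa using hzy)
    have ea : s₁.arr a i = l[i] := by rw [k1.2 a (by simp), hl i hi]
    have hlen : ((l.take i).filter (· ≠ x)).length ≤ i := (List.length_filter_le _ _).trans (by simp)
    have htake : l.take (i + 1) = l.take i ++ [l[i]] := by simp
    have h1 : z ≠ 211 := by omega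
    have h2 : z ≠ 212 := by omega
    have h3 : y' ≠ 212 := by omega
    have h4 : y' ≠ 213 := by omega
    have h5 : y' ≠ 211 := by omega
    have h6 : y' ≠ 200 := by omega
    have h7 : (200 : ℕ) ≠ y' := by omega
    generalize hm : ((l.take i).filter (· ≠ x)).length = m at r2 hlen
    refine Spec.intro fun Q hQ => ?_
    simp only [wp_seq, wp_load, wp_sub, wp_add, wp_ite, wp_skip, wp_store, Operand.val,
      Store.setVar_var, Store.setArr_var, e1, ea, ez, if_neg h1, if_neg h2, if_neg h3, if_neg h4,
      if_neg h5, r2]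
    norm_num
    refine ⟨by omega, by omega, by omega, by omega, by omega, fun h => ⟨by omega, by omega, by omega,
      hQ _ _ (by omega) ⟨?_, ?_, by simp, ?_, ?_⟩⟩, fun h => hQ _ _ (by omega) ⟨?_, ?_, by simp, ?_, ?_⟩⟩
    · simp [h7, e1]
    · rw [Keep.setVar_iff (by simp), Keep.setVar_iff (by simp), Keep.setArr_iff (by simp)]
      simpa using k1
    · have hne : l[i] ≠ x := fun h' => by rw [h'] at h; omega
      rw [htake, List.filter_append]
      simp only [Lst.setVar_iff]
      have : [l[i]].filter (· ≠ x) = [l[i]] := by simp [hne]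
      rw [this]
      exact Lst.append (s := s₁) r1 (by rw [hm]; simp)
    · have hne : l[i] ≠ x := fun h' => by rw [h'] at h; omega
      rw [htake, List.filter_append, List.length_append, hm]
      simp [h6, hne]
    · simpa using e1
    · rw [Keep.setVar_iff (by simp)]; simpa using k1
    · have hne : l[i] = x := Fin.ext (by omega)
      rw [htake, List.filter_append]
      simpa [hne] using r1
    · have hne : l[i] = x := Fin.ext (by omega)
      rw [htake, List.filter_append, List.length_append, hm]
      simpa [h3, h4, h5, h6, hne] using r2
  · refine ⟨?_, by simp, ?_, ?_⟩
    · rw [Keep.setVar_iff (by simp), Keep.setVar_iff (by simp)]; exact Keep.refl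
    · simp [Lst]
    · have : y' ≠ 200 := by omega
      simp [this]
  · rintro k s' hk ⟨k1, -, r1, r2⟩
    rw [List.take_of_length_le (by simp)] at r1 r2
    exact hQ _ _ (by omega) ⟨k1, r1, r2⟩

theorem filter_ne_toFinset (l : List (Fin n)) (x : Fin n) :
    (l.filter (· ≠ x)).toFinset = l.toFinset.erase x := by
  ext y; simp [and_comm]

theorem HasK.le_card {A : Finset (Fin n)} {v : Fin n} (h : HasK G p q A v) : p * q ≤ A.card := by
  obtain ⟨f, hf, hA, -⟩ := h
  have : (Finset.univ.image f) ⊆ A := fun x hx => by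
    obtain ⟨a, -, rfl⟩ := Finset.mem_image.1 hx; exact hA a
  have := Finset.card_le_card this
  rw [Finset.card_image_of_injective _ hf.1] at this
  simpa using this

/-- What the search achieves. -/
def Found (G : SimpleGraph (Fin n)) (p q : ℕ) (l : List (Fin n)) (v : Fin n) (s : Store) : Prop :=
  s.var 50 = 1 ∧ ∃ f : Fin p × Fin q → Fin n, KF G f ∧ (∀ b, f b ∈ l) ∧ (∃ b, f b = v) ∧
    Classes p q s f

theorem notMem_searchArrays {k a x : ℕ} (h : x ≤ 8 ∨ x = 16 ∨ 30 ≤ x) (ha : 22 ≤ a)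
    (h' : x ≤ a ∨ a + k < x ∧ (x < a + 10 ∨ a + 10 + k ≤ x)) : x ∉ searchArrays k a := by
  simp [searchArrays, List.mem_range'_1]; omega

theorem spec_search_leaf (h : Ctx G t p q W a₀ a₁ d) {s : Store} {a b : ℕ} {l : List (Fin n)}
    (hM : Mat G t s l) (hT : Tab t p q s) (hl : Lst s a l) (hb : 100 ≤ b) (hb' : b < 190)
    (hsb : s.var b = l.length) (hLt : l.length ≤ 3 * t) (ha : 30 ≤ a) {v : Fin n} (hv : v ∈ l)
    (h50 : s.var 50 = 0) (hL : l.length = p * q) {k : ℕ} :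
    Spec W (tryList a b) (300 * (3 * t * (3 * t))) s fun s' =>
      Keep b [50] (searchArrays k a) s s' ∧
      ((s'.var 50 = 0 ∧ ¬ HasK G p q l.toFinset v) ∨ Found G p q l v s') := by
  refine (spec_tryList h hM hT hl (by omega) hsb hL hLt ha h50 (by omega)).mono le_rfl ?_
  rintro s' ⟨g1, g2⟩
  refine ⟨g1.mono (by omega) (by simp) (by simp [searchArrays]), g2.imp ?_ ?_⟩
  · rintro ⟨r1, r2⟩
    refine ⟨r1, ?_⟩
    rintro ⟨f, hf, hA, -⟩
    exact r2 ⟨f, hf, fun b => by simpa using hA b⟩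
  · rintro ⟨r1, f, hf, hfl, hc⟩
    exact ⟨r1, f, hf, fun b => (hfl _).2 ⟨b, rfl⟩, (hfl v).1 hv, hc⟩

/-- If the list contains a suitable `K^p_q`, one of the six branches deletes a superfluous vertex,
so `k` levels cope with a surplus of `k`. A positive answer is correct without this bound, and after
it the other branches are skipped. Every level has its own list (arrays `a`, `a + 1`, …), its own
candidates (from array `a + 10` on) and its own variables (steps of `10`), so that a branch does not
spoil the data of its parent. -/
theorem spec_search (h : Ctx G t p q W a₀ a₁ d) {v : Fin n} (k : ℕ) : ∀ {s : Store}
    (_ : At n t p q a₀ a₁ d s) {a b : ℕ} {l : List (Fin n)}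
    (_ : Mat G t s l) (_ : Tab t p q s) (_ : Lst s a l) (_ : 100 ≤ b) (_ : b + 10 * k < 190)
    (_ : s.var b = l.length) (_ : l.length ≤ 3 * t) (_ : 30 ≤ a) (_ : k < 8)
    (_ : v ∈ l) (_ : s.var 51 = v) (_ : s.var 50 = 0) (_ : s.var 6 = p * q),
    Spec W (search k b a) (searchCost k * (3 * t * (3 * t))) s fun s' =>
      Keep b [50] (searchArrays k a) s s' ∧
      ((s'.var 50 = 0 ∧ (l.length ≤ p * q + k → ¬ HasK G p q l.toFinset v)) ∨ Found G p q l v s') := by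
  have hW₁ := h.le_W₁
  have ht := h.params.1
  have hmm : 3 * t ≤ 3 * t * (3 * t) := Nat.le_mul_self _
  induction k with
  | zero =>
    intro s hs a b l hM hT hl hb hbk hsb hLt ha hk hv h51 h50 h6
    have hcard : l.toFinset.card = l.length := List.toFinset_card_of_nodup hM.nodup
    refine Spec.intro fun Q hQ => ?_
    simp only [search, wp_ite, wp_skip, Operand.val, hsb, h6]
    refine ⟨fun hlt => hQ _ _ (by simp only [searchCost]; omega) ⟨Keep.refl, .inl ⟨h50, fun _ hK => ?_⟩⟩,
      fun hge => ⟨fun hgt => hQ _ _ (by simp only [searchCost]; omega) ⟨Keep.refl, .inl ⟨h50,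
        fun _ => by omega⟩⟩, fun hle => ?_⟩⟩
    · have := hK.le_card; omega
    · refine wp_of_spec (spec_search_leaf (k := 0) h hM hT hl hb (by omega) hsb hLt ha hv h50
        (by omega)) ?_
      rintro k₁ s₁ hk₁ ⟨g1, g2⟩
      exact hQ _ _ (by simp only [searchCost]; omega) ⟨g1, g2.imp_left fun ⟨r1, r2⟩ => ⟨r1, fun _ => r2⟩⟩
  | succ k ih =>
    intro s hs a b l hM hT hl hb hbk hsb hLt ha hk hv h51 h50 h6
    have hcard : l.toFinset.card = l.length := List.toFinset_card_of_nodup hM.nodup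
    have hcost : searchCost (k + 1) * (3 * t * (3 * t)) =
        6 * (searchCost k * (3 * t * (3 * t))) + 700 * (3 * t * (3 * t)) := by
      simp only [searchCost]; ring
    refine Spec.intro fun Q hQ => ?_
    simp only [search, wp_ite, wp_seq, wp_skip, Operand.val, hsb, h6]
    refine ⟨fun hlt => hQ _ _ (by rw [hcost]; omega) ⟨Keep.refl, .inl ⟨h50, fun _ hK => ?_⟩⟩,
      fun hge => ⟨fun hgt => ?_, fun hle => ?_⟩⟩
    · have := hK.le_card; omega
    · refine wp_of_spec (spec_branch h hs hM hT hl (by omega) hsb hLt ha h51 hv) ?_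
      rintro k₁ s₁ hk₁ ⟨g1, z, hz, hzl, hzK⟩
      have kA : Keep b [50] (searchArrays (k + 1) a) s s₁ := g1.mono (by omega) (by simp)
        (by simp [searchArrays, List.mem_range'_1])
      refine wp_of_spec (spec_forTo (N := .lit 6) (m := 6)
        (T := searchCost k * (3 * t * (3 * t)) + 9 * l.length + 20) (Inv := fun i s' =>
        Keep b [50] (searchArrays (k + 1) a) s s' ∧ s'.var (b + 1) = i ∧ s'.var b = l.length ∧
          Mat G t s' l ∧ Tab t p q s' ∧ Lst s' a l ∧ (∀ k < 6, s'.arr (a + 10) k = z k) ∧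
        ((s'.var 50 = 0 ∧ (l.length ≤ p * q + (k + 1) → ∀ i' < i, z i' ≠ v →
          ¬ HasK G p q (l.toFinset.erase (z i')) v)) ∨ Found G p q l v s')) (by omega)
        (fun j s' h => ⟨h.2.1, rfl⟩) ?_ ?_) ?_
      · rintro i hi s₂ ⟨m1, m2, m3, m4, m5, m6, m7, m8⟩
        have e51 : s₂.var 51 = v := m1.lit h51 (by omega)
        have e6 : s₂.var 6 = p * q := m1.lit h6 (by omega)
        have hAt₂ : At n t p q a₀ a₁ d s₂ := hs.keep m1 (by omega) (by simp)
          (notMem_searchArrays (by omega) (by omega) (by omega))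
          (notMem_searchArrays (by omega) (by omega) (by omega))
          (notMem_searchArrays (by omega) (by omega) (by omega))
        have hb50 : 50 ≠ b + 1 := by omega
        have fin : ∀ s₃, Keep (b + 2) [50] (searchArrays k (a + 1) ++ [a + 1]) s₂ s₃ →
            ((s₃.var 50 = 0 ∧ (l.length ≤ p * q + (k + 1) → ∀ i' < i + 1, z i' ≠ v →
              ¬ HasK G p q (l.toFinset.erase (z i')) v)) ∨ Found G p q l v s₃) →
            s₃.var (b + 1) = i ∧
            Keep b [50] (searchArrays (k + 1) a) s (s₃.setVar (b + 1) (i + 1)) ∧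
            (s₃.setVar (b + 1) (i + 1)).var (b + 1) = i + 1 ∧
            (s₃.setVar (b + 1) (i + 1)).var b = l.length ∧
            Mat G t (s₃.setVar (b + 1) (i + 1)) l ∧ Tab t p q (s₃.setVar (b + 1) (i + 1)) ∧
            Lst (s₃.setVar (b + 1) (i + 1)) a l ∧
            (∀ k < 6, (s₃.setVar (b + 1) (i + 1)).arr (a + 10) k = z k) ∧
            (((s₃.setVar (b + 1) (i + 1)).var 50 = 0 ∧
              (l.length ≤ p * q + (k + 1) → ∀ i' < i + 1, z i' ≠ v →
                ¬ HasK G p q (l.toFinset.erase (z i')) v)) ∨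
              Found G p q l v (s₃.setVar (b + 1) (i + 1))) := by
          intro s₃ hk hdis
          have hnot : ∀ x, (x ≤ 8 ∨ x = 16 ∨ 30 ≤ x) → (x ≤ a ∨ x = a + 10) →
              x ∉ searchArrays k (a + 1) ++ [a + 1] := fun x h1 h2 => by
            simp only [List.mem_append, List.mem_singleton, not_or]
            exact ⟨notMem_searchArrays (by omega) (by omega) (by omega), by omega⟩
          have hk' : Keep b [50] (searchArrays k (a + 1) ++ [a + 1]) s₂ (s₃.setVar (b + 1) (i + 1)) := by
            rw [Keep.setVar_iff (by simp)]
            exact hk.mono (by omega) (by simp) (by simp)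
          refine ⟨hk.lit m2 (by omega) (by simp; omega), m1.trans hk' le_rfl (by simp) ?_, by simp,
            ?_, m4.keep hk' (fun x h => h) hM.nodup (hnot _ (by omega) (by omega))
            (hnot _ (by omega) (by omega)), m5.keep hk' (hnot _ (by omega) (by omega))
            (hnot _ (by omega) (by omega)), m6.congr (hk'.2 a (hnot _ (by omega) (by omega))),
            fun k hk => by rw [hk'.2 _ (hnot _ (by omega) (by omega)), m7 k hk], ?_⟩
          · intro x
            simp only [searchArrays, List.mem_append, List.mem_range'_1, List.mem_singleton]
            rintro (((h | h) | h) | h)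
            exacts [.inl (.inl h), .inl (.inr (by omega)), .inr (by omega), .inl (.inr (by omega))]
          · simp; exact hk.lit m3 (by omega) (by simp; omega)
          · refine hdis.imp (fun ⟨f1, f2⟩ => ⟨by simpa [hb50] using f1, f2⟩) ?_
            rintro ⟨f1, f, f2, f3, f4, f5⟩
            exact ⟨by simpa [hb50] using f1, f, f2, f3, f4, f5⟩
        have hzi := (z i).2
        refine Spec.intro fun Q hQ => ?_
        simp only [wp_ite, wp_seq, wp_load, wp_sub, wp_add, wp_skip, Operand.val, m2, m7 i hi,
          Store.setVar_var, e51]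
        rcases m8 with ⟨f50, r8⟩ | hF
        · have h51 : ∀ j, 51 ≠ b + j := by omega
          simp [f50, h51]
          set s₃ := ((((s₂.setVar (b + 2) (z i)).setVar (b + 3) (z i - v)).setVar (b + 4)
            (v - z i)).setVar (b + 3) (z i - v + (v - z i))) with hs₃
          have k3 : ∀ As, Keep (b + 2) [50] As s₂ s₃ := fun As => by
            rw [hs₃, Keep.setVar_iff (by simp), Keep.setVar_iff (by simp), Keep.setVar_iff (by simp),
              Keep.setVar_iff (by simp)]
            exact Keep.refl
          have e3 : s₃.var b = l.length := (k3 []).lit m3 (by omega) (by simp; omega)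
          have e50 : s₃.var 50 = 0 := by
            have h50' : ∀ j, 50 ≠ b + j := by omega
            simp only [hs₃, Store.setVar_var, if_neg (h50' _)]; exact f50
          have e51' : s₃.var 51 = v := (k3 []).lit e51 (by omega)
          refine ⟨by omega, by omega, by omega, by omega, by omega, fun hne => ?_, fun heq =>
            hQ _ _ (by omega) (fin s₃ (k3 _) (.inl ⟨e50, fun hle i' hi' => ?_⟩))⟩
          · refine wp_of_spec (spec_copyWithout (a := a) (l := l) (x := z i) (s := s₃) (y := b)
              (z := b + 2) (y' := b + 10) m6 (by simp [hs₃]) e3 (by omega) (by omega) (by omega) (by omega)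
              (by omega) (by omega) (by omega)) ?_
            rintro k₄ s₄ hk₄ ⟨n1, n2, n3⟩
            have k4 : Keep (b + 5) [50] [a + 1] s₃ s₄ := n1.mono (by omega) (by simp) (by simp)
            have k4' : Keep (b + 2) [50] [a + 1] s₂ s₄ := (k3 _).trans k4 (by omega) (by simp) (by simp)
            have hlen : (l.filter (· ≠ z i)).length ≤ l.length := List.length_filter_le _ _
            refine wp_of_spec (ih (hAt₂.keep k4' (by omega) (by simp) (by simp; try omega)
              (by simp; try omega) (by simp; try omega)) (a := a + 1) (b := b + 10)
              (l := l.filter (· ≠ z i)) (m4.keep k4' (fun x hx => List.mem_of_mem_filter hx)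
              (hM.nodup.filter _) (by simp; try omega) (by simp; try omega)) (m5.keep k4' (by simp; try omega)
              (by simp; try omega)) n2 (by omega) (by omega) n3 (by omega) (by omega) (by omega)
              (List.mem_filter.2 ⟨hv, by simpa using hne⟩) (n1.lit e51' (by omega) (by simp; omega))
              (n1.lit e50 (by omega) (by simp; omega))
              (k4'.lit e6 (by omega))) ?_
            rintro k₅ s₅ hk₅ ⟨o1, o2⟩
            refine hQ _ _ (by omega) (fin s₅ ((k4'.mono le_rfl (by simp) (by simp)).trans o1 (by omega)
              (by simp) (by simp +contextual)) ?_)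
            rcases o2 with ⟨o2, o3⟩ | ⟨o2, f, f2, f3, f4, f5⟩
            · refine .inl ⟨o2, fun hle i' hi' => ?_⟩
              rcases (by omega : i' < i ∨ i' = i) with h' | rfl
              · exact r8 hle i' h'
              · intro _
                rw [← filter_ne_toFinset]
                refine o3 ?_
                have : (l.filter (· ≠ z i')).length < l.length := by
                  rw [← List.toFinset_card_of_nodup (hM.nodup.filter _), filter_ne_toFinset,
                    Finset.card_erase_of_mem (by simpa using hzl i'), hcard]
                  omega
                omega
            · exact .inr ⟨o2, f, f2, fun b => List.mem_of_mem_filter (f3 b), f4, f5⟩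
          · rcases (by omega : i' < i ∨ i' = i) with h' | rfl
            · exact r8 hle i' h'
            · exact fun h => absurd heq.symm h
        · have := hF.1
          simp only [this]
          exact ⟨fun h => by omega, fun _ => hQ _ _ (by omega) (fin s₂ Keep.refl (.inr hF))⟩
      · have g1' : Keep 100 [] [9, 10, a + 10] s (s₁.setVar (b + 1) 0) := by
          rw [Keep.setVar_iff (.inl (by omega))]; exact g1.mono (by omega) (by simp) (by simp)
        refine ⟨by rw [Keep.setVar_iff (by simp)]; exact kA, by simp, ?_,
          hM.keep g1' (fun x h => h) hM.nodup (by simp) (by simp),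
          hT.keep g1' (by simp; try omega) (by simp; try omega), ?_, hz, ?_⟩
        · simp; exact g1.lit hsb (by omega)
        · exact hl.congr (g1.2 a (by simp; omega))
        · left
          refine ⟨?_, fun _ i' hi' => by omega⟩
          have : 50 ≠ b + 1 := by omega
          simp [this]; exact g1.lit h50
      · rintro k₂ s₂ hk₂ ⟨m1, -, -, -, -, -, -, m2⟩
        refine hQ _ _ ?_ ⟨m1, m2.imp_left fun ⟨r1, r2⟩ => ⟨r1, fun hle hK => ?_⟩⟩
        · rw [hcost]; omega
        · obtain ⟨i, hi, h1, h2⟩ := hzK hK hgt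
          exact r2 hle i hi h1 h2
    · refine wp_of_spec (spec_search_leaf (k := k + 1) h hM hT hl hb (by omega) hsb hLt ha hv h50
        (by omega)) ?_
      rintro k₁ s₁ hk₁ ⟨g1, g2⟩
      exact hQ _ _ (by rw [hcost]; omega) ⟨g1, g2.imp_left fun ⟨r1, r2⟩ =>
        ⟨r1, fun _ => r2⟩⟩

/-! ## Finding a `K^p_q` that contains a given vertex -/

/-- Write `k` into the entries for adjacent vertices, in the rows of the matrix that belong to the
vertices on the list in array `30`. -/
def setRows (k : ℕ) : Program :=
  .seq (.add 57 (.lit 0) (.lit 0)) (forTo 56 (.var 58) (.seq (.load 55 30 (.var 56))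
    (.seq (.store 6 (.var 55) (.var 57)) (.seq (markRow 57 55 k) (.add 57 (.var 57) (.var 0))))))

/-- List the neighbourhoods of the vertices in the variables `51` and `54` in array `30`. -/
def gather : Program :=
  .seq (.store 30 (.lit 0) (.var 51)) (.seq (.add 150 (.lit 1) (.lit 0)) (.seq (appendUnmarked 30 51)
  (.seq (.add 55 (.lit 0) (.lit 0)) (.seq (.store 4 (.var 51) (.lit 1)) (.seq (markRow 55 51 1)
  (.seq (appendUnmarked 30 54) (.seq (markRow 55 51 0) (.seq (.store 4 (.var 51) (.lit 0))
    (.add 58 (.var 150) (.lit 0))))))))))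

/-- Look for a `K^p_q` that contains the vertices in the variables `51` and `54` in different
classes. -/
def attempt : Program :=
  .seq gather (.seq (setRows 1) (.seq (.add 100 (.var 58) (.lit 0)) (.seq (search 2 100 30) (setRows 0))))

/-- Look for a `K^p_q` that contains the vertex in variable `51`, and set variable `50` to `1` if
there is one. -/
def find : Program :=
  .seq (.add 50 (.lit 0) (.lit 0)) (.seq (.add 150 (.lit 0) (.lit 0)) (.seq (appendUnmarked 7 51)
    (.seq (.add 52 (.var 150) (.lit 0)) (forTo 53 (.lit 2) (.ite (.var 53) (.var 52)
      (.ite (.var 50) (.lit 1) (.seq (.load 54 7 (.var 53)) attempt) .skip) .skip)))))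

/-- The arrays that are changed by one attempt to find a `K^p_q`. -/
def attemptArrays : List ℕ := [6, 9, 10, 11, 12, 13, 14, 22, 30, 31, 32, 40, 41]

/-- The arrays that are changed by the search for a `K^p_q`. -/
def findArrays : List ℕ := 7 :: attemptArrays

/-- A `K^p_q` that contains `v` was found, and written down. -/
def FoundAlive (G : SimpleGraph (Fin n)) (p q : ℕ) (d : ℕ → ℕ) (v : Fin n) (s : Store) : Prop :=
  s.var 50 = 1 ∧ ∃ f : Fin p × Fin q → Fin n, KF G f ∧ (∀ b, f b ∈ alive n d) ∧ (∃ b, f b = v) ∧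
    Classes p q s f

theorem eq_of_mul_add_eq {i i' x y : ℕ} (hx : x < n) (hy : y < n) (h : i * n + x = i' * n + y) :
    i = i' ∧ x = y := by
  have hi : i = i' := by
    have h1 := div_of_lt (q := n) (i := i) hx
    rw [h, div_of_lt hy] at h1
    exact h1.symm
  subst hi
  exact ⟨rfl, by omega⟩

/-- Row `i` begins at `i n`, so the columns can be addressed by the vertices themselves. Only the
cells of neighbours are written, `O(t)` for each row, and the call with `0` erases exactly these. -/
theorem spec_setRows (h : Ctx G t p q W a₀ a₁ d) {s : Store} (hs : At n t p q a₀ a₁ d s)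
    {l : List (Fin n)} (hl : Lst s 30 l) (hn : l.Nodup) (hlen : s.var 58 = l.length)
    (hLt : l.length ≤ 3 * t) {k : ℕ} (hk : k ≤ 1) :
    Spec W (setRows k) (12 * (3 * t * (3 * t))) s fun s' => At n t p q a₀ a₁ d s' ∧
      Keep 55 [] [4, 6] s s' ∧ s'.var 58 = l.length ∧
      (∀ i (hi : i < l.length), s'.arr 6 l[i] = i * n) ∧
      s'.arr 4 = fun j => if ∃ i, ∃ hi : i < l.length, ∃ x ∈ nb G d l[i], j = i * n + x then k
        else s.arr 4 j := by
  have hW₁ := h.le_W₁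
  have hW₂ := h.le_W₂
  have ht := h.params.1
  have hoff : ∀ i < l.length, i * n + n ≤ 3 * (n + t + 2) ^ 2 := fun i hi => by
    have : (i + 1) * n ≤ 3 * t * n := Nat.mul_le_mul_right _ (by omega)
    nlinarith
  have hcost : l.length * (20 * t + 23 + 2) ≤ 10 * (3 * t * (3 * t)) := by
    have := Nat.mul_le_mul hLt (show 20 * t + 25 ≤ 29 * t by omega)
    nlinarith
  have hmm : 9 * t ≤ 3 * t * (3 * t) := by nlinarith
  refine Spec.intro fun Q hQ => ?_
  simp only [setRows, wp_seq, wp_add, Operand.val]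
  refine ⟨by omega, ?_⟩
  refine wp_of_spec (spec_forTo (N := .var 58) (m := l.length) (T := 20 * t + 23)
    (Inv := fun i s' => At n t p q a₀ a₁ d s' ∧ Keep 55 [] [4, 6] s s' ∧ s'.var 56 = i ∧
      s'.var 57 = i * n ∧ s'.var 58 = l.length ∧
      (∀ i' (hi : i' < l.length), i' < i → s'.arr 6 l[i'] = i' * n) ∧
      s'.arr 4 = fun j => if ∃ i', ∃ hi : i' < l.length, i' < i ∧ ∃ x ∈ nb G d l[i'],
        j = i' * n + x then k else s.arr 4 j) (by omega)
    (fun j s' h => ⟨h.2.2.1, h.2.2.2.2.1⟩) ?_ ?_) ?_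
  · rintro i hi s₁ ⟨f1, f2, f3, f4, f5, f6, f7⟩
    have ea : s₁.arr 30 i = l[i] := by rw [f2.2 30 (by simp), hl i hi]
    have hli := (l[i]).2
    have ho := hoff i hi
    refine Spec.intro fun Q hQ => ?_
    simp only [wp_seq, wp_load, wp_store, wp_add, Operand.val, f3, ea, Store.setVar_var, f4]
    norm_num
    refine ⟨by omega, by omega, by omega, ?_⟩
    have hs₂ : At n t p q a₀ a₁ d ((s₁.setVar 55 l[i]).setArr 6 l[i] (i * n)) := by simpa using f1
    refine wp_of_spec (spec_markRow h (y := 55) (o := 57) (v := l[i]) (off := i * n) (k := k)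
      hs₂ (by norm_num) (by simp) (by norm_num) (by simp [f4])
      (by omega) hk) ?_
    rintro k₂ s₂ hk₂ ⟨g1, g2, g3⟩
    have e57 : s₂.var 57 = i * n := g2.lit (by simp [f4])
    have e56 : s₂.var 56 = i := g2.lit (by simp [f3])
    have e58 : s₂.var 58 = l.length := g2.lit (by simp [f5])
    rw [e57, g1.var_n]
    refine ⟨by omega, hQ _ _ (by omega) ⟨by simpa using e56, by simpa using g1, ?_, by simp,
      by simp; ring, by simpa using e58, ?_, ?_⟩⟩
    · simp
      exact Keep.trans (by simpa using f2) g2 (by norm_num) (by simp) (by simp)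
    · intro i' hi' hlt
      simp only [Store.setVar_arr, g2.2 6 (by simp)]
      simp only [Store.setArr_arr, if_true, Function.update_apply, Store.setVar_arr]
      split_ifs with hc
      · have : i' = i := (List.Nodup.getElem_inj_iff hn).1 (Fin.ext hc)
        rw [this]
      · exact f6 i' hi' (by
          have : i' ≠ i := by rintro rfl; exact hc rfl
          omega)
    · funext j
      simp only [Store.setVar_arr, g3]
      simp only [Store.setArr_arr, Store.setVar_arr, f7]
      by_cases hc : ∃ x ∈ nb G d l[i], j = i * n + (x : ℕ)
      · rw [if_pos hc, if_pos ⟨i, hi, by omega, hc⟩]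
      · rw [if_neg hc, if_neg (by norm_num)]
        refine if_congr ⟨?_, ?_⟩ rfl rfl
        · rintro ⟨i', h1, h2, h3⟩; exact ⟨i', h1, by omega, h3⟩
        · rintro ⟨i', h1, h2, h3⟩
          refine ⟨i', h1, ?_, h3⟩
          have : i' ≠ i := by rintro rfl; exact hc (by simpa using h3)
          omega
  · refine ⟨by simpa using hs, by simp, by simp, by simp, by simpa using hlen, by simp, ?_⟩
    funext j; simp
  · rintro k' s' hk' ⟨f1, f2, -, -, f5, f6, f7⟩
    refine hQ _ _ (by omega) ⟨f1, f2, f5, fun i hi => f6 i hi hi, ?_⟩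
    rw [f7]
    funext j
    refine if_congr ⟨?_, ?_⟩ rfl rfl
    · rintro ⟨i', h1, h2, h3⟩; exact ⟨i', h1, h3⟩
    · rintro ⟨i', h1, h3⟩; exact ⟨i', h1, h1, h3⟩

/-- A vertex outside the class of `f a` is a neighbour of `f a`, and one inside is a neighbour of `f
b`. The first alternative only matches the form of the list made by `gather`. -/
theorem cover_two {f : Fin p × Fin q → Fin n}
    (hf : KF G f) (hS : ∀ a, f a ∈ alive n d) {a b : Fin p × Fin q} (hab : a.1 ≠ b.1) (c : Fin p × Fin q) :
    f c = f a ∨ f c ∈ nb G d (f a) ∨ f c ∈ nb G d (f b) := by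
  have hd : d (f c) = 0 := hS c
  by_cases h : c.1 = a.1
  · exact .inr (.inr (by simp [hd, hf.2 b c (fun h' => hab (h'.trans h).symm)]))
  · exact .inr (.inl (by simp [hd, hf.2 a c (Ne.symm h)]))

/-- Two sets of at most `t + 1` vertices with at least `t - q` common elements have a union of at
most `t + q + 2` elements, and `t + q = p q`. For `p = 2` the bound `t - q` is `0`. -/
theorem card_two_le (h : Ctx G t p q W a₀ a₁ d) {f : Fin p × Fin q → Fin n}
    (hf : KF G f) (hS : ∀ a, f a ∈ alive n d) {a b : Fin p × Fin q} (hab : a.1 ≠ b.1) :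
    (nb G d (f a) ∪ nb G d (f b)).card ≤ p * q + 2 := by
  have h1 := Finset.card_union_add_card_inter (nb G d (f a)) (nb G d (f b))
  have h2 := h.card_nb_le (f a)
  have h3 := h.card_nb_le (f b)
  have h4 : t - q ≤ (nb G d (f a) ∩ nb G d (f b)).card := by
    by_cases hp : 3 ≤ p
    · refine (card_common_of_ne h.params hp a b hab.symm).trans ((le_common hf hS a b).trans ?_)
      rw [common]
      refine Finset.card_le_card fun x => ?_
      simp only [Finset.mem_filter, Finset.mem_inter, mem_nb]
      tauto
    · obtain ⟨h1, h2, h3, h4⟩ := h.params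
      obtain rfl : p = 2 := by omega
      simp at h4; omega
  have := KF.pq h.params
  omega

theorem Keep.restore {s s' : Store} {B a : ℕ} {Xs As : List ℕ} (h : Keep B Xs (a :: As) s s')
    (ha : s'.arr a = s.arr a) : Keep B Xs As s s' :=
  ⟨h.1, fun b hb => by
    by_cases hba : b = a
    · rw [hba, ha]
    · exact h.2 b (by simp [hba, hb])⟩

/-- To avoid repetitions, `v` and its neighbours are marked before the neighbours of `u` are
appended. All marks are erased at the end. -/
theorem spec_gather (h : Ctx G t p q W a₀ a₁ d) {s : Store} (hs : At n t p q a₀ a₁ d s)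
    (hM : s.arr 4 = fun _ => 0) {v u : Fin n} (h51 : s.var 51 = v) (h54 : s.var 54 = u) :
    Spec W gather (80 * t + 90) s fun s' => At n t p q a₀ a₁ d s' ∧ Keep 55 [] [30] s s' ∧
      ∃ l : List (Fin n), l.Nodup ∧ Lst s' 30 l ∧ s'.var 58 = l.length ∧
        ∀ x, x ∈ l ↔ x = v ∨ x ∈ nb G d v ∨ x ∈ nb G d u := by
  have hW₁ := h.le_W₁
  have hv := v.2
  refine Spec.intro fun Q hQ => ?_
  simp only [gather, wp_seq, wp_add, wp_store, Operand.val, h51, Store.setVar_var, Store.setArr_var]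
  refine ⟨by omega, by omega, by omega, ?_⟩
  set s₁ := (s.setArr 30 0 v).setVar 150 (1 + 0) with hs₁
  have k1 : Keep 55 [] [4, 30] s s₁ := by simp [hs₁]
  have l1 : Lst s₁ 30 [v] := by
    intro j hj
    simp at hj; subst hj; simp [hs₁]
  have m1 : s₁.arr 4 = fun _ => 0 := by rw [hs₁]; simpa using hM
  refine wp_of_spec (spec_appendUnmarked h (hs.keep k1) (a := 30) (y := 51) (v := v) (l := [v])
    (by norm_num) (by norm_num) (k1.lit h51) (by simp [m1]) l1 (by simp [hs₁]) (by simp; omega)) ?_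
  rintro k₂ s₂ hk₂ ⟨a2, k2, l₁, n1, e1, r1, r2⟩
  have k2' : Keep 55 [] [4, 30] s s₂ := k1.trans k2 (by norm_num) (by simp) (by simp)
  have e51 : s₂.var 51 = v := k2'.lit h51
  simp only [e51]
  norm_num
  refine ⟨by omega, by omega, ?_⟩
  set s₃ := (s₂.setVar 55 0).setArr 4 v 1 with hs₃
  have k3 : Keep 55 [] [4, 30] s s₃ := by simpa [hs₃] using k2'
  have m3 : s₃.arr 4 = fun j => if j = (v : ℕ) then 1 else 0 := by
    rw [hs₃]; funext j
    simp [k2.2 4 (by simp), m1, Function.update_apply]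
  refine wp_of_spec (spec_markRow h (hs.keep k3) (y := 51) (o := 55) (v := v) (off := 0) (k := 1)
    (by norm_num) (k3.lit h51) (by norm_num) (by simp [hs₃]) (by omega) le_rfl) ?_
  rintro k₄ s₄ hk₄ ⟨a4, k4, m4⟩
  have k4' : Keep 55 [] [4, 30] s s₄ := k3.trans k4 (by norm_num) (by simp) (by simp)
  have m4' : s₄.arr 4 = fun j => if (∃ x ∈ nb G d v, j = (x : ℕ)) ∨ j = (v : ℕ) then 1 else 0 := by
    rw [m4, m3]; funext j
    by_cases hj : ∃ x ∈ nb G d v, j = (x : ℕ)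
    · simp only [zero_add, if_pos hj, if_pos (Or.inl hj)]
    · simp only [zero_add, hj, if_false, false_or]
  have len1 : l₁.length ≤ t + 1 := by
    rw [← List.toFinset_card_of_nodup n1]
    refine (Finset.card_le_card fun y hy => ?_).trans (h.card_nb_le v)
    exact ((e1 y).1 (by simpa using hy)).1
  have r1' : Lst s₄ 30 ([v] ++ l₁) := r1.congr (by rw [k4.2 30 (by simp), hs₃]; simp)
  refine wp_of_spec (spec_appendUnmarked h a4 (a := 30) (y := 54) (v := u) (l := [v] ++ l₁)
    (by norm_num) (by norm_num) (k4'.lit h54) (fun j => by rw [m4']; dsimp only; split_ifs <;> omega)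
    r1' (by rw [k4.1 150 (by norm_num) (by simp), hs₃]; simpa using r2) (by simp; omega)) ?_
  rintro k₅ s₅ hk₅ ⟨a5, k5, l₂, n2, e2, r3, r4⟩
  have k5' : Keep 55 [] [4, 30] s s₅ := k4'.trans k5 (by norm_num) (by simp) (by simp)
  have e55 : s₅.var 55 = 0 := k5.lit (k4.lit (by simp [hs₃]))
  refine wp_of_spec (spec_markRow h a5 (y := 51) (o := 55) (v := v) (off := 0) (k := 0)
    (by norm_num) (k5'.lit h51) (by norm_num) e55 (by omega) (by omega)) ?_
  rintro k₆ s₆ hk₆ ⟨a6, k6, m6⟩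
  have k6' : Keep 55 [] [4, 30] s s₆ := k5'.trans k6 (by norm_num) (by simp) (by simp)
  have e51' : s₆.var 51 = v := k6'.lit h51
  have e150 : s₆.var 150 = ([v] ++ l₁ ++ l₂).length := k6.lit r4
  have len2 : l₂.length ≤ t + 1 := by
    rw [← List.toFinset_card_of_nodup n2]
    refine (Finset.card_le_card fun y hy => ?_).trans (h.card_nb_le u)
    exact ((e2 y).1 (by simpa using hy)).1
  have e2' : ∀ x, x ∈ l₂ ↔ x ∈ nb G d u ∧ x ∉ nb G d v ∧ x ≠ v := fun x => by
    have hx : (∃ y ∈ nb G d v, (x : ℕ) = y) ↔ x ∈ nb G d v :=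
      ⟨fun ⟨y, h1, h2⟩ => by rwa [Fin.ext h2], fun h => ⟨x, h, rfl⟩⟩
    rw [e2, m4']
    simp only [hx]
    simp [Fin.ext_iff]
  rw [e51', e150]
  refine ⟨by omega, by simp at len1 len2 ⊢; omega, hQ _ _ (by omega) ⟨?_, ?_, [v] ++ l₁ ++ l₂, ?_, ?_, by simp, ?_⟩⟩
  · simpa using a6
  · refine Keep.restore (a := 4) (by simpa using k6') ?_
    rw [hM]
    funext j
    simp only [Store.setVar_arr, Store.setArr_arr, if_true, m6, k5.2 4 (by simp), m4',
      Function.update_apply, zero_add]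
    by_cases h1 : j = (v : ℕ)
    · rw [if_pos h1]
    · rw [if_neg h1]
      by_cases h2 : ∃ x ∈ nb G d v, j = (x : ℕ)
      · rw [if_pos h2]
      · rw [if_neg h2, if_neg (fun hh => hh.elim h2 h1)]
  · rw [List.nodup_append, List.nodup_append]
    refine ⟨⟨by simp, n1, ?_⟩, n2, ?_⟩
    · rintro a ha b hb rfl
      obtain rfl : a = v := by simpa using ha
      simpa using ((e1 a).1 hb).1
    · rintro a ha b hb rfl
      obtain ⟨h1, h2, h3⟩ := (e2' a).1 hb
      rcases List.mem_append.1 ha with h4 | h4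
      · exact h3 (by simpa using h4)
      · exact h2 ((e1 a).1 h4).1
  · have : Lst s₆ 30 ([v] ++ l₁ ++ l₂) := r3.congr (k6.2 30 (by simp))
    simpa using this
  · intro x
    simp only [List.mem_append, List.mem_singleton, e2', e1, m1]
    tauto

theorem notMem_searchArrays_of_le {x : ℕ} (h : x ≤ 8 ∨ x = 16 ∨ x = 30) : x ∉ searchArrays 2 30 :=
  notMem_searchArrays (by omega) (by norm_num) (by omega)

/-- If there is a `K^p_q` with `v` and `u` in different classes, the surplus of the list is at most
two by `card_two_le`, so two branchings are enough. In any case the list has at most `2 t + 2`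
vertices, which bounds the cost. -/
theorem spec_attempt (h : Ctx G t p q W a₀ a₁ d) {s : Store} (hs : At n t p q a₀ a₁ d s)
    (hT : Tab t p q s) (hM : s.arr 4 = fun _ => 0) {v u : Fin n} (h51 : s.var 51 = v)
    (h54 : s.var 54 = u) (hvu : G.Adj v u) (hdv : d v = 0) (hdu : d u = 0) (h50 : s.var 50 = 0)
    (h6 : s.var 6 = p * q) :
    Spec W attempt (16200 * (3 * t * (3 * t))) s fun s' =>
      Keep 54 [50] attemptArrays s s' ∧
      ((s'.var 50 = 0 ∧ ¬ ∃ f : Fin p × Fin q → Fin n, KF G f ∧ (∀ b, f b ∈ alive n d) ∧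
        ∃ a b, a.1 ≠ b.1 ∧ f a = v ∧ f b = u) ∨ FoundAlive G p q d v s') := by
  have hW₁ := h.le_W₁
  have ht := h.params.1
  have hmm : 9 * t ≤ 3 * t * (3 * t) := by nlinarith
  refine Spec.intro fun Q hQ => ?_
  simp only [attempt, wp_seq, wp_add, Operand.val]
  refine wp_of_spec (spec_gather h hs hM h51 h54) ?_
  rintro k₁ s₁ hk₁ ⟨a1, g1, l, hn, hl, e58, hmem⟩
  have hfin : l.toFinset = nb G d v ∪ nb G d u := by
    ext x
    simp only [List.mem_toFinset, hmem, Finset.mem_union]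
    constructor
    · rintro (rfl | h)
      · exact .inr (by simp [hvu.symm, hdv])
      · exact h
    · exact .inr
  have hcard : l.length = (nb G d v ∪ nb G d u).card := by
    rw [← hfin, List.toFinset_card_of_nodup hn]
  have hlen : l.length ≤ 2 * t + 2 := by
    have := Finset.card_union_le (nb G d v) (nb G d u)
    have := h.card_nb_le v; have := h.card_nb_le u
    omega
  have halive : ∀ x ∈ l, d x = 0 := fun x hx => by
    rcases (hmem x).1 hx with rfl | h | h
    · exact hdv
    · exact (mem_nb.1 h).2
    · exact (mem_nb.1 h).2
  refine wp_of_spec (spec_setRows h a1 hl hn e58 (by omega) le_rfl) ?_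
  rintro k₂ s₂ hk₂ ⟨a2, g2, f58, f6, f4⟩
  have k2 : Keep 55 [] [4, 6, 30] s s₂ := (g1.mono le_rfl (by simp) (by simp)).trans g2 le_rfl
    (by simp) (by simp)
  rw [g1.2 4 (by simp), hM] at f4
  have hrow : ∀ i < l.length, i * n + n ≤ 3 * (n + t + 2) ^ 2 := fun i hi => by
    have : (i + 1) * n ≤ (2 * t + 2) * n := Nat.mul_le_mul_right _ (by omega)
    nlinarith
  have hMat : Mat G t s₂ l := by
    refine ⟨hn, fun x hx => ?_, fun x hx y hy => ?_⟩
    · obtain ⟨i, hi, rfl⟩ := List.mem_iff_getElem.1 hx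
      rw [f6 i hi]; have := hrow i hi; omega
    · obtain ⟨i, hi, rfl⟩ := List.mem_iff_getElem.1 hx
      rw [f6 i hi, f4]
      refine if_congr ⟨?_, fun hadj => ⟨i, hi, y, mem_nb.2 ⟨hadj, halive y hy⟩, rfl⟩⟩ rfl rfl
      rintro ⟨i', hi', x, hx', he⟩
      obtain ⟨rfl, e⟩ := eq_of_mul_add_eq y.2 x.2 he
      rw [Fin.ext e]; exact (mem_nb.1 hx').1
  rw [f58]
  refine ⟨by omega, ?_⟩
  set s₃ := s₂.setVar 100 (l.length + 0) with hs₃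
  have g3 : Keep 59 [] [] s₂ s₃ := by simp [hs₃]
  have k3 : Keep 55 [] [4, 6, 30] s s₃ := k2.trans g3 (by norm_num) (by simp) (by simp)
  have hT₃ : Tab t p q s₃ := hT.keep k3
  refine wp_of_spec (spec_search h 2 (hs.keep k3) (v := v) (a := 30) (b := 100) (l := l)
    (hMat.keep g3 (fun x hx => hx) hn) hT₃ (hl.congr (by rw [g3.2 30 (by simp), g2.2 30 (by simp)]))
    le_rfl (by norm_num) (by simp [hs₃]) (by omega) le_rfl (by norm_num) ((hmem v).2 (.inl rfl))
    (k3.lit h51) (k3.lit h50) (k3.lit h6)) ?_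
  rintro k₄ s₄ hk₄ ⟨g4, r4⟩
  have na : ∀ x, (x ≤ 8 ∨ x = 16 ∨ x = 30) → x ∉ searchArrays 2 30 := fun x hx =>
    notMem_searchArrays_of_le hx
  have a4 := (hs.keep k3).keep g4 (by norm_num) (by simp) (na 0 (by omega)) (na 1 (by omega))
    (na 3 (by omega))
  have l4 : Lst s₄ 30 l := hl.congr (by
    rw [g4.2 30 (na 30 (by omega)), g3.2 30 (by simp), g2.2 30 (by simp)])
  refine wp_of_spec (spec_setRows h a4 l4 hn (g4.lit (g3.lit f58)) (by omega) (Nat.zero_le 1)) ?_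
  rintro k₅ s₅ hk₅ ⟨a5, g5, -, -, m5⟩
  have e4 : s₅.arr 4 = s.arr 4 := by
    rw [m5, g4.2 4 (na 4 (by omega)), g3.2 4 (by simp), f4, hM]
    funext j
    dsimp only
    split_ifs <;> rfl
  have k5 : Keep 54 [50] (4 :: attemptArrays) s s₅ := by
    refine ((k3.mono (B' := 54) (Xs' := [50]) (As' := 4 :: attemptArrays) (by norm_num) (by simp)
      (by simp [attemptArrays])).trans g4 (by norm_num) (by simp) ?_).trans g5 (by norm_num) (by simp)
      (by simp [attemptArrays])
    intro a ha
    simp [searchArrays, List.range'] at ha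
    simp [attemptArrays]; omega
  have e50 : s₅.var 50 = s₄.var 50 := g5.lit rfl
  have e14 : s₅.arr 14 = s₄.arr 14 := g5.2 14 (by simp)
  refine hQ _ _ (by simp only [searchCost] at hk₄; omega) ⟨k5.restore e4, r4.imp ?_ ?_⟩
  · rintro ⟨r1, r2⟩
    refine ⟨by rw [e50, r1], ?_⟩
    rintro ⟨f, hf, hA, a, b, hab, rfl, rfl⟩
    refine r2 (by rw [hcard]; exact card_two_le h hf hA hab) ⟨f, hf, fun c => ?_, a, rfl⟩
    rw [List.mem_toFinset, hmem]
    exact cover_two hf hA hab c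
  · rintro ⟨r1, f, hf, hA, hv, hc⟩
    exact ⟨by rw [e50, r1], f, hf, fun b => halive _ (hA b), hv, fun b => by rw [e14, hc b]⟩

/-- Two neighbours of `v` are tried as partners in another class. By `exists_class_nbr` one of them
is such a partner for any given `K^p_q` through `v`. -/
theorem spec_find (h : Ctx G t p q W a₀ a₁ d) {s : Store} (hs : At n t p q a₀ a₁ d s)
    (hT : Tab t p q s) (hM : s.arr 4 = fun _ => 0) {v : Fin n} (h51 : s.var 51 = v) (hdv : d v = 0)
    (h6 : s.var 6 = p * q) :
    Spec W find (40000 * (3 * t * (3 * t))) s fun s' => Keep 50 [] findArrays s s' ∧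
      ((s'.var 50 = 0 ∧ ¬ ∃ f : Fin p × Fin q → Fin n, KF G f ∧ (∀ b, f b ∈ alive n d) ∧
        ∃ a, f a = v) ∨ FoundAlive G p q d v s') := by
  have hW₁ := h.le_W₁
  have hW₂ := h.le_W₂
  have ht := h.params.1
  have hmm : 9 * t ≤ 3 * t * (3 * t) := by nlinarith
  refine Spec.intro fun Q hQ => ?_
  simp only [find, wp_seq, wp_add, Operand.val]
  refine ⟨by omega, by omega, ?_⟩
  set s₁ := (s.setVar 50 (0 + 0)).setVar 150 (0 + 0) with hs₁
  have k1 : Keep 50 [] [] s s₁ := by simp [hs₁]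
  have k1' : Keep 54 [50] [] s s₁ := by simp [hs₁]
  refine wp_of_spec (spec_appendUnmarked h (hs.keep k1) (a := 7) (y := 51) (v := v) (l := [])
    (by norm_num) (by norm_num) (k1'.lit h51) (by simp [hs₁, hM]) (by simp [Lst]) (by simp [hs₁])
    (by simp)) ?_
  rintro k₂ s₂ hk₂ ⟨a2, g2, l, hn, hmem, hl, e150⟩
  simp only [List.nil_append] at hl e150
  have k2 : Keep 50 [] findArrays s s₂ := (k1.mono le_rfl (by simp) (by simp)).trans g2 (by norm_num)
    (by simp) (by simp [findArrays, attemptArrays])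
  have e51 : s₂.var 51 = v := g2.lit (k1'.lit h51)
  have e50 : s₂.var 50 = 0 := g2.lit (by simp [hs₁])
  have hmem' : ∀ x, x ∈ l ↔ x ∈ nb G d v := fun x => by rw [hmem]; simp [hs₁, hM]
  have hlen : l.length ≤ t + 1 := by
    rw [← List.toFinset_card_of_nodup hn]
    exact (Finset.card_le_card fun y hy => (hmem' y).1 (by simpa using hy)).trans (h.card_nb_le v)
  rw [e150]
  refine ⟨by omega, ?_⟩
  refine wp_of_spec (spec_forTo (N := .lit 2) (m := 2) (T := 16200 * (3 * t * (3 * t)) + 3)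
    (Inv := fun i s' => Keep 50 [] findArrays s s' ∧ s'.var 53 = i ∧ s'.var 51 = v ∧
      s'.var 52 = l.length ∧ Lst s' 7 l ∧
      ((s'.var 50 = 0 ∧ ∀ i', ∀ hi : i' < l.length, i' < i → ¬ ∃ f : Fin p × Fin q → Fin n, KF G f ∧
        (∀ b, f b ∈ alive n d) ∧ ∃ a b, a.1 ≠ b.1 ∧ f a = v ∧ f b = l[i']) ∨
        FoundAlive G p q d v s')) (by omega) (fun j s' h => ⟨h.2.1, rfl⟩) ?_ ?_) ?_
  · rintro i hi s₃ ⟨f1, f2, f3, f4, f5, f6⟩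
    refine Spec.intro fun Q hQ => ?_
    simp only [wp_ite, wp_seq, wp_load, wp_skip, Operand.val, f2, f4]
    have fin : ∀ s₄, Keep 54 [50] attemptArrays s₃ s₄ →
        ((s₄.var 50 = 0 ∧ ∀ i', ∀ hi : i' < l.length, i' < i + 1 → ¬ ∃ f : Fin p × Fin q → Fin n, KF G f ∧
        (∀ b, f b ∈ alive n d) ∧ ∃ a b, a.1 ≠ b.1 ∧ f a = v ∧ f b = l[i']) ∨
        FoundAlive G p q d v s₄) → s₄.var 53 = i ∧
        (Keep 50 [] findArrays s (s₄.setVar 53 (i + 1)) ∧ (s₄.setVar 53 (i + 1)).var 53 = i + 1 ∧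
          (s₄.setVar 53 (i + 1)).var 51 = v ∧ (s₄.setVar 53 (i + 1)).var 52 = l.length ∧
          Lst (s₄.setVar 53 (i + 1)) 7 l ∧
        (((s₄.setVar 53 (i + 1)).var 50 = 0 ∧ ∀ i', ∀ hi : i' < l.length, i' < i + 1 →
          ¬ ∃ f : Fin p × Fin q → Fin n, KF G f ∧
        (∀ b, f b ∈ alive n d) ∧ ∃ a b, a.1 ≠ b.1 ∧ f a = v ∧ f b = l[i']) ∨
        FoundAlive G p q d v (s₄.setVar 53 (i + 1)))) := by
      intro s₄ g4 hd
      refine ⟨g4.lit f2, ?_, by simp, by simpa using g4.lit f3, by simpa using g4.lit f4,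
        f5.congr (g4.2 7 (by simp [attemptArrays])), ?_⟩
      · rw [Keep.setVar_iff (by simp)]
        exact f1.trans g4 (by norm_num) (by simp) (by simp [findArrays, attemptArrays])
      · exact hd.imp (fun ⟨r1, r2⟩ => ⟨by simpa using r1, r2⟩)
          fun ⟨r1, r2⟩ => ⟨by simpa using r1, r2⟩
    refine ⟨fun hil => ⟨fun h50 => ?_, fun h50 => ?_⟩, fun hil => ?_⟩
    · have hli := (l[i]).2
      have hadj := mem_nb.1 ((hmem' l[i]).1 (List.getElem_mem _))
      rw [f5 i hil]
      refine ⟨by omega, by omega, ?_⟩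
      have k4 : Keep 54 [] [] s₃ (s₃.setVar 54 l[i]) := by simp
      have k4' : Keep 50 [] findArrays s (s₃.setVar 54 l[i]) := by
        rw [Keep.setVar_iff (by simp)]; exact f1
      refine wp_of_spec (spec_attempt h (hs.keep k4' (by norm_num) (by simp) (by simp [findArrays, attemptArrays])
        (by simp [findArrays, attemptArrays]) (by simp [findArrays, attemptArrays])) (hT.keep k4' (by simp [findArrays, attemptArrays])
        (by simp [findArrays, attemptArrays])) (v := v) (u := l[i]) (by rw [k4'.2 4 (by simp [findArrays, attemptArrays]), hM])
        (k4.lit f3) (by simp) hadj.1 hdv hadj.2 (by simp; omega) (k4'.lit h6)) ?_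
      rintro k₅ s₅ hk₅ ⟨g5, r5⟩
      refine hQ _ _ (by omega) (fin s₅ ((k4.mono le_rfl (by simp) (by simp)).trans g5 le_rfl
        (by simp) (by simp)) (r5.imp_left fun ⟨r1, r2⟩ => ⟨r1, fun i' hi' hlt => ?_⟩))
      by_cases hii : i' = i
      · subst hii; exact r2
      · refine (f6.resolve_right fun h => ?_).2 i' hi' (by omega)
        have := h.1; omega
    · refine hQ _ _ (by omega) (fin s₃ Keep.refl (.inr ?_))
      refine f6.resolve_left fun h => ?_
      omega
    · refine hQ _ _ (by omega) (fin s₃ Keep.refl (f6.imp_left fun ⟨r1, r2⟩ => ⟨r1, ?_⟩))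
      intro i' hi' _
      exact r2 i' hi' (by omega)
  · refine ⟨by simpa using k2, by simp, by simpa using e51, by simp, by simpa using hl,
      .inl ⟨by simpa using e50, by simp⟩⟩
  · rintro k' s' hk' ⟨f1, -, -, -, -, f6⟩
    refine hQ _ _ (by omega) ⟨f1, f6.imp_left fun ⟨r1, r2⟩ => ⟨r1, ?_⟩⟩
    rintro ⟨f, hf, hA, a, rfl⟩
    have h2 : 2 ≤ l.length := by
      have : t ≤ (nb G d (f a)).card := by
        rw [← card_other h.params a, ← Finset.card_image_of_injective _ hf.1]
        refine Finset.card_le_card fun x hx => ?_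
        obtain ⟨c, hc, rfl⟩ := Finset.mem_image.1 hx
        have := hA c
        simp only [alive, Set.mem_ofPred_eq] at this
        simp [this, hf.2 _ _ (Finset.mem_filter.1 hc).2.symm]
      have e : l.toFinset = nb G d (f a) := by ext x; rw [List.mem_toFinset, hmem']
      rw [← e, List.toFinset_card_of_nodup hn] at this
      omega
    have hne : l[0] ≠ l[1] := fun h' => by simpa using (List.Nodup.getElem_inj_iff hn).1 h'
    obtain ⟨b, hb, hbx⟩ := exists_class_nbr h.params h.bounded hf hne
      (mem_nb.1 ((hmem' l[0]).1 (List.getElem_mem _))).1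
      (mem_nb.1 ((hmem' l[1]).1 (List.getElem_mem _))).1
    rcases hbx with hb' | hb'
    · exact r2 0 (by omega) (by norm_num) ⟨f, hf, hA, a, b, hb.symm, rfl, hb'⟩
    · exact r2 1 (by omega) (by norm_num) ⟨f, hf, hA, a, b, hb.symm, rfl, hb'⟩

/-! ## Tables -/

/-- Set up the tables of the identity and of the quotients by `q`, and the number `p q`. -/
def tables : Program :=
  .seq (.add 6 (.var 1) (.var 3)) (.seq (.add 10 (.var 1) (.var 1)) (.seq (.add 10 (.var 10) (.var 1))
  (.seq (forTo 11 (.var 10) (.store 8 (.var 11) (.var 11))) (.seq (.add 12 (.lit 0) (.lit 0))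
    (forTo 11 (.var 2) (forTo 13 (.var 3) (.seq (.store 16 (.var 12) (.var 11))
      (.add 12 (.var 12) (.lit 1)))))))))

/-- Write a number to the output. -/
def emit (u : Operand) : Program := .seq (.store 2 (.var 7) u) (.add 7 (.var 7) (.lit 1))

/-- The output consists of the numbers on the list. -/
def Out (s : Store) (l : List ℕ) : Prop :=
  s.var 7 = l.length ∧ ∀ i (h : i < l.length), s.arr 2 i = l[i]

/-- The machine cannot multiply or divide: `p q` is computed as `t + q`, and the quotients by `q`
are written by a double loop. -/
theorem spec_tables (h : Ctx G t p q W a₀ a₁ d) {s : Store} (hs : At n t p q a₀ a₁ d s) :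
    Spec W tables (100 * t) s fun s' => Keep 10 [6] [8, 16] s s' ∧ s'.var 6 = p * q ∧ Tab t p q s' := by
  have hW₁ := h.le_W₁
  have ht := At.q_le h
  have hpq := KF.pq h.params
  refine Spec.intro fun Q hQ => ?_
  simp only [tables, wp_seq, wp_add, Operand.val, hs.var_t, hs.var_q, Store.setVar_var]
  norm_num
  refine ⟨by omega, by omega, by omega, ?_⟩
  set s₁ := ((s.setVar 6 (t + q)).setVar 10 (t + t)).setVar 10 (t + t + t) with hs₁
  refine wp_of_spec (spec_forTo (N := .var 10) (m := t + t + t) (T := 1) (Inv := fun i s' =>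
    Keep 10 [] [8] s₁ s' ∧ s'.var 11 = i ∧ s'.var 10 = t + t + t ∧ ∀ i' < i, s'.arr 8 i' = i')
    (by omega) (fun j s' h => ⟨h.2.1, h.2.2.1⟩) ?_ ⟨by simp, by simp, by simp [hs₁], by simp⟩) ?_
  · rintro i hi s₂ ⟨f1, f2, f3, f4⟩
    refine Spec.intro fun Q hQ => ?_
    simp only [wp_store, Operand.val, f2]
    refine ⟨by omega, by omega, hQ _ _ (by omega) ⟨by simpa using f2, by simpa using f1, by simp,
      by simpa using f3, fun i' hi' => ?_⟩⟩
    simp only [Store.setVar_arr, Store.setArr_arr, if_true, Function.update_apply]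
    split_ifs with hc
    · exact hc.symm
    · exact f4 i' (by omega)
  rintro k₂ s₂ hk₂ ⟨f1, -, -, f4⟩
  have e2 : s₂.var 2 = p := f1.lit (by simp [hs₁, hs.var_p])
  have e3 : s₂.var 3 = q := f1.lit (by simp [hs₁, hs.var_q])
  have e6 : s₂.var 6 = p * q := f1.lit (by simp [hs₁, hpq])
  have hstep : ∀ i < p, i * q + q ≤ p * q := fun i hi => by
    have : (i + 1) * q ≤ p * q := Nat.mul_le_mul_right _ hi
    rwa [add_mul, one_mul] at this
  have hcost : p * (q * 4 + 2 + 2) ≤ 12 * t + 4 := by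
    have : p * (q * 4 + 2 + 2) = 4 * (p * q) + 4 * p := by ring
    omega
  refine wp_of_spec (spec_forTo (N := .var 2) (W := W) (m := p) (T := q * 4 + 2) (Inv := fun i s' =>
    Keep 10 [] [16] s₂ s' ∧ s'.var 11 = i ∧ s'.var 12 = i * q ∧
      ∀ i' < i * q, s'.arr 16 i' = i' / q) (by omega)
    (fun j s' h => ⟨h.2.1, h.1.lit e2⟩) ?_ ?_) ?_
  · rintro i hi s₃ ⟨g1, g2, g3, g4⟩
    have := hstep i hi
    refine (spec_forTo (N := .var 3) (m := q) (T := 2) (Inv := fun j s' =>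
      Keep 10 [] [16] s₂ s' ∧ s'.var 11 = i ∧ s'.var 13 = j ∧ s'.var 12 = i * q + j ∧
        ∀ i' < i * q + j, s'.arr 16 i' = i' / q) (by omega)
      (fun j s' h => ⟨h.2.2.1, h.1.lit e3⟩) ?_ ⟨by simpa using g1, by simpa using g2, by simp,
        by simpa using g3, by simpa using g4⟩).mono le_rfl ?_
    · rintro j hj s₄ ⟨k1, k2, k3, k4, k5⟩
      refine Spec.intro fun Q hQ => ?_
      simp only [wp_store, wp_seq, wp_add, Operand.val, k4, Store.setArr_var, k2]
      refine ⟨by omega, by omega, by omega, hQ _ _ (by omega) ⟨by simpa using k3, by simpa using k1,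
        by simpa using k2, by simp, by simp; omega, fun i' hi' => ?_⟩⟩
      simp only [Store.setVar_arr, Store.setArr_arr, if_true, Function.update_apply]
      split_ifs with hc
      · rw [hc, div_of_lt hj]
      · exact k5 i' (by omega)
    · rintro s' ⟨k1, k2, -, k4, k5⟩
      refine ⟨k2, by simpa using k1, by simp, by simp [k4, add_mul], ?_⟩
      rw [add_mul, one_mul]
      exact k5
  · exact ⟨by simp, by simp, by simp, by simp⟩
  · rintro k₃ s₃ hk₃ ⟨g1, -, -, g4⟩
    have g : Keep 10 [] [8, 16] s₁ s₃ := (f1.mono le_rfl (by simp) (by simp)).trans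
      (Keep.trans (Xs := []) (As := [16]) (by simp) g1 le_rfl (by simp) (by simp)) le_rfl (by simp)
      (by simp)
    refine hQ _ _ (by omega) ⟨Keep.trans (by simp [hs₁]) g (by norm_num) (by simp) (by simp),
      g1.lit (by simpa using e6), fun i hi => ?_, g4⟩
    rw [g1.2 8 (by simp)]
    exact f4 i (by omega)

theorem Out.snoc {s s' : Store} {l : List ℕ} (h : Out s l) {x : ℕ} (h7 : s'.var 7 = s.var 7 + 1)
    (ha : s'.arr 2 = Function.update (s.arr 2) (s.var 7) x) : Out s' (l ++ [x]) := by
  refine ⟨by rw [h7, h.1]; simp, fun i hi => ?_⟩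
  rw [ha, h.1, Function.update_apply]
  simp at hi
  split_ifs with hc
  · subst hc; simp
  · rw [h.2 i (by omega), List.getElem_append_left (by omega)]

theorem Out.congr {s s' : Store} {l : List ℕ} (h : Out s l) (h7 : s'.var 7 = s.var 7)
    (ha : s'.arr 2 = s.arr 2) : Out s' l :=
  ⟨by rw [h7, h.1], fun i hi => by rw [ha, h.2 i hi]⟩

theorem Out.keep {s s' : Store} {l : List ℕ} (h : Out s l) {B : ℕ} {Xs As : List ℕ}
    (hk : Keep B Xs As s s') (hB : 7 < B := by norm_num) (hX : 7 ∉ Xs := by simp)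
    (hA : 2 ∉ As := by simp) : Out s' l :=
  h.congr (hk.lit rfl hB hX) (hk.2 2 hA)

/-- A length that precedes its list is written as a placeholder and corrected when the list is
complete. -/
theorem Out.fill {s s' : Store} {l m : List ℕ} {x k : ℕ} (h : Out s (l ++ x :: m))
    (h7 : s'.var 7 = s.var 7) (ha : s'.arr 2 = Function.update (s.arr 2) l.length k) :
    Out s' (l ++ k :: m) := by
  refine ⟨by rw [h7, h.1]; simp, fun i hi => ?_⟩
  rw [ha, Function.update_apply]
  simp at hi
  split_ifs with hc
  · subst hc; simp
  · rw [h.2 i (by simpa using hi)]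
    rcases Nat.lt_or_ge i l.length with h1 | h1
    · rw [List.getElem_append_left h1, List.getElem_append_left h1]
    · obtain ⟨j, rfl⟩ : ∃ j, i = l.length + (j + 1) := ⟨i - l.length - 1, by omega⟩
      simp [List.getElem_append_right]

@[simp] theorem Out.setVar_iff {s : Store} {l : List ℕ} {x k : ℕ} (hx : x ≠ 7) :
    Out (s.setVar x k) l ↔ Out s l := by
  simp [Out, Ne.symm hx]

theorem wp_emit {s : Store} {u : Operand} {k : ℕ} {Q : ℕ → Store → Prop} {l : List ℕ}
    (hl : Out s l) (hW : l.length < W) (hu : u.val s ≤ W)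
    (hQ : ∀ s', Keep 1000 [7] [2] s s' → Out s' (l ++ [u.val s]) → Q (k + 2) s') :
    wp W (emit u) s k Q := by
  simp only [emit, wp_seq, wp_store, wp_add, Operand.val, Store.setArr_var, hl.1]
  refine ⟨by omega, hu, by omega, hQ _ (by simp) (hl.snoc (by simp [hl.1]) (by simp [hl.1]))⟩

/-! ## Reporting the `K^p_q`'s that meet a given one -/

/-- Write `k` into the cells of array `4` that belong to the vertices of the `K^p_q`. -/
def markBase (k : ℕ) : Program :=
  forTo 60 (.var 6) (.seq (.load 61 14 (.var 60)) (.store 4 (.var 61) (.lit k)))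

/-- Record the neighbour outside (in variable `62`) and the number of neighbours inside. -/
def storeExtra : Program :=
  .seq (.store 18 (.var 60) (.var 62)) (.seq (.add 63 (.var 0) (.lit 1))
  (.seq (.sub 63 (.var 63) (.var 62)) (.seq (.store 17 (.var 60) (.var 63))
  (.seq (countMarked 61) (.store 19 (.var 60) (.var 150))))))

/-- Compute for every vertex of the `K^p_q` its neighbour outside (plus `1`, or `0` if there is none)
in array `18`, the difference of `n + 1` and this number in array `17`, and the number of the
neighbours inside in array `19`. -/
def extras : Program :=
  forTo 60 (.var 6) (.seq (.load 61 14 (.var 60)) (.seq (.add 150 (.lit 0) (.lit 0))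
  (.seq (appendUnmarked 20 61) (.seq (.add 62 (.lit 0) (.lit 0))
  (.seq (.ite (.lit 0) (.var 150) (.seq (.load 62 20 (.lit 0)) (.add 62 (.var 62) (.lit 1))) .skip)
    storeExtra)))))

/-- The vertex `y` is not removed, and it is a neighbour of `v` outside the range of `f`. -/
def Extra (G : SimpleGraph (Fin n)) (d : ℕ → ℕ) (f : Fin p × Fin q → Fin n) (v y : Fin n) : Prop :=
  d y = 0 ∧ (∀ c, f c ≠ y) ∧ G.Adj v y

/-- The numbering of the positions class by class, as in array `14`. The remainders only make the
map total. -/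
theorem exists_enum (hp : 0 < p) (hq : 0 < q) : ∃ w : ℕ → Fin p × Fin q,
    (∀ r < p * q, ((w r).1 : ℕ) * q + (w r).2 = r) ∧ (∀ r < p * q, ((w r).1 : ℕ) = r / q) ∧
    ∀ b : Fin p × Fin q, w ((b.1 : ℕ) * q + b.2) = b := by
  refine ⟨fun r => (⟨r / q % p, Nat.mod_lt _ hp⟩, ⟨r % q, Nat.mod_lt _ hq⟩), fun r hr => ?_,
    fun r hr => ?_, fun b => ?_⟩
  · have : r / q < p := Nat.div_lt_of_lt_mul (by rwa [mul_comm])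
    simp only [Nat.mod_eq_of_lt this]
    exact Nat.div_add_mod' r q
  · have : r / q < p := Nat.div_lt_of_lt_mul (by rwa [mul_comm])
    simp only [Nat.mod_eq_of_lt this]
  · have h1 := b.1.2
    refine Prod.ext (Fin.ext ?_) (Fin.ext ?_)
    · simp only [div_of_lt b.2.2, Nat.mod_eq_of_lt h1]
    · simp [Nat.mod_eq_of_lt b.2.2]

theorem spec_markBase (h : Ctx G t p q W a₀ a₁ d) {s : Store} {g : ℕ → Fin n}
    (h6 : s.var 6 = p * q) (hg : ∀ r < p * q, s.arr 14 r = g r) {k : ℕ} (hk : k ≤ 1) :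
    Spec W (markBase k) (10 * t) s fun s' => Keep 60 [] [4] s s' ∧
      s'.arr 4 = fun j => if ∃ r < p * q, j = (g r : ℕ) then k else s.arr 4 j := by
  have hW₁ := h.le_W₁
  have ht := At.q_le h
  have hpq := KF.pq h.params
  refine (spec_forTo (N := .var 6) (m := p * q) (T := 2) (Inv := fun i s' =>
    Keep 60 [] [4] s s' ∧ s'.var 60 = i ∧
      s'.arr 4 = fun j => if ∃ r < i, j = (g r : ℕ) then k else s.arr 4 j) (by omega)
    (fun j s' h => ⟨h.2.1, h.1.lit h6⟩) ?_ ⟨by simp, by simp, by simp⟩).mono (by omega) ?_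
  · rintro i hi s₁ ⟨f1, f2, f3⟩
    have hgi := (g i).2
    have ei : s₁.arr 14 i = g i := by rw [f1.2 14 (by simp), hg i hi]
    refine Spec.intro fun Q hQ => ?_
    simp only [wp_seq, wp_load, wp_store, Operand.val, f2, ei, Store.setVar_var, if_true]
    refine ⟨by omega, by omega, by omega, by omega, hQ _ _ (by omega) ⟨by simpa using f2,
      by simpa using f1, by simp, ?_⟩⟩
    funext j
    simp only [Store.setVar_arr, Store.setArr_arr, if_true, Function.update_apply, f3]
    by_cases h1 : j = (g i : ℕ)
    · rw [if_pos h1, if_pos ⟨i, by omega, h1⟩]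
    · rw [if_neg h1]
      refine if_congr ⟨fun ⟨r, h2, h3⟩ => ⟨r, by omega, h3⟩, fun ⟨r, h2, h3⟩ => ⟨r, ?_, h3⟩⟩ rfl rfl
      have : r ≠ i := by rintro rfl; exact h1 h3
      omega
  · rintro s' ⟨f1, -, f3⟩
    exact ⟨f1, f3⟩

/-- The `t` vertices of the other classes are neighbours of `f a` anyway; a further neighbour inside
must be in the class of `f a`. -/
theorem card_filter_range_gt (hP : Params t p q) {f : Fin p × Fin q → Fin n} (hf : KF G f)
    (hA : ∀ b, f b ∈ alive n d) (a : Fin p × Fin q) :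
    t < ((nb G d (f a)).filter fun x => ∃ c, f c = x).card ↔ Free G f (f a) := by
  classical
  have hd : ∀ c, d (f c) = 0 := hA
  have hco := card_other hP a
  rw [← Finset.card_image_of_injective _ hf.1] at hco
  have hsub : (Finset.univ.filter fun b : Fin p × Fin q => b.1 ≠ a.1).image f ⊆
      (nb G d (f a)).filter fun x => ∃ c, f c = x := fun x hx => by
    obtain ⟨c, hc, rfl⟩ := Finset.mem_image.1 hx
    simp only [Finset.mem_filter, Finset.mem_univ, true_and] at hc
    simp [hd c, hf.2 a c (Ne.symm hc)]
  constructor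
  · intro hlt
    by_contra hno
    have : (nb G d (f a)).filter (fun x => ∃ c, f c = x) ⊆
        (Finset.univ.filter fun b : Fin p × Fin q => b.1 ≠ a.1).image f := fun x hx => by
      obtain ⟨h1, c, rfl⟩ := Finset.mem_filter.1 hx
      refine Finset.mem_image.2 ⟨c, ?_, rfl⟩
      simp only [Finset.mem_filter, Finset.mem_univ, true_and]
      intro hca
      exact hno ⟨a, c, by rintro rfl; simp at h1, hca.symm, rfl, (mem_nb.1 h1).1⟩
    have := Finset.card_le_card this
    omega
  · rintro ⟨a', c, hac, hcl, he, hadj⟩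
    obtain rfl := hf.1 he
    rw [← hco]
    refine Finset.card_lt_card ⟨hsub, fun hle => ?_⟩
    have : f c ∈ (nb G d (f a')).filter fun x => ∃ c, f c = x := by simp [hd c, hadj]
    obtain ⟨c', hc', he'⟩ := Finset.mem_image.1 (hle this)
    obtain rfl := hf.1 he'
    simp only [Finset.mem_filter, Finset.mem_univ, true_and] at hc'
    exact hc' hcl.symm

theorem spec_storeExtra (h : Ctx G t p q W a₀ a₁ d) {s : Store} (hs : At n t p q a₀ a₁ d s)
    {i e : ℕ} {v : Fin n} (h60 : s.var 60 = i) (h61 : s.var 61 = v) (h62 : s.var 62 = e) (hi : i ≤ W)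
    (he : e ≤ n) (h4 : ∀ j, s.arr 4 j ≤ 1) :
    Spec W storeExtra (20 * t + 30) s fun s' => Keep 62 [] [17, 18, 19] s s' ∧
      s'.arr 18 = Function.update (s.arr 18) i e ∧
      s'.arr 17 = Function.update (s.arr 17) i (n + 1 - e) ∧
      s'.arr 19 = Function.update (s.arr 19) i
        ((nb G d v).filter fun x : Fin n => s.arr 4 x ≠ 0).card := by
  have hW₁ := h.le_W₁
  refine Spec.intro fun Q hQ => ?_
  simp only [storeExtra, wp_seq, wp_store, wp_add, wp_sub, Operand.val, Store.setVar_var,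
    Store.setArr_var, h60, h62, hs.var_n]
  norm_num
  refine ⟨by omega, by omega, by omega, by omega, by omega, by omega, ?_⟩
  set s₅ := ((((s.setArr 18 i e).setVar 63 (n + 1)).setVar 63 (n + 1 - e)).setArr 17 i
    (n + 1 - e)) with hs₅
  have k5 : Keep 62 [] [17, 18, 19] s s₅ := by simp [hs₅]
  have m5 : s₅.arr 4 = s.arr 4 := k5.2 4 (by simp)
  refine wp_of_spec (spec_countMarked h (hs.keep k5) (y := 61) (v := v) (by norm_num)
    (by simp [hs₅, h61]) (by rw [m5]; exact h4)) ?_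
  rintro k₆ s₆ hk₆ ⟨a6, g6, e6⟩
  have e60 : s₆.var 60 = i := g6.lit (by simp [hs₅, h60])
  rw [m5] at e6
  have hle : ((nb G d v).filter fun x : Fin n => s.arr 4 x ≠ 0).card ≤ t + 1 :=
    (Finset.card_filter_le _ _).trans (h.card_nb_le _)
  rw [e60, e6]
  refine ⟨by omega, by omega, hQ _ _ (by omega) ⟨?_, ?_, ?_, ?_⟩⟩
  · simpa using k5.trans g6 (by norm_num) (by simp) (by simp)
  · simp [g6.2 18 (by simp), hs₅]
  · simp [g6.2 17 (by simp), hs₅]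
  · simp [g6.2 19 (by simp), hs₅]

/-- One cell per vertex is enough for the neighbours outside, because by `no_two_extra` there is at
most one. The shift by one frees the value `0` for the case that there is none. -/
theorem spec_extras (h : Ctx G t p q W a₀ a₁ d) {s : Store} (hs : At n t p q a₀ a₁ d s)
    {f : Fin p × Fin q → Fin n} (hf : KF G f) (hA : ∀ b, f b ∈ alive n d) {w : ℕ → Fin p × Fin q}
    (h6 : s.var 6 = p * q) (hg : ∀ r < p * q, s.arr 14 r = f (w r)) (h4 : ∀ j, s.arr 4 j ≤ 1)
    (hm : ∀ x : Fin n, s.arr 4 x = 0 ↔ ∀ c, f c ≠ x) :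
    Spec W extras (500 * (3 * t * (3 * t))) s fun s' => Keep 60 [] [17, 18, 19, 20] s s' ∧
      ∀ r < p * q, s'.arr 18 r ≤ n ∧ s'.arr 17 r = n + 1 - s'.arr 18 r ∧
        (∀ y : Fin n, s'.arr 18 r = y + 1 ↔ Extra G d f (f (w r)) y) ∧ s'.arr 19 r ≤ W ∧
        (t < s'.arr 19 r ↔ Free G f (f (w r))) := by
  have hW₁ := h.le_W₁
  have ht := At.q_le h
  have hpq := KF.pq h.params
  have hcost : p * q * (40 * t + 60 + 2) + 2 ≤ 500 * (3 * t * (3 * t)) := by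
    have : p * q * (40 * t + 60 + 2) ≤ 2 * t * (40 * t + 62) := Nat.mul_le_mul_right _ (by omega)
    nlinarith
  refine (spec_forTo (N := .var 6) (m := p * q) (T := 40 * t + 60) (Inv := fun i s' =>
    Keep 60 [] [17, 18, 19, 20] s s' ∧ s'.var 60 = i ∧ ∀ r < i, s'.arr 18 r ≤ n ∧
        s'.arr 17 r = n + 1 - s'.arr 18 r ∧
        (∀ y : Fin n, s'.arr 18 r = y + 1 ↔ Extra G d f (f (w r)) y) ∧ s'.arr 19 r ≤ W ∧
        (t < s'.arr 19 r ↔ Free G f (f (w r)))) (by omega)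
    (fun j s' h => ⟨h.2.1, h.1.lit h6⟩) ?_ ⟨by simp, by simp, by simp⟩).mono hcost ?_
  · rintro i hi s₁ ⟨f1, f2, f3⟩
    have hgi := (f (w i)).2
    have ei : s₁.arr 14 i = f (w i) := by rw [f1.2 14 (by simp), hg i hi]
    have e0 : s₁.var 0 = n := f1.lit hs.var_n
    refine Spec.intro fun Q hQ => ?_
    simp only [wp_seq, wp_load, wp_add, Operand.val, f2, ei]
    refine ⟨by omega, by omega, by omega, ?_⟩
    set s₂ := (s₁.setVar 61 (f (w i))).setVar 150 (0 + 0) with hs₂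
    have k2 : Keep 60 [] [17, 18, 19, 20] s s₂ := by simpa [hs₂] using f1
    have k2' : Keep 61 [] [] s₁ s₂ := by simp [hs₂]
    have m2 : s₂.arr 4 = s.arr 4 := k2.2 4 (by simp)
    refine wp_of_spec (spec_appendUnmarked h (hs.keep k2) (a := 20) (y := 61) (v := f (w i)) (l := [])
      (by norm_num) (by norm_num) (by simp [hs₂]) (by rw [m2]; exact h4) (by simp [Lst]) (by simp [hs₂])
      (by simp)) ?_
    rintro k₃ s₃ hk₃ ⟨a3, g3, l, hn, hmem, hl, e150⟩
    simp only [List.nil_append] at hl e150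
    have hmem' : ∀ x, x ∈ l ↔ Extra G d f (f (w i)) x := fun x => by
      rw [hmem, m2, hm, mem_nb, Extra]; tauto
    have k3 : Keep 61 [] [20] s₁ s₃ := (k2'.mono le_rfl (by simp) (by simp)).trans g3 (by norm_num)
      (by simp) (by simp)
    have k3' : Keep 60 [] [17, 18, 19, 20] s s₃ := k2.trans g3 (by norm_num) (by simp) (by simp)
    have e61 : s₃.var 61 = f (w i) := g3.lit (by simp [hs₂])
    have e60 : s₃.var 60 = i := k3.lit f2
    have n3 : s₃.var 0 = n := k3.lit e0
    have main : ∀ e s₄ k₄, k₄ ≤ 20 * t + 30 → Keep 62 [] [] s₃ s₄ → s₄.var 62 = e → e ≤ n →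
        (∀ y : Fin n, e = y + 1 ↔ Extra G d f (f (w i)) y) →
        wp W storeExtra s₄ k₄ Q := by
      intro e s₄ k₄ hk₄ g4 e62 he hy
      have k4 : Keep 60 [] [17, 18, 19, 20] s s₄ := k3'.trans g4 (by norm_num) (by simp) (by simp)
      have e60' : s₄.var 60 = i := g4.lit e60
      have e61' : s₄.var 61 = f (w i) := g4.lit e61
      have m4 : s₄.arr 4 = s.arr 4 := k4.2 4 (by simp)
      refine wp_of_spec (spec_storeExtra h (hs.keep k4) e60' e61' e62 (by omega) he
        (by rw [m4]; exact h4)) ?_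
      rintro k₆ s₆ hk₆ ⟨g6, q18, q17, q19⟩
      have hset : ((nb G d (f (w i))).filter fun x : Fin n => s₄.arr 4 x ≠ 0) =
          (nb G d (f (w i))).filter fun x => ∃ c, f c = x := by
        refine Finset.filter_congr fun x _ => ?_
        rw [m4, Ne, hm]; push Not; rfl
      have hle : ((nb G d (f (w i))).filter fun x => ∃ c, f c = x).card ≤ t + 1 :=
        (Finset.card_filter_le _ _).trans (h.card_nb_le _)
      rw [hset] at q19
      rw [g4.2 18 (by simp), k3.2 18 (by simp)] at q18
      rw [g4.2 17 (by simp), k3.2 17 (by simp)] at q17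
      rw [g4.2 19 (by simp), k3.2 19 (by simp)] at q19
      refine hQ _ _ (by omega) ⟨g6.lit e60', ?_, by simp, ?_⟩
      · rw [Keep.setVar_iff (by simp)]
        exact k4.trans g6 (by norm_num) (by simp) (by simp)
      · intro r hr
        simp only [Store.setVar_arr, q18, q17, q19]
        by_cases hri : r = i
        · subst hri
          simp only [Function.update_self]
          exact ⟨he, trivial, hy, by omega, card_filter_range_gt h.params hf hA _⟩
        · simp only [Function.update_of_ne hri]
          exact f3 r (by omega)
    simp only [wp_ite, wp_skip, wp_seq, wp_load, wp_add, Operand.val, Store.setVar_var]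
    norm_num
    rw [e150]
    rcases l with _ | ⟨x, l⟩
    · refine ⟨fun h => absurd h (by simp), fun _ => main 0 _ _ (by omega) (by simp) (by simp)
        (by omega) fun y => ?_⟩
      rw [← hmem']; simp
    · have hx := x.2
      have e20 : s₃.arr 20 0 = x := hl 0 (by simp)
      rw [e20]
      refine ⟨fun _ => ⟨by omega, by omega, main (x + 1) _ _ (by omega) (by simp) (by simp)
        (by omega) fun y => ?_⟩, fun h => absurd h (by simp)⟩
      have hxE := (hmem' x).1 (by simp)
      refine ⟨fun hy => ?_, fun hy => ?_⟩
      · have : x = y := Fin.ext (by omega)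
        rwa [← this]
      · by_contra hne
        have : x ≠ y := fun h => hne (by rw [h])
        exact no_two_extra h.params h.bounded hf this hxE.2.2 hy.2.2 (fun c _ => hxE.2.1 c)
          fun c _ => hy.2.1 c
  · rintro s' ⟨f1, -, f3⟩
    exact ⟨f1, f3⟩

/-- The test for different classes. -/
def diffTest : Program :=
  .seq (.load 211 16 (.var 200)) (.seq (.load 212 16 (.var 201)) (.seq (.sub 202 (.var 211) (.var 212))
    (.seq (.sub 213 (.var 212) (.var 211)) (.add 202 (.var 202) (.var 213)))))

/-- The test for different positions in the same class. -/
def sameTest : Program :=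
  .seq (.load 211 16 (.var 200)) (.seq (.load 212 16 (.var 201)) (.seq (.sub 213 (.var 211) (.var 212))
  (.seq (.sub 214 (.var 212) (.var 211)) (.seq (.add 213 (.var 213) (.var 214))
  (.seq (.sub 202 (.var 200) (.var 201)) (.seq (.sub 214 (.var 201) (.var 200))
  (.seq (.add 202 (.var 202) (.var 214)) (.ite (.lit 0) (.var 213) (.add 202 (.lit 0) (.lit 0))
    .skip))))))))

/-- Write to array `dst` the common value of array `18` at the positions that pass the test, or `0`
if there is none. -/
def commonValue (test : Program) (dst : ℕ) : Program :=
  .seq (.add 64 (.var 0) (.lit 1)) (.seq (foldMin (.var 6) (.var 64) test 18 20 23)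
  (.seq (foldMin (.var 6) (.var 64) test 17 21 23) (forTo 60 (.var 6) (.seq (.load 61 20 (.var 60))
    (.seq (.load 62 21 (.var 60)) (.seq (.add 62 (.var 61) (.var 62))
    (.seq (.ite (.var 0) (.var 62) .skip (.add 61 (.lit 0) (.lit 0))) (.store dst (.var 60) (.var 61)))))))))

theorem tests_diff (h : Ctx G t p q W a₀ a₁ d) {s : Store} (hT : Tab t p q s) {As : List ℕ}
    (hAs : 16 ∉ As) : Tests W (p * q) 20 s As diffTest fun i j => i / q ≠ j / q := by
  have hW₁ := h.le_W₁
  have hpq := KF.pq h.params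
  have ht := At.q_le h
  intro s' hk hi hj
  have e1 : s'.arr 16 (s'.var 200) = s'.var 200 / q := by rw [hk.2 16 hAs, hT.div _ hi]
  have e2 : s'.arr 16 (s'.var 201) = s'.var 201 / q := by rw [hk.2 16 hAs, hT.div _ hj]
  have b1 := Nat.div_le_self (s'.var 200) q
  have b2 := Nat.div_le_self (s'.var 201) q
  refine Spec.intro fun Q hQ => ?_
  simp only [diffTest, wp_seq, wp_load, wp_sub, wp_add, Operand.val, Store.setVar_var, e1, Store.setVar_arr]
  norm_num
  rw [e2]
  obtain ⟨x, hx⟩ : ∃ x, s'.var 200 / q = x := ⟨_, rfl⟩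
  obtain ⟨y, hy⟩ : ∃ y, s'.var 201 / q = y := ⟨_, rfl⟩
  rw [hx, hy]
  rw [hx] at b1
  rw [hy] at b2
  refine ⟨by omega, by omega, by omega, by omega, by omega, by omega, by omega,
    hQ _ _ (by omega) ⟨by simp, ?_⟩⟩
  simp [hx, hy]; omega

theorem tests_same (h : Ctx G t p q W a₀ a₁ d) {s : Store} (hT : Tab t p q s) {As : List ℕ}
    (hAs : 16 ∉ As) : Tests W (p * q) 20 s As sameTest fun i j => i / q = j / q ∧ i ≠ j := by
  have hW₁ := h.le_W₁
  have hpq := KF.pq h.params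
  have ht := At.q_le h
  intro s' hk hi hj
  have e1 : s'.arr 16 (s'.var 200) = s'.var 200 / q := by rw [hk.2 16 hAs, hT.div _ hi]
  have e2 : s'.arr 16 (s'.var 201) = s'.var 201 / q := by rw [hk.2 16 hAs, hT.div _ hj]
  have b1 := Nat.div_le_self (s'.var 200) q
  have b2 := Nat.div_le_self (s'.var 201) q
  refine Spec.intro fun Q hQ => ?_
  simp only [sameTest, wp_seq, wp_load, wp_sub, wp_add, wp_ite, wp_skip, Operand.val, Store.setVar_var,
    e1, Store.setVar_arr]
  norm_num
  rw [e2]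
  obtain ⟨x, hx⟩ : ∃ x, s'.var 200 / q = x := ⟨_, rfl⟩
  obtain ⟨y, hy⟩ : ∃ y, s'.var 201 / q = y := ⟨_, rfl⟩
  rw [hx, hy]
  rw [hx] at b1
  rw [hy] at b2
  refine ⟨by omega, by omega, by omega, by omega, by omega, by omega, by omega, by omega, by omega,
    by omega, fun h => hQ _ _ (by omega) ⟨by simp, ?_⟩, fun h => hQ _ _ (by omega) ⟨by simp, ?_⟩⟩
  · simp [hx, hy]; omega
  · simp [hx, hy]; omega

/-- Values are all equal if and only if their minimum is their maximum. As array `17` holds `n + 1`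
minus the values of array `18`, a minimum of it gives a maximum of array `18`, and the two minima
add up to more than `n` exactly if the values agree. A common value `0` and disagreement both give
`0`. -/
theorem spec_commonValue (h : Ctx G t p q W a₀ a₁ d) {s : Store} (hs : At n t p q a₀ a₁ d s)
    (h6 : s.var 6 = p * q) {test : Program} {P : ℕ → ℕ → Prop} {dst : ℕ} (hdst : dst ≠ 20 ∧ dst ≠ 21)
    (htest : ∀ s', Keep 60 [] [20, 23] s s' → Tests W (p * q) 20 s' [20, 23] test P)
    (htest' : ∀ s', Keep 60 [] [20, 23] s s' → Tests W (p * q) 20 s' [21, 23] test P)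
    (hv : ∀ r < p * q, s.arr 18 r ≤ n ∧ s.arr 17 r = n + 1 - s.arr 18 r) :
    Spec W (commonValue test dst) (120 * (3 * t * (3 * t))) s fun s' =>
      Keep 60 [] [dst, 20, 21, 23] s s' ∧ ∀ i < p * q, (∃ j < p * q, P i j) → s'.arr dst i ≤ n ∧
        ∀ y < n, (s'.arr dst i = y + 1 ↔ ∀ j < p * q, P i j → s.arr 18 j = y + 1) := by
  have hW₁ := h.le_W₁
  have hpq := KF.pq h.params
  have ht := At.q_le h
  have hmm : 9 * t ≤ 3 * t * (3 * t) := by nlinarith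
  refine Spec.intro fun Q hQ => ?_
  simp only [commonValue, wp_seq, wp_add, Operand.val, hs.var_n]
  refine ⟨by omega, ?_⟩
  have k1 : Keep 60 [] [20, 23] s (s.setVar 64 (n + 1)) := by simp
  refine wp_of_spec (spec_foldMin (L := p * q) (K := n + 1) (m := 3 * t) (c := 20) (P := P) (by norm_num)
    (by norm_num) (by simpa using h6) (by simp) (by omega) (by omega) (by norm_num) (by norm_num)
    (by norm_num) (fun j hj => by have := hv j hj; simp; omega) (htest _ k1) (by omega) (by omega)) ?_
  rintro k₂ s₂ hk₂ ⟨g2, r2⟩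
  have k2 : Keep 60 [] [20, 23] s s₂ := k1.trans g2 (by norm_num) (by simp) (by simp)
  have e64 : s₂.var 64 = n + 1 := g2.lit (by simp)
  refine wp_of_spec (spec_foldMin (L := p * q) (K := n + 1) (m := 3 * t) (c := 20) (P := P) (by norm_num)
    (by norm_num) (k2.lit h6) e64 (by omega) (by omega) (by norm_num) (by norm_num)
    (by norm_num) (fun j hj => by rw [k2.2 17 (by simp)]; have := hv j hj; omega)
    (htest' _ k2) (by omega) (by omega)) ?_
  rintro k₃ s₃ hk₃ ⟨g3, r3⟩
  have k3 : Keep 60 [] [dst, 20, 21, 23] s s₃ := (k2.mono le_rfl (by simp) (by simp)).trans g3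
    (by norm_num) (by simp) (by simp)
  have e6 : s₃.var 6 = p * q := k3.lit h6
  rw [k2.2 17 (by simp)] at r3
  simp only [Store.setVar_arr] at r2
  have b2 : ∀ i < p * q, s₃.arr 20 i ≤ n + 1 := fun i hi => by
    rw [g3.2 20 (by simp)]; exact (r2 i hi).2.2.1
  have b3 : ∀ i < p * q, s₃.arr 21 i ≤ n + 1 := fun i hi => (r3 i hi).2.2.1
  refine wp_of_spec (spec_forTo (N := .var 6) (m := p * q) (T := 6) (Inv := fun i s' =>
    Keep 60 [] [dst] s₃ s' ∧ s'.var 60 = i ∧ ∀ i' < i, s'.arr dst i' =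
      if n < s₃.arr 20 i' + s₃.arr 21 i' then s₃.arr 20 i' else 0) (by omega)
    (fun j s' h => ⟨h.2.1, h.1.lit e6⟩) ?_ ⟨by simp, by simp, by simp⟩) ?_
  · rintro i hi s₄ ⟨f1, f2, f3⟩
    have q1 : s₄.arr 20 i = s₃.arr 20 i := by rw [f1.2 20 (by simpa using hdst.1.symm)]
    have q2 : s₄.arr 21 i = s₃.arr 21 i := by rw [f1.2 21 (by simpa using hdst.2.symm)]
    have n4 : s₄.var 0 = n := f1.lit (k3.lit hs.var_n)
    have := b2 i hi
    have := b3 i hi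
    have fin : ∀ v, ∀ s₅, (∀ i', s₅.arr i' = s₄.arr i') → Keep 61 [] [] s₄ s₅ →
        v = (if n < s₃.arr 20 i + s₃.arr 21 i then s₃.arr 20 i else 0) →
        (s₅.setArr dst i v).var 60 = i ∧ Keep 60 [] [dst] s₃ ((s₅.setArr dst i v).setVar 60 (i + 1)) ∧
        ((s₅.setArr dst i v).setVar 60 (i + 1)).var 60 = i + 1 ∧
        ∀ i' < i + 1, ((s₅.setArr dst i v).setVar 60 (i + 1)).arr dst i' =
          if n < s₃.arr 20 i' + s₃.arr 21 i' then s₃.arr 20 i' else 0 := by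
      intro v s₅ ha hk hv
      refine ⟨hk.lit f2, ?_, by simp, fun i' hi' => ?_⟩
      · rw [Keep.setVar_iff (by simp), Keep.setArr_iff (by simp)]
        exact f1.trans hk (by norm_num) (by simp) (by simp)
      · simp only [Store.setVar_arr, Store.setArr_arr, if_true, Function.update_apply, ha]
        by_cases hc : i' = i
        · subst hc; rw [if_pos rfl, hv]
        · rw [if_neg hc]; exact f3 i' (by omega)
    refine Spec.intro fun Q hQ => ?_
    simp only [wp_seq, wp_load, wp_add, wp_ite, wp_skip, wp_store, Operand.val, f2, q1,
      Store.setVar_var, Store.setVar_arr, n4]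
    norm_num
    simp only [q2]
    refine ⟨by omega, by omega, by omega, by omega, by omega, fun hlt => ⟨by omega, by omega, hQ _ _ (by omega)
      (fin _ _ (fun _ => rfl) (by simp) ?_)⟩, fun hlt => ⟨by omega, hQ _ _ (by omega)
      (fin _ _ (fun _ => rfl) (by simp) ?_)⟩⟩
    · rw [if_pos hlt]
    · rw [if_neg (by omega)]
  · rintro k₄ s₄ hk₄ ⟨f1, -, f3⟩
    refine hQ _ _ (by omega) ⟨k3.trans f1 le_rfl (by simp) (by simp), fun i hi hex => ?_⟩
    obtain ⟨j₀, hj₀, hP₀⟩ := hex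
    have m20 := r2 i hi
    have m21 := r3 i hi
    rw [f3 i hi, g3.2 20 (by simp)]
    generalize s₂.arr 20 i = x at *
    generalize s₃.arr 21 i = z at *
    have c1 := m20.2.1 j₀ hj₀ hP₀
    have c2 := m21.2.1 j₀ hj₀ hP₀
    have hvj := hv j₀ hj₀
    refine ⟨by split_ifs <;> omega, fun y hy => ⟨fun he j hj hPj => ?_, fun hall => ?_⟩⟩
    · have := m20.2.1 j hj hPj
      have := m21.2.1 j hj hPj
      have := hv j hj
      split_ifs at he
      all_goals omega
    · have h0 := hall j₀ hj₀ hP₀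
      have hx : x = y + 1 := by
        rcases m20.2.2.2 with h' | ⟨j, hj, hPj, h'⟩
        · omega
        · rw [h', hall j hj hPj]
      have hz : z = n - y := by
        rcases m21.2.2.2 with h' | ⟨j, hj, hPj, h'⟩
        · omega
        · rw [h', (hv j hj).2, hall j hj hPj]; omega
      rw [if_pos (by omega), hx]

/-- Write the vertices of the `K^p_q` to the output. -/
def emitBase : Program :=
  forTo 60 (.var 6) (.seq (.load 61 14 (.var 60)) (emit (.var 61)))

/-- Write the list of the core vertices to the output. -/
def emitCore : Program :=
  .seq (.add 65 (.var 7) (.lit 0)) (.seq (emit (.lit 0)) (.seq (.add 66 (.lit 0) (.lit 0))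
  (.seq (.ite (.var 3) (.lit 3) (.ite (.lit 1) (.var 3) (forTo 60 (.var 6) (.seq (.load 61 19 (.var 60))
    (.ite (.var 1) (.var 61) (.seq (.load 61 14 (.var 60)) (.seq (emit (.var 61))
      (.add 66 (.var 66) (.lit 1)))) .skip))) .skip) .skip) (.store 2 (.var 65) (.var 66)))))

/-- Write a replacement to the output. -/
def emitSwap (x y x' y' : ℕ) : Program :=
  .seq (emit (.var x)) (.seq (emit (.var y)) (.seq (emit (.var x')) (.seq (emit (.var y'))
    (.add 66 (.var 66) (.lit 1)))))

/-- A replacement of at most two vertices. -/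
abbrev Swap (n : ℕ) : Type := Fin n × Fin n × Fin n × Fin n

/-- The words of a replacement. -/
def swapWords {n : ℕ} (w : Swap n) : List ℕ :=
  [(w.1 : ℕ), (w.2.1 : ℕ), (w.2.2.1 : ℕ), (w.2.2.2 : ℕ)]

/-- The output consists of the list `l`, a cell for the number of the replacements, and the
replacements on the list `ws`; their number is in variable `66`. -/
def SwapOut {n : ℕ} (s : Store) (l : List ℕ) (ws : List (Swap n)) : Prop :=
  Out s (l ++ 0 :: ws.flatMap swapWords) ∧ s.var 66 = ws.length

/-- Make the variable `o` positive if the vertex in variable `x` is not the excluded one (whose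
successor is in variable `8`). -/
def differs (x o : ℕ) : Program :=
  .seq (.add 72 (.var x) (.lit 1)) (.seq (.sub o (.var 72) (.var 8)) (.seq (.sub 72 (.var 8) (.var 72))
    (.add o (.var o) (.var 72))))

/-- Write the replacements of one vertex to the output. -/
def singles : Program :=
  forTo 60 (.var 6) (.seq (.load 61 14 (.var 60)) (.seq (.load 62 24 (.var 60)) (.ite (.lit 0) (.var 62)
    (.seq (differs 61 63) (.ite (.lit 0) (.var 63) (.seq (.sub 62 (.var 62) (.lit 1))
      (emitSwap 61 62 61 62)) .skip)) .skip)))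

/-- Write the replacements of two vertices, one of which is in variable `61` and is replaced together
with the neighbours of the vertex in variable `62`. -/
def doublesWith : Program :=
  forTo 67 (.var 3) (.seq (.load 68 14 (.var 67)) (.seq (.load 69 25 (.var 67)) (.ite (.lit 0) (.var 69)
    (.seq (differs 68 70) (.ite (.lit 0) (.var 70) (.seq (.sub 69 (.var 69) (.lit 1))
      (.seq (.load 71 4 (.var 69)) (.ite (.lit 0) (.var 71) (emitSwap 68 62 61 69) .skip)))
        .skip)) .skip)))

/-- Write the replacements of two vertices to the output. -/
def doubles : Program :=
  forTo 60 (.var 6) (.ite (.var 60) (.var 3) .skip (.seq (.load 61 14 (.var 60))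
    (.seq (.load 62 25 (.var 60)) (.ite (.lit 0) (.var 62) (.seq (differs 61 63)
      (.ite (.lit 0) (.var 63) (.seq (.sub 62 (.var 62) (.lit 1)) (.seq (.add 64 (.lit 0) (.lit 0))
        (.seq (markRow 64 62 1) (.seq doublesWith (markRow 64 62 0))))) .skip)) .skip))))

/-! ### Writing a record -/

variable {g : ℕ → Fin n}

theorem spec_emitBase (h : Ctx G t p q W a₀ a₁ d) {s : Store} {pre : List ℕ} (ho : Out s pre)
    (h6 : s.var 6 = p * q) (hg : ∀ r < p * q, s.arr 14 r = g r)
    (hW : pre.length + 40 * (n + t + 2) ^ 2 ≤ W) :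
    Spec W emitBase (12 * t) s fun s' => Keep 60 [7] [2] s s' ∧
      Out s' (pre ++ (List.range (p * q)).map fun r => (g r : ℕ)) := by
  have hW₁ := h.le_W₁
  have ht := At.q_le h
  have hpq := KF.pq h.params
  have := pow_bounds n t
  refine (spec_forTo (N := .var 6) (m := p * q) (T := 3) (Inv := fun i s' => Keep 60 [7] [2] s s' ∧
    s'.var 60 = i ∧ Out s' (pre ++ (List.range i).map fun r => (g r : ℕ))) (by omega)
    (fun j s' h => ⟨h.2.1, h.1.lit h6⟩) ?_ ⟨by simp, by simp, by simpa using ho⟩).mono (by omega) ?_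
  · rintro i hi s₁ ⟨f1, f2, f3⟩
    have hgi := (g i).2
    have ei : s₁.arr 14 i = g i := by rw [f1.2 14 (by simp), hg i hi]
    refine Spec.intro fun Q hQ => ?_
    simp only [wp_seq, wp_load, Operand.val, f2, ei]
    refine ⟨by omega, by omega, wp_emit (l := pre ++ (List.range i).map fun r => (g r : ℕ))
      (by simpa using f3) (by simp; omega) (by simp; omega) fun s' hk ho' => ?_⟩
    have k2 : Keep 60 [7] [2] s₁ s' := Keep.trans (by simp) hk (by norm_num) (by simp) (by simp)
    refine hQ _ _ (by omega) ⟨hk.lit (by simpa using f2), ?_, by simp, ?_⟩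
    · rw [Keep.setVar_iff (by simp)]; exact f1.trans k2 le_rfl (by simp) (by simp)
    · rw [Out.setVar_iff (by norm_num), List.range_succ, List.map_append, ← List.append_assoc]
      simpa using ho'
  · rintro s' ⟨f1, -, f3⟩
    exact ⟨f1, f3⟩

/-- The core is empty for `q ≠ 2`. For `q = 2`, the vertices with more than `t` neighbours inside
are the free ones by `card_filter_range_gt`. -/
theorem spec_emitCore (h : Ctx G t p q W a₀ a₁ d) {s : Store} (hs : At n t p q a₀ a₁ d s)
    {pre : List ℕ} (ho : Out s pre) (h6 : s.var 6 = p * q) (hg : ∀ r < p * q, s.arr 14 r = g r)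
    (h19 : ∀ r < p * q, s.arr 19 r ≤ W) (hW : pre.length + 40 * (n + t + 2) ^ 2 ≤ W) :
    Spec W emitCore (30 * t) s fun s' => Keep 60 [7] [2] s s' ∧ ∃ c : List (Fin n),
      c.length ≤ p * q ∧ Out s' (pre ++ c.length :: c.map fun v : Fin n => (v : ℕ)) ∧
      ∀ v, v ∈ c ↔ q = 2 ∧ ∃ r < p * q, t < s.arr 19 r ∧ g r = v := by
  have hW₁ := h.le_W₁
  have ht := At.q_le h
  have hpq := KF.pq h.params
  have := pow_bounds n t
  refine Spec.intro fun Q hQ => ?_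
  simp only [emitCore, wp_seq, wp_add, Operand.val, ho.1]
  refine ⟨by omega, wp_emit (l := pre) (by simpa using ho) (by omega) (by simp) fun s₁ hk₁ o1 => ?_⟩
  simp only [Operand.val] at o1
  have e65 : s₁.var 65 = pre.length := hk₁.lit (by simp)
  have k1 : Keep 60 [7] [2] s s₁ := Keep.trans (by simp) hk₁ (by norm_num) (by simp) (by simp)
  have e3 : s₁.var 3 = q := k1.lit hs.var_q
  have fin : ∀ s₂ k₂, k₂ + 1 ≤ 30 * t → Keep 60 [7] [2] s s₂ → s₂.var 65 = pre.length →
      ∀ c : List (Fin n), c.length ≤ p * q → s₂.var 66 = c.length →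
      Out s₂ (pre ++ 0 :: c.map fun v : Fin n => (v : ℕ)) →
      (∀ v, v ∈ c ↔ q = 2 ∧ ∃ r < p * q, t < s.arr 19 r ∧ g r = v) →
      wp W (.store 2 (.var 65) (.var 66)) s₂ k₂ Q := by
    intro s₂ k₂ hk₂ g2 e65 c hc e66 o2 hmem
    simp only [wp_store, Operand.val, e65, e66]
    refine ⟨by omega, by omega, hQ _ _ hk₂ ⟨by simpa using g2, c, hc, o2.fill rfl (by simp), hmem⟩⟩
  simp only [wp_ite, wp_skip, Operand.val, Store.setVar_var, Nat.reduceEqDiff, reduceIte, e3]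
  refine ⟨by omega, fun h3 => ⟨fun h1 => ?_, fun h1 => ?_⟩, fun h3 => ?_⟩
  · have hq : q = 2 := by omega
    refine wp_of_spec (spec_forTo (N := .var 6) (m := p * q) (T := 6) (Inv := fun i s' =>
      Keep 60 [7] [2] s s' ∧ s'.var 60 = i ∧ s'.var 65 = pre.length ∧ ∃ c : List (Fin n),
        c.length ≤ i ∧ s'.var 66 = c.length ∧ Out s' (pre ++ 0 :: c.map fun v : Fin n => (v : ℕ)) ∧
        ∀ v, v ∈ c ↔ ∃ r < i, t < s.arr 19 r ∧ g r = v) (by omega)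
      (fun j s' h => ⟨h.2.1, h.1.lit h6⟩) ?_ ?_) ?_
    · rintro i hi s₂ ⟨f1, f2, f3, c, c1, c2, c3, c4⟩
      have hgi := (g i).2
      have ei : s₂.arr 14 i = g i := by rw [f1.2 14 (by simp), hg i hi]
      have e19 : s₂.arr 19 i = s.arr 19 i := by rw [f1.2 19 (by simp)]
      have e1 : s₂.var 1 = t := f1.lit hs.var_t
      have := h19 i hi
      refine Spec.intro fun Q hQ => ?_
      simp only [wp_seq, wp_load, wp_ite, wp_skip, wp_add, Operand.val, f2, e19, Store.setVar_var,
        Store.setVar_arr]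
      norm_num
      simp only [ei, e1]
      refine ⟨by omega, by omega, fun hlt => ⟨by omega, by omega, wp_emit
        (l := pre ++ 0 :: c.map fun v : Fin n => (v : ℕ)) (by simpa using c3) (by simp; omega) (by simp; omega)
        fun s' hk ho' => ?_⟩, fun hge => hQ _ _ (by omega) ⟨by simpa using f2, by simpa using f1,
          by simp, by simpa using f3, c, by omega, by simpa using c2, by simpa using c3, fun v => ?_⟩⟩
      · have k2 : Keep 60 [7] [2] s₂ s' := Keep.trans (by simp) hk (by norm_num) (by simp) (by simp)
        have e66 : s'.var 66 = c.length := hk.lit (by simpa using c2)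
        rw [e66]
        refine ⟨by omega, hQ _ _ (by omega) ⟨?_, ?_, by simp, ?_, c ++ [g i], by simpa using c1, by simp,
          ?_, fun v => ?_⟩⟩
        · simpa using hk.lit (by simpa using f2)
        · rw [Keep.setVar_iff (by simp), Keep.setVar_iff (by simp)]
          exact f1.trans k2 le_rfl (by simp) (by simp)
        · simpa using hk.lit (by simpa using f3)
        · rw [Out.setVar_iff (by norm_num), Out.setVar_iff (by norm_num)]
          simpa using ho'
        · rw [List.mem_append, c4, List.mem_singleton]
          constructor
          · rintro (⟨r, h1, h2, h3⟩ | rfl)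
            · exact ⟨r, by omega, h2, h3⟩
            · exact ⟨i, by omega, hlt, rfl⟩
          · rintro ⟨r, h1, h2, h3⟩
            by_cases hri : r = i
            · subst hri; exact .inr h3.symm
            · exact .inl ⟨r, by omega, h2, h3⟩
      · rw [c4]
        refine ⟨fun ⟨r, h1, h2, h3⟩ => ⟨r, by omega, h2, h3⟩, fun ⟨r, h1, h2, h3⟩ => ⟨r, ?_, h2, h3⟩⟩
        have : r ≠ i := by rintro rfl; omega
        omega
    · exact ⟨by simpa using k1, by simp, by simpa using e65, [], by simp, by simp, by simpa using o1,
        by simp⟩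
    · rintro k₂ s₂ hk₂ ⟨f1, -, f3, c, c1, c2, c3, c4⟩
      exact fin s₂ _ (by omega) f1 f3 c c1 c2 c3 fun v => by rw [c4]; simp [hq]
  · exact fin _ _ (by omega) (by simpa using k1) (by simpa using e65) [] (by simp) (by simp)
      (by simpa using o1) fun v => by simp; omega
  · exact fin _ _ (by omega) (by simpa using k1) (by simpa using e65) [] (by simp) (by simp)
      (by simpa using o1) fun v => by simp; omega

theorem length_flatMap_swapWords (ws : List (Swap n)) :
    (ws.flatMap swapWords).length = 4 * ws.length := by
  induction ws with
  | nil => rfl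
  | cons w ws ih => simp [swapWords, ih]; ring

theorem SwapOut.keep {s s' : Store} {l : List ℕ} {ws : List (Swap n)}
    (h : SwapOut s l ws) {B : ℕ} {Xs As : List ℕ} (hk : Keep B Xs As s s') (hB : 66 < B := by norm_num)
    (hX : 7 ∉ Xs ∧ 66 ∉ Xs := by simp) (hA : 2 ∉ As := by simp) : SwapOut s' l ws :=
  ⟨h.1.keep hk (by omega) hX.1 hA, hk.lit h.2 hB hX.2⟩

@[simp] theorem SwapOut.setVar_iff {s : Store} {l : List ℕ} {x k : ℕ}
    {ws : List (Swap n)} (hx : x ≠ 7 ∧ x ≠ 66) :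
    SwapOut (s.setVar x k) l ws ↔ SwapOut s l ws := by
  simp [SwapOut, hx.1, Ne.symm hx.2]

theorem wp_emitSwap {s : Store} {x y x' y' k : ℕ} {Q : ℕ → Store → Prop} {l : List ℕ}
    {ws : List (Swap n)} (hl : SwapOut s l ws)
    (hW : l.length + 4 * ws.length + 5 ≤ W) (hn : n ≤ W) {w : Swap n}
    (hx : s.var x = w.1) (hy : s.var y = w.2.1) (hx' : s.var x' = w.2.2.1) (hy' : s.var y' = w.2.2.2)
    (hlt : (x < 1000 ∧ x ≠ 7) ∧ (y < 1000 ∧ y ≠ 7) ∧ (x' < 1000 ∧ x' ≠ 7) ∧ y' < 1000 ∧ y' ≠ 7)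
    (hQ : ∀ s', Keep 1000 [7, 66] [2] s s' → SwapOut s' l (ws ++ [w]) → Q (k + 9) s') :
    wp W (emitSwap x y x' y') s k Q := by
  have hlen : (l ++ 0 :: ws.flatMap swapWords).length = l.length + 4 * ws.length + 1 := by
    rw [List.length_append, List.length_cons, length_flatMap_swapWords]; omega
  simp only [emitSwap, wp_seq]
  refine wp_emit hl.1 (by omega) (by simp [hx]; omega) fun s₁ k1 o1 => ?_
  refine wp_emit o1 (by simp only [List.length_append, hlen]; simp; omega)
    (by simp [k1.lit hy hlt.2.1.1 (by simpa using hlt.2.1.2)]; omega) fun s₂ k2' o2 => ?_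
  have k2 := k1.trans k2' le_rfl (by simp) (by simp)
  refine wp_emit o2 (by simp only [List.length_append, hlen]; simp; omega)
    (by simp [k2.lit hx' hlt.2.2.1.1 (by simpa using hlt.2.2.1.2)]; omega) fun s₃ k3' o3 => ?_
  have k3 := k2.trans k3' le_rfl (by simp) (by simp)
  refine wp_emit o3 (by simp only [List.length_append, hlen]; simp; omega)
    (by simp [k3.lit hy' hlt.2.2.2.1 (by simpa using hlt.2.2.2.2)]; omega) fun s₄ k4' o4 => ?_
  have k4 := k3.trans k4' le_rfl (by simp) (by simp)
  have e66 : s₄.var 66 = ws.length := k4.lit hl.2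
  simp only [wp_add, Operand.val, e66]
  refine ⟨by omega, hQ _ ?_ ⟨?_, by simp⟩⟩
  · rw [Keep.setVar_iff (by simp)]
    exact k4.mono le_rfl (by simp) (by simp)
  · rw [Out.setVar_iff (by norm_num)]
    simp only [Operand.val, hx, k1.lit hy hlt.2.1.1 (by simpa using hlt.2.1.2),
      k2.lit hx' hlt.2.2.1.1 (by simpa using hlt.2.2.1.2),
      k3.lit hy' hlt.2.2.2.1 (by simpa using hlt.2.2.2.2)] at o4
    simpa [swapWords] using o4

theorem wp_differs {s : Store} {x o k a e : ℕ} {Q : ℕ → Store → Prop} (hx : s.var x = a)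
    (h8 : s.var 8 = e) (ho : 60 ≤ o) (ho' : o ≠ 72) (ha : a < W) (he : e ≤ W)
    (hQ : ∀ s', Keep 60 [] [] s s' → (∀ y, y ≠ o → y ≠ 72 → s'.var y = s.var y) →
      (0 < s'.var o ↔ a + 1 ≠ e) → Q (k + 4) s') : wp W (differs x o) s k Q := by
  have h1 : (8 : ℕ) ≠ o := by omega
  simp only [differs, wp_seq, wp_add, wp_sub, Operand.val, Store.setVar_var, hx, h8, Nat.reduceEqDiff,
    reduceIte, if_neg h1, if_neg (Ne.symm ho'), if_neg ho']
  refine ⟨by omega, by omega, by omega, by omega, hQ _ ?_ (fun y hy hy' => by simp [hy, hy']) ?_⟩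
  · rw [Keep.setVar_iff (by simp; omega), Keep.setVar_iff (by simp), Keep.setVar_iff (by simp; omega),
      Keep.setVar_iff (by simp)]
    exact Keep.refl
  · simp; omega

theorem spec_singles (h : Ctx G t p q W a₀ a₁ d) {s : Store} {l : List ℕ}
    (ho : SwapOut s l ([] : List (Swap n))) (h6 : s.var 6 = p * q)
    (hg : ∀ r < p * q, s.arr 14 r = g r) (h24 : ∀ r < p * q, s.arr 24 r ≤ n) {e : ℕ}
    (h8 : s.var 8 = e) (he : e ≤ n) (hW : l.length + 30 * (n + t + 2) ^ 2 ≤ W) :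
    Spec W singles (50 * t) s fun s' => Keep 60 [7] [2] s s' ∧ ∃ ws, ws.length ≤ p * q ∧
      SwapOut s' l ws ∧ ∀ w, w ∈ ws ↔ ∃ r < p * q, ∃ y : Fin n, s.arr 24 r = y + 1 ∧
        (g r : ℕ) + 1 ≠ e ∧ w = (g r, y, g r, y) := by
  have hW₁ := h.le_W₁
  have ht := At.q_le h
  have hpq := KF.pq h.params
  have := pow_bounds n t
  refine (spec_forTo (N := .var 6) (m := p * q) (T := 18) (Inv := fun i s' => Keep 60 [7] [2] s s' ∧
    s'.var 60 = i ∧ ∃ ws, ws.length ≤ i ∧ SwapOut s' l ws ∧ ∀ w, w ∈ ws ↔ ∃ r < i, ∃ y : Fin n,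
      s.arr 24 r = y + 1 ∧ (g r : ℕ) + 1 ≠ e ∧ w = (g r, y, g r, y)) (by omega)
    (fun j s' h => ⟨h.2.1, h.1.lit h6⟩) ?_ ⟨by simp, by simp, [], by simp, by simpa using ho,
      by simp⟩).mono (by omega) ?_
  · rintro i hi s₁ ⟨f1, f2, ws, c1, c2, c3⟩
    have hgi := (g i).2
    have ei : s₁.arr 14 i = g i := by rw [f1.2 14 (by simp), hg i hi]
    have e24 : s₁.arr 24 i = s.arr 24 i := by rw [f1.2 24 (by simp)]
    have b24 := h24 i hi
    have e8 : s₁.var 8 = e := f1.lit h8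
    refine Spec.intro fun Q hQ => ?_
    have none : ∀ s₂ k₂, k₂ ≤ 18 → Keep 61 [] [] s₁ s₂ → SwapOut s₂ l ws →
        (∀ y : Fin n, ¬ (s.arr 24 i = y + 1 ∧ (g i : ℕ) + 1 ≠ e)) → Q k₂ s₂ := by
      intro s₂ k₂ hk₂ g2 o2 hno
      refine hQ _ _ hk₂ ⟨g2.lit f2, ?_, by simp, ws, by omega, by simpa using o2, fun w => ?_⟩
      · rw [Keep.setVar_iff (by simp)]
        exact f1.trans g2 (by norm_num) (by simp) (by simp)
      · rw [c3]
        refine ⟨fun ⟨r, h1, h2⟩ => ⟨r, by omega, h2⟩, fun ⟨r, h1, y, h2, h3, h4⟩ => ⟨r, ?_, y, h2, h3, h4⟩⟩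
        have : r ≠ i := by rintro rfl; exact hno y ⟨h2, h3⟩
        omega
    simp only [wp_seq, wp_load, wp_ite, wp_skip, Operand.val, f2, ei, Store.setVar_var, Store.setVar_arr,
      Nat.reduceEqDiff, reduceIte, e24]
    refine ⟨by omega, by omega, by omega, by omega, fun hpos => ?_, fun hz => none _ _ (by omega)
      (by simp) (by simpa using c2) fun y => by omega⟩
    refine wp_differs (a := g i) (e := e) (by simp) (by simpa using e8) (by norm_num) (by norm_num)
      (by omega) (by omega) fun s₂ k2 v2 hd => ?_
    have k2' : Keep 61 [] [] s₁ s₂ := by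
      refine ⟨fun x hx _ => ?_, fun a ha => k2.2 a ha⟩
      rw [v2 x (by omega) (by omega)]
      simp [show x ≠ 61 by omega, show x ≠ 62 by omega]
    have o2 : SwapOut s₂ l ws := ⟨(by simpa using c2.1 : Out _ _).congr (v2 7 (by norm_num) (by norm_num))
      (k2.2 2 (by simp)), by rw [v2 66 (by norm_num) (by norm_num)]; simpa using c2.2⟩
    have e61 : s₂.var 61 = g i := by rw [v2 61 (by norm_num) (by norm_num)]; simp
    have e62 : s₂.var 62 = s.arr 24 i := by rw [v2 62 (by norm_num) (by norm_num)]; simp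
    refine ⟨fun hne => ?_, fun heq => none _ _ (by omega) k2' o2 fun y => by tauto⟩
    simp only [wp_sub, Operand.val, e62]
    refine ⟨by omega, ?_⟩
    obtain ⟨y, hy⟩ : ∃ y : Fin n, s.arr 24 i = y + 1 := ⟨⟨s.arr 24 i - 1, by omega⟩, by simp; omega⟩
    refine wp_emitSwap (w := (g i, y, g i, y)) (l := l) (ws := ws) (by simpa using o2) (by omega) (by omega)
      (by simpa using e61) (by simp [hy]) (by simpa using e61) (by simp [hy]) (by norm_num)
      fun s₃ k3 o3 => hQ _ _ (by omega) ⟨?_, ?_, by simp, ws ++ [(g i, y, g i, y)], by simp; omega,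
        by simpa using o3, fun w => ?_⟩
    · exact k3.lit (by simpa using k2'.lit f2)
    · rw [Keep.setVar_iff (by simp)]
      refine f1.trans (Keep.trans (B := 60) (Xs := [7]) (As := [2]) ?_ k3 (by norm_num) (by simp)
        (by simp)) le_rfl (by simp) (by simp)
      simpa using k2'.mono (by norm_num) (by simp) (by simp)
    · rw [List.mem_append, c3, List.mem_singleton]
      constructor
      · rintro (⟨r, h1, h2⟩ | rfl)
        · exact ⟨r, by omega, h2⟩
        · exact ⟨i, by omega, y, hy, hd.1 hne, rfl⟩
      · rintro ⟨r, h1, y', h2, h3, h4⟩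
        by_cases hri : r = i
        · subst hri
          have : y = y' := Fin.ext (by omega)
          exact .inr (by rw [h4, this])
        · exact .inl ⟨r, by omega, y', h2, h3, h4⟩
  · rintro s' ⟨f1, -, f3⟩
    exact ⟨f1, f3⟩

theorem spec_doublesWith (h : Ctx G t p q W a₀ a₁ d) {s : Store} {l : List ℕ}
    {ws : List (Swap n)}
    (ho : SwapOut s l ws) (h3 : s.var 3 = q)
    (hg : ∀ r < q, s.arr 14 r = g r) (h25 : ∀ r < q, s.arr 25 r ≤ n) {e : ℕ}
    (h8 : s.var 8 = e) (he : e ≤ n) {v y : Fin n} (h61 : s.var 61 = v) (h62 : s.var 62 = y)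
    (h4 : ∀ x : Fin n, s.arr 4 x = if x ∈ nb G d y then 1 else 0)
    (hW : l.length + 4 * (ws.length + q) + 9 ≤ W) :
    Spec W doublesWith (25 * t) s fun s' => Keep 67 [7, 66] [2] s s' ∧ ∃ ws', ws'.length ≤ q ∧
      SwapOut s' l (ws ++ ws') ∧ ∀ w, w ∈ ws' ↔ ∃ r < q, ∃ y' : Fin n, s.arr 25 r = y' + 1 ∧
        (g r : ℕ) + 1 ≠ e ∧ y' ∈ nb G d y ∧ w = (g r, y, v, y') := by
  have hW₁ := h.le_W₁
  have ht := At.q_le h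
  refine (spec_forTo (N := .var 3) (m := q) (T := 20) (Inv := fun i s' => Keep 67 [7, 66] [2] s s' ∧
    s'.var 67 = i ∧ ∃ ws', ws'.length ≤ i ∧ SwapOut s' l (ws ++ ws') ∧ ∀ w, w ∈ ws' ↔ ∃ r < i,
      ∃ y' : Fin n, s.arr 25 r = y' + 1 ∧ (g r : ℕ) + 1 ≠ e ∧ y' ∈ nb G d y ∧ w = (g r, y, v, y'))
    (by omega) (fun j s' h => ⟨h.2.1, h.1.lit h3⟩) ?_ ⟨by simp, by simp, [], by simp, by simpa using ho,
      by simp⟩).mono (by omega) ?_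
  · rintro i hi s₁ ⟨f1, f2, ws', c1, c2, c3⟩
    have hgi := (g i).2
    have ei : s₁.arr 14 i = g i := by rw [f1.2 14 (by simp), hg i hi]
    have e25 : s₁.arr 25 i = s.arr 25 i := by rw [f1.2 25 (by simp)]
    have b25 := h25 i hi
    have e8 : s₁.var 8 = e := f1.lit h8
    have e61 : s₁.var 61 = v := f1.lit h61
    have e62 : s₁.var 62 = y := f1.lit h62
    have e4 : s₁.arr 4 = s.arr 4 := f1.2 4 (by simp)
    refine Spec.intro fun Q hQ => ?_
    have none : ∀ s₂ k₂, k₂ ≤ 20 → Keep 68 [] [] s₁ s₂ → SwapOut s₂ l (ws ++ ws') →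
        (∀ y' : Fin n, ¬ (s.arr 25 i = y' + 1 ∧ (g i : ℕ) + 1 ≠ e ∧ y' ∈ nb G d y)) → Q k₂ s₂ := by
      intro s₂ k₂ hk₂ g2 o2 hno
      refine hQ _ _ hk₂ ⟨g2.lit f2, ?_, by simp, ws', by omega, by simpa using o2, fun w => ?_⟩
      · rw [Keep.setVar_iff (by simp)]
        exact f1.trans g2 (by norm_num) (by simp) (by simp)
      · rw [c3]
        refine ⟨fun ⟨r, h1, h2⟩ => ⟨r, by omega, h2⟩, fun ⟨r, h1, y, h2, h3, h4, h5⟩ => ⟨r, ?_, y, h2, h3, h4, h5⟩⟩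
        have : r ≠ i := by rintro rfl; exact hno y ⟨h2, h3, h4⟩
        omega
    simp only [wp_seq, wp_load, wp_ite, wp_skip, Operand.val, f2, ei, Store.setVar_var, Store.setVar_arr,
      Nat.reduceEqDiff, reduceIte, e25]
    refine ⟨by omega, by omega, by omega, by omega, fun hpos => ?_, fun hz => none _ _ (by omega)
      (by simp) (by simpa using c2) fun y => by omega⟩
    refine wp_differs (a := g i) (e := e) (by simp) (by simpa using e8) (by norm_num) (by norm_num)
      (by omega) (by omega) fun s₂ k2 v2 hd => ?_
    have k2' : Keep 68 [] [] s₁ s₂ := by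
      refine ⟨fun x hx _ => ?_, fun a ha => k2.2 a ha⟩
      rw [v2 x (by omega) (by omega)]
      simp [show x ≠ 68 by omega, show x ≠ 69 by omega]
    have o2 : SwapOut s₂ l (ws ++ ws') := c2.keep k2' (by norm_num)
    have e68 : s₂.var 68 = g i := by rw [v2 68 (by norm_num) (by norm_num)]; simp
    have e69 : s₂.var 69 = s.arr 25 i := by rw [v2 69 (by norm_num) (by norm_num)]; simp
    refine ⟨fun hne => ?_, fun heq => none _ _ (by omega) k2' o2 fun y => by tauto⟩
    obtain ⟨y', hy⟩ : ∃ y' : Fin n, s.arr 25 i = y' + 1 := ⟨⟨s.arr 25 i - 1, by omega⟩, by simp; omega⟩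
    have e4' : s₂.arr 4 y' = if y' ∈ nb G d y then 1 else 0 := by rw [k2'.2 4 (by simp), e4, h4]
    have e69' : s₂.var 69 - 1 = y' := by omega
    simp only [wp_sub, Operand.val, Store.setVar_var, Store.setVar_arr, reduceIte, e69', e4']
    refine ⟨by omega, by omega, by split_ifs <;> omega, fun hadj => ?_, fun hadj => none _ _ (by omega)
      (by simpa using k2') (by simpa using o2) fun x hx => ?_⟩
    · have hnb : y' ∈ nb G d y := by by_contra hn; rw [if_neg hn] at hadj; omega
      refine wp_emitSwap (w := (g i, y, v, y')) (l := l) (ws := ws ++ ws') (by simpa using o2)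
        (by simp; omega) (by omega) (by simpa using e68) (by simpa using k2'.lit e62)
        (by simpa using k2'.lit e61) (by simp) (by norm_num)
        fun s₃ k3 o3 => hQ _ _ (by omega) ⟨?_, ?_, by simp, ws' ++ [(g i, y, v, y')], by simp; omega,
          by simpa using o3, fun w => ?_⟩
      · exact k3.lit (by simpa using k2'.lit f2)
      · rw [Keep.setVar_iff (by simp)]
        refine f1.trans (Keep.trans (B := 67) (Xs := [7, 66]) (As := [2]) ?_ k3 (by norm_num) (by simp)
          (by simp)) le_rfl (by simp) (by simp)
        simpa using k2'.mono (by norm_num) (by simp) (by simp)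
      · rw [List.mem_append, c3, List.mem_singleton]
        constructor
        · rintro (⟨r, h1, h2⟩ | rfl)
          · exact ⟨r, by omega, h2⟩
          · exact ⟨i, by omega, y', hy, hd.1 hne, hnb, rfl⟩
        · rintro ⟨r, h1, x, h2, h3, h4, h5⟩
          by_cases hri : r = i
          · subst hri
            have : y' = x := Fin.ext (by omega)
            exact .inr (by rw [h5, this])
          · exact .inl ⟨r, by omega, x, h2, h3, h4, h5⟩
    · have : y' = x := Fin.ext (by omega)
      rw [← this] at hx
      rw [if_pos hx.2.2] at hadj
      omega
  · rintro s' ⟨f1, -, f3⟩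
    exact ⟨f1, f3⟩

/-- For `p = 2`, the case in which it is called, `r` runs through class `1` and `r'` through class
`0`. Array `25` holds at `r` the outside neighbour common to the class mates of `g r`. Such a vertex
fits into the opposite class, so `y`, read at `r`, replaces `g r'`, and `y'`, read at `r'`, replaces
`g r`. The neighbours of `y` are marked once for each `r`, which makes each test `y' ∈ nb G d y` a
single access. -/
theorem spec_doubles (h : Ctx G t p q W a₀ a₁ d) {s : Store} (hs : At n t p q a₀ a₁ d s) {l : List ℕ}
    {ws : List (Swap n)}
    (ho : SwapOut s l ws) (h6 : s.var 6 = p * q)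
    (hg : ∀ r < p * q, s.arr 14 r = g r) (h25 : ∀ r < p * q, s.arr 25 r ≤ n) {e : ℕ}
    (h8 : s.var 8 = e) (he : e ≤ n) (hM : s.arr 4 = fun _ => 0) (hws : ws.length ≤ p * q)
    (hW : l.length + 30 * (n + t + 2) ^ 2 ≤ W) :
    Spec W doubles (100 * (3 * t * (3 * t))) s fun s' => Keep 60 [7] [2] s s' ∧
      ∃ ws', ws'.length ≤ p * q * q ∧ SwapOut s' l (ws ++ ws') ∧ ∀ w, w ∈ ws' ↔
        ∃ r < p * q, q ≤ r ∧ ∃ y : Fin n, s.arr 25 r = y + 1 ∧ (g r : ℕ) + 1 ≠ e ∧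
          ∃ r' < q, ∃ y' : Fin n, s.arr 25 r' = y' + 1 ∧ (g r' : ℕ) + 1 ≠ e ∧ y' ∈ nb G d y ∧
            w = (g r', y, g r, y') := by
  have hW₁ := h.le_W₁
  have ht := At.q_le h
  have hpq := KF.pq h.params
  have := pow_bounds n t
  have hqq : ∀ i < p * q, i * q + q ≤ 2 * (n + t + 2) ^ 2 := fun i hi => by
    have : (i + 1) * q ≤ 2 * t * t := Nat.mul_le_mul (by omega) ht.1
    nlinarith
  have hcost : p * q * (65 * t + 60 + 2) + 2 ≤ 100 * (3 * t * (3 * t)) := by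
    have : p * q * (65 * t + 60 + 2) ≤ 2 * t * (65 * t + 62) := Nat.mul_le_mul_right _ (by omega)
    nlinarith
  refine (spec_forTo (N := .var 6) (m := p * q) (T := 65 * t + 60) (Inv := fun i s' =>
    Keep 60 [7] [2] s s' ∧ s'.var 60 = i ∧ ∃ ws', ws'.length ≤ i * q ∧ SwapOut s' l (ws ++ ws') ∧
      ∀ w, w ∈ ws' ↔ ∃ r < i, q ≤ r ∧ ∃ y : Fin n, s.arr 25 r = y + 1 ∧ (g r : ℕ) + 1 ≠ e ∧
          ∃ r' < q, ∃ y' : Fin n, s.arr 25 r' = y' + 1 ∧ (g r' : ℕ) + 1 ≠ e ∧ y' ∈ nb G d y ∧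
            w = (g r', y, g r, y'))
    (by omega) (fun j s' h => ⟨h.2.1, h.1.lit h6⟩) ?_ ⟨by simp, by simp, [], by simp, by simpa using ho,
      by simp⟩).mono hcost ?_
  · rintro i hi s₁ ⟨f1, f2, ws', c1, c2, c3⟩
    have hgi := (g i).2
    have ei : s₁.arr 14 i = g i := by rw [f1.2 14 (by simp), hg i hi]
    have e25 : s₁.arr 25 i = s.arr 25 i := by rw [f1.2 25 (by simp)]
    have b25 := h25 i hi
    have e8 : s₁.var 8 = e := f1.lit h8
    have e3 : s₁.var 3 = q := f1.lit hs.var_q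
    have e4 : s₁.arr 4 = fun _ => 0 := by rw [f1.2 4 (by simp), hM]
    have hiq := hqq i hi
    have hiq' : (i + 1) * q = i * q + q := by ring
    refine Spec.intro fun Q hQ => ?_
    have none : ∀ s₂ k₂, k₂ ≤ 65 * t + 60 → Keep 61 [] [] s₁ s₂ → SwapOut s₂ l (ws ++ ws') →
        (∀ y : Fin n, ¬ (q ≤ i ∧ s.arr 25 i = y + 1 ∧ (g i : ℕ) + 1 ≠ e)) → Q k₂ s₂ := by
      intro s₂ k₂ hk₂ g2 o2 hno
      refine hQ _ _ hk₂ ⟨g2.lit f2, ?_, by simp, ws', by omega, by simpa using o2, fun w => ?_⟩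
      · rw [Keep.setVar_iff (by simp)]
        exact f1.trans g2 (by norm_num) (by simp) (by simp)
      · rw [c3]
        refine ⟨fun ⟨r, h1, h2⟩ => ⟨r, by omega, h2⟩, fun ⟨r, h1, h2, y, h3, h4, h5⟩ =>
          ⟨r, ?_, h2, y, h3, h4, h5⟩⟩
        have : r ≠ i := by rintro rfl; exact hno y ⟨h2, h3, h4⟩
        omega
    simp only [wp_seq, wp_load, wp_ite, wp_skip, Operand.val, f2, ei, Store.setVar_var, Store.setVar_arr,
      Nat.reduceEqDiff, reduceIte, e25, e3]
    refine ⟨fun hlt => none _ _ (by omega) (by simp) c2 fun y => by omega, fun hge => ⟨by omega, by omega,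
      by omega, by omega, fun hpos => ?_, fun hz => none _ _ (by omega)
      (by simp) (by simpa using c2) fun y => by omega⟩⟩
    refine wp_differs (a := g i) (e := e) (by simp) (by simpa using e8) (by norm_num) (by norm_num)
      (by omega) (by omega) fun s₂ k2 v2 hd => ?_
    have k2' : Keep 61 [] [] s₁ s₂ := by
      refine ⟨fun x hx _ => ?_, fun a ha => k2.2 a ha⟩
      rw [v2 x (by omega) (by omega)]
      simp [show x ≠ 61 by omega, show x ≠ 62 by omega]
    have o2 : SwapOut s₂ l (ws ++ ws') := ⟨(by simpa using c2.1 : Out _ _).congr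
      (v2 7 (by norm_num) (by norm_num)) (k2.2 2 (by simp)), by
        rw [v2 66 (by norm_num) (by norm_num)]; simpa using c2.2⟩
    have e61 : s₂.var 61 = g i := by rw [v2 61 (by norm_num) (by norm_num)]; simp
    have e62 : s₂.var 62 = s.arr 25 i := by rw [v2 62 (by norm_num) (by norm_num)]; simp
    refine ⟨fun hne => ?_, fun heq => none _ _ (by omega) k2' o2 fun y => by tauto⟩
    obtain ⟨y, hy⟩ : ∃ y : Fin n, s.arr 25 i = y + 1 := ⟨⟨s.arr 25 i - 1, by omega⟩, by simp; omega⟩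
    have e62' : s₂.var 62 - 1 = y := by omega
    simp only [wp_sub, wp_add, Operand.val, e62']
    refine ⟨by omega, by omega, ?_⟩
    set s₃ := (s₂.setVar 62 y).setVar 64 (0 + 0) with hs₃
    have k3' : Keep 61 [] [] s₁ s₃ := by simpa [hs₃] using k2'
    have k3 : Keep 60 [7] [4, 2] s s₃ := (f1.mono le_rfl (by simp) (by simp)).trans k3' (by norm_num)
      (by simp) (by simp)
    have o3 : SwapOut s₃ l (ws ++ ws') := by simpa [hs₃] using o2
    refine wp_of_spec (spec_markRow h (hs.keep k3) (y := 62) (o := 64) (v := y) (off := 0) (k := 1)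
      (by norm_num) (by simp [hs₃]) (by norm_num) (by simp [hs₃]) (by omega) le_rfl) ?_
    rintro k₄ s₄ hk₄ ⟨a4, k4, m4⟩
    rw [k3'.2 4 (by simp), e4] at m4
    have k4' : Keep 60 [7] [4, 2] s s₄ := k3.trans k4 (by norm_num) (by simp) (by simp)
    refine wp_of_spec (spec_doublesWith h (o3.keep k4) (g := g) (e := e) (v := g i) (y := y) a4.var_q
      (fun r hr => by rw [k4'.2 14 (by simp), hg r (by omega)])
      (fun r hr => by rw [k4'.2 25 (by simp)]; exact h25 r (by omega)) (k4.lit (k3'.lit e8)) he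
      (k4.lit (by simpa [hs₃] using e61)) (k4.lit (by simp [hs₃])) (fun x => ?_) (by simp; omega)) ?_
    · rw [m4]
      refine if_congr ⟨?_, fun hx => ⟨x, hx, by simp⟩⟩ rfl rfl
      rintro ⟨z, hz, hxz⟩
      have : x = z := Fin.ext (by omega)
      rwa [this]
    rintro k₅ s₅ hk₅ ⟨k5, ws₂, d1, d2, d3⟩
    have k5' : Keep 60 [7] [4, 2] s s₅ := k4'.trans k5 (by norm_num) (by simp) (by simp)
    refine wp_of_spec (spec_markRow h (hs.keep k5') (y := 62) (o := 64) (v := y) (off := 0) (k := 0)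
      (by norm_num) (k5.lit (k4.lit (by simp [hs₃]))) (by norm_num)
      (k5.lit (k4.lit (by simp [hs₃]))) (by omega) (by omega)) ?_
    rintro k₆ s₆ hk₆ ⟨a6, k6, m6⟩
    have k6' : Keep 60 [7] [4, 2] s s₆ := k5'.trans k6 (by norm_num) (by simp) (by simp)
    refine hQ _ _ (by omega) ⟨?_, ?_, by simp, ws' ++ ws₂, by simp; omega, ?_, fun w => ?_⟩
    · exact k6.lit (k5.lit (k4.lit (k3'.lit f2)))
    · rw [Keep.setVar_iff (by simp)]
      refine k6'.restore ?_
      rw [m6, k5.2 4 (by simp), m4, hM]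
      funext j
      by_cases hj : ∃ x ∈ nb G d y, j = 0 + (x : ℕ) <;> simp only [hj, reduceIte]
    · rw [SwapOut.setVar_iff (by norm_num), ← List.append_assoc]
      exact d2.keep k6
    · rw [List.mem_append, c3, d3, k4'.2 25 (by simp)]
      constructor
      · rintro (⟨r, h1, h2⟩ | ⟨r', h1, y', h2, h3, h4, h5⟩)
        · exact ⟨r, by omega, h2⟩
        · exact ⟨i, by omega, by omega, y, hy, hd.1 hne, r', h1, y', h2, h3, h4, h5⟩
      · rintro ⟨r, h1, h2, x, h3, h4, r', h5, y', h6, h7, h8, h9⟩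
        by_cases hri : r = i
        · subst hri
          have : y = x := Fin.ext (by omega)
          subst this
          exact .inr ⟨r', h5, y', h6, h7, h8, h9⟩
        · exact .inl ⟨r, by omega, h2, x, h3, h4, r', h5, y', h6, h7, h8, h9⟩
  · rintro s' ⟨f1, -, f3⟩
    exact ⟨f1, f3⟩

/-- Compute the possible replacements of the vertices of the `K^p_q` whose classes are in array
`14`. -/
def analyse : Program :=
  .seq (markBase 1) (.seq extras (.seq (markBase 0) (.seq (commonValue diffTest 24)
    (commonValue sameTest 25))))

/-- Write the record of the `K^p_q` whose classes are in array `14`. -/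
def record : Program :=
  .seq analyse (.seq emitBase (.seq emitCore (.seq (.add 9 (.var 7) (.lit 0)) (.seq (emit (.lit 0))
  (.seq (.add 66 (.lit 0) (.lit 0)) (.seq singles
  (.seq (.ite (.var 2) (.lit 3) doubles .skip) (.store 2 (.var 9) (.var 66)))))))))

/-- The arrays that are changed when a record is written. -/
def recordArrays : List ℕ := [2, 17, 18, 19, 20, 21, 23, 24, 25]

/-- Reconciles the nested lists in `Record.words` with the single loop over array `14`. -/
theorem flatMap_finRange {α : Type*} (F : Fin p × Fin q → α) {w : ℕ → Fin p × Fin q}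
    (hw : ∀ b : Fin p × Fin q, w ((b.1 : ℕ) * q + b.2) = b) :
    (List.finRange p).flatMap (fun i => (List.finRange q).map fun j => F (i, j)) =
      (List.range (p * q)).map fun r => F (w r) := by
  rw [← List.map_coe_finRange_eq_range, List.map_map, ← List.ofFn_eq_map, List.ofFn_mul,
    List.flatMap_def, ← List.ofFn_eq_map]
  congr 2
  funext i
  rw [← List.ofFn_eq_map]
  congr 1
  funext j
  simp [hw (i, j)]

/-- Reduces replacements of one vertex to the table of outside neighbours. The conditions on `y`
alone can be read off at any vertex of another class, and there is one. -/
theorem single_iff (hP : Params t p q) {f : Fin p × Fin q → Fin n} {a : Fin p × Fin q} {y : Fin n} :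
    Single G (alive n d) f a y ↔ ∀ b, b.1 ≠ a.1 → Extra G d f (f b) y := by
  obtain ⟨c, hc⟩ := exists_ne_fst hP a
  constructor
  · rintro ⟨h1, h2, h3⟩ b hb
    exact ⟨h1, h2, (h3 b hb).symm⟩
  · intro h
    exact ⟨(h c hc).1, (h c hc).2.1, fun b hb => (h b hb).2.2.symm⟩

theorem exists_same_class (hP : Params t p q) (hp : p = 2) (b : Fin p × Fin q) :
    ∃ c : Fin p × Fin q, c.1 = b.1 ∧ c ≠ b := by
  have hq : 2 ≤ q := by
    obtain ⟨h1, h2, h3, h4⟩ := hP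
    subst hp; simp at h4; omega
  by_cases h : (b.2 : ℕ) = 0
  · exact ⟨(b.1, ⟨1, by omega⟩), rfl, fun h' => by rw [← h'] at h; simp at h⟩
  · exact ⟨(b.1, ⟨0, by omega⟩), rfl, fun h' => by rw [← h'] at h; simp at h⟩

/-- With two classes, `y` joins the class of `a` and has to see the class of `b` without `b`; so it
is the outside neighbour of the mates of `b`, not of those of `a`. Since `q ≥ 2`, there are such
mates, at which the conditions on `y` alone can be read off. -/
theorem double_iff (hP : Params t p q) (hp : p = 2) {f : Fin p × Fin q → Fin n} {a b : Fin p × Fin q}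
    (hab : a.1 ≠ b.1) {y y' : Fin n} :
    Double G (alive n d) f a b y y' ↔ (∀ c, c.1 = b.1 → c ≠ b → Extra G d f (f c) y) ∧
      (∀ c, c.1 = a.1 → c ≠ a → Extra G d f (f c) y') ∧ G.Adj y y' := by
  have two : ∀ c : Fin p × Fin q, c.1 ≠ a.1 ↔ c.1 = b.1 := fun c => by
    have h1 := c.1.2; have h2 := a.1.2; have h3 := b.1.2
    have h4 : (a.1 : ℕ) ≠ b.1 := fun h => hab (Fin.ext h)
    rw [Ne, Fin.ext_iff, Fin.ext_iff]; omega
  have two' : ∀ c : Fin p × Fin q, c.1 ≠ b.1 ↔ c.1 = a.1 := fun c => by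
    rw [Ne, ← two, not_not]
  constructor
  · rintro ⟨-, -, h1, h2, h3, h4, h5, h6, h7⟩
    exact ⟨fun c hc hcb => ⟨h1, h3, (h5 c ((two c).2 hc) hcb).symm⟩,
      fun c hc hca => ⟨h2, h4, (h6 c ((two' c).2 hc) hca).symm⟩, h7⟩
  · rintro ⟨h1, h2, h3⟩
    obtain ⟨c, hc, hcb⟩ := exists_same_class hP hp b
    obtain ⟨c', hc', hca⟩ := exists_same_class hP hp a
    exact ⟨hp, hab, (h1 c hc hcb).1, (h2 c' hc' hca).1, (h1 c hc hcb).2.1, (h2 c' hc' hca).2.1,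
      fun e he heb => (h1 e ((two e).1 he) heb).2.2.symm,
      fun e he hea => (h2 e ((two' e).1 he) hea).2.2.symm, h3⟩

/-- The common value over the other classes yields the replacements of one vertex, that over the
class mates the parts of the replacements of two. The latter is claimed only for `p = 2`, where
every vertex has a class mate. -/
theorem spec_analyse (h : Ctx G t p q W a₀ a₁ d) {s : Store} (hs : At n t p q a₀ a₁ d s)
    (hT : Tab t p q s) (hM : s.arr 4 = fun _ => 0) {f : Fin p × Fin q → Fin n} (hf : KF G f)
    (hA : ∀ b, f b ∈ alive n d) (h6 : s.var 6 = p * q) {w : ℕ → Fin p × Fin q}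
    (w1 : ∀ r < p * q, ((w r).1 : ℕ) * q + (w r).2 = r) (w2 : ∀ r < p * q, ((w r).1 : ℕ) = r / q)
    (ws : ∀ b : Fin p × Fin q, ∃ r < p * q, w r = b) (hg : ∀ r < p * q, s.arr 14 r = f (w r)) :
    Spec W analyse (800 * (3 * t * (3 * t))) s fun s' => Keep 60 [] (recordArrays.erase 2) s s' ∧
      ∀ r < p * q, s'.arr 19 r ≤ W ∧ (t < s'.arr 19 r ↔ Free G f (f (w r))) ∧ s'.arr 24 r ≤ n ∧
        (∀ y : Fin n, s'.arr 24 r = y + 1 ↔ Single G (alive n d) f (w r) y) ∧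
        (p = 2 → s'.arr 25 r ≤ n ∧ ∀ y : Fin n, s'.arr 25 r = y + 1 ↔
          ∀ c, c.1 = (w r).1 → c ≠ w r → Extra G d f (f c) y) := by
  have ht := At.q_le h
  have hpq := KF.pq h.params
  have hmm : 9 * t ≤ 3 * t * (3 * t) := by nlinarith
  have wc : ∀ r < p * q, ∀ r' < p * q, ((w r).1 = (w r').1 ↔ r / q = r' / q) := fun r hr r' hr' => by
    rw [Fin.ext_iff, w2 r hr, w2 r' hr']
  have wi : ∀ r < p * q, ∀ r' < p * q, (w r = w r' ↔ r = r') := fun r hr r' hr' =>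
    ⟨fun h => by rw [← w1 r hr, ← w1 r' hr', h], fun h => by rw [h]⟩
  refine Spec.intro fun Q hQ => ?_
  simp only [analyse, wp_seq]
  refine wp_of_spec (spec_markBase h (g := fun r => f (w r)) h6 hg le_rfl) ?_
  rintro k₁ s₁ hk₁ ⟨g1, m1⟩
  rw [hM] at m1
  refine wp_of_spec (spec_extras h (hs.keep g1) hf hA (g1.lit h6)
    (fun r hr => by rw [g1.2 14 (by simp), hg r hr]) (fun j => by rw [m1]; dsimp only; split_ifs <;> omega)
    fun x => ?_) ?_
  · rw [m1]
    constructor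
    · rintro hx c rfl
      obtain ⟨r, hr, rfl⟩ := ws c
      dsimp only at hx
      rw [if_pos ⟨r, hr, rfl⟩] at hx
      omega
    · intro hx
      refine if_neg ?_
      rintro ⟨r, -, hr⟩
      exact hx (w r) (Fin.ext hr.symm)
  rintro k₂ s₂ hk₂ ⟨g2, x2⟩
  refine wp_of_spec (spec_markBase h (g := fun r => f (w r)) (g2.lit (g1.lit h6))
    (fun r hr => by rw [g2.2 14 (by simp), g1.2 14 (by simp), hg r hr]) (Nat.zero_le 1)) ?_
  rintro k₃ s₃ hk₃ ⟨g3, m3⟩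
  have g13 : Keep 60 [] [17, 18, 19, 20] s s₃ := by
    refine Keep.restore (a := 4) (((g1.mono le_rfl (by simp) (by simp)).trans g2 le_rfl (by simp)
      (by simp)).trans g3 le_rfl (by simp) (by simp)) ?_
    rw [m3, g2.2 4 (by simp), m1, hM]
    funext j
    by_cases hj : ∃ r < p * q, j = (f (w r) : ℕ) <;> simp only [hj, reduceIte]
  have x3 : ∀ r < p * q, s₃.arr 18 r ≤ n ∧ s₃.arr 17 r = n + 1 - s₃.arr 18 r ∧
        (∀ y : Fin n, s₃.arr 18 r = y + 1 ↔ Extra G d f (f (w r)) y) ∧ s₃.arr 19 r ≤ W ∧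
        (t < s₃.arr 19 r ↔ Free G f (f (w r))) := fun r hr => by
    rw [g3.2 17 (by simp), g3.2 18 (by simp), g3.2 19 (by simp)]; exact x2 r hr
  refine wp_of_spec (spec_commonValue h (hs.keep g13) (g13.lit h6) (dst := 24)
    (P := fun i j => i / q ≠ j / q) (by norm_num)
    (fun s' hk => tests_diff h ((hT.keep g13).keep hk) (by simp))
    (fun s' hk => tests_diff h ((hT.keep g13).keep hk) (by simp))
    fun r hr => ⟨(x3 r hr).1, (x3 r hr).2.1⟩) ?_
  rintro k₄ s₄ hk₄ ⟨g4, x4⟩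
  have g14 : Keep 60 [] (recordArrays.erase 2) s s₄ := (g13.mono le_rfl (by simp)
    (by simp [recordArrays])).trans g4 le_rfl (by simp) (by simp [recordArrays])
  have hs4 : At n t p q a₀ a₁ d s₄ := hs.keep g14 (by norm_num) (by simp) (by simp [recordArrays])
    (by simp [recordArrays]) (by simp [recordArrays])
  have hT4 : Tab t p q s₄ := hT.keep g14 (by simp [recordArrays]) (by simp [recordArrays])
  refine wp_of_spec (spec_commonValue h hs4 (g14.lit h6) (dst := 25)
    (P := fun i j => i / q = j / q ∧ i ≠ j) (by norm_num)
    (fun s' hk => tests_same h (hT4.keep hk) (by simp))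
    (fun s' hk => tests_same h (hT4.keep hk) (by simp))
    fun r hr => by
      rw [g4.2 17 (by simp), g4.2 18 (by simp)]; exact ⟨(x3 r hr).1, (x3 r hr).2.1⟩) ?_
  rintro k₅ s₅ hk₅ ⟨g5, x5⟩
  rw [g4.2 18 (by simp)] at x5
  refine hQ _ _ (by omega) ⟨g14.trans g5 le_rfl (by simp) (by simp [recordArrays]), fun r hr => ?_⟩
  have q19 : s₅.arr 19 r = s₃.arr 19 r := by rw [g5.2 19 (by simp), g4.2 19 (by simp)]
  have q24 : s₅.arr 24 r = s₄.arr 24 r := by rw [g5.2 24 (by simp)]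
  have x24 := x4 r hr (by
    obtain ⟨b, hb⟩ := exists_ne_fst h.params (w r)
    obtain ⟨r', hr', rfl⟩ := ws b
    exact ⟨r', hr', fun h => hb ((wc r' hr' r hr).2 h.symm)⟩)
  rw [q19, q24]
  refine ⟨(x3 r hr).2.2.2.1, (x3 r hr).2.2.2.2, x24.1, fun y => ?_, fun hp => ?_⟩
  · rw [x24.2 y y.2, single_iff h.params]
    constructor
    · intro hall b hb
      obtain ⟨r', hr', rfl⟩ := ws b
      exact ((x3 r' hr').2.2.1 y).1 (hall r' hr' fun h => hb ((wc r' hr' r hr).2 h.symm))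
    · intro hall r' hr' hne
      exact ((x3 r' hr').2.2.1 y).2 (hall _ fun h => hne ((wc r' hr' r hr).1 h).symm)
  · have x25 := x5 r hr (by
      obtain ⟨c, hc, hcb⟩ := exists_same_class h.params hp (w r)
      obtain ⟨r', hr', rfl⟩ := ws c
      exact ⟨r', hr', ((wc r' hr' r hr).1 hc).symm, fun h => hcb ((wi r' hr' r hr).2 h.symm)⟩)
    refine ⟨x25.1, fun y => ?_⟩
    rw [x25.2 y y.2]
    constructor
    · intro hall b hb hbr
      obtain ⟨r', hr', rfl⟩ := ws b
      exact ((x3 r' hr').2.2.1 y).1 (hall r' hr' ⟨((wc r' hr' r hr).1 hb).symm,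
        fun h => hbr ((wi r' hr' r hr).2 h.symm)⟩)
    · intro hall r' hr' hne
      exact ((x3 r' hr').2.2.1 y).2 (hall _ ((wc r' hr' r hr).2 hne.1.symm)
        fun h => hne.2 ((wi r' hr' r hr).1 h).symm)

/-- The number `e` names the vertex that must not be replaced: it is `v + 1` in the local search,
which wants only the `K^p_q`'s through `v`, and `0`, for no restriction, in the algorithm. -/
theorem spec_record (h : Ctx G t p q W a₀ a₁ d) {s : Store} (hs : At n t p q a₀ a₁ d s)
    (hT : Tab t p q s) (hM : s.arr 4 = fun _ => 0) {f : Fin p × Fin q → Fin n} (hf : KF G f)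
    (hA : ∀ b, f b ∈ alive n d) (hC : Classes p q s f) (h6 : s.var 6 = p * q) {e : ℕ}
    (h8 : s.var 8 = e) (he : e ≤ n) (hfix : ∀ v : Fin n, (v : ℕ) + 1 = e → ∃ a, f a = v)
    {pre : List ℕ} (ho : Out s pre) (hW : pre.length + 100 * (n + t + 2) ^ 2 ≤ W) :
    Spec W record (1000 * (3 * t * (3 * t))) s fun s' => Keep 60 [7, 9] recordArrays s s' ∧
      ∃ r : Record n p q, Out s' (pre ++ r.words) ∧ r.words.length ≤ 20 * (n + t + 2) ^ 2 ∧
        r.Represents {H' : G.Subgraph | IsKpq p q (alive n d) H' ∧ Meet H' (toSub hf) ∧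
          ∀ v : Fin n, (v : ℕ) + 1 = e → v ∈ H'.verts} := by
  have ht := At.q_le h
  have hpq := KF.pq h.params
  have := pow_bounds n t
  have hmm : 9 * t ≤ 3 * t * (3 * t) := by nlinarith
  have htt : t * t + 4 * t ≤ (n + t + 2) ^ 2 := by nlinarith
  have hqq : p * q * q ≤ 2 * (t * t) := by
    have := Nat.mul_le_mul (show p * q ≤ 2 * t by omega) ht.1
    nlinarith
  obtain ⟨w, w1, w2, w3⟩ := exists_enum (p := p) (q := q) (by omega) (by omega)
  have ws : ∀ b : Fin p × Fin q, ∃ r < p * q, w r = b := fun b => ⟨_, index_lt b, w3 b⟩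
  have hg : ∀ r < p * q, s.arr 14 r = f (w r) := fun r hr => by
    have := hC (w r); rwa [w1 r hr] at this
  refine Spec.intro fun Q hQ => ?_
  simp only [record, wp_seq]
  refine wp_of_spec (spec_analyse h hs hT hM hf hA h6 w1 w2 ws hg) ?_
  rintro k₁ s₁ hk₁ ⟨g1, x1⟩
  have k1 : Keep 60 [7, 9] recordArrays s s₁ := g1.mono le_rfl (by simp)
    (by simp [recordArrays])
  have h141 : ∀ r < p * q, s₁.arr 14 r = f (w r) := fun r hr => by
    rw [k1.2 14 (by simp [recordArrays]), hg r hr]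
  refine wp_of_spec (spec_emitBase h (g := fun r => f (w r)) (ho.keep g1 (by norm_num) (by simp)
    (by simp [recordArrays])) (k1.lit h6) h141 (by omega)) ?_
  rintro k₂ s₂ hk₂ ⟨g2, o2⟩
  have k2 : Keep 60 [7, 9] recordArrays s s₂ := k1.trans g2 le_rfl (by simp) (by simp [recordArrays])
  have hs2 : At n t p q a₀ a₁ d s₂ := hs.keep k2 (by norm_num) (by simp) (by simp [recordArrays])
    (by simp [recordArrays]) (by simp [recordArrays])
  set base := (List.range (p * q)).map fun r => (f (w r) : ℕ) with hbase
  have lbase : base.length = p * q := by simp [hbase]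
  clear_value base
  refine wp_of_spec (spec_emitCore h (g := fun r => f (w r)) hs2 o2 (k2.lit h6)
    (fun r hr => by rw [g2.2 14 (by simp), h141 r hr])
    (fun r hr => by rw [g2.2 19 (by simp)]; exact (x1 r hr).1) ?_) ?_
  · rw [List.length_append]
    omega
  rintro k₃ s₃ hk₃ ⟨g3, c, c1, o3, c2⟩
  have k3 : Keep 60 [7, 9] recordArrays s s₃ := k2.trans g3 le_rfl (by simp) (by simp [recordArrays])
  set pre₃ := pre ++ base ++ c.length :: c.map fun v : Fin n => (v : ℕ) with hpre₃
  have lpre : pre₃.length ≤ pre.length + 4 * t + 1 := by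
    simp [hpre₃, lbase]; omega
  simp only [wp_add, Operand.val, o3.1]
  refine ⟨by omega, wp_emit (l := pre₃) (by simpa using o3) (by omega) (by simp) fun s₄ g4 o4 => ?_⟩
  simp only [Operand.val] at o4
  refine ⟨by omega, ?_⟩
  set s₅ := s₄.setVar 66 (0 + 0) with hs₅
  have k4 : Keep 60 [7, 9] [2] s₃ s₅ := by
    rw [hs₅, Keep.setVar_iff (by simp)]
    exact Keep.trans (by simp) g4 (by norm_num) (by simp) (by simp)
  have k5 : Keep 60 [7, 9] recordArrays s s₅ := k3.trans k4 le_rfl (by simp) (by simp [recordArrays])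
  have sw5 : SwapOut s₅ pre₃ ([] : List (Swap n)) := by
    refine ⟨by simpa [hs₅] using o4, by simp [hs₅]⟩
  have h145 : ∀ r < p * q, s₅.arr 14 r = f (w r) := fun r hr => by
    rw [k5.2 14 (by simp [recordArrays]), hg r hr]
  have q51 : ∀ a, a ≠ 2 → s₅.arr a = s₁.arr a := fun a ha => by
    rw [k4.2 a (by simpa), g3.2 a (by simpa), g2.2 a (by simpa)]
  have e9 : s₅.var 9 = pre₃.length := by
    rw [hs₅]; simpa using g4.lit (k := pre₃.length) (y := 9) (by simp)
  refine wp_of_spec (spec_singles h (g := fun r => f (w r)) sw5 (k5.lit h6) h145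
    (fun r hr => by rw [q51 24 (by norm_num)]; exact (x1 r hr).2.2.1) (k5.lit h8) he (by omega)) ?_
  rintro k₆ s₆ hk₆ ⟨g6, sw₁, l6, o6, m6⟩
  have k6 : Keep 60 [7, 9] recordArrays s s₆ := k5.trans g6 le_rfl (by simp) (by simp [recordArrays])
  have hs6 : At n t p q a₀ a₁ d s₆ := hs.keep k6 (by norm_num) (by simp) (by simp [recordArrays])
    (by simp [recordArrays]) (by simp [recordArrays])
  rw [q51 24 (by norm_num)] at m6
  have fin : ∀ s₇ k₇, k₇ + 1 ≤ 1000 * (3 * t * (3 * t)) → Keep 60 [7] [2] s₆ s₇ →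
      ∀ sw₂ : List (Swap n), sw₂.length ≤ 2 * (t * t) →
      SwapOut s₇ pre₃ (sw₁ ++ sw₂) →
      (∀ u ∈ sw₂, ∃ a b y y', Double G (alive n d) f a b y y' ∧ (f a : ℕ) + 1 ≠ e ∧
        (f b : ℕ) + 1 ≠ e ∧ u = (f a, y, f b, y')) →
      (∀ a b y y', (a.1 : ℕ) = 0 → Double G (alive n d) f a b y y' → (f a : ℕ) + 1 ≠ e →
        (f b : ℕ) + 1 ≠ e → (f a, y, f b, y') ∈ sw₂) →
      wp W (.store 2 (.var 9) (.var 66)) s₇ k₇ Q := by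
    intro s₇ k₇ hk₇ g7 sw₂ l7 o7 hd₁ hd₂
    simp only [wp_store, Operand.val, o7.2, g7.lit (g6.lit e9)]
    have lw : (sw₁ ++ sw₂).length ≤ 2 * t + 2 * (t * t) := by simp; omega
    have hwords : (⟨f, c, sw₁ ++ sw₂⟩ : Record n p q).words =
        base ++ c.length :: (c.map fun v : Fin n => (v : ℕ)) ++
          (sw₁ ++ sw₂).length :: (sw₁ ++ sw₂).flatMap swapWords := by
      rw [hbase, ← flatMap_finRange (fun b => (f b : ℕ)) w3, Record.words]
      simp [List.map_eq_flatMap, show (swapWords : Swap n → _) = fun w =>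
        [(w.1 : ℕ), (w.2.1 : ℕ), (w.2.2.1 : ℕ), (w.2.2.2 : ℕ)] from rfl]
    refine ⟨by omega, by omega, hQ _ _ hk₇ ⟨?_, ⟨f, c, sw₁ ++ sw₂⟩, ?_, ?_, ?_⟩⟩
    · rw [Keep.setArr_iff (by simp [recordArrays])]
      exact k6.trans g7 le_rfl (by simp) (by simp [recordArrays])
    · have := o7.1.fill (s' := s₇.setArr 2 pre₃.length (sw₁ ++ sw₂).length)
        (k := (sw₁ ++ sw₂).length) rfl (by simp)
      rw [hwords]
      simpa [hpre₃] using this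
    · rw [hwords, List.length_append, List.length_append, List.length_cons, List.length_cons,
        length_flatMap_swapWords, List.length_map, lbase]
      omega
    · refine represents_of (fix := fun v : Fin n => (v : ℕ) + 1 = e) h.params h.bounded hf hA
        (spans_toSub hf) hfix rfl (fun v => ?_) (fun u hu => ?_) (fun a y hy hne => ?_)
        fun a b y y' h0 hy ha hb => List.mem_append_right _ (hd₂ a b y y' h0 hy ha hb)
      · rw [c2]
        refine and_congr_right fun hq => ⟨?_, fun hv => ?_⟩
        · rintro ⟨r, hr, hlt, rfl⟩
          rw [g2.2 19 (by simp)] at hlt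
          exact (x1 r hr).2.1.1 hlt
        · obtain ⟨a, rfl⟩ := hv.exists_eq
          obtain ⟨r, hr, rfl⟩ := ws a
          rw [g2.2 19 (by simp)]
          exact ⟨r, hr, (x1 r hr).2.1.2 hv, rfl⟩
      · rcases List.mem_append.1 hu with hu | hu
        · obtain ⟨r, hr, y, hy, hne, rfl⟩ := (m6 u).1 hu
          exact .inl ⟨w r, y, ((x1 r hr).2.2.2.1 y).1 hy, hne, rfl⟩
        · exact .inr (hd₁ u hu)
      · obtain ⟨r, hr, rfl⟩ := ws a
        exact List.mem_append_left _ ((m6 _).2 ⟨r, hr, y, ((x1 r hr).2.2.2.1 y).2 hy, hne, rfl⟩)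
  simp only [wp_ite, wp_skip, Operand.val, hs6.var_p]
  refine ⟨fun hp => ?_, fun hp => ?_⟩
  · have hp2 : p = 2 := by omega
    have q61 : ∀ a, a ≠ 2 → s₆.arr a = s₁.arr a := fun a ha => by
      rw [g6.2 a (by simpa), q51 a ha]
    refine wp_of_spec (spec_doubles h (g := fun r => f (w r)) hs6 (ws := sw₁) o6 (k6.lit h6)
      (fun r hr => by rw [g6.2 14 (by simp), h145 r hr])
      (fun r hr => by rw [q61 25 (by norm_num)]; exact ((x1 r hr).2.2.2.2 hp2).1) (k6.lit h8) he
      (by rw [k6.2 4 (by simp [recordArrays]), hM]) l6 (by omega)) ?_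
    rintro k₇ s₇ hk₇ ⟨g7, sw₂, l7, o7, m7⟩
    rw [q61 25 (by norm_num)] at m7
    have c0 : ∀ r < q, ((w r).1 : ℕ) = 0 := fun r hr => by
      rw [w2 r (by omega), Nat.div_eq_of_lt hr]
    have c1 : ∀ r < p * q, q ≤ r → ((w r).1 : ℕ) ≠ 0 := fun r hr hq => by
      rw [w2 r hr]; exact (Nat.div_pos hq (by omega)).ne'
    refine fin s₇ _ (by omega) g7 sw₂ (by omega) o7 (fun u hu => ?_) fun a b y y' h0 hd ha hb => ?_
    · obtain ⟨r, hr, hq, y, hy, hne, r', hr', y', hy', hne', hadj, rfl⟩ := (m7 u).1 hu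
      rw [mem_nb] at hadj
      refine ⟨w r', w r, y, y', (double_iff h.params hp2 fun hc => ?_).2
        ⟨(((x1 r hr).2.2.2.2 hp2).2 y).1 hy, (((x1 r' (by omega)).2.2.2.2 hp2).2 y').1 hy', hadj.1⟩,
        hne', hne, rfl⟩
      exact c1 r hr hq (by rw [← hc, c0 r' hr'])
    · have hab := hd.2.1
      have hy' : d y' = 0 := hd.2.2.2.1
      obtain ⟨d1, d2, d3⟩ := (double_iff h.params hp2 hab).1 hd
      obtain ⟨r', hr', rfl⟩ := ws a
      obtain ⟨r, hr, rfl⟩ := ws b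
      have lt_q : ¬ q ≤ r' := fun hq => c1 r' hr' hq h0
      have le_q : q ≤ r := by
        by_contra hq
        exact hab (Fin.ext (by rw [h0, c0 r (by omega)]))
      exact (m7 _).2 ⟨r, hr, le_q, y, (((x1 r hr).2.2.2.2 hp2).2 y).2 d1, hb, r', by omega, y',
        (((x1 r' hr').2.2.2.2 hp2).2 y').2 d2, ha, mem_nb.2 ⟨d3, hy'⟩, rfl⟩
  · exact fin s₆ _ (by omega) Keep.refl [] (by simp) (by simpa using o6) (by simp)
      fun a b y y' _ hd => by have := hd.1; omega

/-! ## Inputs, the friend procedure and the local search -/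

theorem IsInput.ctx {x : ℕ} {s : Store} (h : IsInput G t p q x s) (hP : Params t p q)
    (hB : Bounded G t) (hW : 1000 * (n + t + 2) ^ 4 ≤ W) :
    Ctx G t p q W (s.arr 0) (s.arr 1) fun _ => 0 :=
  ⟨hP, hB, hW, h.off_zero, h.off_succ, h.adj, by simp⟩

theorem IsInput.arr_eq {x : ℕ} {s : Store} (h : IsInput G t p q x s) {a : ℕ} (ha : 2 ≤ a) :
    s.arr a = fun _ => 0 := funext (h.arr_rest a ha)

theorem IsInput.at {x : ℕ} {s : Store} (h : IsInput G t p q x s) :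
    At n t p q (s.arr 0) (s.arr 1) (fun _ => 0) s :=
  ⟨h.var_n, h.var_t, h.var_p, h.var_q, rfl, rfl, h.arr_eq (by norm_num)⟩

theorem alive_zero : alive n (fun _ => 0) = Set.univ := by simp [alive]

/-- As `n + t + 2 ≥ 5` and `5 ^ 5 > 1000`, five more factors absorb the constant. -/
theorem one_thousand_mul_le {C : ℕ} (hC : 9 ≤ C) (ht : 3 ≤ t) :
    1000 * (n + t + 2) ^ 4 ≤ (n + t + 2) ^ C := by
  have h5 : 5 ^ 5 ≤ (n + t + 2) ^ 5 := Nat.pow_le_pow_left (by omega) 5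
  calc 1000 * (n + t + 2) ^ 4 ≤ (n + t + 2) ^ 5 * (n + t + 2) ^ 4 :=
        Nat.mul_le_mul (by omega) le_rfl
    _ = (n + t + 2) ^ 9 := by rw [← pow_add]
    _ ≤ _ := Nat.pow_le_pow_right (by omega) hC

def friendMain : Program :=
  .seq (.add 30 (.var 4) (.lit 0)) (.seq friend (.add 5 (.var 31) (.lit 0)))

theorem spec_friendMain (hP : Params t p q) (hB : Bounded G t)
    (hW : 1000 * (n + t + 2) ^ 4 ≤ W) {v : Fin n} {s : Store} (hs : IsInput G t p q v s) :
    Spec W friendMain (1100 * t) s fun s' =>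
      ∃ a : Option (Fin n), OutputOption s' a ∧ FriendAnswer G p q Set.univ v a := by
  have h := hs.ctx hP hB hW
  have hW₁ := h.le_W₁
  have ht := At.q_le h
  have hv := v.2
  refine Spec.intro fun Q hQ => ?_
  simp only [friendMain, wp_seq, wp_add, Operand.val, hs.var_x]
  refine ⟨by omega, wp_of_spec (spec_friend (v := v) h (s := s.setVar 30 (v + 0))
    (by simpa using hs.at) (by simpa using hs.arr_eq (by norm_num)) (by simp)) ?_⟩
  rw [alive_zero]
  rintro k s₁ hk ⟨-, -, ⟨h0, ha⟩ | ⟨x, hx, ha⟩⟩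
  · exact ⟨by omega, hQ _ _ (by omega) ⟨none, by simp [OutputOption, h0], ha⟩⟩
  · exact ⟨by omega, hQ _ _ (by omega) ⟨some x, by simp [OutputOption, hx], ha⟩⟩

def searchMain : Program :=
  .seq tables (.seq (.add 51 (.var 4) (.lit 0)) (.seq find (.ite (.lit 0) (.var 50)
    (.seq (.add 8 (.var 4) (.lit 1)) (.seq record (.add 5 (.lit 1) (.lit 0)))) .skip)))

theorem OutputRecords.of_out {s : Store} {rs : List (Record n p q)} (h5 : s.var 5 = rs.length)
    (ho : Out s (rs.flatMap Record.words)) : OutputRecords s rs := ⟨h5, ho.2⟩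

/-- One record is enough, since all `K^p_q`'s through `v` meet the one that was found, and the
exclusion of `v` from the replacements leaves just those. -/
theorem spec_searchMain (hP : Params t p q) (hB : Bounded G t)
    (hW : 1000 * (n + t + 2) ^ 4 ≤ W) {v : Fin n} {s : Store} (hs : IsInput G t p q v s) :
    Spec W searchMain (500000 * t ^ 2) s fun s' =>
      ∃ (Fs : List (Set G.Subgraph)) (rs : List (Record n p q)),
        OutputRecords s' rs ∧ List.Forall₂ Record.Represents rs Fs ∧
          {H | ∃ F ∈ Fs, H ∈ F} = {H | IsKpq p q Set.univ H ∧ v ∈ H.verts} := by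
  have h := hs.ctx hP hB hW
  have hW₁ := h.le_W₁
  have hW₂ := h.le_W₂
  have ht := At.q_le h
  have hv := v.2
  have htt : 3 * t ≤ t ^ 2 := by rw [sq]; exact Nat.mul_le_mul ht.2.2.1 le_rfl
  have h9 : 3 * t * (3 * t) = 9 * t ^ 2 := by ring
  refine Spec.intro fun Q hQ => ?_
  simp only [searchMain, wp_seq]
  refine wp_of_spec (spec_tables h hs.at) ?_
  rintro k₁ s₁ hk₁ ⟨g1, e6, hT⟩
  simp only [wp_add, Operand.val, g1.lit hs.var_x]
  have g1' : Keep 10 [6] [8, 16] s (s₁.setVar 51 (v + 0)) :=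
    g1.setVar (by simp)
  have hs1 := hs.at.keep g1'
  have hM : s.arr 4 = fun _ => 0 := hs.arr_eq (by norm_num)
  refine ⟨by omega, wp_of_spec (spec_find (v := v) h hs1 (hT.keep (B := 10) (Xs := []) (As := []) (Keep.refl.setVar (by simp)))
    (by rw [g1'.2 4 (by simp), hM]) (by simp) rfl (by simpa using e6)) ?_⟩
  rintro k₂ s₂ hk₂ ⟨g2, hfind⟩
  have k2 : Keep 10 [6] (8 :: 16 :: findArrays) s s₂ := (g1'.mono le_rfl (by simp) (by simp)).trans
    g2 (by norm_num) (by simp) (by simp +contextual)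
  have hs2 := hs.at.keep k2 (by norm_num) (by simp) (by simp [findArrays, attemptArrays])
    (by simp [findArrays, attemptArrays]) (by simp [findArrays, attemptArrays])
  simp only [wp_ite, wp_seq, wp_add, wp_skip, Operand.val, k2.lit hs.var_x]
  rcases hfind with ⟨h0, hno⟩ | ⟨h1, f, hf, hA, hvf, hC⟩
  · refine ⟨fun h' => by omega, fun _ => hQ _ _ (by omega) ⟨[], [], ?_, .nil, ?_⟩⟩
    · exact ⟨k2.lit (hs.var_rest 5 le_rfl), by simp⟩
    · ext H
      simp only [List.not_mem_nil, false_and, exists_false, Set.mem_ofPred_eq, false_iff, not_and]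
      intro hH hvH
      obtain ⟨f, hf, -, hsp⟩ := isKpq_iff.1 hH
      exact hno ⟨f, hf, fun _ => rfl, hsp.mem.1 hvH⟩
  · refine ⟨fun _ => ⟨by omega, ?_⟩, fun h' => by omega⟩
    have out0 : Out (s₂.setVar 8 (v + 1)) [] :=
      ⟨by simpa using k2.lit (hs.var_rest 7 (by norm_num)), by simp⟩
    have hT2 : Tab t p q s₂ := ((hT.keep (B := 10) (Xs := []) (As := [])
      (Keep.refl.setVar (by simp))).keep g2 (by simp [findArrays, attemptArrays]) (by simp [findArrays, attemptArrays]))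
    refine wp_of_spec (spec_record h (s := s₂.setVar 8 (v + 1)) (e := v + 1) (by simpa using hs2)
      (hT2.keep (B := 8) (Xs := []) (As := []) (Keep.refl.setVar (by simp)))
      (by rw [Store.setVar_arr, k2.2 4 (by simp [findArrays, attemptArrays]), hM]) hf hA hC
      (by simpa using g2.lit (y := 6) (by simpa using e6)) (by simp) (by omega)
      (fun u hu => by rwa [show u = v from Fin.ext (by omega)]) out0 (by simp; omega)) ?_
    rintro k₃ s₃ hk₃ ⟨g3, r, hr, -, hrep⟩
    refine ⟨by omega, hQ _ _ (by omega) ⟨[{H' | IsKpq p q (alive n fun _ => 0) H' ∧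
      Meet H' (toSub hf) ∧ ∀ u : Fin n, (u : ℕ) + 1 = v + 1 → u ∈ H'.verts}], [r],
      .of_out (by simp) ?_, .cons hrep .nil, ?_⟩⟩
    · simpa using hr
    · ext H
      simp only [List.mem_singleton, exists_eq_left, Set.mem_ofPred_eq, alive_zero]
      refine ⟨fun hH => ⟨hH.1, hH.2.2 v rfl⟩, fun hH => ⟨hH.1, ⟨v, hH.2, (spans_toSub hf).mem.2 hvf⟩,
        fun u hu => ?_⟩⟩
      rw [show u = v from Fin.ext (by omega)]
      exact hH.2

/-! ## Removing vertices -/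

/-- The rule for amortized costs: the decrease of the potential `φ` pays for each pass and its test.
-/
theorem spec_loop {W : ℕ} {u v : Operand} {c : Program} {Inv : ℕ → Store → Prop}
    (step : ∀ φ s, Inv φ s → u.val s < v.val s →
      wp W c s 0 fun k s' => ∃ φ', k + 1 + φ' ≤ φ ∧ Inv φ' s') (φ : ℕ) (s : Store) (h : Inv φ s) :
    Spec W (.loop u v c) (φ + 1) s fun s' => ¬ u.val s' < v.val s' ∧ ∃ φ', Inv φ' s' := by
  induction φ using Nat.strong_induction_on generalizing s with
  | _ φ ih =>
    by_cases hc : u.val s < v.val s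
    · obtain ⟨l, s', hr, φ', hφ, hI⟩ := step φ s h hc
      obtain ⟨l', s'', hr', hl', hQ⟩ := ih φ' (by omega) s' hI
      exact ⟨l + l' + 1, s'', .loopMore hc hr hr', by omega, hQ⟩
    · exact ⟨1, s, .loopDone hc, by omega, hc, φ, h⟩

/-- Remove the vertices in the first `y` cells of array `a`. -/
def killList (a y : ℕ) : Program :=
  forTo 13 (.var y) (.seq (.load 14 a (.var 13)) (.store 3 (.var 14) (.lit 1)))

/-- The removed vertices after the removal of those on the list. -/
def kill {n : ℕ} (d : ℕ → ℕ) (l : List (Fin n)) (i : ℕ) : ℕ := if ∃ x ∈ l, (x : ℕ) = i then 1 else d i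

theorem Ctx.kill (h : Ctx G t p q W a₀ a₁ d) (l : List (Fin n)) :
    Ctx G t p q W a₀ a₁ (kill d l) :=
  { h with dead_le := fun i => by have := h.dead_le i; unfold KpqSearch.kill; split_ifs <;> omega }

theorem alive_kill (l : List (Fin n)) : alive n (kill d l) = alive n d \ {x | x ∈ l} := by
  ext x
  simp only [alive, kill, Set.mem_ofPred_eq, Set.mem_sdiff, Fin.val_inj, exists_eq_right]
  split_ifs with hx <;> simp [hx]

theorem spec_killList (h : Ctx G t p q W a₀ a₁ d) {s : Store} (hs : At n t p q a₀ a₁ d s)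
    {a y : ℕ} {l : List (Fin n)} (hl : Lst s a l) (hy : s.var y = l.length) (ha : a ≠ 3)
    (hy' : y ≠ 13 ∧ y ≠ 14) (hlen : l.length ≤ 10 * (n + t + 2)) :
    Spec W (killList a y) (4 * l.length + 2) s fun s' => Keep 1000 [13, 14] [3] s s' ∧
      At n t p q a₀ a₁ (kill d l) s' := by
  have hW₁ := h.le_W₁
  refine (spec_forTo (N := .var y) (m := l.length) (T := 2) (Inv := fun j s' =>
    Keep 1000 [13, 14] [3] s s' ∧ s'.var 13 = j ∧ s'.var y = l.length ∧
      At n t p q a₀ a₁ (kill d (l.take j)) s') (by omega) (fun j s' h => ⟨h.2.1, h.2.2.1⟩) ?_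
    ⟨by simp, by simp, by simp [hy, hy'.1], ?_⟩).mono (by omega) fun s' hs' => ?_
  · rintro j hj s₁ ⟨f1, f2, f3, f4⟩
    have := l[j].2
    refine Spec.intro fun Q hQ => ?_
    have e : s₁.arr a j = l[j] := by rw [f1.2 a (by simpa), hl j hj]
    simp only [wp_seq, wp_load, wp_store, Operand.val, f2, e, Store.setVar_var, reduceIte]
    refine ⟨by omega, by omega, by omega, by omega, hQ _ _ (by omega) ⟨by simpa using f2,
      by simpa using f1, by simp, by simpa [hy'] using f3, ?_⟩⟩
    obtain ⟨g0, g1, g2, g3, g4, g5, g6⟩ := f4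
    refine ⟨by simpa, by simpa, by simpa, by simpa, by simpa, by simpa, ?_⟩
    funext i
    simp only [Store.setVar_arr, Store.setArr_arr, reduceIte, g6, Function.update_apply, kill,
      List.take_add_one, List.getElem?_eq_getElem hj, Option.toList_some, List.mem_append,
      List.mem_singleton, or_and_right, exists_or, exists_eq_left]
    by_cases hi : i = l[j]
    · simp [hi]
    · simp [hi, Ne.symm hi]
  · rw [List.take_zero, show kill d ([] : List (Fin n)) = d by funext i; simp [kill]]
    simpa using hs
  · exact ⟨hs'.1, by simpa using hs'.2.2.2⟩

/-- Remove the vertices in variables `10` and `12` and their common neighbours. -/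
def killCommon : Program :=
  .seq (.add 15 (.lit 0) (.lit 0)) (.seq (.store 33 (.lit 0) (.var 10))
  (.seq (.store 33 (.lit 1) (.var 12)) (.seq (.add 150 (.lit 0) (.lit 2))
  (.seq (markRow 15 12 1) (.seq (markRow 15 10 0) (.seq (appendUnmarked 33 12)
  (.seq (markRow 15 12 0) (killList 33 150))))))))

/-- First the neighbours of `u` are marked, then those of `v` are unmarked. The neighbours of `u`
that are now unmarked are the common ones. -/
theorem spec_killCommon (h : Ctx G t p q W a₀ a₁ d) {s : Store} (hs : At n t p q a₀ a₁ d s)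
    (hM : s.arr 4 = fun _ => 0) {v u : Fin n} (h10 : s.var 10 = v) (h12 : s.var 12 = u) :
    Spec W killCommon (200 * t) s fun s' => Keep 30 [13, 14, 15] [3, 33] s s' ∧
      ∃ l : List (Fin n), At n t p q a₀ a₁ (kill d l) s' ∧
        {x | x ∈ l} = {v, u} ∪ commonIn G (alive n d) v u := by
  have hW₁ := h.le_W₁
  have ht := At.q_le h
  refine Spec.intro fun Q hQ => ?_
  simp only [killCommon, wp_seq, wp_add, wp_store, Operand.val, Store.setVar_var, Store.setArr_var,
    h10, h12, Nat.reduceEqDiff, reduceIte]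
  refine ⟨by omega, by omega, by omega, by omega, by omega, by omega, ?_⟩
  set s₁ := ((((s.setVar 15 (0 + 0)).setArr 33 0 v).setArr 33 1 u).setVar 150 (0 + 2)) with hs₁
  have k1 : Keep 30 [13, 14, 15] [33] s s₁ := by simp [hs₁]
  have hs1 := hs.keep k1
  have e10 : s₁.var 10 = v := k1.lit h10
  have e12 : s₁.var 12 = u := k1.lit h12
  have e15 : s₁.var 15 = 0 := by simp [hs₁]
  have l1 : Lst s₁ 33 [v, u] := by
    intro j hj
    rcases j with _ | _ | j
    · simp [hs₁]
    · simp [hs₁]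
    · simp at hj
  refine wp_of_spec (spec_markRow h hs1 (by norm_num) e12 (by norm_num) e15 (Nat.zero_le _) le_rfl) ?_
  rintro k₂ s₂ hk₂ ⟨hs2, k2, m2⟩
  refine wp_of_spec (spec_markRow h hs2 (by norm_num) (k2.lit e10) (by norm_num) (k2.lit e15)
    (Nat.zero_le _) zero_le_one) ?_
  rintro k₃ s₃ hk₃ ⟨hs3, k3, m3⟩
  have k13 := k2.trans k3 le_rfl (by simp) (by simp)
  have m3' : ∀ x : Fin n, x ∈ nb G d u → (s₃.arr 4 x = 0 ↔ x ∈ nb G d v) := fun x hx => by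
    rw [m3, m2]
    simp only [zero_add, Fin.val_inj, exists_eq_right', hx]
    split_ifs with hx' <;> simp [hx']
  refine wp_of_spec (spec_appendUnmarked h hs3 (by norm_num) (by norm_num) (k13.lit e12)
    (fun j => ?_) (l := [v, u]) (l1.congr (k13.2 33 (by simp))) (k13.lit (by simp [hs₁]))
    (by simp; omega)) ?_
  · rw [m3, m2, k1.2 4 (by simp), hM]
    dsimp only
    split_ifs <;> simp
  rintro k₄ s₄ hk₄ ⟨hs4, k4, l, l_nodup, l_mem, l4, e4⟩
  have k14 : Keep 150 [] [4, 33] s₁ s₄ := (k13.mono (by norm_num) (by simp) (by simp)).trans k4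
    le_rfl (by simp) (by simp)
  refine wp_of_spec (spec_markRow h hs4 (by norm_num) (k14.lit e12) (by norm_num) (k14.lit e15)
    (Nat.zero_le _) zero_le_one) ?_
  rintro k₅ s₅ hk₅ ⟨hs5, k5, m5⟩
  have len : l.length ≤ t + 1 := by
    rw [← List.toFinset_card_of_nodup l_nodup]
    exact le_trans (Finset.card_le_card fun y hy => ((l_mem y).1 (by simpa using hy)).1)
      (h.card_nb_le u)
  have len' : ([v, u] ++ l).length ≤ t + 3 := by simp; omega
  have m5' : s₅.arr 4 = s.arr 4 := by
    rw [m5, k4.2 4 (by simp), m3, m2, k1.2 4 (by simp), hM]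
    funext j
    dsimp only
    split_ifs <;> simp
  have k15 : Keep 30 [13, 14, 15] [33] s s₅ := by
    have : Keep 30 [13, 14, 15] [4, 33] s s₅ := (k1.mono le_rfl (by simp) (by simp)).trans
      (k14.trans k5 (by norm_num) (by simp) (by simp)) (by norm_num) (by simp) (by simp)
    exact this.restore m5'
  refine wp_of_spec (spec_killList h hs5 (l := [v, u] ++ l) (l4.congr (k5.2 33 (by simp)))
    (k5.lit e4) (by norm_num) (by norm_num) (by omega)) ?_
  rintro k₆ s₆ hk₆ ⟨k6, hs6⟩
  refine hQ _ _ (by omega) ⟨(k15.mono le_rfl (by simp) (by simp)).trans k6 (by norm_num)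
    (by simp) (by simp), _, hs6, ?_⟩
  ext x
  have := m3' x
  simp only [mem_nb] at this
  simp only [List.mem_append, List.mem_cons, List.not_mem_nil, or_false, Set.mem_ofPred_eq, l_mem,
    mem_nb, Set.mem_union, Set.mem_insert_iff, Set.mem_singleton_iff, commonIn, alive]
  tauto

/-! ## The rounds of the algorithm -/

/-- Output the family of the `K^p_q` in array `14`, and remove the vertices of the latter. -/
def report : Program := .seq record (.seq (.add 5 (.var 5) (.lit 1)) (killList 14 6))

/-- One round, for the vertex in variable `10`. -/
def round : Program :=
  .seq (.add 30 (.var 10) (.lit 0)) (.seq friend (.ite (.lit 0) (.var 31)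
    (.seq (.sub 12 (.var 31) (.lit 1)) (.seq (.add 51 (.var 10) (.lit 0)) (.seq find
      (.ite (.lit 0) (.var 50) report (.seq (.add 51 (.var 12) (.lit 0)) (.seq find
        (.ite (.lit 0) (.var 50) report killCommon)))))))
    (.store 3 (.var 10) (.lit 1))))

/-- The store represents the state `st` of the algorithm, and the records `rs` are written to the
output. -/
structure State (G : SimpleGraph (Fin n)) [DecidableRel G.Adj] (t p q W : ℕ) (a₀ a₁ d : ℕ → ℕ)
    (st : AlgState G) (rs : List (Record n p q)) (s : Store) : Prop where
  ctx : Ctx G t p q W a₀ a₁ d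
  store : At n t p q a₀ a₁ d s
  tab : Tab t p q s
  marks : s.arr 4 = fun _ => 0
  pq : s.var 6 = p * q
  excl : s.var 8 = 0
  reach : Reachable G t p q st
  alive_eq : st.alive = alive n d
  rep : List.Forall₂ Record.Represents rs st.out
  out : Out s (rs.flatMap Record.words)
  count : s.var 5 = rs.length
  words_le : (rs.flatMap Record.words).length + 20 * (n + t + 2) ^ 2 * (alive n d).ncard ≤
    20 * (n + t + 2) ^ 2 * n
  length_le : rs.length + (alive n d).ncard ≤ n

variable {st : AlgState G} {rs : List (Record n p q)} {s s' : Store}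

theorem State.keep (h : State G t p q W a₀ a₁ d st rs s) {B : ℕ} {As : List ℕ}
    (hk : Keep B [] As s s') (hB : 9 ≤ B := by norm_num)
    (hA : ∀ a ∈ [0, 1, 2, 3, 4, 8, 16], a ∉ As := by simp) : State G t p q W a₀ a₁ d st rs s' :=
  { h with
    store := h.store.keep hk (by omega) (by simp) (hA 0 (by simp)) (hA 1 (by simp)) (hA 3 (by simp))
    tab := h.tab.keep hk (hA 8 (by simp)) (hA 16 (by simp))
    marks := by rw [hk.2 4 (hA 4 (by simp)), h.marks]
    pq := hk.lit h.pq (by omega)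
    excl := hk.lit h.excl (by omega)
    out := h.out.keep hk (by omega) (by simp) (hA 2 (by simp))
    count := hk.lit h.count (by omega) }

theorem ncard_kill {l : List (Fin n)} (hl : ∀ x ∈ l, d x = 0) :
    (alive n (kill d l)).ncard + {x | x ∈ l}.ncard = (alive n d).ncard := by
  rw [alive_kill]
  exact Set.ncard_sdiff_add_ncard_of_subset hl

/-- A round that returns nothing. -/
theorem State.drop (h : State G t p q W a₀ a₁ d st rs s) {As : List ℕ}
    (hk : Keep 10 [] As s s') {l : List (Fin n)} (hs : At n t p q a₀ a₁ (kill d l) s')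
    (hr : Round p q st ⟨st.alive \ {x | x ∈ l}, st.out⟩)
    (hA : ∀ a ∈ [2, 4, 8, 16], a ∉ As := by simp) :
    State G t p q W a₀ a₁ (kill d l) ⟨st.alive \ {x | x ∈ l}, st.out⟩ rs s' := by
  have hle : (alive n (kill d l)).ncard ≤ (alive n d).ncard := by
    rw [alive_kill]; exact Set.ncard_le_ncard Set.sdiff_subset
  have := Nat.mul_le_mul_left (20 * (n + t + 2) ^ 2) hle
  have := h.words_le
  have := h.length_le
  exact { h with
    ctx := h.ctx.kill l
    store := hs
    tab := h.tab.keep hk (hA 8 (by simp)) (hA 16 (by simp))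
    marks := by rw [hk.2 4 (hA 4 (by simp)), h.marks]
    pq := hk.lit h.pq
    excl := hk.lit h.excl
    reach := h.reach.tail hr
    alive_eq := by rw [alive_kill, ← h.alive_eq]
    out := h.out.keep hk (by norm_num) (by simp) (hA 2 (by simp))
    count := hk.lit h.count
    words_le := by omega
    length_le := by omega }

/-- Nothing is excluded here, so the record represents the family of `Round.report`. At least one
vertex is removed for each record of at most `20 (n + t + 2)²` words, which keeps the length of the
whole output below `W`. The removal of all `p q ≥ t` vertices is what pays for the time. -/
theorem spec_report (h : State G t p q W a₀ a₁ d st rs s) {v₁ v₂ v : Fin n} (h₁ : d v₁ = 0)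
    (hv : v = v₁ ∨ v = v₂) (hfr : FriendAnswer G p q (alive n d) v₁ (some v₂))
    (hf : FoundAlive G p q d v s) :
    Spec W report (10000 * (t * t)) s fun s' => s'.var 10 = s.var 10 ∧
      ∃ (l : List (Fin n)) (st' : AlgState G) (rs' : List (Record n p q)),
        State G t p q W a₀ a₁ (kill d l) st' rs' s' ∧ (∀ x ∈ l, d x = 0) ∧
        t ≤ {x | x ∈ l}.ncard := by
  have hc := h.ctx
  have hW := hc.le_W
  have hW₁ := hc.le_W₁
  have hW₂ := hc.le_W₂
  have ht := At.q_le hc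
  have hpq := KF.pq hc.params
  have hle := h.words_le
  have hle' := h.length_le
  obtain ⟨-, f, hf, hA, hvf, hC⟩ := hf
  have htt : 3 * t ≤ t * t := Nat.mul_le_mul ht.2.2.1 le_rfl
  have h9 : 3 * t * (3 * t) = 9 * (t * t) := by ring
  have hnW : 20 * (n + t + 2) ^ 2 * n + 100 * (n + t + 2) ^ 2 ≤ W := by
    have : 20 * (n + t + 2) ^ 2 * n ≤ 20 * (n + t + 2) ^ 2 * (n + t + 2) ^ 2 :=
      Nat.mul_le_mul le_rfl ((by omega : n ≤ n + t + 2).trans (Nat.le_self_pow (by omega) _))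
    have e : 20 * (n + t + 2) ^ 2 * (n + t + 2) ^ 2 = 20 * (n + t + 2) ^ 4 := by ring
    have := pow_bounds n t
    omega
  refine Spec.intro fun Q hQ => ?_
  simp only [report, wp_seq]
  refine wp_of_spec (spec_record hc h.store h.tab h.marks hf hA hC h.pq h.excl (Nat.zero_le _)
    (fun v hv => by omega) h.out (by omega)) ?_
  rintro k₁ s₁ hk₁ ⟨g1, r, o1, lr, hr⟩
  have e5 : s₁.var 5 = rs.length := g1.lit h.count
  simp only [wp_add, Operand.val, e5]
  have g1' : Keep 60 [5, 7, 9] recordArrays s (s₁.setVar 5 (rs.length + 1)) :=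
    (g1.mono le_rfl (by simp) (by simp)).setVar (by simp)
  obtain ⟨w, w1, -, w3⟩ := exists_enum (p := p) (q := q) (by omega) (by omega)
  set l := (List.range (p * q)).map fun r => f (w r) with hl
  have len : l.length = p * q := by simp [hl]
  have meml : ∀ x, x ∈ l ↔ ∃ b, f b = x := fun x => by
    simp only [hl, List.mem_map, List.mem_range]
    exact ⟨fun ⟨r, _, h⟩ => ⟨_, h⟩, fun ⟨b, h⟩ => ⟨_, index_lt b, by rw [w3, h]⟩⟩
  have setl : {x | x ∈ l} = (toSub hf).verts := by
    ext x; rw [Set.mem_ofPred_eq, meml, (spans_toSub hf).mem]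
  have l1 : Lst (s₁.setVar 5 (rs.length + 1)) 14 l := fun j hj => by
    rw [Store.setVar_arr, g1.2 14 (by simp [recordArrays])]
    have hj' : j < p * q := len ▸ hj
    have := hC (w j)
    rw [w1 j hj'] at this
    simp [hl, this]
  have hkill : ∀ x ∈ l, d x = 0 := fun x hx => by
    obtain ⟨b, rfl⟩ := (meml x).1 hx
    exact hA b
  have ncard : {x | x ∈ l}.ncard = p * q := by
    rw [setl, (spans_toSub hf).1, ← Set.image_univ, Set.ncard_image_of_injective _ hf.1]
    simp
  have key := ncard_kill hkill
  rw [ncard] at key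
  have hs1 := h.store.keep g1' (by norm_num) (by simp) (by simp [recordArrays])
    (by simp [recordArrays]) (by simp [recordArrays])
  refine ⟨by omega, wp_of_spec (spec_killList hc hs1 l1 (by rw [len, g1'.lit h.pq])
    (by norm_num) (by norm_num) (by omega)) ?_⟩
  rintro k₂ s₂ hk₂ ⟨g2, hs2⟩
  have g : Keep 10 [5, 7, 9] (3 :: recordArrays) s s₂ := (g1'.mono (by norm_num) (by simp)
    (by simp +contextual)).trans g2 (by norm_num) (by simp) (by simp)
  have hwl : 20 * (n + t + 2) ^ 2 * ((alive n (kill d l)).ncard + 1) ≤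
    20 * (n + t + 2) ^ 2 * (alive n d).ncard := Nat.mul_le_mul_left _ (by omega)
  have hround := Round.report st v₁ v₂ (p := p) (q := q) (by rw [h.alive_eq]; exact h₁)
    (by rw [h.alive_eq]; exact hfr) (toSub hf) (by
      rw [h.alive_eq]; exact isKpq_iff.2 ⟨f, hf, hA, spans_toSub hf⟩)
    (by simp only [(spans_toSub hf).mem]; rcases hv with rfl | rfl
        · exact .inl hvf
        · exact .inr hvf)
  refine hQ _ _ (by omega) ⟨?_, l, _, rs ++ [r],
    { ctx := hc.kill l
      store := hs2
      tab := h.tab.keep g (by simp [recordArrays]) (by simp [recordArrays])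
      marks := by rw [g.2 4 (by simp [recordArrays]), h.marks]
      pq := g.lit h.pq
      excl := g.lit h.excl
      reach := h.reach.tail hround
      alive_eq := by rw [alive_kill, setl, ← h.alive_eq]
      rep := List.rel_append h.rep (.cons (by simpa [h.alive_eq] using hr) .nil)
      out := by
        rw [List.flatMap_append, List.flatMap_singleton]
        exact (Out.setVar_iff (by norm_num)).2 o1 |>.keep g2
      count := by rw [List.length_append, List.length_singleton]; exact g2.lit (by simp)
      words_le := by
        rw [List.flatMap_append, List.flatMap_singleton, List.length_append]
        rw [Nat.mul_add] at hwl
        omega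
      length_le := by rw [List.length_append, List.length_singleton]; omega }, hkill, by omega⟩
  rw [g2.lit (g1'.lit rfl)]

/-- The threshold is `t` for `p = 2`, and for `p ≥ 3` it is `t - q`, which is at least `t / 2`
because then `2 q ≤ t`. -/
theorem le_ncard_commonIn (hP : Params t p q) {S : Set (Fin n)} {v₁ v₂ : Fin n}
    (h : FriendAnswer G p q S v₁ (some v₂)) :
    t ≤ 2 * ({v₁, v₂} ∪ commonIn G S v₁ v₂ : Set (Fin n)).ncard := by
  have h1 := h.2.2
  have h2 : (commonIn G S v₁ v₂).ncard ≤ ({v₁, v₂} ∪ commonIn G S v₁ v₂ : Set (Fin n)).ncard :=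
    Set.ncard_le_ncard Set.subset_union_right
  rw [thr_eq hP] at h1
  obtain ⟨-, -, -, ht⟩ := hP
  split_ifs at h1 with hp
  · omega
  · have : 2 * q ≤ (p - 1) * q := Nat.mul_le_mul_right q (by omega)
    omega

/-- Every round removes vertices, and its cost is proportional to their number. -/
theorem spec_round (h : State G t p q W a₀ a₁ d st rs s) {v : Fin n} (h10 : s.var 10 = v)
    (hv : d v = 0) :
    wp W round s 0 fun k s' => s'.var 10 = v ∧
      ∃ (l : List (Fin n)) (st' : AlgState G) (rs' : List (Record n p q)),
        State G t p q W a₀ a₁ (kill d l) st' rs' s' ∧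
        k + 3 + 2000000 * t * (alive n (kill d l)).ncard ≤ 2000000 * t * (alive n d).ncard := by
  have hc := h.ctx
  have hW₁ := hc.le_W₁
  have ht := At.q_le hc
  have hvn := v.2
  have htt : 3 * t ≤ t * t := Nat.mul_le_mul ht.2.2.1 le_rfl
  have h9 : 3 * t * (3 * t) = 9 * (t * t) := by ring
  -- A round that only asks for a friend costs `O(t)`, for which the removal of `v` pays.
  have small : ∀ (k : ℕ) (l : List (Fin n)), (∀ x ∈ l, d x = 0) → v ∈ l → k ≤ 2000 * t →
      k + 3 + 2000000 * t * (alive n (kill d l)).ncard ≤ 2000000 * t * (alive n d).ncard := by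
    intro k l hl hvl hk
    have h1 := ncard_kill hl
    have h2 : 0 < {x | x ∈ l}.ncard := (Set.ncard_pos).2 ⟨v, hvl⟩
    have := Nat.mul_le_mul_left (2000000 * t)
      (by omega : (alive n (kill d l)).ncard + 1 ≤ (alive n d).ncard)
    rw [Nat.mul_add] at this
    omega
  -- A round with local searches costs `O(t²)`, for which the removal of `t / 2` vertices pays.
  have large : ∀ (k : ℕ) (l : List (Fin n)), (∀ x ∈ l, d x = 0) → t ≤ 2 * {x | x ∈ l}.ncard →
      k ≤ 800000 * (t * t) →
      k + 3 + 2000000 * t * (alive n (kill d l)).ncard ≤ 2000000 * t * (alive n d).ncard := by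
    intro k l hl hlt hk
    have h1 := ncard_kill hl
    have h2 := Nat.mul_le_mul_left (1000000 * t) hlt
    rw [← h1, Nat.mul_add]
    have : 1000000 * t * t = 1000000 * (t * t) := by ring
    have : 1000000 * t * (2 * {x | x ∈ l}.ncard) = 2000000 * t * {x | x ∈ l}.ncard := by ring
    omega
  simp only [round, wp_seq, wp_add, Operand.val, h10]
  have k1 : Keep 30 [] [] s (s.setVar 30 (v + 0)) := Keep.refl.setVar (by simp)
  have S1 := h.keep k1
  refine ⟨by omega, wp_of_spec (spec_friend (v := v) hc S1.store S1.marks (by simp)) ?_⟩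
  rintro k₁ s₁ hk₁ ⟨-, g1, hans⟩
  have S2 := S1.keep g1
  have k2 : Keep 30 [] [7] s s₁ := (k1.mono le_rfl (by simp) (by simp)).trans g1 (by norm_num)
    (by simp) (by simp)
  have e10 : s₁.var 10 = v := k2.lit h10
  simp only [wp_ite, wp_seq, wp_store, wp_sub, wp_add, Operand.val, e10]
  rcases hans with ⟨h31, hno⟩ | ⟨u, h31, hfr⟩
  · have hk : Keep 10 [] [3] s₁ (s₁.setArr 3 v 1) := Keep.refl.setArr (by simp)
    have hset : {x | x ∈ [v]} = ({v} : Set (Fin n)) := by ext; simp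
    refine ⟨fun _ => by omega, fun _ => ⟨by omega, by omega, by simpa using e10, [v],
      ⟨st.alive \ {x | x ∈ [v]}, st.out⟩, rs, S2.drop hk ?_ ?_, small _ _ (by simpa) (by simp)
        (by omega)⟩⟩
    · obtain ⟨g0, g1, g2, g3, g4, g5, g6⟩ := S2.store
      refine ⟨g0, g1, g2, g3, by simpa, by simpa, ?_⟩
      funext i
      simp [kill, g6, Function.update_apply, eq_comm]
    · rw [hset]
      exact .dropOne st v (by rw [h.alive_eq]; exact hv) (by rw [h.alive_eq]; exact hno)
  have hun := u.2
  have hdu : d u = 0 := hfr.1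
  simp only [h31, Store.setVar_var, Nat.reduceEqDiff, reduceIte, e10, Nat.add_sub_cancel]
  refine ⟨fun _ => ⟨by omega, by omega, ?_⟩, fun _ => by omega⟩
  set s₂ := (s₁.setVar 12 u).setVar 51 (v + 0) with hs₂
  have g2 : Keep 12 [] [] s₁ s₂ := (Keep.refl.setVar (by simp)).setVar (by simp)
  have S3 := S2.keep g2
  have rep : ∀ (s₃ : Store) (k₃ : ℕ) (x : Fin n), State G t p q W a₀ a₁ d st rs s₃ →
      s₃.var 10 = v → x = v ∨ x = u → FoundAlive G p q d x s₃ → k₃ ≤ 730000 * (t * t) →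
      wp W report s₃ k₃ fun k s' => s'.var 10 = v ∧
        ∃ (l : List (Fin n)) (st' : AlgState G) (rs' : List (Record n p q)),
        State G t p q W a₀ a₁ (kill d l) st' rs' s' ∧
        k + 3 + 2000000 * t * (alive n (kill d l)).ncard ≤ 2000000 * t * (alive n d).ncard := by
    intro s₃ k₃ x S h10 hx hF hk₃
    refine wp_of_spec (spec_report S hv hx hfr hF) ?_
    rintro k₄ s₄ hk₄ ⟨e, l, st', rs', S', hl, hlt⟩
    exact ⟨by rw [e, h10], l, st', rs', S', large _ l hl (by omega) (by omega)⟩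
  refine wp_of_spec (spec_find (v := v) hc S3.store S3.tab S3.marks (by simp [hs₂]) hv S3.pq) ?_
  rintro k₃ s₃ hk₃ ⟨g3, hfind⟩
  have arrs : ∀ a ∈ [0, 1, 2, 3, 4, 8, 16], a ∉ findArrays := by
    simp [findArrays, attemptArrays]
  have S4 := S3.keep g3 (by norm_num) arrs
  have f10 : s₃.var 10 = v := g3.lit (by simpa [hs₂] using e10)
  have f12 : s₃.var 12 = u := g3.lit (by simp [hs₂])
  refine ⟨fun h50 => ?_, fun h50 => ?_⟩
  · exact rep s₃ _ v S4 f10 (.inl rfl) (hfind.resolve_left fun h => by omega) (by omega)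
  have hno₁ := (hfind.resolve_right fun h => by have := h.1; omega).2
  simp only [f12]
  refine ⟨by omega, ?_⟩
  have g4 : Keep 50 [] [] s₃ (s₃.setVar 51 (u + 0)) := Keep.refl.setVar (by simp)
  have S5 := S4.keep g4
  refine wp_of_spec (spec_find (v := u) hc S5.store S5.tab S5.marks (by simp) hdu S5.pq) ?_
  rintro k₄ s₄ hk₄ ⟨g5, hfind'⟩
  have S6 := S5.keep g5 (by norm_num) arrs
  have l10 : s₄.var 10 = v := g5.lit (g4.lit f10)
  have l12 : s₄.var 12 = u := g5.lit (g4.lit f12)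
  refine ⟨fun h50 => ?_, fun h50 => ?_⟩
  · exact rep s₄ _ u S6 l10 (.inr rfl) (hfind'.resolve_left fun h => by omega) (by omega)
  have hno₂ := (hfind'.resolve_right fun h => by have := h.1; omega).2
  refine wp_of_spec (spec_killCommon hc S6.store S6.marks l10 l12) ?_
  rintro k₅ s₅ hk₅ ⟨g6, l, hs5, hl⟩
  refine ⟨g6.lit l10, l, _, rs, S6.drop (g6.mono (by norm_num) (by simp) fun _ h => h) hs5 ?_,
    large _ l (fun x hx => ?_) (by rw [hl]; exact le_ncard_commonIn hc.params hfr) (by omega)⟩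
  · rw [hl, ← h.alive_eq]
    refine .dropMany st v u (by rw [h.alive_eq]; exact hv) (by rw [h.alive_eq]; exact hfr) ?_
    intro H hH
    rw [h.alive_eq] at hH
    obtain ⟨f, hf, hA, hsp⟩ := isKpq_iff.1 hH
    exact ⟨fun hm => hno₁ ⟨f, hf, hA, hsp.mem.1 hm⟩, fun hm => hno₂ ⟨f, hf, hA, hsp.mem.1 hm⟩⟩
  · have : x ∈ ({v, u} ∪ commonIn G (alive n d) v u : Set (Fin n)) := hl ▸ hx
    rcases this with (rfl | rfl) | hx
    exacts [hv, hdu, hx.1]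

/-! ## The implementation of the algorithm -/

/-- Remove the vertices of small degree, and make variable `16` positive if others remain. -/
def init : Program :=
  forTo 10 (.var 0) (.seq (.load 12 0 (.var 10)) (.seq (.add 11 (.var 10) (.lit 1))
    (.seq (.load 11 0 (.var 11)) (.seq (.sub 11 (.var 11) (.var 12))
      (.ite (.var 11) (.var 1) (.store 3 (.var 10) (.lit 1)) (.add 16 (.lit 1) (.lit 0)))))))

/-- The pointer in variable `10` stays where it is after a round, since the reported `K^p_q` may
contain only the friend, so that the vertex itself can survive. It passes only removed vertices, and
these never come back. -/
def rounds : Program :=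
  .loop (.var 10) (.var 0) (.seq (.load 11 3 (.var 10))
    (.ite (.var 11) (.lit 1) round (.add 10 (.var 10) (.lit 1))))

/-- The tables cost `O(t)`, which is within `O(m)` if some vertex has degree at least `t`, but not
in general. Therefore they are made only if variable `16` says that there is such a vertex. -/
def main : Program :=
  .seq init (.ite (.lit 0) (.var 16)
    (.seq tables (.seq (.add 10 (.lit 0) (.lit 0)) rounds)) .skip)

/-- Marks the vertices of degree less than `t` among those that are less than `j`. -/
def lowDegree (G : SimpleGraph (Fin n)) [DecidableRel G.Adj] (t j i : ℕ) : ℕ :=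
  if ∃ v : Fin n, (v : ℕ) = i ∧ i < j ∧ G.degree v < t then 1 else 0

theorem spec_init (h : Ctx G t p q W a₀ a₁ fun _ => 0)
    (hs : At n t p q a₀ a₁ (fun _ => 0) s) (h16 : s.var 16 = 0) :
    Spec W init (9 * n + 2) s fun s' => Keep 10 [] [3] s s' ∧ s'.arr 3 = lowDegree G t n ∧
      ((s'.var 16 = 1 ∧ ∃ v, t ≤ G.degree v) ∨ (s'.var 16 = 0 ∧ ∀ v, G.degree v < t)) := by
  have hW₁ := h.le_W₁
  refine (spec_forTo (N := .var 0) (m := n) (T := 6) (Inv := fun j s' => Keep 10 [] [3] s s' ∧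
    s'.var 10 = j ∧ s'.arr 3 = lowDegree G t j ∧ ((s'.var 16 = 1 ∧ ∃ v, t ≤ G.degree v) ∨
      (s'.var 16 = 0 ∧ ∀ v : Fin n, (v : ℕ) < j → G.degree v < t))) (by omega)
    (fun j s' h => ⟨h.2.1, h.1.lit hs.var_n⟩) ?_ ⟨by simp, by simp, ?_, .inr ⟨by simpa, by simp⟩⟩).mono
    (by omega) fun s' hs' => ⟨hs'.1, hs'.2.2.1, hs'.2.2.2.imp_right fun h => ⟨h.1, fun v => h.2 v v.2⟩⟩
  · rintro j hj s₁ ⟨f1, f2, f3, f4⟩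
    refine Spec.intro fun Q hQ => ?_
    have e0 : s₁.arr 0 = a₀ := by rw [f1.2 0 (by simp), hs.off]
    have e1 : s₁.var 1 = t := f1.lit hs.var_t
    have e := h.off_succ ⟨j, hj⟩
    have hb := h.bounded ⟨j, hj⟩
    have w0 := h.off_le_W hj.le
    have w1 := h.off_le_W (v := j + 1) hj
    simp only at e
    simp only [wp_seq, wp_load, wp_add, wp_sub, wp_ite, wp_store, Operand.val, f2, e0, e1, e,
      Store.setVar_var, Store.setVar_arr, Nat.reduceEqDiff, reduceIte, Nat.add_sub_cancel_left]
    refine ⟨by omega, by omega, by omega, by omega, by omega, by omega, fun hlt => ⟨by omega,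
      by omega, hQ _ _ (by omega) ⟨by simpa using f2, by simpa using f1, by simp, ?_, ?_⟩⟩,
      fun hge => ⟨by omega, hQ _ _ (by omega) ⟨by simpa using f2, by simpa using f1, by simp, ?_,
        .inl ⟨by simp, _, not_lt.1 hge⟩⟩⟩⟩
    · funext i
      simp only [Store.setVar_arr, Store.setArr_arr, reduceIte, f3, Function.update_apply, lowDegree]
      by_cases hij : i = j
      · rw [if_pos hij, if_pos ⟨⟨j, hj⟩, by simp [hij], by omega, hlt⟩]
      · simp only [hij, reduceIte, show i < j + 1 ↔ i < j by omega]
    · refine f4.imp (fun h => ⟨by simpa using h.1, h.2⟩) fun h => ⟨by simpa using h.1, fun v hv => ?_⟩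
      by_cases hvj : (v : ℕ) = j
      · rwa [show v = ⟨j, hj⟩ from Fin.ext hvj]
      · exact h.2 v (by omega)
    · simp only [Store.setVar_arr, f3]
      funext i
      simp only [lowDegree]
      congr 1
      refine propext (exists_congr fun v => and_congr_right fun hv => ⟨fun h => ⟨by omega, h.2⟩,
        fun h => ⟨?_, h.2⟩⟩)
      have : i ≠ j := by
        rintro rfl
        exact hge (by rw [← show v = ⟨i, hj⟩ from Fin.ext hv]; exact h.2)
      omega
  · rw [Store.setVar_arr, hs.dead]
    funext i
    simp [lowDegree]

/-- The potential is `2000000 t` for every remaining vertex and `4` for every step that the pointer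
still has to make. -/
theorem spec_rounds (h : State G t p q W a₀ a₁ d st rs s) (h10 : s.var 10 = 0) :
    Spec W rounds (2000000 * t * (alive n d).ncard + 4 * n + 1) s fun s' =>
      ∃ (st' : AlgState G) (rs' : List (Record n p q)), Reachable G t p q st' ∧ st'.alive = ∅ ∧
        OutputRecords s' rs' ∧ List.Forall₂ Record.Represents rs' st'.out := by
  refine (spec_loop (u := .var 10) (v := .var 0) (Inv := fun φ s' =>
    ∃ (d : ℕ → ℕ) (st' : AlgState G) (rs' : List (Record n p q)), State G t p q W a₀ a₁ d st' rs' s' ∧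
      s'.var 10 ≤ n ∧ (∀ v : Fin n, (v : ℕ) < s'.var 10 → d v ≠ 0) ∧
        φ = 2000000 * t * (alive n d).ncard + 4 * (n - s'.var 10)) ?_ _ s
    ⟨d, st, rs, h, by omega, fun v hv => by omega, rfl⟩).mono (by omega) ?_
  · rintro _ s₁ ⟨d, st, rs, S, hle, hd, rfl⟩ hlt
    have hc := S.ctx
    have hW₁ := hc.le_W₁
    simp only [Operand.val, S.store.var_n] at hlt
    obtain ⟨v, hv⟩ : ∃ v : Fin n, (v : ℕ) = s₁.var 10 := ⟨⟨_, hlt⟩, rfl⟩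
    have hdv := hc.dead_le v
    rw [← hv] at hd hlt ⊢
    simp only [wp_seq, wp_load, wp_ite, wp_add, Operand.val, S.store.dead, ← hv, Store.setVar_var,
      Nat.reduceEqDiff, reduceIte]
    have g : Keep 11 [] [] s₁ (s₁.setVar 11 (d v)) := Keep.refl.setVar (by simp)
    have S' := S.keep g
    refine ⟨by omega, by omega, fun h0 => ?_, fun h1 => ⟨by omega, _, ?_, d, st, rs,
      S'.keep (B := 10) (As := []) (Keep.refl.setVar (by simp)), ?_, fun u hu => ?_, rfl⟩⟩
    · obtain ⟨l, s₂, hr, e, L, st', rs', S₂, hk⟩ := spec_round S' (v := v) (by simp [hv]) (by omega)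
      refine ⟨l, s₂, hr, _, ?_, kill d L, st', rs', S₂, by omega, fun u hu => ?_, rfl⟩
      · omega
      · have := hd u (by omega)
        unfold kill
        split_ifs <;> omega
    · simp
      omega
    · simp
    · by_cases huv : u = v
      · subst huv; omega
      · exact hd u (by have := Fin.val_ne_of_ne huv; omega)
  · rintro s' ⟨hge, φ, d, st', rs', S, -, hd, -⟩
    simp only [Operand.val, S.store.var_n] at hge
    refine ⟨st', rs', S.reach, ?_, .of_out S.count S.out, S.rep⟩
    rw [S.alive_eq, Set.eq_empty_iff_forall_notMem]
    exact fun v hv => hd v (by omega) hv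

/-- Degrees of at least one give `n ≤ 2 m`, which pays for the initialization and for the moves of
the pointer. The vertices that are left have degree at least `t`, so `t` times their number is at
most the sum of the degrees, `2 m`. -/
theorem spec_main (hP : Params t p q) (hB : Bounded G t) (hn : 0 < n)
    (hdeg : ∀ v, 1 ≤ G.degree v) (hW : 1000 * (n + t + 2) ^ 4 ≤ W) (hs : IsInput G t p q 0 s) :
    Spec W main (5000000 * G.edgeFinset.card) s fun s' =>
      ∃ (st : AlgState G) (rs : List (Record n p q)), Reachable G t p q st ∧ st.alive = ∅ ∧
        OutputRecords s' rs ∧ List.Forall₂ Record.Represents rs st.out := by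
  have h := hs.ctx hP hB hW
  have hsum := G.sum_degrees_eq_twice_card_edges
  have hnm : n ≤ 2 * G.edgeFinset.card := by
    rw [← hsum]
    simpa using Finset.sum_le_sum fun v (_ : v ∈ Finset.univ) => hdeg v
  refine Spec.intro fun Q hQ => ?_
  simp only [main, wp_seq]
  refine wp_of_spec (spec_init h hs.at (hs.var_rest 16 (by norm_num))) ?_
  rintro k₁ s₁ hk₁ ⟨g1, dead, h16⟩
  have hd : ∀ v : Fin n, lowDegree G t n v = 0 ↔ t ≤ G.degree v := fun v => by
    simp [lowDegree, Fin.val_inj]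
  have hA : alive n (lowDegree G t n) = {v | t ≤ G.degree v} := Set.ext fun v => hd v
  simp only [wp_ite, wp_seq, wp_skip, Operand.val]
  rcases h16 with ⟨h16, v, hv⟩ | ⟨h16, hlow⟩
  · refine ⟨fun _ => ?_, fun h => by omega⟩
    have htm : t * (alive n (lowDegree G t n)).ncard ≤ 2 * G.edgeFinset.card := by
      rw [← hsum, hA, Set.ncard_eq_toFinset_card']
      calc _ = ∑ v ∈ {v | t ≤ G.degree v}.toFinset, t := by rw [Finset.sum_const, smul_eq_mul, mul_comm]
        _ ≤ ∑ v ∈ {v | t ≤ G.degree v}.toFinset, G.degree v :=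
          Finset.sum_le_sum fun v hv => by simpa using hv
        _ ≤ _ := Finset.sum_le_sum_of_subset (Finset.subset_univ _)
    have hpos : 0 < (alive n (lowDegree G t n)).ncard := by
      rw [hA]; exact (Set.ncard_pos).2 ⟨v, hv⟩
    have htm' : t * 1 ≤ t * (alive n (lowDegree G t n)).ncard := Nat.mul_le_mul_left t hpos
    have hcard : (alive n (lowDegree G t n)).ncard ≤ n := by
      simpa using Set.ncard_le_card (alive n (lowDegree G t n))
    have hc : Ctx G t p q W (s.arr 0) (s.arr 1) (lowDegree G t n) :=
      { h with dead_le := fun i => by unfold lowDegree; split_ifs <;> omega }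
    have hs1 : At n t p q (s.arr 0) (s.arr 1) (lowDegree G t n) s₁ :=
      ⟨g1.lit hs.var_n, g1.lit hs.var_t, g1.lit hs.var_p, g1.lit hs.var_q, g1.2 0 (by simp),
        g1.2 1 (by simp), dead⟩
    refine wp_of_spec (spec_tables hc hs1) ?_
    rintro k₂ s₂ hk₂ ⟨g2, e6, hT⟩
    have g3 : Keep 10 [6] [8, 16] s₁ (s₂.setVar 10 (0 + 0)) := g2.setVar (by simp)
    have g : Keep 10 [6] [3, 8, 16] s (s₂.setVar 10 (0 + 0)) :=
      (g1.mono le_rfl (by simp) (by simp)).trans g3 le_rfl (by simp) (by simp)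
    have S : State G t p q W (s.arr 0) (s.arr 1) (lowDegree G t n) (initState G t) []
        (s₂.setVar 10 (0 + 0)) :=
      { ctx := hc
        store := hs1.keep g3
        tab := hT.keep (B := 10) (Xs := []) (As := []) (Keep.refl.setVar (by simp))
        marks := by rw [g.2 4 (by simp), hs.arr_eq (by norm_num)]
        pq := by simpa using e6
        excl := g.lit (hs.var_rest 8 (by norm_num))
        reach := .refl
        alive_eq := hA.symm
        rep := .nil
        out := ⟨g.lit (hs.var_rest 7 (by norm_num)), by simp⟩
        count := g.lit (hs.var_rest 5 le_rfl)
        words_le := by simpa using hcard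
        length_le := by simpa using hcard }
    simp only [wp_add, Operand.val]
    refine ⟨by omega, wp_of_spec (spec_rounds S (by simp)) fun k₃ s₃ hk₃ hpost =>
      hQ _ _ ?_ hpost⟩
    rw [mul_assoc] at hk₃
    omega
  · refine ⟨fun h => by omega, fun _ => hQ _ _ (by omega) ⟨initState G t, [], .refl, ?_,
      ⟨g1.lit (hs.var_rest 5 le_rfl), by simp⟩, .nil⟩⟩
    rw [Set.eq_empty_iff_forall_notMem]
    exact fun v hv => absurd (hlow v) (not_lt.2 hv)

end

end KpqSearch

/-! ### The four assertions -/

theorem mainTheorem12 :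
    -- correctness of the algorithm, whatever choices it makes
    (∀ (n t p q : ℕ) (G : SimpleGraph (Fin n)) [DecidableRel G.Adj],
      Params t p q → Bounded G t → ∀ s : AlgState G, Reachable G t p q s →
        (s.alive.Nonempty → ∃ s', Round p q s s') ∧
        (∀ s', Round p q s s' → s'.alive ⊂ s.alive) ∧
        (s.alive = ∅ →
          s.found = {H | IsKpq p q Set.univ H} ∧
          s.foundPairs = {P | IsKpq p q Set.univ P.1 ∧ IsKpq p q Set.univ P.2 ∧
            P.1 ≠ P.2 ∧ Meet P.1 P.2})) ∧
    -- an implementation of the algorithm that runs in time `O(m)`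
    (∃ (c : Program) (C : ℕ), ∀ (n t p q : ℕ) (G : SimpleGraph (Fin n)) [DecidableRel G.Adj],
      0 < n → Params t p q → Bounded G t → (∀ v, 1 ≤ G.degree v) →
        ∀ s₀ : Store, IsInput G t p q 0 s₀ →
          ∃ (k : ℕ) (s₁ : Store), Runs ((n + t + 2) ^ C) c s₀ k s₁ ∧ k ≤ C * G.edgeFinset.card ∧
            ∃ (s : AlgState G) (rs : List (Record n p q)),
              Reachable G t p q s ∧ s.alive = ∅ ∧ OutputRecords s₁ rs ∧
              List.Forall₂ Record.Represents rs s.out) ∧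
    -- the local search: all `K^p_q`'s that contain a given vertex, in time `O(t ^ 2)`
    (∃ (c : Program) (C : ℕ), ∀ (n t p q : ℕ) (G : SimpleGraph (Fin n)) [DecidableRel G.Adj],
      Params t p q → Bounded G t →
        ∀ (v : Fin n) (s₀ : Store), IsInput G t p q v s₀ →
          ∃ (k : ℕ) (s₁ : Store), Runs ((n + t + 2) ^ C) c s₀ k s₁ ∧ k ≤ C * t ^ 2 ∧
            ∃ (Fs : List (Set G.Subgraph)) (rs : List (Record n p q)),
              OutputRecords s₁ rs ∧ List.Forall₂ Record.Represents rs Fs ∧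
              {H | ∃ F ∈ Fs, H ∈ F} = {H | IsKpq p q Set.univ H ∧ v ∈ H.verts}) ∧
    -- the friend procedure, in time `O(t)`
    (∃ (c : Program) (C : ℕ), ∀ (n t p q : ℕ) (G : SimpleGraph (Fin n)) [DecidableRel G.Adj],
      Params t p q → Bounded G t →
        ∀ (v : Fin n) (s₀ : Store), IsInput G t p q v s₀ →
          ∃ (k : ℕ) (s₁ : Store), Runs ((n + t + 2) ^ C) c s₀ k s₁ ∧ k ≤ C * t ∧
            ∃ a : Option (Fin n), OutputOption s₁ a ∧ FriendAnswer G p q Set.univ v a) := by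
  refine ⟨fun n t p q G _ hP hB s hs => algorithm_correct hP hB hs,
    ⟨main, 5000000, fun n t p q G _ hn hP hB hdeg s hs => ?_⟩,
    ⟨searchMain, 500000, fun n t p q G _ hP hB v s hs => ?_⟩,
    ⟨friendMain, 1100, fun n t p q G _ hP hB v s hs => ?_⟩⟩
  · obtain ⟨k, s₁, hr, hk, hQ⟩ :=
      spec_main hP hB hn hdeg (one_thousand_mul_le (C := 5000000) (by norm_num) hP.1) hs
    exact ⟨k, s₁, hr, by rwa [zero_add] at hk, hQ⟩
  · obtain ⟨k, s₁, hr, hk, hQ⟩ :=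
      spec_searchMain hP hB (one_thousand_mul_le (C := 500000) (by norm_num) hP.1) hs
    exact ⟨k, s₁, hr, by rwa [zero_add] at hk, hQ⟩
  · obtain ⟨k, s₁, hr, hk, hQ⟩ :=
      spec_friendMain hP hB (one_thousand_mul_le (C := 1100) (by norm_num) hP.1) hs
    exact ⟨k, s₁, hr, by rwa [zero_add] at hk, hQ⟩
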